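/- Let $\mathsf{k}$ be a field and work with $\{\mathbf a,\mathbf m\}$-coloured non-symmetric operads and operadic bimodules. Let $(A_\infty^{\mathrm{Col}},M_\infty^{\mathrm{Col}})$ be the DG-operad generated by operations $\mu_n^{\mathbf c}$ ($n\ge 2$, $\mathbf c\in\{\mathbf a,\mathbf m\}$) of profile $(\mathbf a^{n-1},\mathbf c;\mathbf c)$ and homological degree $n-2$, and the DG-bimodule over it generated by operations $f_n^{\mathbf c}$ ($n\ge 1$) of profile $(\mathbf a^{n-1},\mathbf c;\mathbf c)$ and homological degree $n-1$, with differentials $$d\mu^{\mathbf c}_n=-\sum_{\substack{p+q+r=n\\ q\ge 2,\ p+r\ge 1}}(-1)^{p+qr}\mu^{\mathbf c}_{p+1+r}\,(\mathrm{id}^{\otimes p}\otimes\mu_q\otimes\mathrm{id}^{\otimes r}),$$ $$d f^{\mathbf c}_n=\sum_{\substack{p+q+r=n\\ q\ge 2}}(-1)^{p+qr} f^{\mathbf c}_{p+1+r}\,(\mathrm{id}^{\otimes p}\otimes\mu_q\otimes\mathrm{id}^{\otimes r})-\sum_{\substack{j\ge 2\\ i_1+\dots+i_j=n}}(-1)^{\sum_t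 (j-t)(i_t-1)}\mu^{\mathbf c}_j(f^{\mathbf a}_{i_1}\otimes\dots\otimes f^{\mathbf a}_{i_{j-1}}\otimes f^{\mathbf c}_{i_j}),$$ where $\mu_q$ has colour $\mathbf c$ if $r=0$ and colour $\mathbf a$ if $r\ge 1$. Let $\Omega$ be the quotient of $A_\infty^{\mathrm{Col}}$ by the DG-ideal generated by the $\mu^{\mathbf a}_i$ with $i>2$, and let $T$ be the induced quotient of $M_\infty^{\mathrm{Col}}$ by the DG-subbimodule generated moreover by the $f^{\mathbf a}_i$ with $i>1$. Let $I^n=[0,1]^n$ be the cube with its product cell structure. Let the freehedron $\mathcal F_n$ be the cube $[0,1]^n$ with the following subdivision: $\mathcal F_0$ is a point, $\mathcal F_1=[0,1]$ with distinguished face $X_1=\{1\}$, and, for $n\ge 2$, $\mathcal F_n$ is $\mathcal F_{n-1}\times[0,1]$ with $X_{n-1}\times[0,1]$ split into $X_{n-1}\times[0,\frac12]$ and $X_n:=X_{n-1}\times[\frac12,1]$. Put $I(\mathbf a^n;\mathbf a)=\mathcal F(\mathbf a^n;\mathbf a)=\mathrm{pt}$ for $n\ge1$, $I(\mathbf a^n,\mathbf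 m;\mathbf m)=I^{n-1}$ for $n\ge 1$, $I(\mathbf m;\mathbf m)=\mathrm{pt}$, $\mathcal F(\mathbf a^n,\mathbf m;\mathbf m)=\mathcal F_n$ for $n\ge 0$, and $\emptyset$ at all other profiles. Writing the coordinates of $\mathcal F_n$ in the order $(x_n,\dots,x_1)$, with the newest one first, define structure maps as follows (where a cube of arity one acts as a unit). * Composition of cubes at the input $\mathbf m$ is $(x,y)\mapsto(x,1,y)$; composition with $I(\mathbf a^j;\mathbf a)$ at the $i$-th input inserts $j-1$ zeros after the first $i-1$ coordinates. * The right action on freehedra at the input $\mathbf m$ is $((y_1,\dots,y_p),z)\mapsto(y_1,\dots,y_{p-1},\frac{y_p}2,1-\frac z2,1)$; the right action of $I(\mathbf a^j;\mathbf a)$ at the $i$-th input inserts $j-1$ ones after the first $i-1$ coordinates. * The left action of $x\in I(\mathbf a^n,\mathbf m;\mathbf m)$ on points $t_s\in\mathcal F(\mathbf a^{j_s};\mathbf a)$, $1\le s\le n$, and $y\in\mathcal F(\mathbf a^q,\mathbf m;\mathbf m)$ is $(1-x',0,y)$, where $x'$ is the composite of $x$ with the points of $I(\mathbf a^{j_s};\mathbf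 a)$. Then: 1. The cells described above are the closed cells of CW structures on the cubes $[0,1]^n$, and these structure maps send products of cells onto cells and satisfy the axioms of an operad $I$ and of an operadic $I$-bimodule $\mathcal F$. So the cubes form a CW-operad and the freehedra form a CW-operadic bimodule over it. 2. The underlying pair of $(\Omega,T)$ is isomorphic to the pair of cellular chains $C_*(I,\mathcal F)$: there are isomorphisms of chain complexes $\Omega(l;c)\cong C_*(I(l;c))$ and $T(l;c)\cong C_*(\mathcal F(l;c))$ for all profiles, in particular $$\Omega(\mathbf a^n,\mathbf m;\mathbf m)\cong C_*(I^{n-1})\ (n\ge 1),\qquad T(\mathbf a^n,\mathbf m;\mathbf m)\cong C_*(\mathcal F_n)\ (n\ge 0),$$ compatible with units, operadic composition, and the left and right bimodule actions. They can be chosen so that $\mu^{\mathbf m}_{n}$ and $f^{\mathbf m}_{n}$ correspond to the top cells of $I^{n-2}$ and $\mathcal F_{n-1}$ respectively, and $\mu_2^{\mathbf a}$ and $f_1^{\mathbf a}$ to the point. -/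

import Mathlib

universe u

namespace OperadicFreehedra

/-! ## Colours, tuples, and the shape of a pair (DG-operad, DG-bimodule) -/

/-- The two colours: `a` for algebra, `m` for module. -/
inductive Col : Type
  | a : Col
  | m : Col
  deriving DecidableEq

/-- Tuples `(x₁, …, xₙ)` with `xᵢ ∈ X (lᵢ; cᵢ)`. The first index is the list of output colours
`c₁ … cₙ`, the second one is the concatenation of the input profiles `l₁ … lₙ`. -/
inductive Tup (X : List Col → Col → Type u) : List Col → List Col → Type u
  | nil : Tup X [] []
  | cons {c : Col} {cs l1 l2 l : List Col} (hl : l = l1 ++ l2)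
      (x : X l1 c) (T : Tup X cs l2) : Tup X (c :: cs) l

/-- Apply a map to every entry of a tuple. -/
def Tup.map {X Y : List Col → Col → Type u} (f : ∀ l c, X l c → Y l c) :
    ∀ {cs l : List Col}, Tup X cs l → Tup Y cs l
  | _, _, .nil => .nil
  | _, _, .cons hl x T => .cons hl (f _ _ x) (T.map f)

/-- The arities of the entries of a tuple. -/
def Tup.arities {X : List Col → Col → Type u} : ∀ {cs l : List Col}, Tup X cs l → List ℕ
  | _, _, .nil => []
  | _, _, .cons (l1 := l1) _ _ T => l1.length :: T.arities

/-- The data of a two-coloured non-symmetric DG-operad `P` and of a DG-bimodule `M` over it: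
for every profile `(l; c)` of input colours `l` and output colour `c` a graded `k`-module with a
differential, units, partial compositions `x ∘ᵢ y` (the input of colour `c'` after the inputs `l1`
is the one that is plugged), the right action `x ∘ᵢ y` with `x ∈ M`, `y ∈ P`, and the left action
`x (t₁, …, tₙ)` with `x ∈ P`, `tᵢ ∈ M`. Degrees are homological: the differential lowers the degree
by one. -/
structure DGPair (k : Type u) [Field k] where
  P : List Col → Col → Type u
  M : List Col → Col → Type u
  [addP : ∀ l c, AddCommGroup (P l c)]
  [modP : ∀ l c, Module k (P l c)]
  [addM : ∀ l c, AddCommGroup (M l c)]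
  [modM : ∀ l c, Module k (M l c)]
  gradeP : ∀ l c, ℕ → Submodule k (P l c)
  gradeM : ∀ l c, ℕ → Submodule k (M l c)
  dP : ∀ l c, P l c →ₗ[k] P l c
  dM : ∀ l c, M l c →ₗ[k] M l c
  one : ∀ c, P [c] c
  comp : ∀ {l0 l1 l2 l' l : List Col} {c c' : Col}, l0 = l1 ++ c' :: l2 → l = l1 ++ (l' ++ l2) →
    P l0 c →ₗ[k] P l' c' →ₗ[k] P l c
  right : ∀ {l0 l1 l2 l' l : List Col} {c c' : Col}, l0 = l1 ++ c' :: l2 → l = l1 ++ (l' ++ l2) →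
    M l0 c →ₗ[k] P l' c' →ₗ[k] M l c
  left : ∀ {cs l : List Col} {c : Col}, P cs c → Tup M cs l → M l c

attribute [instance] DGPair.addP DGPair.modP DGPair.addM DGPair.modM

/-- Isomorphisms of pairs (DG-operad, DG-bimodule): isomorphisms of complexes for all profiles,
compatible with units, operadic composition and both actions. -/
structure DGPair.Iso {k : Type u} [Field k] (A B : DGPair k) where
  onP : ∀ l c, A.P l c ≃ₗ[k] B.P l c
  onM : ∀ l c, A.M l c ≃ₗ[k] B.M l c
  map_gradeP : ∀ l c n, (A.gradeP l c n).map (onP l c).toLinearMap = B.gradeP l c n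
  map_gradeM : ∀ l c n, (A.gradeM l c n).map (onM l c).toLinearMap = B.gradeM l c n
  map_dP : ∀ l c x, onP l c (A.dP l c x) = B.dP l c (onP l c x)
  map_dM : ∀ l c x, onM l c (A.dM l c x) = B.dM l c (onM l c x)
  map_one : ∀ c, onP [c] c (A.one c) = B.one c
  map_comp : ∀ {l0 l1 l2 l' l : List Col} {c c' : Col} (hx : l0 = l1 ++ c' :: l2)
    (hl : l = l1 ++ (l' ++ l2)) (x : A.P l0 c) (y : A.P l' c'),
    onP l c (A.comp hx hl x y) = B.comp hx hl (onP l0 c x) (onP l' c' y)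
  map_right : ∀ {l0 l1 l2 l' l : List Col} {c c' : Col} (hx : l0 = l1 ++ c' :: l2)
    (hl : l = l1 ++ (l' ++ l2)) (x : A.M l0 c) (y : A.P l' c'),
    onM l c (A.right hx hl x y) = B.right hx hl (onM l0 c x) (onP l' c' y)
  map_left : ∀ {cs l : List Col} {c : Col} (x : A.P cs c) (T : Tup A.M cs l),
    onM l c (A.left x T) = B.left (onP cs c x) (T.map fun l c => onM l c)

/-! ## Linear algebra helpers -/

section Linear

variable {k : Type u} [Field k]

/-- The bilinear extension of a map of bases. -/
noncomputable def bil {A B C : Type*} (g : A → B → C) :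
    (A →₀ k) →ₗ[k] (B →₀ k) →ₗ[k] (C →₀ k) :=
  Finsupp.linearCombination k (fun x => Finsupp.lmapDomain k k (g x))

/-- A bilinear map induced on quotients. -/
def bilQ {A B C : Type*} [AddCommGroup A] [Module k A] [AddCommGroup B] [Module k B]
    [AddCommGroup C] [Module k C] (p : Submodule k A) (q : Submodule k B) (r : Submodule k C)
    (f : A →ₗ[k] B →ₗ[k] C) (h1 : ∀ x ∈ p, ∀ y, f x y ∈ r) (h2 : ∀ x, ∀ y ∈ q, f x y ∈ r) :
    (A ⧸ p) →ₗ[k] (B ⧸ q) →ₗ[k] (C ⧸ r) :=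
  p.liftQ
    { toFun := fun x => q.mapQ r (f x) (fun y hy => h2 x y hy)
      map_add' := fun x y => by ext z; simp
      map_smul' := fun s x => by ext z; simp }
    (fun x hx => by
      rw [LinearMap.mem_ker]
      ext z
      simpa using h1 x hx z)

end Linear

/-! ## Free operad and free bimodule on the generators `μ` and `f` -/

/-- Formal operadic monomials in the generators `μ c n = μ^c_{n+2}` of profile `(a^{n+1}, c; c)`
(arity `n + 2`, degree `n`). -/
inductive OTerm : List Col → Col → Type
  | one (c : Col) : OTerm [c] c
  | mu (c : Col) (n : ℕ) : OTerm (List.replicate (n + 1) Col.a ++ [c]) c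
  | comp {l0 l1 l2 l' l : List Col} {c c' : Col} (hx : l0 = l1 ++ c' :: l2)
      (hl : l = l1 ++ (l' ++ l2)) (x : OTerm l0 c) (y : OTerm l' c') : OTerm l c

/-- Index for `BTerm`: one output colour, or a tuple of output colours. -/
inductive Out : Type
  | single (c : Col) : Out
  | tuple (cs : List Col) : Out

/-- Formal bimodule monomials in the generators `f c n = f^c_{n+1}` of profile `(a^n, c; c)`
(arity `n + 1`, degree `n`), and tuples of such monomials. -/
inductive BTerm : Out → List Col → Type
  | f (c : Col) (n : ℕ) : BTerm (.single c) (List.replicate n Col.a ++ [c])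
  | right {l0 l1 l2 l' l : List Col} {c c' : Col} (hx : l0 = l1 ++ c' :: l2)
      (hl : l = l1 ++ (l' ++ l2)) (x : BTerm (.single c) l0) (y : OTerm l' c') :
      BTerm (.single c) l
  | left {cs l : List Col} {c : Col} (x : OTerm cs c) (T : BTerm (.tuple cs) l) :
      BTerm (.single c) l
  | nil : BTerm (.tuple []) []
  | cons {c : Col} {cs l1 l2 l : List Col} (hl : l = l1 ++ l2) (t : BTerm (.single c) l1)
      (T : BTerm (.tuple cs) l2) : BTerm (.tuple (c :: cs)) l

/-- The degree of an operadic monomial. -/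
def OTerm.deg : ∀ {l : List Col} {c : Col}, OTerm l c → ℕ
  | _, _, .one _ => 0
  | _, _, .mu _ n => n
  | _, _, .comp _ _ x y => x.deg + y.deg

/-- The degree of a bimodule monomial, or the total degree of a tuple. -/
def BTerm.deg : ∀ {o : Out} {l : List Col}, BTerm o l → ℕ
  | _, _, .f _ n => n
  | _, _, .right _ _ x y => x.deg + y.deg
  | _, _, .left x T => x.deg + T.deg
  | _, _, .nil => 0
  | _, _, .cons _ t T => t.deg + T.deg

/-- The index of the tuple obtained by appending a tuple with output colours `cs'`. -/
def Out.append : Out → List Col → Out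
  | .single c, cs' => .tuple (c :: cs')
  | .tuple cs, cs' => .tuple (cs ++ cs')

/-- Put a monomial, or a tuple of monomials, in front of the tuple `T'`. -/
def BTerm.appendTo {cs' l' : List Col} (T' : BTerm (.tuple cs') l') :
    ∀ {o : Out} {l : List Col}, BTerm o l → BTerm (o.append cs') (l ++ l')
  | _, _, .f c n => .cons rfl (.f c n) T'
  | _, _, .right hx hl x y => .cons rfl (.right hx hl x y) T'
  | _, _, .left x T => .cons rfl (.left x T) T'
  | _, _, .nil => T'
  | _, _, .cons hl t T => .cons (by subst hl; rw [List.append_assoc]) t (BTerm.appendTo T' T)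

/-- Concatenation of tuples of monomials. -/
def BTerm.append {cs l cs' l' : List Col} (T : BTerm (.tuple cs) l) (T' : BTerm (.tuple cs') l') :
    BTerm (.tuple (cs ++ cs')) (l ++ l') :=
  BTerm.appendTo T' T

/-- The colour of input number `p` (counted from zero) of the profile `a^{p+r}, c`. -/
def headCol (c : Col) (r : ℕ) : Col := if r = 0 then c else Col.a

/-- The colours of the inputs after input number `p` of the profile `a^{p+r}, c`. -/
def tailCols (c : Col) (r : ℕ) : List Col := (List.replicate r Col.a ++ [c]).tail

theorem replicate_split (c : Col) (p r : ℕ) :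
    List.replicate (p + r) Col.a ++ [c]
      = List.replicate p Col.a ++ headCol c r :: tailCols c r := by
  cases r with
  | zero => simp [headCol, tailCols]
  | succ r =>
    rw [List.replicate_add, List.append_assoc]
    simp [headCol, tailCols, List.replicate_succ]

theorem replicate_plug (c : Col) (p s r : ℕ) :
    List.replicate (p + s + r) Col.a ++ [c]
      = List.replicate p Col.a
        ++ ((List.replicate s Col.a ++ [headCol c r]) ++ tailCols c r) := by
  rw [Nat.add_assoc, List.replicate_add, List.append_assoc, replicate_split c s r]
  simp

section Differential

variable (k : Type u) [Field k]

/-- The differential of the generator `μ^c_N`, `N = n + 2`: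
`d μ_N = - ∑ (-1)^{p + q r} μ_{p+1+r} (id^p ⊗ μ_q ⊗ id^r)`, the sum over `p + q + r = N`, `q ≥ 2`,
`p + r ≥ 1`. Here `q = s + 2`; the inner operation has colour `c` if `r = 0` and colour `a`
otherwise. -/
noncomputable def dMu (c : Col) (n : ℕ) :
    OTerm (List.replicate (n + 1) Col.a ++ [c]) c →₀ k :=
  - ∑ s : Fin n, ∑ p : Fin (n - s + 1),
      Finsupp.single
        (OTerm.comp (l0 := List.replicate (n - s - 1 + 1) Col.a ++ [c])
          (l1 := List.replicate p Col.a) (l2 := tailCols c (n - s - p))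
          (c' := headCol c (n - s - p))
          (by rw [← replicate_split]; congr 2; omega)
          (by rw [← replicate_plug]; congr 2; omega)
          (OTerm.mu c (n - s - 1)) (OTerm.mu (headCol c (n - s - p)) s))
        ((-1 : k) ^ ((p : ℕ) + (s + 2) * (n - s - p)))

/-- The differential on operadic monomials, the derivation that extends `dMu`. -/
noncomputable def OTerm.d : ∀ {l : List Col} {c : Col}, OTerm l c → (OTerm l c →₀ k)
  | _, _, .one _ => 0
  | _, _, .mu c n => dMu k c n
  | _, _, .comp hx hl x y =>
      bil (OTerm.comp hx hl) x.d (Finsupp.single y 1)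
        + (-1 : k) ^ x.deg • bil (OTerm.comp hx hl) (Finsupp.single x 1) y.d

/-- `∑ ± (f^a_{i_1}, …, f^a_{i_j}, f^c_{i_{j+1}})` over all `i_1 + … + i_{j+1} = n + 1`, with sign
exponent `∑_t (j + 1 - t) (i_t - 1)`. -/
noncomputable def fSum (c : Col) : ∀ j n : ℕ,
    (BTerm (.tuple (List.replicate j Col.a ++ [c])) (List.replicate n Col.a ++ [c]) →₀ k)
  | 0, n => Finsupp.single (BTerm.cons (by simp) (BTerm.f c n) BTerm.nil) 1
  | j + 1, n => ∑ i : Fin n, (-1 : k) ^ ((j + 1) * (i : ℕ)) •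
      Finsupp.mapDomain
        (fun T => BTerm.cons (l1 := List.replicate i Col.a ++ [Col.a])
          (l2 := List.replicate (n - 1 - i) Col.a ++ [c])
          (by
            rw [← List.replicate_succ', ← List.append_assoc, ← List.replicate_add]
            congr 2; omega)
          (BTerm.f Col.a i) T)
        (fSum c j (n - 1 - i))

/-- The differential of the generator `f^c_N`, `N = n + 1`:
`d f_N = ∑ (-1)^{p + q r} f_{p+1+r} (id^p ⊗ μ_q ⊗ id^r) - ∑ ± μ_j (f_{i_1} ⊗ … ⊗ f_{i_j})`,
the first sum over `p + q + r = N`, `q ≥ 2`, the second over `j ≥ 2` and `i_1 + … + i_j = N`. -/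
noncomputable def dF (c : Col) (n : ℕ) :
    BTerm (.single c) (List.replicate n Col.a ++ [c]) →₀ k :=
  (∑ s : Fin n, ∑ p : Fin (n - s),
      Finsupp.single
        (BTerm.right (l0 := List.replicate (n - 1 - s) Col.a ++ [c])
          (l1 := List.replicate p Col.a) (l2 := tailCols c (n - 1 - s - p))
          (c' := headCol c (n - 1 - s - p))
          (by rw [← replicate_split]; congr 2; omega)
          (by rw [← replicate_plug]; congr 2; omega)
          (BTerm.f c (n - 1 - s)) (OTerm.mu (headCol c (n - 1 - s - p)) s))
        ((-1 : k) ^ ((p : ℕ) + (s + 2) * (n - 1 - s - p))))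
  - ∑ j : Fin n, Finsupp.mapDomain (BTerm.left (OTerm.mu c j)) (fSum k c (j + 1) n)

/-- The differential on bimodule monomials and on tuples, the derivation that extends `dF`. -/
noncomputable def BTerm.d : ∀ {o : Out} {l : List Col}, BTerm o l → (BTerm o l →₀ k)
  | _, _, .f c n => dF k c n
  | _, _, .right hx hl x y =>
      bil (BTerm.right hx hl) x.d (Finsupp.single y 1)
        + (-1 : k) ^ x.deg • bil (BTerm.right hx hl) (Finsupp.single x 1) (y.d k)
  | _, _, .left x T =>
      bil BTerm.left (x.d k) (Finsupp.single T 1)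
        + (-1 : k) ^ x.deg • bil BTerm.left (Finsupp.single x 1) T.d
  | _, _, .nil => 0
  | _, _, .cons hl t T =>
      bil (BTerm.cons hl) t.d (Finsupp.single T 1)
        + (-1 : k) ^ t.deg • bil (BTerm.cons hl) (Finsupp.single t 1) T.d

/-- Linear extension of `OTerm.d`. -/
noncomputable def dO (l : List Col) (c : Col) : (OTerm l c →₀ k) →ₗ[k] (OTerm l c →₀ k) :=
  Finsupp.linearCombination k (OTerm.d k)

/-- Linear extension of `BTerm.d`. -/
noncomputable def dB (o : Out) (l : List Col) : (BTerm o l →₀ k) →ₗ[k] (BTerm o l →₀ k) :=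
  Finsupp.linearCombination k (BTerm.d k)

/-! ## The ideals -/

/-- Combinations of operadic monomials that vanish: the consequences of the axioms of a
(non-symmetric, coloured, graded) operad, together with the DG-ideal generated by those `μ^c_{n+2}`
with `(c, n) ∈ Z`. -/
inductive OZero (Z : Set (Col × ℕ)) : ∀ {l : List Col} {c : Col}, (OTerm l c →₀ k) → Prop
  | zero {l : List Col} {c : Col} : OZero Z (0 : OTerm l c →₀ k)
  | add {l : List Col} {c : Col} {x y : OTerm l c →₀ k} :
      OZero Z x → OZero Z y → OZero Z (x + y)
  | smul {l : List Col} {c : Col} (s : k) {x : OTerm l c →₀ k} : OZero Z x → OZero Z (s • x)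
  | comp_left {l0 l1 l2 l' l : List Col} {c c' : Col} (hx : l0 = l1 ++ c' :: l2)
      (hl : l = l1 ++ (l' ++ l2)) {x : OTerm l0 c →₀ k} (y : OTerm l' c' →₀ k) :
      OZero Z x → OZero Z (bil (OTerm.comp hx hl) x y)
  | comp_right {l0 l1 l2 l' l : List Col} {c c' : Col} (hx : l0 = l1 ++ c' :: l2)
      (hl : l = l1 ++ (l' ++ l2)) (x : OTerm l0 c →₀ k) {y : OTerm l' c' →₀ k} :
      OZero Z y → OZero Z (bil (OTerm.comp hx hl) x y)
  | diff {l : List Col} {c : Col} {x : OTerm l c →₀ k} : OZero Z x → OZero Z (dO k l c x)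
  | gen {c : Col} {n : ℕ} : (c, n) ∈ Z → OZero Z (Finsupp.single (OTerm.mu c n) 1)
  | one_comp {l : List Col} {c : Col} (hx : [c] = [] ++ c :: []) (hl : l = [] ++ (l ++ []))
      (y : OTerm l c) :
      OZero Z (Finsupp.single (OTerm.comp hx hl (OTerm.one c) y) 1 - Finsupp.single y 1)
  | comp_one {l l1 l2 : List Col} {c c' : Col} (hx : l = l1 ++ c' :: l2)
      (hl : l = l1 ++ ([c'] ++ l2)) (x : OTerm l c) :
      OZero Z (Finsupp.single (OTerm.comp hx hl x (OTerm.one c')) 1 - Finsupp.single x 1)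
  | sequential {l0 l1 l2 l' m1 m2 l'' lxy lyz l : List Col} {c c' c'' : Col}
      (hx : l0 = l1 ++ c' :: l2) (hy : l' = m1 ++ c'' :: m2)
      (hxy : lxy = l1 ++ (l' ++ l2)) (hyz : lyz = m1 ++ (l'' ++ m2))
      (hxy' : lxy = (l1 ++ m1) ++ c'' :: (m2 ++ l2))
      (hl : l = (l1 ++ m1) ++ (l'' ++ (m2 ++ l2))) (hl' : l = l1 ++ (lyz ++ l2))
      (x : OTerm l0 c) (y : OTerm l' c') (z : OTerm l'' c'') :
      OZero Z (Finsupp.single (OTerm.comp hxy' hl (OTerm.comp hx hxy x y) z) 1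
        - Finsupp.single (OTerm.comp hx hl' x (OTerm.comp hy hyz y z)) 1)
  | parallel {l0 l1 l2 l3 l' l'' lxy lxz l : List Col} {c c' c'' : Col}
      (hx : l0 = l1 ++ c' :: (l2 ++ c'' :: l3)) (hx' : l0 = (l1 ++ c' :: l2) ++ c'' :: l3)
      (hxy : lxy = l1 ++ (l' ++ (l2 ++ c'' :: l3)))
      (hxy' : lxy = (l1 ++ (l' ++ l2)) ++ c'' :: l3)
      (hxz : lxz = (l1 ++ c' :: l2) ++ (l'' ++ l3))
      (hxz' : lxz = l1 ++ c' :: (l2 ++ (l'' ++ l3)))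
      (hl : l = (l1 ++ (l' ++ l2)) ++ (l'' ++ l3)) (hl' : l = l1 ++ (l' ++ (l2 ++ (l'' ++ l3))))
      (x : OTerm l0 c) (y : OTerm l' c') (z : OTerm l'' c'') :
      OZero Z (Finsupp.single (OTerm.comp hxy' hl (OTerm.comp hx hxy x y) z) 1
        - (-1 : k) ^ (y.deg * z.deg) •
          Finsupp.single (OTerm.comp hxz' hl' (OTerm.comp hx' hxz x z) y) 1)

/-- Combinations of bimodule monomials (or of tuples) that vanish: the consequences of the axioms
of a bimodule over the operad of monomials modulo `OZero Z`, together with the DG-subbimodule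
generated by those `f^c_{n+1}` with `(c, n) ∈ W`. -/
inductive BZero (Z W : Set (Col × ℕ)) : ∀ {o : Out} {l : List Col}, (BTerm o l →₀ k) → Prop
  | zero {o : Out} {l : List Col} : BZero Z W (0 : BTerm o l →₀ k)
  | add {o : Out} {l : List Col} {x y : BTerm o l →₀ k} :
      BZero Z W x → BZero Z W y → BZero Z W (x + y)
  | smul {o : Out} {l : List Col} (s : k) {x : BTerm o l →₀ k} :
      BZero Z W x → BZero Z W (s • x)
  | right_left {l0 l1 l2 l' l : List Col} {c c' : Col} (hx : l0 = l1 ++ c' :: l2)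
      (hl : l = l1 ++ (l' ++ l2)) {x : BTerm (.single c) l0 →₀ k} (y : OTerm l' c' →₀ k) :
      BZero Z W x → BZero Z W (bil (BTerm.right hx hl) x y)
  | right_right {l0 l1 l2 l' l : List Col} {c c' : Col} (hx : l0 = l1 ++ c' :: l2)
      (hl : l = l1 ++ (l' ++ l2)) (x : BTerm (.single c) l0 →₀ k) {y : OTerm l' c' →₀ k} :
      OZero k Z y → BZero Z W (bil (BTerm.right hx hl) x y)
  | left_left {cs l : List Col} {c : Col} {x : OTerm cs c →₀ k}
      (T : BTerm (.tuple cs) l →₀ k) : OZero k Z x → BZero Z W (bil BTerm.left x T)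
  | left_right {cs l : List Col} {c : Col} (x : OTerm cs c →₀ k)
      {T : BTerm (.tuple cs) l →₀ k} : BZero Z W T → BZero Z W (bil BTerm.left x T)
  | cons_left {c : Col} {cs l1 l2 l : List Col} (hl : l = l1 ++ l2)
      {t : BTerm (.single c) l1 →₀ k} (T : BTerm (.tuple cs) l2 →₀ k) :
      BZero Z W t → BZero Z W (bil (BTerm.cons hl) t T)
  | cons_right {c : Col} {cs l1 l2 l : List Col} (hl : l = l1 ++ l2)
      (t : BTerm (.single c) l1 →₀ k) {T : BTerm (.tuple cs) l2 →₀ k} :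
      BZero Z W T → BZero Z W (bil (BTerm.cons hl) t T)
  | diff {o : Out} {l : List Col} {x : BTerm o l →₀ k} : BZero Z W x → BZero Z W (dB k o l x)
  | gen {c : Col} {n : ℕ} : (c, n) ∈ W → BZero Z W (Finsupp.single (BTerm.f c n) 1)
  | one_left {l : List Col} {c : Col} (hl : l = l ++ []) (t : BTerm (.single c) l) :
      BZero Z W (Finsupp.single (BTerm.left (OTerm.one c) (BTerm.cons hl t BTerm.nil)) 1
        - Finsupp.single t 1)
  | right_one {l l1 l2 : List Col} {c c' : Col} (hx : l = l1 ++ c' :: l2)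
      (hl : l = l1 ++ ([c'] ++ l2)) (x : BTerm (.single c) l) :
      BZero Z W (Finsupp.single (BTerm.right hx hl x (OTerm.one c')) 1 - Finsupp.single x 1)
  | right_sequential {l0 l1 l2 l' m1 m2 l'' lxy lyz l : List Col} {c c' c'' : Col}
      (hx : l0 = l1 ++ c' :: l2) (hy : l' = m1 ++ c'' :: m2)
      (hxy : lxy = l1 ++ (l' ++ l2)) (hyz : lyz = m1 ++ (l'' ++ m2))
      (hxy' : lxy = (l1 ++ m1) ++ c'' :: (m2 ++ l2))
      (hl : l = (l1 ++ m1) ++ (l'' ++ (m2 ++ l2))) (hl' : l = l1 ++ (lyz ++ l2))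
      (x : BTerm (.single c) l0) (y : OTerm l' c') (z : OTerm l'' c'') :
      BZero Z W (Finsupp.single (BTerm.right hxy' hl (BTerm.right hx hxy x y) z) 1
        - Finsupp.single (BTerm.right hx hl' x (OTerm.comp hy hyz y z)) 1)
  | right_parallel {l0 l1 l2 l3 l' l'' lxy lxz l : List Col} {c c' c'' : Col}
      (hx : l0 = l1 ++ c' :: (l2 ++ c'' :: l3)) (hx' : l0 = (l1 ++ c' :: l2) ++ c'' :: l3)
      (hxy : lxy = l1 ++ (l' ++ (l2 ++ c'' :: l3)))
      (hxy' : lxy = (l1 ++ (l' ++ l2)) ++ c'' :: l3)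
      (hxz : lxz = (l1 ++ c' :: l2) ++ (l'' ++ l3))
      (hxz' : lxz = l1 ++ c' :: (l2 ++ (l'' ++ l3)))
      (hl : l = (l1 ++ (l' ++ l2)) ++ (l'' ++ l3)) (hl' : l = l1 ++ (l' ++ (l2 ++ (l'' ++ l3))))
      (x : BTerm (.single c) l0) (y : OTerm l' c') (z : OTerm l'' c'') :
      BZero Z W (Finsupp.single (BTerm.right hxy' hl (BTerm.right hx hxy x y) z) 1
        - (-1 : k) ^ (y.deg * z.deg) •
          Finsupp.single (BTerm.right hxz' hl' (BTerm.right hx' hxz x z) y) 1)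
  /- `(x ∘ y)(T₁, T, T₂) = ± x (T₁, y(T), T₂)` -/
  | left_comp {cs1 cs2 cs l1 l2 l : List Col} {c c' : Col}
      (x : OTerm (cs1 ++ c' :: cs2) c) (y : OTerm cs c')
      (T1 : BTerm (.tuple cs1) l1) (T : BTerm (.tuple cs) l) (T2 : BTerm (.tuple cs2) l2) :
      BZero Z W
        (Finsupp.single (BTerm.left (OTerm.comp rfl rfl x y) (T1.append (T.append T2))) 1
        - (-1 : k) ^ (y.deg * T1.deg) •
          Finsupp.single
            (BTerm.left x (T1.append (BTerm.cons rfl (BTerm.left y T) T2))) 1)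
  /- `x (T₁, t, T₂) ∘ z = ± x (T₁, t ∘ z, T₂)` -/
  | left_right_comm {cs1 cs2 l1 l2 lt m1 m2 lz ltz : List Col} {c c' c'' : Col}
      (ht : lt = m1 ++ c'' :: m2) (htz : ltz = m1 ++ (lz ++ m2))
      (hx : l1 ++ (lt ++ l2) = (l1 ++ m1) ++ c'' :: (m2 ++ l2))
      (hl : l1 ++ (ltz ++ l2) = (l1 ++ m1) ++ (lz ++ (m2 ++ l2)))
      (x : OTerm (cs1 ++ c' :: cs2) c) (T1 : BTerm (.tuple cs1) l1)
      (t : BTerm (.single c') lt) (T2 : BTerm (.tuple cs2) l2) (z : OTerm lz c'') :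
      BZero Z W
        (Finsupp.single
          (BTerm.right hx hl (BTerm.left x (T1.append (BTerm.cons rfl t T2))) z) 1
        - (-1 : k) ^ (z.deg * T2.deg) •
          Finsupp.single
            (BTerm.left x (T1.append (BTerm.cons rfl (BTerm.right ht htz t z) T2))) 1)

/-- The vanishing combinations of operadic monomials, as a submodule. -/
def idealO (Z : Set (Col × ℕ)) (l : List Col) (c : Col) : Submodule k (OTerm l c →₀ k) where
  carrier := {x | OZero k Z x}
  zero_mem' := OZero.zero
  add_mem' := OZero.add
  smul_mem' s _ h := OZero.smul s h

/-- The vanishing combinations of bimodule monomials or tuples, as a submodule. -/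
def idealB (Z W : Set (Col × ℕ)) (o : Out) (l : List Col) : Submodule k (BTerm o l →₀ k) where
  carrier := {x | BZero k Z W x}
  zero_mem' := BZero.zero
  add_mem' := BZero.add
  smul_mem' s _ h := BZero.smul s h

/-- The operad of monomials modulo `OZero`. -/
abbrev OQuot (Z : Set (Col × ℕ)) (l : List Col) (c : Col) : Type u :=
  (OTerm l c →₀ k) ⧸ idealO k Z l c

/-- The bimodule of monomials modulo `BZero`, and its tuples. -/
abbrev BQuot (Z W : Set (Col × ℕ)) (o : Out) (l : List Col) : Type u :=
  (BTerm o l →₀ k) ⧸ idealB k Z W o l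

/-- The class of a tuple of elements of the quotient bimodule. -/
noncomputable def tupClass (Z W : Set (Col × ℕ)) : ∀ {cs l : List Col},
    Tup (fun l c => BQuot k Z W (.single c) l) cs l → BQuot k Z W (.tuple cs) l
  | _, _, .nil => Submodule.Quotient.mk (Finsupp.single BTerm.nil 1)
  | _, _, .cons hl t T =>
      bilQ (idealB k Z W _ _) (idealB k Z W _ _) (idealB k Z W _ _) (bil (BTerm.cons hl))
        (fun _ h y => BZero.cons_left hl y h) (fun x _ h => BZero.cons_right hl x h)
        t (tupClass Z W T)

/-- The pair (DG-operad, DG-bimodule) obtained from the free operad on the `μ^c_n` and the free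
bimodule on the `f^c_n` with the differentials `dMu`, `dF`, by dividing out the generators
`μ^c_{n+2}` with `(c, n) ∈ Z` and `f^c_{n+1}` with `(c, n) ∈ W`. -/
noncomputable def presentedPair (Z W : Set (Col × ℕ)) : DGPair k where
  P := OQuot k Z
  M := fun l c => BQuot k Z W (.single c) l
  gradeP := fun l c n => (Submodule.span k
    {x | ∃ t : OTerm l c, t.deg = n ∧ x = Finsupp.single t 1}).map (idealO k Z l c).mkQ
  gradeM := fun l c n => (Submodule.span k
    {x | ∃ t : BTerm (.single c) l, t.deg = n ∧ x = Finsupp.single t 1}).map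
      (idealB k Z W (.single c) l).mkQ
  dP := fun l c => (idealO k Z l c).mapQ (idealO k Z l c) (dO k l c) (fun _ h => OZero.diff h)
  dM := fun l c => (idealB k Z W (.single c) l).mapQ (idealB k Z W (.single c) l)
    (dB k (.single c) l) (fun _ h => BZero.diff h)
  one := fun c => Submodule.Quotient.mk (Finsupp.single (OTerm.one c) 1)
  comp := fun hx hl =>
    bilQ (idealO k Z _ _) (idealO k Z _ _) (idealO k Z _ _) (bil (OTerm.comp hx hl))
      (fun _ h y => OZero.comp_left hx hl y h) (fun x _ h => OZero.comp_right hx hl x h)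
  right := fun hx hl =>
    bilQ (idealB k Z W _ _) (idealO k Z _ _) (idealB k Z W _ _) (bil (BTerm.right hx hl))
      (fun _ h y => BZero.right_left hx hl y h) (fun x _ h => BZero.right_right hx hl x h)
  left := fun x T =>
    bilQ (idealO k Z _ _) (idealB k Z W _ _) (idealB k Z W _ _) (bil BTerm.left)
      (fun _ h y => BZero.left_left y h) (fun x _ h => BZero.left_right x h)
      x (tupClass k Z W T)

/-- The underlying pair of `(A_∞^Col, M_∞^Col)`. -/
noncomputable def aInfPair : DGPair k := presentedPair k ∅ ∅

/-- The underlying pair of `(Ω, T)`: the quotient of `(A_∞^Col, M_∞^Col)` by `μ^a_i` for `i > 2`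
and `f^a_i` for `i > 1`. -/
noncomputable def omegaT : DGPair k :=
  presentedPair k {g | g.1 = Col.a ∧ g.2 + 2 > 2} {g | g.1 = Col.a ∧ g.2 + 1 > 1}

/-- The class of `μ^c_{n+2}` in `Ω`. -/
noncomputable def omegaMu (c : Col) (n : ℕ) :
    (omegaT k).P (List.replicate (n + 1) Col.a ++ [c]) c :=
  Submodule.Quotient.mk (Finsupp.single (OTerm.mu c n) 1)

/-- The class of `f^c_{n+1}` in `T`. -/
noncomputable def omegaF (c : Col) (n : ℕ) :
    (omegaT k).M (List.replicate n Col.a ++ [c]) c :=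
  Submodule.Quotient.mk (Finsupp.single (BTerm.f c n) 1)

end Differential

/-! ## Rectangular cell complexes and their cellular chains -/

/-- Closed intervals with rational endpoints; one-point intervals are allowed. -/
abbrev Iv : Type := NonemptyInterval ℚ

/-- A box, the product of a list of intervals. -/
abbrev Box : Type := List Iv

/-- The dimension of a box. -/
def boxDim (w : Box) : ℕ := w.countP (fun I => decide (I.fst < I.snd))

/-- The points of a box, as lists of coordinates. -/
def boxPts (w : Box) : Set (List ℝ) :=
  {x | List.Forall₂ (fun (t : ℝ) (I : Iv) => (I.fst : ℝ) ≤ t ∧ t ≤ (I.snd : ℝ)) x w}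

/-- The points of a box, as a subset of `ℝ^n`. -/
def boxSet (n : ℕ) (w : Box) : Set (Fin n → ℝ) := {x | List.ofFn x ∈ boxPts w}

/-- The boxes in `X` are the closed cells of a CW structure on the cube `[0,1]^n`. -/
def IsCellStructure (n : ℕ) (X : Finset Box) : Prop :=
  ∃ C : Topology.CWComplex (Set.Icc (0 : Fin n → ℝ) 1), ∀ (d : ℕ) (A : Set (Fin n → ℝ)),
    (∃ e : C.cell d, C.map d e '' Metric.closedBall 0 1 = A) ↔
      ∃ w ∈ X, boxDim w = d ∧ boxSet n w = A

/-- Sign of `J₁ × J₂ × …` in the boundary of `I₁ × I₂ × …`, at the first place where `I` is a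
proper interval and `J` is a point: an upper end counts `1`, a lower end `-1`, and every proper
interval before that place contributes a factor `-1`. -/
def faceSign : Box → Box → ℤ
  | I :: v, J :: w =>
      if I.fst < I.snd then
        if J.fst < J.snd then - faceSign v w
        else if J.fst = I.snd then 1
        else if J.fst = I.fst then -1
        else 0
      else faceSign v w
  | _, _ => 0

open Classical in
/-- The incidence number of the cells `v` and `w`, for the product orientations of boxes. -/
noncomputable def incidence (v w : Box) : ℤ :=
  if List.Forall₂ (fun J I : Iv => J ≤ I) w v ∧ boxDim w + 1 = boxDim v then faceSign v w else 0

section Chains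

variable (k : Type u) [Field k]

/-- Cellular chains of a complex of boxes: the `k`-module with basis the cells. -/
abbrev Chain (X : Finset Box) : Type u := {w // w ∈ X} →₀ k

/-- Chains of degree `n`. -/
noncomputable def chainGrade (X : Finset Box) (n : ℕ) : Submodule k (Chain k X) :=
  Submodule.span k {x | ∃ w : {w // w ∈ X}, boxDim w.1 = n ∧ x = Finsupp.single w 1}

/-- The cellular boundary. -/
noncomputable def boundary (X : Finset Box) : Chain k X →ₗ[k] Chain k X :=
  Finsupp.linearCombination k
    (fun v => ∑ w : {w // w ∈ X}, Finsupp.single w ((incidence v.1 w.1 : ℤ) : k))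

/-- Combinations of cells of `X` as combinations of boxes. -/
noncomputable def chainBoxes (X : Finset Box) : Chain k X →ₗ[k] (Box →₀ k) :=
  Finsupp.lmapDomain k k Subtype.val

/-- A combination of cells of `X`, given as a combination of boxes; boxes that are not cells of `X`
are left out. -/
noncomputable def toChain (X : Finset Box) : (Box →₀ k) →ₗ[k] Chain k X :=
  Finsupp.lcomapDomain Subtype.val Subtype.val_injective

/-- The chain of a single cell. -/
noncomputable def cellChain (X : Finset Box) (w : Box) : Chain k X :=
  toChain k X (Finsupp.single w 1)

end Chains

/-! ## Coordinatewise affine embeddings -/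

/-- One coordinate of the target of a coordinatewise affine embedding: either constant, or an affine
function `x ↦ s x + t` of the next coordinate of the source. -/
inductive Slot : Type
  | const (q : ℚ) : Slot
  | aff (s t : ℚ) : Slot

/-- Apply a list of slots, for given meanings of constants and of affine functions. -/
def Slot.eval {α : Type*} (cst : ℚ → α) (act : ℚ → ℚ → α → α) : List Slot → List α → List α
  | [], _ => []
  | .const q :: S, xs => cst q :: Slot.eval cst act S xs
  | .aff s t :: S, x :: xs => act s t x :: Slot.eval cst act S xs
  | .aff _ _ :: _, [] => []

/-- The image of an interval under `x ↦ s x + t`. -/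
def affIv (s t : ℚ) (I : Iv) : Iv :=
  ⟨(min (s * I.fst + t) (s * I.snd + t), max (s * I.fst + t) (s * I.snd + t)), min_le_max⟩

/-- The map of points given by a list of slots. -/
noncomputable def evalPt : List Slot → List ℝ → List ℝ :=
  Slot.eval (fun q => (q : ℝ)) (fun s t x => (s : ℝ) * x + (t : ℝ))

/-- The image of a box under the map given by a list of slots. -/
def evalBox : List Slot → Box → Box :=
  Slot.eval (fun q => NonemptyInterval.pure q) affIv

/-- The number of coordinates of the source. -/
def Slot.inputs : List Slot → ℕ
  | [] => 0
  | .const _ :: S => Slot.inputs S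
  | .aff _ _ :: S => Slot.inputs S + 1

theorem mem_affIv (s t : ℚ) (I : Iv) (y : ℝ) :
    (((affIv s t I).fst : ℝ) ≤ y ∧ y ≤ ((affIv s t I).snd : ℝ)) ↔
      ∃ x : ℝ, ((I.fst : ℝ) ≤ x ∧ x ≤ (I.snd : ℝ)) ∧ (s : ℝ) * x + (t : ℝ) = y := by
  have hI : (I.fst : ℝ) ≤ (I.snd : ℝ) := by exact_mod_cast I.fst_le_snd
  simp only [affIv, Rat.cast_min, Rat.cast_max, Rat.cast_add, Rat.cast_mul]
  rcases lt_trichotomy (s : ℝ) 0 with hs | hs | hs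
  · rw [min_eq_right (by nlinarith), max_eq_left (by nlinarith)]
    constructor
    · rintro ⟨h1, h2⟩
      have hne : (s : ℝ) ≠ 0 := hs.ne
      refine ⟨(y - t) / s, ⟨?_, ?_⟩, by rw [mul_div_cancel₀ _ hne]; ring⟩
      · rw [le_div_iff_of_neg hs]; linarith
      · rw [div_le_iff_of_neg hs]; linarith
    · rintro ⟨x, ⟨h1, h2⟩, rfl⟩
      constructor <;> nlinarith
  · simp only [hs, zero_mul, zero_add, min_self, max_self]
    constructor
    · rintro ⟨h1, h2⟩
      exact ⟨I.fst, ⟨le_rfl, hI⟩, le_antisymm h1 h2⟩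
    · rintro ⟨x, -, rfl⟩
      exact ⟨le_rfl, le_rfl⟩
  · rw [min_eq_left (by nlinarith), max_eq_right (by nlinarith)]
    constructor
    · rintro ⟨h1, h2⟩
      have hne : (s : ℝ) ≠ 0 := hs.ne'
      refine ⟨(y - t) / s, ⟨?_, ?_⟩, by rw [mul_div_cancel₀ _ hne]; ring⟩
      · rw [le_div_iff₀ hs]; linarith
      · rw [div_le_iff₀ hs]; linarith
    · rintro ⟨x, ⟨h1, h2⟩, rfl⟩
      constructor <;> nlinarith

/-- `evalBox S w` is the image of the box `w` under `evalPt S`. -/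
theorem image_evalPt (S : List Slot) (w : Box) (h : Slot.inputs S = w.length) :
    evalPt S '' boxPts w = boxPts (evalBox S w) := by
  induction S generalizing w with
  | nil =>
    cases w with
    | cons _ _ => simp [Slot.inputs] at h
    | nil => ext y; simp [boxPts, evalPt, evalBox, Slot.eval]
  | cons a S ih =>
    cases a with
    | const q =>
      ext y
      have := Set.ext_iff.1 (ih w h)
      simp only [Set.mem_image] at this
      simp only [boxPts, evalPt, evalBox, Slot.eval, Set.mem_image, Set.mem_ofPred_eq] at this ⊢
      constructor
      · rintro ⟨x, hx, rfl⟩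
        exact .cons ⟨le_rfl, le_rfl⟩ ((this _).1 ⟨x, hx, rfl⟩)
      · intro hy
        cases hy with
        | cons h1 h2 =>
          obtain ⟨x, hx, rfl⟩ := (this _).2 h2
          exact ⟨x, hx, congrArg (· :: _) (le_antisymm h1.1 h1.2)⟩
    | aff s t =>
      cases w with
      | nil => simp [Slot.inputs] at h
      | cons I w =>
        ext y
        have := Set.ext_iff.1 (ih w (by simpa [Slot.inputs] using h))
        simp only [Set.mem_image] at this
        simp only [boxPts, evalPt, evalBox, Slot.eval, Set.mem_image, Set.mem_ofPred_eq] at this ⊢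
        constructor
        · rintro ⟨x, hx, rfl⟩
          cases hx with
          | cons h1 h2 =>
            exact .cons ((mem_affIv s t I _).2 ⟨_, h1, rfl⟩) ((this _).1 ⟨_, h2, rfl⟩)
        · intro hy
          cases hy with
          | cons h1 h2 =>
            obtain ⟨x, hx, rfl⟩ := (this _).2 h2
            obtain ⟨x0, hx0, rfl⟩ := (mem_affIv s t I _).1 h1
            exact ⟨x0 :: x, .cons hx0 hx, rfl⟩

/-- The degree `±1` of the map from a box onto its image: a factor `-1` for each proper interval on
which the slope is negative. -/
def evalSign : List Slot → Box → ℤ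
  | .const _ :: S, w => evalSign S w
  | .aff s _ :: S, I :: w => (if I.fst < I.snd ∧ s < 0 then -1 else 1) * evalSign S w
  | _, _ => 1

/-- The chain map into the cellular chains of `X` induced by a list of slots. -/
noncomputable def pushChain (k : Type u) [Field k] (S : List Slot) (X : Finset Box) :
    (Box →₀ k) →ₗ[k] Chain k X :=
  toChain k X ∘ₗ Finsupp.linearCombination k
    (fun w => Finsupp.single (evalBox S w) ((evalSign S w : ℤ) : k))

/-- The cross product of chains: the product of cells is the product box. -/
noncomputable def cross (k : Type u) [Field k] :
    (Box →₀ k) →ₗ[k] (Box →₀ k) →ₗ[k] (Box →₀ k) :=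
  bil (fun v w : Box => v ++ w)

/-! ## Cubes and freehedra -/

/-- The interval `[p, q]` for `p ≤ q`. -/
def iv (p q : ℚ) (h : p ≤ q) : Iv := ⟨(p, q), h⟩

/-- The cell `[0,1]`. -/
def unitIv : Iv := iv 0 1 (by norm_num)

/-- The cells of `[0,1]`. -/
def intervalCells : Finset Iv := {NonemptyInterval.pure 0, NonemptyInterval.pure 1, unitIv}

/-- The cells of `[0,1]` subdivided at `1/2`. -/
def halvedCells : Finset Iv :=
  {NonemptyInterval.pure 0, NonemptyInterval.pure (1 / 2), NonemptyInterval.pure 1,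
    iv 0 (1 / 2) (by norm_num), iv (1 / 2) 1 (by norm_num)}

/-- The cells of the cube `I^n`. -/
def cube : ℕ → Finset Box
  | 0 => {[]}
  | n + 1 => (cube n).biUnion fun w => intervalCells.image fun I => I :: w

/-- The distinguished hyperface of the freehedron of dimension `n ≥ 1`. New coordinates are put in
front of the old ones. -/
def distFace : ℕ → Box
  | 0 => []
  | 1 => [NonemptyInterval.pure 1]
  | n + 2 => iv (1 / 2) 1 (by norm_num) :: distFace (n + 1)

open Classical in
/-- The cells of the freehedron `F_n`, a subdivision of `[0,1]^n`: `F_{n+1}` is `[0,1] × F_n` with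
`[0,1] × X_n` split at `1/2`, where `X_n` is the distinguished hyperface. -/
noncomputable def freehedron : ℕ → Finset Box
  | 0 => {[]}
  | 1 => intervalCells.image fun I => [I]
  | n + 2 => (freehedron (n + 1)).biUnion fun w =>
      (if List.Forall₂ (fun J I : Iv => J ≤ I) w (distFace (n + 1))
        then halvedCells else intervalCells).image fun I => I :: w

/-! ## The CW-operad of cubes and the CW-bimodule of freehedra -/

/-- Profiles `(a^n, c; c)`; all other profiles are empty. -/
def IsProfile (l : List Col) (c : Col) : Prop := ∃ n : ℕ, l = List.replicate n Col.a ++ [c]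

/-- The dimension of the cube of operations of arity `n`: a point for output `a`, and `I^{n-2}` for
output `m`, with a point for `n = 1`. -/
def cubeDim : Col → ℕ → ℕ
  | .a, _ => 0
  | .m, n => n - 2

/-- The dimension of the freehedron of arity `n`: a point for output `a`, and `F_{n-1}` for
output `m`. -/
def freeDim : Col → ℕ → ℕ
  | .a, _ => 0
  | .m, n => n - 1

open Classical in
/-- The cells of the operad of cubes at the profile `(l; c)`. -/
noncomputable def cubeOp (l : List Col) (c : Col) : Finset Box :=
  if IsProfile l c then cube (cubeDim c l.length) else ∅

open Classical in
/-- The cells of the bimodule of freehedra at the profile `(l; c)`. -/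
noncomputable def freeMod (l : List Col) (c : Col) : Finset Box :=
  if IsProfile l c then freehedron (freeDim c l.length) else ∅

theorem cubeOp_m (n : ℕ) : cubeOp (List.replicate n Col.a ++ [Col.m]) Col.m = cube (n - 1) := by
  rw [cubeOp, if_pos ⟨n, rfl⟩]
  simp [cubeDim]

theorem freeMod_m (n : ℕ) :
    freeMod (List.replicate n Col.a ++ [Col.m]) Col.m = freehedron n := by
  rw [freeMod, if_pos ⟨n, rfl⟩]
  simp [freeDim]

/-- `n` coordinates that are copied. -/
def copies (n : ℕ) : List Slot := List.replicate n (.aff 1 0)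

/-- Operadic composition of cubes, into input number `i` (of colour `c'`, counted from zero) of an
operation of arity `n` with output `c`, of an operation of arity `n'`. Into the module input:
`(x, y) ↦ (x, 1, y)` (and the identity if one of the two arities is one). Into an algebra input, the
leaf is multiplied: `n' - 1` zeros are inserted after the first `i` coordinates. -/
def compSlots : Col → Col → ℕ → ℕ → ℕ → List Slot
  | .a, _, _, _, _ => []
  | .m, .a, i, n, n' => copies i ++ List.replicate (n' - 1) (.const 0) ++ copies (n - 2 - i)
  | .m, .m, _, n, n' =>
      if n ≤ 1 then copies (n' - 2)
      else if n' ≤ 1 then copies (n - 2)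
      else copies (n - 2) ++ [.const 1] ++ copies (n' - 2)

/-- Right action of cubes on freehedra. Into the module input:
`(y, z) ↦ (y₁, …, y_{p-1}, y_p / 2, 1 - z₁ / 2, …, 1 - z_q / 2, 1)` (and the identity if the cube is
the unit). Into an algebra input, the leaf is multiplied: `n' - 1` ones are inserted after the first
`i` coordinates. -/
def rightSlots : Col → Col → ℕ → ℕ → ℕ → List Slot
  | .a, _, _, _, _ => []
  | .m, .a, i, n, n' => copies i ++ List.replicate (n' - 1) (.const 1) ++ copies (n - 1 - i)
  | .m, .m, _, n, n' =>
      if n' ≤ 1 then copies (n - 1)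
      else (if n ≤ 1 then [] else copies (n - 2) ++ [.aff (1 / 2) 0])
        ++ List.replicate (n' - 2) (.aff (-1 / 2) 1) ++ [.const 1]

/-- Auxiliary to `leftSlots`, for the output `m`; the list holds the arities of the entries. -/
def leftSlotsAux : List ℕ → List Slot
  | [] => []
  | [j] => copies (j - 1)
  | [j, j'] => List.replicate (j - 1) (.const 1) ++ .const 0 :: copies (j' - 1)
  | j :: j' :: j'' :: js =>
      List.replicate (j - 1) (.const 1) ++ .aff (-1) 1 :: leftSlotsAux (j' :: j'' :: js)

/-- Left action of cubes on freehedra: `(x, t₁, …, t_n, y) ↦ (1 - x', 0, y)`, where `x'` is `x` with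
its leaves multiplied according to the arities of the `tᵢ` (and the identity if the cube is the
unit). -/
def leftSlots : Col → List ℕ → List Slot
  | .a, _ => []
  | .m, js => leftSlotsAux js

/-- The coordinates of a tuple of boxes or points, one after the other. -/
def Tup.coords {α : Type} {X : List Col → Col → Type} (f : ∀ l c, X l c → List α) :
    ∀ {cs l : List Col}, Tup X cs l → List α
  | _, _, .nil => []
  | _, _, .cons _ x T => f _ _ x ++ T.coords f

/-- The points of the cube at the profile `(l; c)`. -/
def cubePts (l : List Col) (c : Col) : Set (List ℝ) :=
  {x | IsProfile l c ∧ x.length = cubeDim c l.length ∧ ∀ t ∈ x, 0 ≤ t ∧ t ≤ 1}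

/-- The points of the freehedron at the profile `(l; c)`. -/
def freePts (l : List Col) (c : Col) : Set (List ℝ) :=
  {x | IsProfile l c ∧ x.length = freeDim c l.length ∧ ∀ t ∈ x, 0 ≤ t ∧ t ≤ 1}

/-- Operadic composition on points of cubes. -/
noncomputable def compPt (c c' : Col) (i n n' : ℕ) (x y : List ℝ) : List ℝ :=
  evalPt (compSlots c c' i n n') (x ++ y)

/-- Right action on points of freehedra. -/
noncomputable def rightPt (c c' : Col) (i n n' : ℕ) (x y : List ℝ) : List ℝ :=
  evalPt (rightSlots c c' i n n') (x ++ y)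

/-- Left action on points of freehedra. -/
noncomputable def leftPt (c : Col) (js : List ℕ) (x ys : List ℝ) : List ℝ :=
  evalPt (leftSlots c js) (x ++ ys)

/-- Tuples of points of freehedra. -/
abbrev PtTup (cs l : List Col) : Type := Tup (fun l c => freePts l c) cs l

/-- The coordinates of a tuple of points of freehedra. -/
def PtTup.pts {cs l : List Col} (T : PtTup cs l) : List ℝ := T.coords (fun _ _ x => x.1)

/-- The cubes form an operad and the freehedra form a bimodule over it, in cell complexes: all
structure maps send products of cells onto cells, and the axioms hold for points. -/
structure IsCWPair : Prop where
  one_cell : ∀ c : Col, [] ∈ cubeOp [c] c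
  comp_cell : ∀ {l1 l2 l' : List Col} {c c' : Col} {v w : Box},
    v ∈ cubeOp (l1 ++ c' :: l2) c → w ∈ cubeOp l' c' →
    evalBox (compSlots c c' l1.length (l1 ++ c' :: l2).length l'.length) (v ++ w)
      ∈ cubeOp (l1 ++ (l' ++ l2)) c
  right_cell : ∀ {l1 l2 l' : List Col} {c c' : Col} {v w : Box},
    v ∈ freeMod (l1 ++ c' :: l2) c → w ∈ cubeOp l' c' →
    evalBox (rightSlots c c' l1.length (l1 ++ c' :: l2).length l'.length) (v ++ w)
      ∈ freeMod (l1 ++ (l' ++ l2)) c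
  left_cell : ∀ {cs l : List Col} {c : Col} {v : Box}
    (T : Tup (fun l c => {w // w ∈ freeMod l c}) cs l), v ∈ cubeOp cs c →
    evalBox (leftSlots c T.arities) (v ++ T.coords (fun _ _ w => w.1)) ∈ freeMod l c
  one_comp : ∀ {l : List Col} {c : Col} {y : List ℝ}, y ∈ cubePts l c →
    compPt c c 0 1 l.length [] y = y
  comp_one : ∀ {l1 l2 : List Col} {c c' : Col} {x : List ℝ}, x ∈ cubePts (l1 ++ c' :: l2) c →
    compPt c c' l1.length (l1 ++ c' :: l2).length 1 x [] = x
  sequential : ∀ {l1 l2 m1 m2 l'' : List Col} {c c' c'' : Col} {x y z : List ℝ},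
    x ∈ cubePts (l1 ++ c' :: l2) c → y ∈ cubePts (m1 ++ c'' :: m2) c' → z ∈ cubePts l'' c'' →
    compPt c c'' (l1 ++ m1).length (l1 ++ ((m1 ++ c'' :: m2) ++ l2)).length l''.length
      (compPt c c' l1.length (l1 ++ c' :: l2).length (m1 ++ c'' :: m2).length x y) z
    = compPt c c' l1.length (l1 ++ c' :: l2).length (m1 ++ (l'' ++ m2)).length x
      (compPt c' c'' m1.length (m1 ++ c'' :: m2).length l''.length y z)
  parallel : ∀ {l1 l2 l3 l' l'' : List Col} {c c' c'' : Col} {x y z : List ℝ},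
    x ∈ cubePts (l1 ++ c' :: (l2 ++ c'' :: l3)) c → y ∈ cubePts l' c' → z ∈ cubePts l'' c'' →
    compPt c c'' (l1 ++ (l' ++ l2)).length (l1 ++ (l' ++ (l2 ++ c'' :: l3))).length l''.length
      (compPt c c' l1.length (l1 ++ c' :: (l2 ++ c'' :: l3)).length l'.length x y) z
    = compPt c c' l1.length (l1 ++ c' :: (l2 ++ (l'' ++ l3))).length l'.length
      (compPt c c'' (l1 ++ c' :: l2).length (l1 ++ c' :: (l2 ++ c'' :: l3)).length l''.length
        x z) y
  right_one : ∀ {l1 l2 : List Col} {c c' : Col} {x : List ℝ}, x ∈ freePts (l1 ++ c' :: l2) c →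
    rightPt c c' l1.length (l1 ++ c' :: l2).length 1 x [] = x
  right_sequential : ∀ {l1 l2 m1 m2 l'' : List Col} {c c' c'' : Col} {x y z : List ℝ},
    x ∈ freePts (l1 ++ c' :: l2) c → y ∈ cubePts (m1 ++ c'' :: m2) c' → z ∈ cubePts l'' c'' →
    rightPt c c'' (l1 ++ m1).length (l1 ++ ((m1 ++ c'' :: m2) ++ l2)).length l''.length
      (rightPt c c' l1.length (l1 ++ c' :: l2).length (m1 ++ c'' :: m2).length x y) z
    = rightPt c c' l1.length (l1 ++ c' :: l2).length (m1 ++ (l'' ++ m2)).length x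
      (compPt c' c'' m1.length (m1 ++ c'' :: m2).length l''.length y z)
  right_parallel : ∀ {l1 l2 l3 l' l'' : List Col} {c c' c'' : Col} {x y z : List ℝ},
    x ∈ freePts (l1 ++ c' :: (l2 ++ c'' :: l3)) c → y ∈ cubePts l' c' → z ∈ cubePts l'' c'' →
    rightPt c c'' (l1 ++ (l' ++ l2)).length (l1 ++ (l' ++ (l2 ++ c'' :: l3))).length l''.length
      (rightPt c c' l1.length (l1 ++ c' :: (l2 ++ c'' :: l3)).length l'.length x y) z
    = rightPt c c' l1.length (l1 ++ c' :: (l2 ++ (l'' ++ l3))).length l'.length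
      (rightPt c c'' (l1 ++ c' :: l2).length (l1 ++ c' :: (l2 ++ c'' :: l3)).length l''.length
        x z) y
  one_left : ∀ {l : List Col} {c : Col} {y : List ℝ}, y ∈ freePts l c →
    leftPt c [l.length] [] y = y
  left_comp : ∀ {cs1 cs2 cs l1 l2 l : List Col} {c c' : Col} {x y : List ℝ}
    (T1 : PtTup cs1 l1) (T : PtTup cs l) (T2 : PtTup cs2 l2),
    x ∈ cubePts (cs1 ++ c' :: cs2) c → y ∈ cubePts cs c' →
    leftPt c (T1.arities ++ (T.arities ++ T2.arities))
      (compPt c c' cs1.length (cs1 ++ c' :: cs2).length cs.length x y)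
      (T1.pts ++ (T.pts ++ T2.pts))
    = leftPt c (T1.arities ++ l.length :: T2.arities) x
      (T1.pts ++ (leftPt c' T.arities y T.pts ++ T2.pts))
  left_right : ∀ {cs1 cs2 l1 l2 m1 m2 l' : List Col} {c c' c'' : Col} {x t z : List ℝ}
    (T1 : PtTup cs1 l1) (T2 : PtTup cs2 l2),
    x ∈ cubePts (cs1 ++ c' :: cs2) c → t ∈ freePts (m1 ++ c'' :: m2) c' → z ∈ cubePts l' c'' →
    rightPt c c'' (l1 ++ m1).length (l1 ++ ((m1 ++ c'' :: m2) ++ l2)).length l'.length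
      (leftPt c (T1.arities ++ (m1 ++ c'' :: m2).length :: T2.arities) x
        (T1.pts ++ (t ++ T2.pts))) z
    = leftPt c (T1.arities ++ (m1 ++ (l' ++ m2)).length :: T2.arities) x
      (T1.pts ++ (rightPt c' c'' m1.length (m1 ++ c'' :: m2).length l'.length t z ++ T2.pts))

/-- The cross product of a tuple of chains of freehedra. -/
noncomputable def tupBoxes (k : Type u) [Field k] : ∀ {cs l : List Col},
    Tup (fun l c => Chain k (freeMod l c)) cs l → (Box →₀ k)
  | _, _, .nil => Finsupp.single [] 1
  | _, _, .cons _ t T => cross k (chainBoxes k _ t) (tupBoxes k T)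

/-- The pair `C_*(I, F)`: cellular chains on the operad of cubes and on the bimodule of freehedra,
with the operations induced by the structure maps. -/
noncomputable def cellularPair (k : Type u) [Field k] : DGPair k where
  P := fun l c => Chain k (cubeOp l c)
  M := fun l c => Chain k (freeMod l c)
  gradeP := fun l c n => chainGrade k (cubeOp l c) n
  gradeM := fun l c n => chainGrade k (freeMod l c) n
  dP := fun l c => boundary k (cubeOp l c)
  dM := fun l c => boundary k (freeMod l c)
  one := fun c => cellChain k (cubeOp [c] c) []
  comp := fun {l0 l1 _ l' l c c'} _ _ =>
    ((cross k).compl₁₂ (chainBoxes k (cubeOp l0 c)) (chainBoxes k (cubeOp l' c'))).compr₂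
      (pushChain k (compSlots c c' l1.length l0.length l'.length) (cubeOp l c))
  right := fun {l0 l1 _ l' l c c'} _ _ =>
    ((cross k).compl₁₂ (chainBoxes k (freeMod l0 c)) (chainBoxes k (cubeOp l' c'))).compr₂
      (pushChain k (rightSlots c c' l1.length l0.length l'.length) (freeMod l c))
  left := fun {cs l c} x T =>
    pushChain k (leftSlots c T.arities) (freeMod l c)
      (cross k (chainBoxes k (cubeOp cs c) x) (tupBoxes k T))

end OperadicFreehedra

open OperadicFreehedra

/-!
The statement has a geometric part and an algebraic part.

*Cells and structure maps.* All structure maps are coordinatewise affine embeddings, encoded by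
lists of slots, and `Slot.eval` evaluates such a list on points as well as on boxes. The axioms are
therefore proved once, for an arbitrary action of affine maps of one variable (`AffLaws`,
`eval_sequential`, `eval_parallel`, `eval_left_comp`, …). A freehedron is an iterated product with
intervals in which the interval over a cell of the distinguished hyperface is halved; the recursive
description `IsFreeCell` of its cells is what makes `right_mem_freeMod` and `left_mem_freeMod` (cells
go to cells) and the CW structure accessible.

*Realization.* The boundary of a cube is a product of boundaries of intervals, while a subdivision
replaces the chain `[0,1]` by `[0,1/2] + [1/2,1]`. Both become visible at once if every rational point
`q` is given a formal primitive, and `[p,q]` is replaced by the primitive of `q` minus that of `p`: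
`boxR` is the resulting multiplicative map from boxes to formal combinations of lists of labelled
points (`LPt`). It is injective on the cells of a cube or a freehedron (`realChain_injective`), it
turns the cellular boundary into a derivation (`realChain_boundary`), and an affine embedding acts on it by `evalL`.
Sending `μ^m_{n+2}` and `f^m_{n+1}` to the realized cube `[0,1]^n` extends to all operadic and bimodule
monomials (`OTerm.real`, `BTerm.real`). The axioms of an operadic bimodule hold for the realization,
and so do the formulas for `dμ` and `df` (`realO_dMu`, `realB_dF`): every face of a cube is hit by
exactly one summand, where the last faces of the freehedron arise as the sum of its small cells. Hence
the realization descends to `Ω` and `T` (`realO_eq_zero`, `realB_eq_zero`).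

*Normal forms.* The realization has the same target for the algebraic and for the cellular side, so
it suffices to show that both sides have the same image and that it is injective on `Ω` and `T`. Every
operadic monomial vanishes or equals a normal form, and every bimodule monomial is a multiple of a
normal form (`exists_isFormO`, `exists_isFormB`). Normal forms with output `m` are indexed by words:
in the operad by the cells of a cube, where `0` stands for an insertion of `μ^a_2` and `1` for a
composition at the module input (`CubeWord`); in the bimodule by pairs of words, where the first one
describes iterated right actions of `μ^a_2` and left actions of `μ^m` on some `f^m` (`FreeWord`) and the
second one an operation that acts from the right at the module input. The reductions use that `μ^a_2`
is associative and commutes with `f^a_1`, which is what `dμ^a_3 = 0` and `df^a_2 = 0` say. Each normal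
form is realized by a single cell up to a unit, and every cell of the cube or freehedron occurs for
exactly one of them (`exists_cellOf`, `cellOf_injective`). By `exists_equiv` this gives isomorphisms
`Ω(l;c) ≅ C_*(I(l;c))` and `T(l;c) ≅ C_*(F(l;c))` over the common target of the realizations.
Compatibility with differentials, units, compositions and actions follows, because all of them are
compatible with the injective realization of chains.
-/

namespace OperadicFreehedra

/-! ### Slots over an arbitrary affine line -/

/-- The laws that make a set `α` with constants and affine maps behave like an affine line over `ℚ`.
Both the real line and the line of labelled rational points are instances. -/
structure AffLaws {α : Type*} (cst : ℚ → α) (act : ℚ → ℚ → α → α) : Prop where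
  act_one : ∀ x, act 1 0 x = x
  act_cst : ∀ s t q, act s t (cst q) = cst (s * q + t)
  act_act : ∀ s t s' t' x, act s t (act s' t' x) = act (s * s') (s * t' + t) x

section Points

variable {α : Type*} {cst : ℚ → α} {act : ℚ → ℚ → α → α}

theorem eval_nil (xs : List α) : Slot.eval cst act [] xs = [] := by
  cases xs <;> rfl

theorem eval_append (S T : List Slot) (xs ys : List α) (h : xs.length = Slot.inputs S) :
    Slot.eval cst act (S ++ T) (xs ++ ys) = Slot.eval cst act S xs ++ Slot.eval cst act T ys := by
  induction S generalizing xs with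
  | nil =>
    have : xs = [] := List.length_eq_zero_iff.1 (by simpa [Slot.inputs] using h)
    subst this; simp [eval_nil]
  | cons s S ih =>
    cases s with
    | const q => simp [Slot.eval, ih xs (by simpa [Slot.inputs] using h)]
    | aff s t =>
      cases xs with
      | nil => simp [Slot.inputs] at h
      | cons x xs => simp [Slot.eval, ih xs (by simpa [Slot.inputs] using h)]

theorem eval_replicate_aff (s t : ℚ) (n : ℕ) (xs : List α) (h : xs.length = n) :
    Slot.eval cst act (List.replicate n (.aff s t)) xs = xs.map (act s t) := by
  induction n generalizing xs with
  | zero => simp [List.length_eq_zero_iff.1 h, Slot.eval]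
  | succ n ih =>
    cases xs with
    | nil => simp at h
    | cons x xs => simp [List.replicate_succ, Slot.eval, ih xs (by simpa using h)]

theorem eval_replicate_const (q : ℚ) (n : ℕ) (T : List Slot) (xs : List α) :
    Slot.eval cst act (List.replicate n (.const q) ++ T) xs
      = List.replicate n (cst q) ++ Slot.eval cst act T xs := by
  induction n with
  | zero => simp
  | succ n ih => simp [List.replicate_succ, Slot.eval, ih]

theorem eval_copies (H : AffLaws cst act) (n : ℕ) (xs : List α) (h : xs.length = n) :
    Slot.eval cst act (copies n) xs = xs := by
  rw [copies, eval_replicate_aff 1 0 n xs h, show act 1 0 = id from funext H.act_one, List.map_id]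

theorem inputs_append (S T : List Slot) :
    Slot.inputs (S ++ T) = Slot.inputs S + Slot.inputs T := by
  induction S with
  | nil => simp [Slot.inputs]
  | cons s S ih => cases s <;> simp [Slot.inputs, ih]; omega

theorem inputs_replicate_aff (s t : ℚ) (n : ℕ) :
    Slot.inputs (List.replicate n (.aff s t)) = n := by
  induction n with
  | zero => rfl
  | succ n ih => simp [List.replicate_succ, Slot.inputs, ih]

theorem inputs_replicate_const (q : ℚ) (n : ℕ) :
    Slot.inputs (List.replicate n (.const q)) = 0 := by
  induction n with
  | zero => rfl
  | succ n ih => simp [List.replicate_succ, Slot.inputs, ih]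

theorem inputs_copies (n : ℕ) : Slot.inputs (copies n) = n := inputs_replicate_aff 1 0 n

theorem eval_copies_append (H : AffLaws cst act) (n : ℕ) (T : List Slot) (xs ys : List α)
    (h : xs.length = n) :
    Slot.eval cst act (copies n ++ T) (xs ++ ys) = xs ++ Slot.eval cst act T ys := by
  rw [eval_append _ _ _ _ (by rw [inputs_copies, h]), eval_copies H n xs h]

/-! ### Closed forms of the structure maps on points -/

/-- Composition of cubes at an algebra input. -/
theorem eval_comp_a (H : AffLaws cst act) {i n n' : ℕ} {x1 x2 : List α} (h1 : x1.length = i)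
    (h2 : x1.length + x2.length = n - 2) :
    Slot.eval cst act (compSlots .m .a i n n') (x1 ++ x2)
      = x1 ++ (List.replicate (n' - 1) (cst 0) ++ x2) := by
  rw [compSlots, List.append_assoc, eval_copies_append H _ _ _ _ h1, eval_replicate_const,
    eval_copies H _ _ (by omega)]

/-- Composition of cubes at the module input. -/
theorem eval_comp_m (H : AffLaws cst act) {i n n' : ℕ} {x y : List α} (hx : x.length + 2 = n)
    (hy : y.length + 2 = n') :
    Slot.eval cst act (compSlots .m .m i n n') (x ++ y) = x ++ cst 1 :: y := by
  rw [compSlots, if_neg (by omega), if_neg (by omega), List.append_assoc,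
    eval_copies_append H _ _ _ _ (by omega)]
  simp [Slot.eval, eval_copies H (n' - 2) y (by omega)]

theorem eval_comp_m_one_left (H : AffLaws cst act) {i n n' : ℕ} {y : List α} (hn : n ≤ 1)
    (hy : y.length = n' - 2) :
    Slot.eval cst act (compSlots .m .m i n n') y = y := by
  rw [compSlots, if_pos hn, eval_copies H _ _ hy]

theorem eval_comp_m_one_right (H : AffLaws cst act) {i n n' : ℕ} {x : List α} (hn : n' ≤ 1)
    (hx : x.length = n - 2) :
    Slot.eval cst act (compSlots .m .m i n n') x = x := by
  rw [compSlots]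
  split_ifs with h
  · rw [eval_copies H _ _ (by omega)]
  · rw [eval_copies H _ _ hx]

/-- The right action at an algebra input. -/
theorem eval_right_a (H : AffLaws cst act) {i n n' : ℕ} {x1 x2 : List α} (h1 : x1.length = i)
    (h2 : x1.length + x2.length = n - 1) :
    Slot.eval cst act (rightSlots .m .a i n n') (x1 ++ x2)
      = x1 ++ (List.replicate (n' - 1) (cst 1) ++ x2) := by
  rw [rightSlots, List.append_assoc, eval_copies_append H _ _ _ _ h1, eval_replicate_const,
    eval_copies H _ _ (by omega)]

/-- The right action of the unit. -/
theorem eval_right_m_one (H : AffLaws cst act) {i n n' : ℕ} {x : List α} (hn : n' ≤ 1)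
    (hx : x.length = n - 1) :
    Slot.eval cst act (rightSlots .m .m i n n') x = x := by
  rw [rightSlots, if_pos hn, eval_copies H _ _ hx]

/-- The right action at the module input, on a freehedron of positive dimension. -/
theorem eval_right_m (H : AffLaws cst act) {i n n' : ℕ} {x y : List α} {t : α}
    (hx : x.length + 2 = n) (hy : y.length + 2 = n') :
    Slot.eval cst act (rightSlots .m .m i n n') ((x ++ [t]) ++ y)
      = x ++ (act (1 / 2) 0 t :: (y.map (act (-1 / 2) 1) ++ [cst 1])) := by
  rw [rightSlots, if_neg (by omega), if_neg (by omega), List.append_assoc, List.append_assoc,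
    List.append_assoc, eval_copies_append H _ _ _ _ (by omega)]
  simp only [List.cons_append, List.nil_append, Slot.eval]
  have := eval_append (cst := cst) (act := act) (List.replicate (n' - 2) (.aff (-1 / 2) 1))
    [.const 1] y [] (by rw [inputs_replicate_aff]; omega)
  rw [List.append_nil] at this
  rw [this, eval_replicate_aff _ _ _ _ (by omega)]
  simp [Slot.eval]

/-- The right action at the module input, on a point. -/
theorem eval_right_m_nil {i n n' : ℕ} {y : List α} (hn : n ≤ 1)
    (hy : y.length + 2 = n') :
    Slot.eval cst act (rightSlots .m .m i n n') y
      = y.map (act (-1 / 2) 1) ++ [cst 1] := by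
  rw [rightSlots, if_neg (by omega), if_pos hn]
  have := eval_append (cst := cst) (act := act) (List.replicate (n' - 2) (.aff (-1 / 2) 1))
    [.const 1] y [] (by rw [inputs_replicate_aff]; omega)
  rw [List.append_nil] at this
  rw [List.nil_append, this, eval_replicate_aff _ _ _ _ (by omega)]
  simp [Slot.eval]

/-- The block of coordinates that the left action makes of algebra arities `js` and of the
coordinates `x`, the last coordinate `1` of a cube of arity at least two included. -/
def leftBlock (cst : ℚ → α) (act : ℚ → ℚ → α → α) : List ℕ → List α → List α
  | j :: js, x :: xs => List.replicate (j - 1) (cst 1) ++ act (-1) 1 x :: leftBlock cst act js xs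
  | _, _ => []

theorem leftBlock_append {js js' : List ℕ} {x x' : List α} (h : js.length = x.length) :
    leftBlock cst act (js ++ js') (x ++ x')
      = leftBlock cst act js x ++ leftBlock cst act js' x' := by
  induction js generalizing x with
  | nil => rw [List.length_eq_zero_iff.1 h.symm]; simp [leftBlock]
  | cons j js ih =>
    cases x with
    | nil => simp at h
    | cons x xs => simp [leftBlock, ih (x := xs) (by simpa using h)]

theorem length_leftBlock {js : List ℕ} {x : List α} (h : js.length = x.length)
    (hj : ∀ j ∈ js, 1 ≤ j) : (leftBlock cst act js x).length = js.sum := by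
  induction js generalizing x with
  | nil => simp [leftBlock]
  | cons j js ih =>
    cases x with
    | nil => simp at h
    | cons x xs =>
      have := hj j (by simp)
      simp only [leftBlock, List.length_append, List.length_replicate, List.length_cons,
        ih (x := xs) (by simpa using h) (fun j hj' => hj j (by simp [hj'])), List.sum_cons]
      omega

/-- Closed form of the left action. -/
theorem eval_left (H : AffLaws cst act) {js : List ℕ} {j : ℕ} {x y : List α}
    (hx : x.length + 1 = js.length) (hy : y.length = j - 1) :
    Slot.eval cst act (leftSlots .m (js ++ [j])) (x ++ y)
      = leftBlock cst act js (x ++ [cst 1]) ++ y := by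
  rw [leftSlots]
  induction js generalizing x with
  | nil => simp at hx
  | cons j1 js ih =>
    cases js with
    | nil =>
      have hx : x = [] := List.length_eq_zero_iff.1 (by simpa using hx)
      subst hx
      simp only [List.cons_append, List.nil_append, leftSlotsAux, eval_replicate_const, Slot.eval,
        leftBlock, eval_copies H _ _ hy, H.act_cst, List.append_assoc]
      norm_num
    | cons j2 js =>
      cases x with
      | nil => simp at hx
      | cons x xs =>
        have := ih (x := xs) (by simpa using hx)
        rcases hjs : js ++ [j] with _ | ⟨j3, js'⟩
        · simp at hjs
        · simp only [List.cons_append, hjs, leftSlotsAux, eval_replicate_const, Slot.eval,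
            leftBlock, List.append_assoc] at this ⊢
          simpa using this

theorem eval_left_one (H : AffLaws cst act) {j : ℕ} {y : List α} (hy : y.length = j - 1) :
    Slot.eval cst act (leftSlots .m [j]) y = y := by
  rw [leftSlots, leftSlotsAux, eval_copies H _ _ hy]

theorem eval_left_a (js : List ℕ) (y : List α) : Slot.eval cst act (leftSlots .a js) y = [] := by
  rw [leftSlots, eval_nil]

theorem eval_comp_out_a (c : Col) (i n n' : ℕ) (y : List α) :
    Slot.eval cst act (compSlots .a c i n n') y = [] := by
  rw [compSlots, eval_nil]

theorem eval_right_out_a (c : Col) (i n n' : ℕ) (y : List α) :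
    Slot.eval cst act (rightSlots .a c i n n') y = [] := by
  rw [rightSlots, eval_nil]

end Points

/-! ### Profiles -/

theorem IsProfile.append_cons {l1 l2 : List Col} {c c' : Col} (h : IsProfile (l1 ++ c' :: l2) c) :
    l1 = List.replicate l1.length Col.a ∧
      ((c' = c ∧ l2 = []) ∨ (c' = Col.a ∧ IsProfile l2 c)) := by
  obtain ⟨n, hn⟩ := h
  induction l1 generalizing n with
  | nil =>
    cases n with
    | zero => simp at hn; simp [hn]
    | succ n =>
      simp only [List.nil_append, List.replicate_succ, List.cons_append, List.cons.injEq] at hn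
      exact ⟨rfl, Or.inr ⟨hn.1, n, hn.2⟩⟩
  | cons b l1 ih =>
    cases n with
    | zero => simp at hn
    | succ n =>
      simp only [List.replicate_succ, List.cons_append, List.cons.injEq] at hn
      obtain ⟨h1, h2⟩ := ih n hn.2
      refine ⟨?_, h2⟩
      rw [List.length_cons, List.replicate_succ, ← h1, hn.1]

theorem IsProfile.length_pos {l : List Col} {c : Col} (h : IsProfile l c) : 1 ≤ l.length := by
  obtain ⟨n, rfl⟩ := h; simp

theorem IsProfile.eq_replicate {l : List Col} {c : Col} (h : IsProfile l c) :
    l = List.replicate (l.length - 1) Col.a ++ [c] := by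
  obtain ⟨n, rfl⟩ := h; simp

theorem IsProfile.of_replicate_append {l : List Col} {c : Col} (n : ℕ) (h : IsProfile l c) :
    IsProfile (List.replicate n Col.a ++ l) c := by
  obtain ⟨m, rfl⟩ := h
  exact ⟨n + m, by rw [List.replicate_add, List.append_assoc]⟩

theorem IsProfile.eq_replicate_a {l : List Col} (h : IsProfile l .a) :
    l = List.replicate l.length Col.a := by
  obtain ⟨n, rfl⟩ := h; simp [List.replicate_succ']

/-- Plugging a profile into a profile gives a profile. -/
theorem IsProfile.plug {l1 l2 l' : List Col} {c c' : Col} (h : IsProfile (l1 ++ c' :: l2) c)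
    (h' : IsProfile l' c') : IsProfile (l1 ++ (l' ++ l2)) c := by
  obtain ⟨h1, ⟨rfl, rfl⟩ | ⟨rfl, h2⟩⟩ := h.append_cons
  · rw [h1, List.append_nil]; exact h'.of_replicate_append _
  · rw [h1, h'.eq_replicate_a]; exact (h2.of_replicate_append _).of_replicate_append _

/-- Conversely, if the result of plugging a profile is a profile, then so is the outer list. -/
theorem isProfile_m_cases {l1 l2 : List Col} {c' : Col} (h : IsProfile (l1 ++ c' :: l2) .m) :
    (c' = .m ∧ l2 = [] ∧ l1 = List.replicate l1.length Col.a) ∨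
      (c' = .a ∧ 1 ≤ l2.length ∧ IsProfile l2 .m ∧ l1 = List.replicate l1.length Col.a) := by
  obtain ⟨h1, ⟨rfl, rfl⟩ | ⟨rfl, h2⟩⟩ := h.append_cons
  · exact Or.inl ⟨rfl, rfl, h1⟩
  · exact Or.inr ⟨rfl, h2.length_pos, h2, h1⟩

/-! ### The axioms for points -/

/-- `x` is a list of as many coordinates as the cube at the profile `(l; c)` has. -/
def IsCubePt {α : Type*} (l : List Col) (c : Col) (x : List α) : Prop :=
  IsProfile l c ∧ x.length = cubeDim c l.length

/-- `x` is a list of as many coordinates as the freehedron at the profile `(l; c)` has. -/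
def IsFreePt {α : Type*} (l : List Col) (c : Col) (x : List α) : Prop :=
  IsProfile l c ∧ x.length = freeDim c l.length

section Points

variable {α : Type*} {cst : ℚ → α} {act : ℚ → ℚ → α → α}

theorem IsCubePt.eq_nil {l : List Col} {x : List α} (h : IsCubePt l .a x) : x = [] :=
  List.length_eq_zero_iff.1 h.2

theorem IsFreePt.eq_nil {l : List Col} {x : List α} (h : IsFreePt l .a x) : x = [] :=
  List.length_eq_zero_iff.1 h.2

theorem exists_append_length {x : List α} {i : ℕ} (h : i ≤ x.length) :
    ∃ x1 x2, x = x1 ++ x2 ∧ x1.length = i :=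
  ⟨x.take i, x.drop i, (List.take_append_drop i x).symm, by simpa using h⟩

theorem length_eval {S : List Slot} {xs : List α} (h : xs.length = Slot.inputs S) :
    (Slot.eval cst act S xs).length = S.length := by
  induction S generalizing xs with
  | nil => rw [eval_nil]; rfl
  | cons s S ih =>
    cases s with
    | const q => simp [Slot.eval, ih (xs := xs) (by simpa [Slot.inputs] using h)]
    | aff s t =>
      cases xs with
      | nil => simp [Slot.inputs] at h
      | cons x xs => simp [Slot.eval, ih (xs := xs) (by simpa [Slot.inputs] using h)]

theorem inputs_compSlots {l1 l2 : List Col} {c c' : Col} {n' : ℕ}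
    (hp : IsProfile (l1 ++ c' :: l2) c) :
    Slot.inputs (compSlots c c' l1.length (l1 ++ c' :: l2).length n')
      = cubeDim c (l1 ++ c' :: l2).length + cubeDim c' n' := by
  cases c with
  | a =>
    obtain ⟨-, h | h⟩ := hp.append_cons <;> simp [compSlots, Slot.inputs, cubeDim, h.1]
  | m =>
    obtain ⟨rfl, rfl, h1⟩ | ⟨rfl, h1, h2, h3⟩ := isProfile_m_cases hp
    · simp only [compSlots, cubeDim, List.length_append, List.length_cons, List.length_nil]
      split_ifs <;> simp only [inputs_append, inputs_copies, Slot.inputs] <;> omega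
    · simp [compSlots, cubeDim, inputs_append, inputs_copies, inputs_replicate_const]; omega

theorem length_compSlots {l1 l2 l' : List Col} {c c' : Col}
    (hp : IsProfile (l1 ++ c' :: l2) c) (hp' : IsProfile l' c') :
    (compSlots c c' l1.length (l1 ++ c' :: l2).length l'.length).length
      = cubeDim c (l1 ++ (l' ++ l2)).length := by
  have := hp'.length_pos
  cases c with
  | a => simp [compSlots, cubeDim]
  | m =>
    obtain ⟨rfl, rfl, h1⟩ | ⟨rfl, h1, h2, h3⟩ := isProfile_m_cases hp
    · simp only [compSlots, cubeDim, List.length_append, List.length_cons, List.length_nil]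
      split_ifs <;> simp only [copies, List.length_append, List.length_cons, List.length_nil,
        List.length_replicate] <;> omega
    · simp [compSlots, cubeDim, copies]; omega

theorem inputs_rightSlots {l1 l2 : List Col} {c c' : Col} {n' : ℕ}
    (hp : IsProfile (l1 ++ c' :: l2) c) :
    Slot.inputs (rightSlots c c' l1.length (l1 ++ c' :: l2).length n')
      = freeDim c (l1 ++ c' :: l2).length + cubeDim c' n' := by
  cases c with
  | a =>
    obtain ⟨-, h | h⟩ := hp.append_cons <;> simp [rightSlots, Slot.inputs, cubeDim, freeDim, h.1]
  | m =>
    obtain ⟨rfl, rfl, h1⟩ | ⟨rfl, h1, h2, h3⟩ := isProfile_m_cases hp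
    · simp only [rightSlots, cubeDim, freeDim, List.length_append, List.length_cons, List.length_nil]
      split_ifs <;> simp only [inputs_append, inputs_copies, Slot.inputs, inputs_replicate_aff] <;>
        omega
    · simp [rightSlots, cubeDim, freeDim, inputs_append, inputs_copies, inputs_replicate_const]

theorem length_rightSlots {l1 l2 l' : List Col} {c c' : Col}
    (hp : IsProfile (l1 ++ c' :: l2) c) (hp' : IsProfile l' c') :
    (rightSlots c c' l1.length (l1 ++ c' :: l2).length l'.length).length
      = freeDim c (l1 ++ (l' ++ l2)).length := by
  have := hp'.length_pos
  cases c with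
  | a => simp [rightSlots, freeDim]
  | m =>
    obtain ⟨rfl, rfl, h1⟩ | ⟨rfl, h1, h2, h3⟩ := isProfile_m_cases hp
    · simp only [rightSlots, freeDim, List.length_append, List.length_cons, List.length_nil]
      split_ifs <;> simp only [copies, List.length_append, List.length_cons, List.length_nil,
        List.length_replicate] <;> omega
    · simp [rightSlots, freeDim, copies]; omega

theorem IsCubePt.comp {l1 l2 l' : List Col} {c c' : Col} {x y : List α}
    (hx : IsCubePt (l1 ++ c' :: l2) c x) (hy : IsCubePt l' c' y) :
    IsCubePt (l1 ++ (l' ++ l2)) c (Slot.eval cst act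
      (compSlots c c' l1.length (l1 ++ c' :: l2).length l'.length) (x ++ y)) :=
  ⟨hx.1.plug hy.1, by
    rw [length_eval (by rw [inputs_compSlots hx.1, List.length_append, hx.2, hy.2]),
      length_compSlots hx.1 hy.1]⟩

theorem IsFreePt.right {l1 l2 l' : List Col} {c c' : Col} {x y : List α}
    (hx : IsFreePt (l1 ++ c' :: l2) c x) (hy : IsCubePt l' c' y) :
    IsFreePt (l1 ++ (l' ++ l2)) c (Slot.eval cst act
      (rightSlots c c' l1.length (l1 ++ c' :: l2).length l'.length) (x ++ y)) :=
  ⟨hx.1.plug hy.1, by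
    rw [length_eval (by rw [inputs_rightSlots hx.1, List.length_append, hx.2, hy.2]),
      length_rightSlots hx.1 hy.1]⟩

theorem eval_one_comp (H : AffLaws cst act) {l : List Col} {c : Col} {y : List α}
    (hy : IsCubePt l c y) : Slot.eval cst act (compSlots c c 0 1 l.length) ([] ++ y) = y := by
  cases c with
  | a => rw [eval_comp_out_a, hy.eq_nil]
  | m => rw [List.nil_append, eval_comp_m_one_left H le_rfl hy.2]

theorem eval_comp_one (H : AffLaws cst act) {l1 l2 : List Col} {c c' : Col} {x : List α}
    (hx : IsCubePt (l1 ++ c' :: l2) c x) :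
    Slot.eval cst act (compSlots c c' l1.length (l1 ++ c' :: l2).length 1) (x ++ []) = x := by
  cases c with
  | a => rw [eval_comp_out_a, hx.eq_nil]
  | m =>
    obtain ⟨hp, hd⟩ := hx
    obtain ⟨rfl, rfl, h1⟩ | ⟨rfl, h1, h2, h3⟩ := isProfile_m_cases hp
    · rw [List.append_nil, eval_comp_m_one_right H le_rfl hd]
    · simp only [cubeDim, List.length_append, List.length_cons] at hd ⊢
      obtain ⟨x1, x2, rfl, hl⟩ := exists_append_length (x := x) (i := l1.length) (by omega)
      rw [List.append_nil, eval_comp_a H hl (by simp at hd; omega)]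
      simp

theorem eval_right_one (H : AffLaws cst act) {l1 l2 : List Col} {c c' : Col} {x : List α}
    (hx : IsFreePt (l1 ++ c' :: l2) c x) :
    Slot.eval cst act (rightSlots c c' l1.length (l1 ++ c' :: l2).length 1) (x ++ []) = x := by
  cases c with
  | a => rw [eval_right_out_a, hx.eq_nil]
  | m =>
    obtain ⟨hp, hd⟩ := hx
    obtain ⟨rfl, rfl, h1⟩ | ⟨rfl, h1, h2, h3⟩ := isProfile_m_cases hp
    · rw [List.append_nil, eval_right_m_one H le_rfl hd]
    · simp only [freeDim, List.length_append, List.length_cons] at hd ⊢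
      obtain ⟨x1, x2, rfl, hl⟩ := exists_append_length (x := x) (i := l1.length) (by omega)
      rw [List.append_nil, eval_right_a H hl (by simp at hd; omega)]
      simp

theorem replicate_append_replicate_append (v : α) (m n : ℕ) (x : List α) :
    List.replicate m v ++ (List.replicate n v ++ x) = List.replicate (m + n) v ++ x := by
  rw [← List.append_assoc, List.replicate_append_replicate]

theorem eval_sequential (H : AffLaws cst act) {l1 l2 m1 m2 l'' : List Col} {c c' c'' : Col}
    {x y z : List α} (hx : IsCubePt (l1 ++ c' :: l2) c x) (hy : IsCubePt (m1 ++ c'' :: m2) c' y)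
    (hz : IsCubePt l'' c'' z) :
    Slot.eval cst act (compSlots c c'' (l1 ++ m1).length
        (l1 ++ ((m1 ++ c'' :: m2) ++ l2)).length l''.length)
      (Slot.eval cst act (compSlots c c' l1.length (l1 ++ c' :: l2).length
        (m1 ++ c'' :: m2).length) (x ++ y) ++ z)
    = Slot.eval cst act (compSlots c c' l1.length (l1 ++ c' :: l2).length
        (m1 ++ (l'' ++ m2)).length)
      (x ++ Slot.eval cst act (compSlots c' c'' m1.length (m1 ++ c'' :: m2).length l''.length)
        (y ++ z)) := by
  cases c with
  | a => simp only [eval_comp_out_a]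
  | m =>
    obtain ⟨hp, hd⟩ := hx
    obtain ⟨hq, he⟩ := hy
    obtain ⟨hr, hf⟩ := hz
    have hr1 := hr.length_pos
    obtain ⟨rfl, rfl, h1⟩ | ⟨rfl, h1, h2, h3⟩ := isProfile_m_cases hp
    · obtain ⟨rfl, rfl, h2⟩ | ⟨rfl, h2, h3, h4⟩ := isProfile_m_cases hq
      · simp only [cubeDim, List.length_append, List.length_cons, List.length_nil,
          List.append_nil] at hd he hf ⊢
        -- units have arity one and no coordinate, so they are treated apart
        rcases Nat.eq_zero_or_pos l1.length with h0 | h0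
        · obtain rfl : x = [] := List.length_eq_zero_iff.1 (by omega)
          obtain rfl : l1 = [] := List.length_eq_zero_iff.1 h0
          have := (IsCubePt.comp (cst := cst) (act := act) ⟨hq, by simpa [cubeDim] using he⟩
            ⟨hr, hf⟩).2
          simp only [cubeDim, List.length_append, List.length_cons, List.length_nil,
            List.append_nil] at this
          rw [List.nil_append, List.nil_append, eval_comp_m_one_left H (y := y) (by simp)
            (by simpa using he), eval_comp_m_one_left H (by simp) this]
          simp
        rcases Nat.eq_zero_or_pos m1.length with h5 | h5
        · obtain rfl : y = [] := List.length_eq_zero_iff.1 (by omega)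
          rw [List.append_nil, List.nil_append, eval_comp_m_one_right H (x := x) (by omega)
            (by omega), eval_comp_m_one_left H (y := z) (by omega) (by omega), h5]
          simp
        rcases Nat.lt_or_ge l''.length 2 with h6 | h6
        · obtain rfl : z = [] := List.length_eq_zero_iff.1 (by omega)
          rw [List.append_nil, List.append_nil, eval_comp_m_one_right H (x := y) (by omega)
            (by omega), eval_comp_m_one_right H (n' := l''.length) (by omega)]
          · congr 2; omega
          · rw [eval_comp_m H (by omega) (by omega)]; simp; omega
        · rw [eval_comp_m H (x := x) (y := y) (by omega) (by omega),
            eval_comp_m H (x := y) (y := z) (by omega) (by omega),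
            eval_comp_m H (by simp; omega) (by omega),
            eval_comp_m H (by omega) (by simp; omega)]
          simp
      · obtain rfl : z = [] := List.length_eq_zero_iff.1 hf
        simp only [cubeDim, List.length_append, List.length_cons, List.length_nil,
          List.append_nil] at hd he hf ⊢
        obtain ⟨y1, y2, rfl, hl⟩ := exists_append_length (x := y) (i := m1.length) (by omega)
        simp only [List.length_append] at he
        rw [eval_comp_a H (x1 := y1) (x2 := y2) hl (by omega)]
        rcases Nat.eq_zero_or_pos l1.length with h0 | h0
        · obtain rfl : x = [] := List.length_eq_zero_iff.1 (by omega)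
          rw [List.nil_append, List.nil_append, eval_comp_m_one_left H (by omega) (by simp; omega),
            eval_comp_m_one_left H (by omega) (by simp; omega), eval_comp_a H (by omega)
              (by omega)]
        · rw [eval_comp_m H (by omega) (by simp; omega), eval_comp_m H (by omega)
            (by simp; omega)]
          have := eval_comp_a H (i := l1.length + m1.length)
            (n := l1.length + (m1.length + (m2.length + 1) + 0)) (n' := l''.length)
            (x1 := x ++ cst 1 :: y1) (x2 := y2)  (by simp; omega) (by simp; omega)
          simpa using this
    · obtain ⟨h5, -⟩ := hq.append_cons
      obtain rfl : c'' = .a := by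
        obtain ⟨-, h | h⟩ := hq.append_cons
        exacts [h.1, h.1]
      obtain rfl : z = [] := List.length_eq_zero_iff.1 hf
      obtain rfl : y = [] := List.length_eq_zero_iff.1 he
      simp only [cubeDim, List.length_append, List.length_cons, List.length_nil,
          List.append_nil, eval_comp_out_a] at hd he hf ⊢
      obtain ⟨x1, x2, rfl, hl⟩ := exists_append_length (x := x) (i := l1.length) (by omega)
      simp only [List.length_append] at hd
      rw [eval_comp_a H hl (by omega), eval_comp_a H hl (by omega)]
      have := eval_comp_a H (i := l1.length + m1.length)
            (n := l1.length + (m1.length + (m2.length + 1) + l2.length)) (n' := l''.length)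
            (x1 := x1 ++ List.replicate m1.length (cst 0))
            (x2 := List.replicate m2.length (cst 0) ++ x2)  (by simp; omega) (by simp; omega)
      simp only [List.append_assoc, replicate_append_replicate_append] at this
      rw [show m1.length + (m2.length + 1) - 1 = m1.length + m2.length by omega, this,
        show m1.length + (l''.length - 1 + m2.length) = m1.length + (l''.length + m2.length) - 1
          by omega]

theorem eval_parallel (H : AffLaws cst act) {l1 l2 l3 l' l'' : List Col} {c c' c'' : Col}
    {x y z : List α} (hx : IsCubePt (l1 ++ c' :: (l2 ++ c'' :: l3)) c x) (hy : IsCubePt l' c' y)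
    (hz : IsCubePt l'' c'' z) :
    Slot.eval cst act (compSlots c c'' (l1 ++ (l' ++ l2)).length
        (l1 ++ (l' ++ (l2 ++ c'' :: l3))).length l''.length)
      (Slot.eval cst act (compSlots c c' l1.length (l1 ++ c' :: (l2 ++ c'' :: l3)).length
        l'.length) (x ++ y) ++ z)
    = Slot.eval cst act (compSlots c c' l1.length (l1 ++ c' :: (l2 ++ (l'' ++ l3))).length
        l'.length)
      (Slot.eval cst act (compSlots c c'' (l1 ++ c' :: l2).length
        (l1 ++ c' :: (l2 ++ c'' :: l3)).length l''.length) (x ++ z) ++ y) := by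
  cases c with
  | a => simp only [eval_comp_out_a]
  | m =>
    obtain ⟨hp, hd⟩ := hx
    obtain ⟨hq, he⟩ := hy
    obtain ⟨hr, hf⟩ := hz
    have hr1 := hr.length_pos
    have hq1 := hq.length_pos
    obtain ⟨rfl, h, h1⟩ | ⟨rfl, h1, h2, h3⟩ := isProfile_m_cases hp
    · simp at h
    obtain rfl : y = [] := List.length_eq_zero_iff.1 he
    obtain ⟨rfl, rfl, h4⟩ | ⟨rfl, h4, h5, h6⟩ := isProfile_m_cases h2
    · simp only [cubeDim, List.length_append, List.length_cons, List.length_nil,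
        List.append_nil] at hd he hf ⊢
      obtain ⟨x1, x2, rfl, hl⟩ := exists_append_length (x := x) (i := l1.length) (by omega)
      simp only [List.length_append] at hd
      rw [eval_comp_a H hl (by omega)]
      rcases Nat.lt_or_ge l''.length 2 with h6 | h6
      · obtain rfl : z = [] := List.length_eq_zero_iff.1 (by omega)
        simp only [List.append_nil]
        rw [eval_comp_m_one_right H (by omega) (by simp; omega),
          eval_comp_m_one_right H (by omega) (by simp; omega), eval_comp_a H hl (by omega)]
      · rw [eval_comp_m H (by simp; omega) (by omega), eval_comp_m H (by simp; omega) (by omega)]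
        have := eval_comp_a H (i := l1.length)
            (n := l1.length + (l2.length + l''.length + 1)) (n' := l'.length)
            (x1 := x1) (x2 := x2 ++ cst 1 :: z) (by omega) (by simp; omega)
        simp only [List.append_assoc] at this ⊢
        rw [this]
    · obtain rfl : z = [] := List.length_eq_zero_iff.1 hf
      simp only [cubeDim, List.length_append, List.length_cons, List.length_nil,
        List.append_nil] at hd he hf ⊢
      obtain ⟨x1, x2, rfl, hl⟩ := exists_append_length (x := x) (i := l1.length) (by omega)
      obtain ⟨x2, x3, rfl, hl'⟩ := exists_append_length (x := x2) (i := l2.length + 1)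
        (by simp at hd; omega)
      simp only [List.length_append] at hd
      rw [eval_comp_a H hl (by simp; omega), ← List.append_assoc x1 x2 x3,
        eval_comp_a H (x1 := x1 ++ x2) (by simp; omega) (by simp; omega),
        List.append_assoc x1 x2, eval_comp_a H hl (by simp; omega)]
      have := eval_comp_a H (i := l1.length + (l'.length + l2.length))
            (n := l1.length + (l'.length + (l2.length + (l3.length + 1)))) (n' := l''.length)
            (x1 := x1 ++ (List.replicate (l'.length - 1) (cst 0) ++ x2)) (x2 := x3)
            (by simp; omega) (by simp; omega)
      simpa using this

end Points

/-! ### The right action on points -/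

section Points

variable {α : Type*} {cst : ℚ → α} {act : ℚ → ℚ → α → α}

/-- Halve the last coordinate, if there is one. -/
def halfLast (act : ℚ → ℚ → α → α) (x : List α) : List α :=
  x.dropLast ++ x.getLast?.toList.map (act (1 / 2) 0)

theorem halfLast_concat (x : List α) (t : α) :
    halfLast act (x ++ [t]) = x ++ [act (1 / 2) 0 t] := by
  simp [halfLast]

theorem halfLast_append {x y : List α} (hy : y ≠ []) :
    halfLast act (x ++ y) = x ++ halfLast act y := by
  obtain ⟨y, t, rfl⟩ : ∃ y' t, y = y' ++ [t] := ⟨_, _, (List.dropLast_append_getLast hy).symm⟩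
  rw [← List.append_assoc, halfLast_concat, halfLast_concat, List.append_assoc]

theorem length_halfLast (x : List α) : (halfLast act x).length = x.length := by
  rcases List.eq_nil_or_concat' x with rfl | ⟨x, t, rfl⟩
  · simp [halfLast]
  · rw [halfLast_concat]; simp

/-- The right action at the module input, by a cube other than the unit. -/
theorem eval_right_half (H : AffLaws cst act) {i n n' : ℕ} {x y : List α}
    (hx : x.length = n - 1) (hy : y.length + 2 = n') :
    Slot.eval cst act (rightSlots .m .m i n n') (x ++ y)
      = halfLast act x ++ (y.map (act (-1 / 2) 1) ++ [cst 1]) := by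
  rcases List.eq_nil_or_concat' x with rfl | ⟨x, t, rfl⟩
  · rw [List.nil_append, eval_right_m_nil (by simp at hx; omega) hy]
    simp [halfLast]
  · rw [eval_right_m H (by simp at hx; omega) hy, halfLast_concat, List.append_assoc]
    rfl

theorem eval_right_sequential (H : AffLaws cst act) {l1 l2 m1 m2 l'' : List Col} {c c' c'' : Col}
    {x y z : List α} (hx : IsFreePt (l1 ++ c' :: l2) c x) (hy : IsCubePt (m1 ++ c'' :: m2) c' y)
    (hz : IsCubePt l'' c'' z) :
    Slot.eval cst act (rightSlots c c'' (l1 ++ m1).length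
        (l1 ++ ((m1 ++ c'' :: m2) ++ l2)).length l''.length)
      (Slot.eval cst act (rightSlots c c' l1.length (l1 ++ c' :: l2).length
        (m1 ++ c'' :: m2).length) (x ++ y) ++ z)
    = Slot.eval cst act (rightSlots c c' l1.length (l1 ++ c' :: l2).length
        (m1 ++ (l'' ++ m2)).length)
      (x ++ Slot.eval cst act (compSlots c' c'' m1.length (m1 ++ c'' :: m2).length l''.length)
        (y ++ z)) := by
  cases c with
  | a => simp only [eval_right_out_a]
  | m =>
    obtain ⟨hp, hd⟩ := hx
    obtain ⟨hq, he⟩ := hy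
    obtain ⟨hr, hf⟩ := hz
    have hr1 := hr.length_pos
    obtain ⟨rfl, rfl, h1⟩ | ⟨rfl, h1, h2, h3⟩ := isProfile_m_cases hp
    · obtain ⟨rfl, rfl, h2⟩ | ⟨rfl, h2, h3, h4⟩ := isProfile_m_cases hq
      · simp only [cubeDim, freeDim, List.length_append, List.length_cons, List.length_nil,
          List.append_nil] at hd he hf ⊢
        rcases Nat.eq_zero_or_pos m1.length with h5 | h5
        · obtain rfl : y = [] := List.length_eq_zero_iff.1 (by omega)
          rw [List.append_nil, List.nil_append, eval_right_m_one H (x := x) (by omega)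
            (by omega), eval_comp_m_one_left H (y := z) (by omega) (by omega), h5]
          simp
        rcases Nat.lt_or_ge l''.length 2 with h6 | h6
        · obtain rfl : z = [] := List.length_eq_zero_iff.1 (by omega)
          rw [List.append_nil, List.append_nil, eval_comp_m_one_right H (x := y) (by omega)
            (by omega), eval_right_m_one H (n' := l''.length) (by omega)]
          · congr 2; omega
          · rw [eval_right_half H (by omega) (by omega)]; simp [length_halfLast]; omega
        · rw [eval_right_half H (x := x) (y := y) (by omega) (by omega),
            eval_comp_m H (x := y) (y := z) (by omega) (by omega),
            eval_right_half H (by simp [length_halfLast]; omega) (by omega),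
            eval_right_half H (by omega) (by simp; omega)]
          rw [halfLast_append (by simp), halfLast_concat]
          simp [H.act_cst]
          norm_num
      · obtain rfl : z = [] := List.length_eq_zero_iff.1 hf
        simp only [cubeDim, freeDim, List.length_append, List.length_cons, List.length_nil,
          List.append_nil] at hd he hf ⊢
        obtain ⟨y1, y2, rfl, hl⟩ := exists_append_length (x := y) (i := m1.length) (by omega)
        simp only [List.length_append] at he
        rw [eval_comp_a H (x1 := y1) (x2 := y2) hl (by omega),
          eval_right_half H (by omega) (by simp; omega), eval_right_half H (by omega)
            (by simp; omega)]
        have := eval_right_a H (i := l1.length + m1.length)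
            (n := l1.length + (m1.length + (m2.length + 1) + 0)) (n' := l''.length)
            (x1 := halfLast act x ++ y1.map (act (-1 / 2) 1))
            (x2 := y2.map (act (-1 / 2) 1) ++ [cst 1])
            (by simp [length_halfLast]; omega) (by simp [length_halfLast]; omega)
        simpa [H.act_cst] using this
    · obtain ⟨h5, -⟩ := hq.append_cons
      obtain rfl : c'' = .a := by
        obtain ⟨-, h | h⟩ := hq.append_cons
        exacts [h.1, h.1]
      obtain rfl : z = [] := List.length_eq_zero_iff.1 hf
      obtain rfl : y = [] := List.length_eq_zero_iff.1 he
      simp only [cubeDim, freeDim, List.length_append, List.length_cons, List.length_nil,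
          List.append_nil, eval_comp_out_a] at hd he hf ⊢
      obtain ⟨x1, x2, rfl, hl⟩ := exists_append_length (x := x) (i := l1.length) (by omega)
      simp only [List.length_append] at hd
      rw [eval_right_a H hl (by omega), eval_right_a H hl (by omega)]
      have := eval_right_a H (i := l1.length + m1.length)
            (n := l1.length + (m1.length + (m2.length + 1) + l2.length)) (n' := l''.length)
            (x1 := x1 ++ List.replicate m1.length (cst 1))
            (x2 := List.replicate m2.length (cst 1) ++ x2)  (by simp; omega) (by simp; omega)
      simp only [List.append_assoc, replicate_append_replicate_append] at this
      rw [show m1.length + (m2.length + 1) - 1 = m1.length + m2.length by omega, this,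
        show m1.length + (l''.length - 1 + m2.length) = m1.length + (l''.length + m2.length) - 1
          by omega]

theorem eval_right_parallel (H : AffLaws cst act) {l1 l2 l3 l' l'' : List Col} {c c' c'' : Col}
    {x y z : List α} (hx : IsFreePt (l1 ++ c' :: (l2 ++ c'' :: l3)) c x) (hy : IsCubePt l' c' y)
    (hz : IsCubePt l'' c'' z) :
    Slot.eval cst act (rightSlots c c'' (l1 ++ (l' ++ l2)).length
        (l1 ++ (l' ++ (l2 ++ c'' :: l3))).length l''.length)
      (Slot.eval cst act (rightSlots c c' l1.length (l1 ++ c' :: (l2 ++ c'' :: l3)).length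
        l'.length) (x ++ y) ++ z)
    = Slot.eval cst act (rightSlots c c' l1.length (l1 ++ c' :: (l2 ++ (l'' ++ l3))).length
        l'.length)
      (Slot.eval cst act (rightSlots c c'' (l1 ++ c' :: l2).length
        (l1 ++ c' :: (l2 ++ c'' :: l3)).length l''.length) (x ++ z) ++ y) := by
  cases c with
  | a => simp only [eval_right_out_a]
  | m =>
    obtain ⟨hp, hd⟩ := hx
    obtain ⟨hq, he⟩ := hy
    obtain ⟨hr, hf⟩ := hz
    have hr1 := hr.length_pos
    have hq1 := hq.length_pos
    obtain ⟨rfl, h, h1⟩ | ⟨rfl, h1, h2, h3⟩ := isProfile_m_cases hp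
    · simp at h
    obtain rfl : y = [] := List.length_eq_zero_iff.1 he
    obtain ⟨rfl, rfl, h4⟩ | ⟨rfl, h4, h5, h6⟩ := isProfile_m_cases h2
    · simp only [cubeDim, freeDim, List.length_append, List.length_cons, List.length_nil,
        List.append_nil] at hd he hf ⊢
      obtain ⟨x1, x2, rfl, hl⟩ := exists_append_length (x := x) (i := l1.length) (by omega)
      simp only [List.length_append] at hd
      have hx2 : x2 ≠ [] := by rintro rfl; simp at hd; omega
      rw [eval_right_a H hl (by omega)]
      rcases Nat.lt_or_ge l''.length 2 with h6 | h6
      · obtain rfl : z = [] := List.length_eq_zero_iff.1 (by omega)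
        simp only [List.append_nil]
        rw [eval_right_m_one H (by omega) (by simp; omega),
          eval_right_m_one H (by omega) (by simp; omega), eval_right_a H hl (by omega)]
      · rw [eval_right_half H (by simp; omega) (by omega),
          eval_right_half H (by simp; omega) (by omega), halfLast_append hx2,
          halfLast_append (by simp [hx2]), halfLast_append hx2]
        have := eval_right_a H (i := l1.length)
            (n := l1.length + (l2.length + l''.length + 1)) (n' := l'.length)
            (x1 := x1) (x2 := halfLast act x2 ++ (z.map (act (-1 / 2) 1) ++ [cst 1]))
            (by omega) (by simp [length_halfLast]; omega)
        simp only [List.append_assoc] at this ⊢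
        rw [this]
    · obtain rfl : z = [] := List.length_eq_zero_iff.1 hf
      simp only [cubeDim, freeDim, List.length_append, List.length_cons, List.length_nil,
        List.append_nil] at hd he hf ⊢
      obtain ⟨x1, x2, rfl, hl⟩ := exists_append_length (x := x) (i := l1.length) (by omega)
      obtain ⟨x2, x3, rfl, hl'⟩ := exists_append_length (x := x2) (i := l2.length + 1)
        (by simp at hd; omega)
      simp only [List.length_append] at hd
      rw [eval_right_a H hl (by simp; omega), ← List.append_assoc x1 x2 x3,
        eval_right_a H (x1 := x1 ++ x2) (by simp; omega) (by simp; omega),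
        List.append_assoc x1 x2, eval_right_a H hl (by simp; omega)]
      have := eval_right_a H (i := l1.length + (l'.length + l2.length))
            (n := l1.length + (l'.length + (l2.length + (l3.length + 1)))) (n' := l''.length)
            (x1 := x1 ++ (List.replicate (l'.length - 1) (cst 1) ++ x2)) (x2 := x3)
            (by simp; omega) (by simp; omega)
      simpa using this

/-! ### Tuples and the left action on points -/

/-- `js` are arities of a tuple of freehedra with output colours `cs`, with `N` inputs and `d`
coordinates altogether. -/
inductive IsTupShape : List Col → ℕ → List ℕ → ℕ → Prop
  | nil : IsTupShape [] 0 [] 0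
  | cons {c : Col} {cs : List Col} {N j d : ℕ} {js : List ℕ} (hj : 1 ≤ j)
      (h : IsTupShape cs N js d) : IsTupShape (c :: cs) (j + N) (j :: js) (freeDim c j + d)

theorem IsTupShape.length_eq {cs : List Col} {N d : ℕ} {js : List ℕ} (h : IsTupShape cs N js d) :
    js.length = cs.length := by
  induction h with
  | nil => rfl
  | cons hj h ih => simp [ih]

theorem IsTupShape.one_le {cs : List Col} {N d : ℕ} {js : List ℕ} (h : IsTupShape cs N js d) :
    ∀ j ∈ js, 1 ≤ j := by
  induction h with
  | nil => simp
  | cons hj h ih => simpa [hj] using ih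

theorem IsTupShape.sum_eq {cs : List Col} {N d : ℕ} {js : List ℕ} (h : IsTupShape cs N js d) :
    js.sum = N := by
  induction h with
  | nil => rfl
  | cons hj h ih => simp [ih]

theorem IsTupShape.append {cs cs' : List Col} {N N' d d' : ℕ} {js js' : List ℕ}
    (h : IsTupShape cs N js d) (h' : IsTupShape cs' N' js' d') :
    IsTupShape (cs ++ cs') (N + N') (js ++ js') (d + d') := by
  induction h with
  | nil => simpa using h'
  | cons hj h ih => rw [Nat.add_assoc, Nat.add_assoc]; exact .cons hj ih

theorem isTupShape_singleton {c : Col} {j : ℕ} (hj : 1 ≤ j) :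
    IsTupShape [c] j [j] (freeDim c j) := by
  simpa using IsTupShape.cons (c := c) hj .nil

theorem IsTupShape.eq_zero {p N d : ℕ} {js : List ℕ}
    (h : IsTupShape (List.replicate p Col.a) N js d) : d = 0 := by
  induction p generalizing N d js with
  | zero => cases h; rfl
  | succ p ih =>
    rw [List.replicate_succ] at h
    cases h with
    | cons hj h => rw [ih h]; rfl

theorem IsTupShape.nil_inv {N d : ℕ} {js : List ℕ} (h : IsTupShape [] N js d) :
    N = 0 ∧ js = [] ∧ d = 0 := by
  cases h; exact ⟨rfl, rfl, rfl⟩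

theorem IsTupShape.profile {cs : List Col} {c : Col} {N d : ℕ} {js : List ℕ}
    (h : IsTupShape cs N js d) (hc : IsProfile cs c) :
    ∃ js0 j, js = js0 ++ [j] ∧ js0.length + 1 = cs.length ∧ d = freeDim c j ∧ 1 ≤ j ∧
      (∀ j ∈ js0, 1 ≤ j) ∧ N = js0.sum + j := by
  obtain ⟨n, rfl⟩ := hc
  induction n generalizing N d js with
  | zero =>
    cases h with
    | cons hj h => cases h; exact ⟨[], _, rfl, rfl, rfl, hj, by simp, by simp⟩
  | succ n ih =>
    rw [List.replicate_succ, List.cons_append] at h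
    cases h with
    | cons hj h =>
      obtain ⟨js0, j, rfl, h2, rfl, h3, h4, rfl⟩ := ih h
      exact ⟨_ :: js0, j, rfl, by simp at h2; simp [h2], by simp [freeDim], h3, by simpa [hj] using h4,
        by simp [Nat.add_assoc]⟩

theorem inputs_leftSlotsAux (js : List ℕ) (j : ℕ) :
    Slot.inputs (leftSlotsAux (js ++ [j])) = js.length - 1 + (j - 1) := by
  induction js with
  | nil => simp [leftSlotsAux, inputs_copies]
  | cons j1 js ih =>
    cases js with
    | nil =>
      simp [leftSlotsAux, inputs_append, inputs_replicate_const, Slot.inputs, inputs_copies]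
    | cons j2 js =>
      rcases hjs : js ++ [j] with _ | ⟨j3, js'⟩
      · simp at hjs
      · simp only [List.cons_append, hjs, leftSlotsAux, inputs_append, inputs_replicate_const,
          Slot.inputs, List.length_cons] at ih ⊢
        omega

theorem length_leftSlotsAux (js : List ℕ) (j : ℕ) (hj : 1 ≤ j) (h : ∀ j ∈ js, 1 ≤ j) :
    (leftSlotsAux (js ++ [j])).length = js.sum + (j - 1) := by
  induction js with
  | nil => simp [leftSlotsAux, copies]
  | cons j1 js ih =>
    have h1 := h j1 (by simp)
    cases js with
    | nil =>
      simp [leftSlotsAux, copies]; omega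
    | cons j2 js =>
      specialize ih (fun j hj => h j (by simp at hj ⊢; tauto))
      rcases hjs : js ++ [j] with _ | ⟨j3, js'⟩
      · simp at hjs
      · simp only [List.cons_append, hjs, leftSlotsAux, List.length_append, List.length_replicate,
          List.length_cons, List.sum_cons] at ih ⊢
        omega

theorem inputs_leftSlots {cs : List Col} {c : Col} {N d : ℕ} {js : List ℕ}
    (h : IsTupShape cs N js d) (hc : IsProfile cs c) :
    Slot.inputs (leftSlots c js) = cubeDim c cs.length + d := by
  obtain ⟨js0, j, rfl, h2, rfl, h3, h4, rfl⟩ := h.profile hc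
  cases c with
  | a => rfl
  | m => rw [leftSlots, inputs_leftSlotsAux, cubeDim, freeDim]; omega

theorem length_leftSlots {cs : List Col} {c : Col} {N d : ℕ} {js : List ℕ}
    (h : IsTupShape cs N js d) (hc : IsProfile cs c) :
    (leftSlots c js).length = freeDim c N := by
  obtain ⟨js0, j, rfl, h2, rfl, h3, h4, rfl⟩ := h.profile hc
  cases c with
  | a => rfl
  | m => rw [leftSlots, length_leftSlotsAux _ _ h3 h4, freeDim]; omega

/-- The coordinates of a cube of arity `n`, followed by a coordinate `1` if the cube is not the
unit. In these terms composition at the module input is concatenation. -/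
def hat (cst : ℚ → α) (n : ℕ) (x : List α) : List α := if n ≤ 1 then [] else x ++ [cst 1]

theorem length_hat {n : ℕ} {x : List α} (h : x.length = n - 2) :
    (hat cst n x).length = n - 1 := by
  rw [hat]; split_ifs <;> simp <;> omega

theorem eval_left_hat (H : AffLaws cst act) {js : List ℕ} {n j : ℕ} {x y : List α}
    (hn : js.length + 1 = n) (hx : x.length = n - 2) (hy : y.length = j - 1) :
    Slot.eval cst act (leftSlots .m (js ++ [j])) (x ++ y)
      = leftBlock cst act js (hat cst n x) ++ y := by
  rw [hat]
  split_ifs with h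
  · obtain rfl : js = [] := List.length_eq_zero_iff.1 (by omega)
    obtain rfl : x = [] := List.length_eq_zero_iff.1 (by omega)
    rw [List.nil_append, List.nil_append, eval_left_one H hy, leftBlock, List.nil_append]
    simp
  · rw [eval_left H (by omega) hy]

theorem hat_comp_m (H : AffLaws cst act) {i n n' : ℕ} {x y : List α} (hn : 1 ≤ n) (hn' : 1 ≤ n')
    (hx : x.length = n - 2) (hy : y.length = n' - 2) :
    hat cst (n + n' - 1) (Slot.eval cst act (compSlots .m .m i n n') (x ++ y))
      = hat cst n x ++ hat cst n' y := by
  rcases Nat.lt_or_ge n 2 with h | h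
  · obtain rfl : x = [] := List.length_eq_zero_iff.1 (by omega)
    rw [List.nil_append, eval_comp_m_one_left H (by omega) hy, show n + n' - 1 = n' by omega]
    simp [hat, show n ≤ 1 by omega]
  rcases Nat.lt_or_ge n' 2 with h' | h'
  · obtain rfl : y = [] := List.length_eq_zero_iff.1 (by omega)
    rw [List.append_nil, eval_comp_m_one_right H (by omega) hx, show n + n' - 1 = n by omega]
    simp [hat, show n' ≤ 1 by omega]
  rw [eval_comp_m H (by omega) (by omega)]
  simp [hat, show ¬ n ≤ 1 by omega, show ¬ n' ≤ 1 by omega, show ¬ n + n' ≤ 2 by omega]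

/-- Leaves that are multiplied give coordinates `1` after the left action. -/
theorem leftBlock_zeros (H : AffLaws cst act) {js js' : List ℕ} {n : ℕ} {t : α} {r : List α}
    (hn : js.length = n + 1) (hj : ∀ j ∈ js, 1 ≤ j) :
    leftBlock cst act (js ++ js') (List.replicate n (cst 0) ++ t :: r)
      = List.replicate (js.sum - 1) (cst 1) ++ act (-1) 1 t :: leftBlock cst act js' r := by
  induction js generalizing n with
  | nil => simp at hn
  | cons j js ih =>
    have h1 := hj j (by simp)
    cases js with
    | nil =>
      obtain rfl : n = 0 := by simpa using hn.symm
      simp [leftBlock]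
    | cons j2 js =>
      have h2 := hj j2 (by simp)
      obtain ⟨n, rfl⟩ : ∃ n', n = n' + 1 := ⟨js.length, by simp at hn; omega⟩
      change List.replicate (j - 1) (cst 1) ++ act (-1) 1 (cst 0) ::
        leftBlock cst act (j2 :: js ++ js') (List.replicate n (cst 0) ++ t :: r) = _
      rw [ih (by simpa using hn) (fun j hj' => hj j (by simp at hj' ⊢; tauto)), H.act_cst,
        show List.replicate ((j :: j2 :: js).sum - 1) (cst 1)
          = List.replicate (j - 1) (cst 1) ++ (List.replicate 1 (cst 1) ++
            List.replicate ((j2 :: js).sum - 1) (cst 1)) by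
          rw [List.replicate_append_replicate, List.replicate_append_replicate]
          congr 1
          simp; omega]
      simp

theorem eval_one_left (H : AffLaws cst act) {l : List Col} {c : Col} {y : List α}
    (hy : IsFreePt l c y) : Slot.eval cst act (leftSlots c [l.length]) ([] ++ y) = y := by
  cases c with
  | a => rw [eval_left_a, hy.eq_nil]
  | m => rw [List.nil_append, eval_left_one H hy.2]

theorem eval_left_comp (H : AffLaws cst act) {cs1 cs2 cs : List Col} {c c' : Col}
    {N1 N N2 : ℕ} {js1 js js2 : List ℕ} {x y L1 L L2 : List α}
    (hx : IsCubePt (cs1 ++ c' :: cs2) c x) (hy : IsCubePt cs c' y)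
    (h1 : IsTupShape cs1 N1 js1 L1.length) (h : IsTupShape cs N js L.length)
    (h2 : IsTupShape cs2 N2 js2 L2.length) :
    Slot.eval cst act (leftSlots c (js1 ++ (js ++ js2)))
      (Slot.eval cst act (compSlots c c' cs1.length (cs1 ++ c' :: cs2).length cs.length) (x ++ y)
        ++ (L1 ++ (L ++ L2)))
    = Slot.eval cst act (leftSlots c (js1 ++ N :: js2))
      (x ++ (L1 ++ (Slot.eval cst act (leftSlots c' js) (y ++ L) ++ L2))) := by
  cases c with
  | a => simp only [eval_left_a]
  | m =>
    obtain ⟨hp, hd⟩ := hx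
    obtain ⟨hq, he⟩ := hy
    have hq1 := hq.length_pos
    have hc := IsCubePt.comp (cst := cst) (act := act) ⟨hp, hd⟩ ⟨hq, he⟩
    have hlen1 := h1.length_eq
    have hlen2 := h2.length_eq
    have hlen := h.length_eq
    have hsum := h.sum_eq
    have hone := h.one_le
    obtain ⟨rfl, rfl, h3⟩ | ⟨rfl, h3, h4, h5⟩ := isProfile_m_cases hp
    · obtain ⟨rfl, rfl, hL2⟩ := h2.nil_inv
      obtain rfl : L2 = [] := List.length_eq_zero_iff.1 hL2
      have h4 := h1.one_le
      rw [h3] at h1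
      obtain rfl : L1 = [] := List.length_eq_zero_iff.1 h1.eq_zero
      obtain ⟨js0, j, rfl, h6, h7, h8, h9, rfl⟩ := h.profile hq
      obtain ⟨n, hn⟩ : ∃ n, n = (cs1 ++ [Col.m]).length := ⟨_, rfl⟩
      rw [List.append_nil, List.append_nil, List.append_nil, List.nil_append, List.nil_append,
        ← List.append_assoc, eval_left_hat H (n := n + cs.length - 1) (by
            simp at hn h6 ⊢; omega) (by
            rw [hc.2, cubeDim]; simp at hn ⊢; omega) h7,
        eval_left_hat H (x := y) h6 he h7, eval_left_hat H (n := n) (by simp [hn, hlen1])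
          (by rw [hn]; exact hd) ?_, ← hn, hat_comp_m H (by simp [hn]) hq1 (by rw [hn]; exact hd) he,
          leftBlock_append, List.append_assoc]
      · rw [length_hat (by rw [hn]; exact hd)]; simp [hn, hlen1]
      · rw [List.length_append, length_leftBlock _ h9, h7, freeDim]
        · omega
        · rw [length_hat he]; omega
    · have hr1 := h4.length_pos
      obtain rfl : y = [] := List.length_eq_zero_iff.1 he
      rw [h5] at h1
      obtain rfl : L1 = [] := List.length_eq_zero_iff.1 h1.eq_zero
      rw [hq.eq_replicate_a] at h
      obtain rfl : L = [] := List.length_eq_zero_iff.1 h.eq_zero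
      obtain ⟨js0, j, rfl, h6, h7, h8, h9, rfl⟩ := h2.profile h4
      have hl1 : (hat cst (cs1 ++ Col.a :: cs2).length x).length
          = (cs1 ++ Col.a :: cs2).length - 1 := length_hat hd
      simp only [List.length_append, List.length_cons, cubeDim, List.length_nil] at hd hl1 hlen2
      obtain ⟨x1, x2, rfl, hl⟩ := exists_append_length (x := x) (i := cs1.length) (by omega)
      simp only [List.length_append] at hd
      rw [List.append_nil, eval_comp_a H hl (by simp; omega)]
      simp only [List.nil_append, eval_left_a]
      rw [show js1 ++ (js ++ (js0 ++ [j])) = (js1 ++ (js ++ js0)) ++ [j] by simp,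
        eval_left_hat H (n := cs1.length +
        (cs.length + cs2.length)) (by simp; omega) (by simp; omega) h7, 
        show js1 ++ N :: (js0 ++ [j]) = (js1 ++ N :: js0) ++ [j] by simp, eval_left_hat H
        (n := cs1.length + (cs2.length + 1)) (by simp; omega) (by simp; omega) h7,
        hat, if_neg (by omega), hat, if_neg (by omega), List.append_assoc, List.append_assoc,
        List.append_assoc, leftBlock_append (by omega),
        leftBlock_append (js' := N :: js0) (by omega)]
      rcases hx2 : x2 ++ [cst 1] with _ | ⟨t, r⟩
      · simp at hx2
      · rw [leftBlock_zeros H (by omega) hone, hsum, leftBlock]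

theorem eval_left_right (H : AffLaws cst act) {cs1 cs2 l1 l2 m1 m2 l' : List Col}
    {c c' c'' : Col} {js1 js2 : List ℕ} {x t z L1 L2 : List α}
    (hx : IsCubePt (cs1 ++ c' :: cs2) c x) (ht : IsFreePt (m1 ++ c'' :: m2) c' t)
    (hz : IsCubePt l' c'' z)
    (h1 : IsTupShape cs1 l1.length js1 L1.length) (h2 : IsTupShape cs2 l2.length js2 L2.length) :
    Slot.eval cst act (rightSlots c c'' (l1 ++ m1).length
        (l1 ++ ((m1 ++ c'' :: m2) ++ l2)).length l'.length)
      (Slot.eval cst act (leftSlots c (js1 ++ (m1 ++ c'' :: m2).length :: js2))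
        (x ++ (L1 ++ (t ++ L2))) ++ z)
    = Slot.eval cst act (leftSlots c (js1 ++ (m1 ++ (l' ++ m2)).length :: js2))
      (x ++ (L1 ++ (Slot.eval cst act (rightSlots c' c'' m1.length (m1 ++ c'' :: m2).length
        l'.length) (t ++ z) ++ L2))) := by
  cases c with
  | a => simp only [eval_left_a, eval_right_out_a]
  | m =>
    obtain ⟨hp, hd⟩ := hx
    obtain ⟨hq, he⟩ := ht
    obtain ⟨hr, hf⟩ := hz
    have hr1 := hr.length_pos
    have hlen1 := h1.length_eq
    have hsum1 := h1.sum_eq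
    have hone1 := h1.one_le
    have hlen2 := h2.length_eq
    obtain ⟨rfl, rfl, h3⟩ | ⟨rfl, h3, h4, h5⟩ := isProfile_m_cases hp
    · obtain ⟨hl2, rfl, hL2⟩ := h2.nil_inv
      obtain rfl : L2 = [] := List.length_eq_zero_iff.1 hL2
      obtain rfl : l2 = [] := List.length_eq_zero_iff.1 hl2
      have hrt := (IsFreePt.right (cst := cst) (act := act) (x := t) (y := z)
        ⟨hq, he⟩ ⟨hr, hf⟩).2
      rw [h3] at h1
      obtain rfl : L1 = [] := List.length_eq_zero_iff.1 h1.eq_zero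
      simp only [List.append_nil, List.nil_append]
      have hxl : x.length = cs1.length + 1 - 2 := by simpa [cubeDim] using hd
      rw [eval_left_hat H (n := cs1.length + 1) (by omega) hxl he,
        eval_left_hat H (n := cs1.length + 1) (by omega) hxl hrt]
      obtain ⟨B, hB⟩ : ∃ B, B = leftBlock cst act js1 (hat cst (cs1.length + 1) x) := ⟨_, rfl⟩
      have hBl : B.length = l1.length := by
        rw [hB, length_leftBlock _ hone1, hsum1]
        rw [length_hat hxl, hlen1]; omega
      -- halving does not change the last coordinate `0` of the block
      have hBh : halfLast act B = B := by
        rw [hB, hat]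
        split_ifs with h
        · cases js1 <;> simp [leftBlock, halfLast]
        · rcases List.eq_nil_or_concat' js1 with h0 | ⟨js', j, rfl⟩
          · rw [h0] at hlen1; simp at hlen1; omega
          · simp at hlen1
            rw [leftBlock_append (by omega)]
            simp only [leftBlock, H.act_cst]
            rw [← List.append_assoc, halfLast_concat, H.act_cst]
            norm_num
      rw [← hB]
      obtain ⟨rfl, rfl, h4⟩ | ⟨rfl, h4, h5, h6⟩ := isProfile_m_cases hq
      · simp only [freeDim, cubeDim, List.length_append, List.length_cons, List.length_nil] at he hf ⊢
        rcases Nat.lt_or_ge l'.length 2 with h6 | h6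
        · obtain rfl : z = [] := List.length_eq_zero_iff.1 (by omega)
          rw [List.append_nil, List.append_nil, eval_right_m_one H (x := t) (by omega) (by omega),
            eval_right_m_one H (by omega) (by simp; omega)]
        · rw [eval_right_half H (by simp; omega) (by omega), eval_right_half H (by omega)
            (by omega)]
          rcases eq_or_ne t [] with rfl | h
          · simp only [List.append_nil, hBh]
            simp [halfLast]
          · rw [halfLast_append h, List.append_assoc]
      · obtain rfl : z = [] := List.length_eq_zero_iff.1 hf
        simp only [freeDim, cubeDim, List.length_append, List.length_cons, List.length_nil] at he hf ⊢
        obtain ⟨t1, t2, rfl, hl⟩ := exists_append_length (x := t) (i := m1.length) (by omega)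
        simp only [List.length_append] at he
        rw [List.append_nil, List.append_nil, ← List.append_assoc, eval_right_a H (by simp; omega)
          (by simp; omega), eval_right_a H hl (by omega), List.append_assoc]
    · obtain rfl : t = [] := List.length_eq_zero_iff.1 he
      have hr2 := h4.length_pos
      obtain rfl : c'' = .a := by
        obtain ⟨-, h | h⟩ := hq.append_cons
        exacts [h.1, h.1]
      obtain rfl : z = [] := List.length_eq_zero_iff.1 hf
      rw [h5] at h1
      obtain rfl : L1 = [] := List.length_eq_zero_iff.1 h1.eq_zero
      obtain ⟨js0, j, rfl, h6, h7, h8, h9, h10⟩ := h2.profile h4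
      simp only [List.nil_append, eval_right_out_a, List.append_nil]
      have hxl : x.length = cs1.length + (cs2.length + 1) - 2 := by simpa [cubeDim] using hd
      have hjl : ∀ k : ℕ, (js1 ++ k :: js0).length + 1 = cs1.length + (cs2.length + 1) := by
        simp; omega
      rw [show ∀ k : ℕ, js1 ++ k :: (js0 ++ [j]) = (js1 ++ k :: js0) ++ [j] by simp,
        eval_left_hat H (hjl _) hxl h7,
        show ∀ k : ℕ, js1 ++ k :: (js0 ++ [j]) = (js1 ++ k :: js0) ++ [j] by simp,
        eval_left_hat H (hjl _) hxl h7]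
      have hh := length_hat (cst := cst) hxl
      obtain ⟨X, hX⟩ : ∃ X, X = hat cst (cs1.length + (cs2.length + 1)) x := ⟨_, rfl⟩
      rw [← hX] at hh ⊢
      obtain ⟨x1, x2, rfl, hl⟩ := exists_append_length (x := X) (i := cs1.length) (by omega)
      cases x2 with
      | nil => simp at hh; omega
      | cons s x2 =>
      have hB1 : (leftBlock cst act js1 x1).length = l1.length := by
        rw [length_leftBlock (by omega) hone1, hsum1]
      have hB2 : (leftBlock cst act js0 x2).length = js0.sum := by
        rw [length_leftBlock (by simp at hh; omega) h9]
      rw [leftBlock_append (by omega), leftBlock_append (by omega), leftBlock, leftBlock]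
      have := eval_right_a H (i := (l1 ++ m1).length)
        (n := (l1 ++ (m1 ++ Col.a :: m2 ++ l2)).length) (n' := l'.length)
        (x1 := leftBlock cst act js1 x1 ++ List.replicate m1.length (cst 1))
        (x2 := List.replicate m2.length (cst 1) ++ act (-1) 1 s :: (leftBlock cst act js0 x2 ++ L2))
        (by simp; omega) (by rw [freeDim] at h7; simp; omega)
      simp only [List.append_assoc, replicate_append_replicate_append, List.cons_append] at this ⊢
      rw [show (m1 ++ Col.a :: m2).length - 1 = m1.length + m2.length by simp, this,
        show m1.length + (l'.length - 1 + m2.length) = (m1 ++ (l' ++ m2)).length - 1 by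
          simp; omega]

end Points

/-! ### Cells -/

theorem iv_ext {I J : Iv} (h1 : I.fst = J.fst) (h2 : I.snd = J.snd) : I = J :=
  NonemptyInterval.ext (Prod.ext h1 h2)

theorem affIv_fst (s t : ℚ) (I : Iv) :
    (affIv s t I).fst = min (s * I.fst + t) (s * I.snd + t) := rfl

theorem affIv_snd (s t : ℚ) (I : Iv) :
    (affIv s t I).snd = max (s * I.fst + t) (s * I.snd + t) := rfl

theorem affLaws_affIv : AffLaws (fun q => (NonemptyInterval.pure q : Iv)) affIv where
  act_one I := by
    have := I.fst_le_snd
    apply iv_ext <;> simp [affIv_fst, affIv_snd, this]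
  act_cst s t q := by apply iv_ext <;> simp [affIv_fst, affIv_snd]
  act_act s t s' t' I := by
    apply iv_ext
    · simp only [affIv_fst, affIv_snd]
      rcases le_total (s' * I.fst + t') (s' * I.snd + t') with h | h
      · rw [min_eq_left h, max_eq_right h]
        congr 1 <;> ring
      · rw [min_eq_right h, max_eq_left h, min_comm]
        congr 1 <;> ring
    · simp only [affIv_fst, affIv_snd]
      rcases le_total (s' * I.fst + t') (s' * I.snd + t') with h | h
      · rw [min_eq_left h, max_eq_right h]
        congr 1 <;> ring
      · rw [min_eq_right h, max_eq_left h, max_comm]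
        congr 1 <;> ring

theorem affLaws_real :
    AffLaws (fun q : ℚ => (q : ℝ)) (fun s t x => (s : ℝ) * x + (t : ℝ)) where
  act_one x := by simp
  act_cst s t q := by push_cast; ring
  act_act s t s' t' x := by push_cast; ring

theorem mem_intervalCells {I : Iv} :
    I ∈ intervalCells ↔ I = NonemptyInterval.pure 0 ∨ I = NonemptyInterval.pure 1 ∨ I = unitIv := by
  simp [intervalCells]

theorem mem_halvedCells {I : Iv} :
    I ∈ halvedCells ↔ I = NonemptyInterval.pure 0 ∨ I = NonemptyInterval.pure (1 / 2) ∨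
      I = NonemptyInterval.pure 1 ∨ I = iv 0 (1 / 2) (by norm_num) ∨
      I = iv (1 / 2) 1 (by norm_num) := by
  simp [halvedCells]

/-- The upper half `[1/2, 1]` of the unit interval. -/
def upperIv : Iv := iv (1 / 2) 1 (by norm_num)

/-- The box `w` lies in the distinguished hyperface of the freehedron of its dimension. -/
def InDist : Box → Prop
  | [] => False
  | [I] => I ≤ NonemptyInterval.pure 1
  | I :: J :: w => I ≤ upperIv ∧ InDist (J :: w)

theorem inDist_cons {I : Iv} {w : Box} (h : w ≠ []) :
    InDist (I :: w) ↔ I ≤ upperIv ∧ InDist w := by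
  cases w with
  | nil => simp at h
  | cons J w => rfl

theorem inDist_iff (n : ℕ) (w : Box) :
    List.Forall₂ (fun J I : Iv => J ≤ I) w (distFace (n + 1)) ↔ w.length = n + 1 ∧ InDist w := by
  induction n generalizing w with
  | zero =>
    cases w with
    | nil => simp [distFace]
    | cons I w => cases w <;> simp [distFace, InDist]
  | succ n ih =>
    cases w with
    | nil => simp [distFace]
    | cons I w =>
      rw [distFace, List.forall₂_cons, ih]
      cases w with
      | nil => simp
      | cons J w =>
        rw [inDist_cons (List.cons_ne_nil J w)]
        simp only [List.length_cons, upperIv]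
        constructor
        · rintro ⟨h1, h2, h3⟩; exact ⟨by omega, h1, h3⟩
        · rintro ⟨h1, h2, h3⟩; exact ⟨h2, by omega, h3⟩

open Classical in
/-- The cells of the new coordinate of a freehedron, over the cell `w` of the previous one. -/
noncomputable def cellsOver (w : Box) : Finset Iv :=
  if InDist w then halvedCells else intervalCells

/-- The boxes that are cells of freehedra. -/
def IsFreeCell : Box → Prop
  | [] => True
  | I :: w => IsFreeCell w ∧ I ∈ cellsOver w

theorem mem_freehedron (n : ℕ) (w : Box) :
    w ∈ freehedron n ↔ w.length = n ∧ IsFreeCell w := by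
  induction n generalizing w with
  | zero =>
    cases w <;> simp [freehedron, IsFreeCell]
  | succ n ih =>
    cases n with
    | zero =>
      cases w with
      | nil => simp [freehedron]
      | cons I w =>
        cases w <;> simp [freehedron, IsFreeCell, cellsOver, InDist]
    | succ n =>
      cases w with
      | nil => simp [freehedron]
      | cons I w =>
        simp only [freehedron, Finset.mem_biUnion, Finset.mem_image, List.cons.injEq,
          List.length_cons, Nat.add_right_cancel_iff, IsFreeCell]
        constructor
        · rintro ⟨v, hv, J, hJ, rfl, rfl⟩
          obtain ⟨h1, h2⟩ := (ih v).1 hv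
          refine ⟨h1, h2, ?_⟩
          have h3 := (inDist_iff n v).trans (and_iff_right h1)
          rw [cellsOver]
          by_cases h : InDist v
          · rw [if_pos (h3.2 h)] at hJ; rwa [if_pos h]
          · rw [if_neg (mt h3.1 h)] at hJ; rwa [if_neg h]
        · rintro ⟨h1, h2, h3⟩
          refine ⟨w, (ih w).2 ⟨h1, h2⟩, I, ?_, rfl, rfl⟩
          have h4 := (inDist_iff n w).trans (and_iff_right h1)
          rw [cellsOver] at h3
          by_cases h : InDist w
          · rw [if_pos h] at h3; rwa [if_pos (h4.2 h)]
          · rw [if_neg h] at h3; rwa [if_neg (mt h4.1 h)]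

theorem mem_cube (n : ℕ) (w : Box) :
    w ∈ cube n ↔ w.length = n ∧ ∀ I ∈ w, I ∈ intervalCells := by
  induction n generalizing w with
  | zero =>
    simp only [cube, Finset.mem_singleton]
    constructor
    · rintro rfl; simp
    · rintro ⟨h, -⟩; exact List.length_eq_zero_iff.1 h
  | succ n ih =>
    cases w with
    | nil => simp [cube]
    | cons I w =>
      simp only [cube, Finset.mem_biUnion, Finset.mem_image, List.cons.injEq, ih]
      constructor
      · rintro ⟨v, ⟨h1, h2⟩, J, hJ, rfl, rfl⟩
        refine ⟨by simpa using h1, ?_⟩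
        simpa [hJ] using h2
      · rintro ⟨h1, h2⟩
        exact ⟨w, ⟨by simpa using h1, fun J hJ => h2 J (by simp [hJ])⟩, I, h2 I (by simp), rfl, rfl⟩

theorem mem_cubeOp {l : List Col} {c : Col} {w : Box} :
    w ∈ cubeOp l c ↔ IsCubePt l c w ∧ ∀ I ∈ w, I ∈ intervalCells := by
  rw [cubeOp, IsCubePt]
  split_ifs with h
  · rw [mem_cube]; tauto
  · simp [h]

theorem mem_freeMod {l : List Col} {c : Col} {w : Box} :
    w ∈ freeMod l c ↔ IsFreePt l c w ∧ IsFreeCell w := by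
  rw [freeMod, IsFreePt]
  split_ifs with h
  · rw [mem_freehedron]; tauto
  · simp [h]

/-- Slots that preserve the cells of the interval. -/
def IsCellSlot : Slot → Prop
  | .const q => q = 0 ∨ q = 1
  | .aff s t => (s = 1 ∧ t = 0) ∨ (s = -1 ∧ t = 1)

theorem affIv_neg_mem {I : Iv} (h : I ∈ intervalCells) : affIv (-1) 1 I ∈ intervalCells := by
  rw [mem_intervalCells] at h ⊢
  obtain rfl | rfl | rfl := h
  · right; left; apply iv_ext <;> simp [affIv_fst, affIv_snd]
  · left; apply iv_ext <;> simp [affIv_fst, affIv_snd]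
  · right; right; apply iv_ext <;> simp [affIv_fst, affIv_snd, unitIv, iv]

theorem mem_eval_intervalCells {S : List Slot} (hS : ∀ s ∈ S, IsCellSlot s) {w : Box}
    (hw : ∀ I ∈ w, I ∈ intervalCells) : ∀ I ∈ evalBox S w, I ∈ intervalCells := by
  induction S generalizing w with
  | nil => rw [evalBox, eval_nil]; simp
  | cons s S ih =>
    have hS' : ∀ s ∈ S, IsCellSlot s := fun s hs => hS s (by simp [hs])
    have hs := hS s (by simp)
    cases s with
    | const q =>
      intro I hI
      simp only [evalBox, Slot.eval, List.mem_cons] at hI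
      obtain rfl | hI := hI
      · rw [mem_intervalCells]
        obtain rfl | rfl := hs <;> simp
      · exact ih hS' hw I hI
    | aff s t =>
      cases w with
      | nil => simp [evalBox, Slot.eval]
      | cons J w =>
        intro I hI
        simp only [evalBox, Slot.eval, List.mem_cons] at hI
        obtain rfl | hI := hI
        · obtain ⟨rfl, rfl⟩ | ⟨rfl, rfl⟩ := hs
          · rw [affLaws_affIv.act_one]; exact hw J (by simp)
          · exact affIv_neg_mem (hw J (by simp))
        · exact ih hS' (fun J hJ => hw J (by simp [hJ])) I hI

theorem isCellSlot_copies (n : ℕ) : ∀ s ∈ copies n, IsCellSlot s := by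
  intro s hs
  rw [List.eq_of_mem_replicate hs]
  exact Or.inl ⟨rfl, rfl⟩

theorem isCellSlot_compSlots (c c' : Col) (i n n' : ℕ) :
    ∀ s ∈ compSlots c c' i n n', IsCellSlot s := by
  intro s hs
  have h0 : IsCellSlot (.const 0) := Or.inl rfl
  have h1 : IsCellSlot (.const 1) := Or.inr rfl
  cases c with
  | a => simp [compSlots] at hs
  | m =>
    cases c' with
    | a =>
      simp only [compSlots, List.mem_append] at hs
      obtain (hs | hs) | hs := hs
      · exact isCellSlot_copies _ s hs
      · rw [List.eq_of_mem_replicate hs]; exact h0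
      · exact isCellSlot_copies _ s hs
    | m =>
      simp only [compSlots] at hs
      split_ifs at hs
      · exact isCellSlot_copies _ s hs
      · exact isCellSlot_copies _ s hs
      · simp only [List.mem_append, List.mem_singleton] at hs
        obtain (hs | rfl) | hs := hs
        · exact isCellSlot_copies _ s hs
        · exact h1
        · exact isCellSlot_copies _ s hs

theorem comp_mem_cubeOp {l1 l2 l' : List Col} {c c' : Col} {v w : Box}
    (hv : v ∈ cubeOp (l1 ++ c' :: l2) c) (hw : w ∈ cubeOp l' c') :
    evalBox (compSlots c c' l1.length (l1 ++ c' :: l2).length l'.length) (v ++ w)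
      ∈ cubeOp (l1 ++ (l' ++ l2)) c := by
  rw [mem_cubeOp] at hv hw ⊢
  refine ⟨hv.1.comp hw.1, mem_eval_intervalCells (isCellSlot_compSlots _ _ _ _ _) ?_⟩
  intro I hI
  rw [List.mem_append] at hI
  exact hI.elim (hv.2 I) (hw.2 I)

/-! ### Cells under the right action -/

theorem intervalCells_subset_of_point {I : Iv} (h : I ∈ intervalCells) (h' : I ≠ unitIv) :
    I ∈ halvedCells := by
  rw [mem_intervalCells] at h
  rw [mem_halvedCells]
  tauto

theorem pure_one_mem_cellsOver (w : Box) : NonemptyInterval.pure 1 ∈ cellsOver w := by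
  rw [cellsOver]; split_ifs
  · simp [mem_halvedCells]
  · simp [mem_intervalCells]

theorem pure_zero_mem_cellsOver (w : Box) : NonemptyInterval.pure 0 ∈ cellsOver w := by
  rw [cellsOver]; split_ifs
  · simp [mem_halvedCells]
  · simp [mem_intervalCells]

theorem pure_one_le_upperIv : (NonemptyInterval.pure 1 : Iv) ≤ upperIv := by
  rw [NonemptyInterval.le_def]; simp [upperIv, iv]; norm_num

theorem cellsOver_congr {v w : Box} (h : InDist v ↔ InDist w) : cellsOver v = cellsOver w := by
  rw [cellsOver, cellsOver]; congr 1; exact propext h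

/-- Coordinates `1` may be inserted anywhere but after the last coordinate. -/
theorem insert_ones {v2 : Box} (h2 : v2 ≠ []) (k : ℕ) (v1 : Box) :
    (InDist (v1 ++ (List.replicate k (NonemptyInterval.pure 1) ++ v2)) ↔ InDist (v1 ++ v2)) ∧
    (IsFreeCell (v1 ++ (List.replicate k (NonemptyInterval.pure 1) ++ v2)) ↔
      IsFreeCell (v1 ++ v2)) := by
  induction v1 with
  | nil =>
    induction k with
    | zero => simp
    | succ k ih =>
      simp only [List.nil_append, List.replicate_succ, List.cons_append, IsFreeCell] at ih ⊢
      rw [inDist_cons (by simp [h2]), ih.1, ih.2]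
      exact ⟨and_iff_right pure_one_le_upperIv, and_iff_left (pure_one_mem_cellsOver _)⟩
  | cons I v1 ih =>
    simp only [List.cons_append, IsFreeCell]
    rw [inDist_cons (by simp [h2]), inDist_cons (by simp [h2]), ih.1, ih.2, cellsOver_congr ih.1]
    exact ⟨Iff.rfl, Iff.rfl⟩

theorem affIv_half_cases {I : Iv} (h : I ∈ intervalCells) :
    affIv (-1 / 2) 1 I ≤ upperIv ∧ affIv (-1 / 2) 1 I ∈ halvedCells := by
  rw [mem_intervalCells] at h
  rw [mem_halvedCells, NonemptyInterval.le_def]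
  obtain rfl | rfl | rfl := h
  · refine ⟨by simp [affIv_fst, affIv_snd, upperIv, iv]; norm_num, ?_⟩
    right; right; left
    apply iv_ext <;> simp [affIv_fst, affIv_snd]
  · refine ⟨by simp [affIv_fst, affIv_snd, upperIv, iv]; norm_num, ?_⟩
    right; left
    apply iv_ext <;> simp [affIv_fst, affIv_snd] <;> norm_num
  · refine ⟨by simp [affIv_fst, affIv_snd, upperIv, iv, unitIv]; norm_num, ?_⟩
    right; right; right; right
    apply iv_ext <;> simp [affIv_fst, affIv_snd, unitIv, iv] <;> norm_num

/-- The part of a cell that comes from a cube under the right action. -/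
theorem upper_cells {w : Box} (hw : ∀ I ∈ w, I ∈ intervalCells) :
    InDist (w.map (affIv (-1 / 2) 1) ++ [NonemptyInterval.pure 1]) ∧
      IsFreeCell (w.map (affIv (-1 / 2) 1) ++ [NonemptyInterval.pure 1]) := by
  induction w with
  | nil =>
    refine ⟨le_rfl, trivial, ?_⟩
    exact pure_one_mem_cellsOver _
  | cons I w ih =>
    obtain ⟨h1, h2⟩ := ih fun J hJ => hw J (by simp [hJ])
    obtain ⟨h3, h4⟩ := affIv_half_cases (hw I (by simp))
    rw [List.map_cons, List.cons_append, inDist_cons (by simp)]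
    refine ⟨⟨h3, h1⟩, h2, ?_⟩
    rwa [cellsOver, if_pos h1]

theorem affIv_half_lower {I : Iv} (h : I ∈ intervalCells) :
    affIv (1 / 2) 0 I ∈ halvedCells ∧
      (affIv (1 / 2) 0 I ≤ upperIv ↔ I ≤ NonemptyInterval.pure 1) := by
  rw [mem_intervalCells] at h
  rw [mem_halvedCells, NonemptyInterval.le_def, NonemptyInterval.le_def]
  obtain rfl | rfl | rfl := h
  · refine ⟨?_, by simp [affIv_fst, affIv_snd, upperIv, iv]; norm_num⟩
    left
    apply iv_ext <;> simp [affIv_fst, affIv_snd]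
  · refine ⟨?_, by simp [affIv_fst, affIv_snd, upperIv, iv]; norm_num⟩
    right; left
    apply iv_ext <;> simp [affIv_fst, affIv_snd]
  · refine ⟨?_, by simp [affIv_fst, affIv_snd, upperIv, iv, unitIv]; norm_num⟩
    right; right; right; left
    apply iv_ext <;> simp [affIv_fst, affIv_snd, unitIv, iv]

theorem halve_cells {d : Box} (hd : InDist d ∧ IsFreeCell d) (t : Iv) (u : Box) :
    (InDist (u ++ [t]) → t ∈ intervalCells → InDist (u ++ (affIv (1 / 2) 0 t :: d))) ∧
    (t ∈ intervalCells → InDist (u ++ (affIv (1 / 2) 0 t :: d)) → InDist (u ++ [t])) ∧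
    (IsFreeCell (u ++ [t]) → IsFreeCell (u ++ (affIv (1 / 2) 0 t :: d)) ∧ t ∈ intervalCells) := by
  have hne : d ≠ [] := by rintro rfl; exact hd.1
  induction u with
  | nil =>
    simp only [List.nil_append, IsFreeCell]
    rw [inDist_cons hne]
    refine ⟨fun h ht => ⟨(affIv_half_lower ht).2.2 h, hd.1⟩,
      fun ht h => (affIv_half_lower ht).2.1 h.1, fun h => ?_⟩
    have ht : t ∈ intervalCells := by simpa [cellsOver, InDist] using h
    refine ⟨⟨hd.2, ?_⟩, ht⟩
    rw [cellsOver, if_pos hd.1]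
    exact (affIv_half_lower ht).1
  | cons I u ih =>
    obtain ⟨h1, h2, h3⟩ := ih
    simp only [List.cons_append, IsFreeCell]
    rw [inDist_cons (by simp), inDist_cons (by simp)]
    refine ⟨fun h ht => ⟨h.1, h1 h.2 ht⟩, fun ht h => ⟨h.1, h2 ht h.2⟩, fun h => ?_⟩
    obtain ⟨h4, h5⟩ := h3 h.1
    refine ⟨⟨h4, ?_⟩, h5⟩
    rw [cellsOver_congr ⟨fun h => h2 h5 h, fun h => h1 h h5⟩]
    exact h.2

theorem right_mem_freeMod {l1 l2 l' : List Col} {c c' : Col} {v w : Box}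
    (hv : v ∈ freeMod (l1 ++ c' :: l2) c) (hw : w ∈ cubeOp l' c') :
    evalBox (rightSlots c c' l1.length (l1 ++ c' :: l2).length l'.length) (v ++ w)
      ∈ freeMod (l1 ++ (l' ++ l2)) c := by
  rw [mem_freeMod] at hv ⊢
  rw [mem_cubeOp] at hw
  refine ⟨hv.1.right hw.1, ?_⟩
  have H := affLaws_affIv
  obtain ⟨⟨hp, hd⟩, hvc⟩ := hv
  obtain ⟨⟨hq, he⟩, hwc⟩ := hw
  have hq1 := hq.length_pos
  cases c with
  | a => rw [evalBox, eval_right_out_a]; trivial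
  | m =>
    obtain ⟨rfl, rfl, h1⟩ | ⟨rfl, h1, h2, h3⟩ := isProfile_m_cases hp
    · rw [freeDim] at hd
      rw [cubeDim] at he
      rcases Nat.lt_or_ge l'.length 2 with h6 | h6
      · obtain rfl : w = [] := List.length_eq_zero_iff.1 (by omega)
        rw [evalBox, List.append_nil, eval_right_m_one H (by omega) (by omega)]
        exact hvc
      · rw [evalBox, eval_right_half H hd (by omega)]
        have hdc := upper_cells hwc
        rcases List.eq_nil_or_concat' v with rfl | ⟨u, t, rfl⟩
        · simpa [halfLast] using hdc.2
        · rw [halfLast_concat, List.append_assoc]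
          exact ((halve_cells hdc t u).2.2 hvc).1
    · obtain rfl : w = [] := List.length_eq_zero_iff.1 he
      simp only [freeDim, List.length_append, List.length_cons] at hd
      obtain ⟨v1, v2, rfl, hl⟩ := exists_append_length (x := v) (i := l1.length) (by omega)
      simp only [List.length_append] at hd
      rw [evalBox, List.append_nil, eval_right_a H hl (by simp; omega)]
      exact ((insert_ones (by rintro rfl; simp at hd; omega) _ v1).2).2 hvc

/-! ### Tuples of cells and the left action -/

theorem Tup.isTupShape {α : Type} {X : List Col → Col → Type} (f : ∀ l c, X l c → List α)
    (hf : ∀ l c x, IsFreePt l c (f l c x)) {cs l : List Col} (T : Tup X cs l) :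
    IsTupShape cs l.length T.arities (T.coords f).length := by
  induction T with
  | nil => exact .nil
  | cons hl x T ih =>
    subst hl
    simp only [Tup.arities, Tup.coords, List.length_append]
    rw [(hf _ _ x).2]
    exact .cons (hf _ _ x).1.length_pos ih

theorem Tup.coords_profile {α : Type} {X : List Col → Col → Type} (f : ∀ l c, X l c → List α)
    (hf : ∀ l c x, IsFreePt l c (f l c x)) {cs l : List Col} (T : Tup X cs l) {c : Col}
    (hc : IsProfile cs c) : ∃ l' x, T.coords f = f l' c x := by
  induction T with
  | nil => obtain ⟨n, hn⟩ := hc; simp at hn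
  | cons hl x T ih =>
    obtain ⟨-, ⟨rfl, rfl⟩ | ⟨rfl, h⟩⟩ := IsProfile.append_cons (l1 := []) hc
    · cases T
      exact ⟨_, x, by simp [Tup.coords]⟩
    · obtain ⟨l', x', h'⟩ := ih h
      refine ⟨l', x', ?_⟩
      change f _ _ x ++ T.coords f = _
      rw [h', (hf _ _ x).eq_nil, List.nil_append]

theorem isFreeCell_append_zero {y : Box} (hy : IsFreeCell y) (B : Box)
    (hB : ∀ I ∈ B, I ∈ intervalCells) :
    ¬ InDist (B ++ NonemptyInterval.pure 0 :: y) ∧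
      IsFreeCell (B ++ NonemptyInterval.pure 0 :: y) := by
  induction B with
  | nil =>
    refine ⟨?_, hy, pure_zero_mem_cellsOver y⟩
    rw [List.nil_append]
    cases y with
    | nil => rw [InDist, NonemptyInterval.le_def]; simp
    | cons I y =>
      rw [inDist_cons (by simp), NonemptyInterval.le_def]
      simp [upperIv, iv]
  | cons I B ih =>
    obtain ⟨h1, h2⟩ := ih fun J hJ => hB J (by simp [hJ])
    rw [List.cons_append, inDist_cons (by simp)]
    refine ⟨fun h => h1 h.2, h2, ?_⟩
    rw [cellsOver, if_neg h1]
    exact hB I (by simp)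

theorem mem_leftBlock {js : List ℕ} {w : Box} (hw : ∀ I ∈ w, I ∈ intervalCells) :
    ∀ I ∈ leftBlock (fun q => (NonemptyInterval.pure q : Iv)) affIv js w, I ∈ intervalCells := by
  induction js generalizing w with
  | nil => simp [leftBlock]
  | cons j js ih =>
    cases w with
    | nil => simp [leftBlock]
    | cons J w =>
      intro I hI
      rw [leftBlock, List.mem_append, List.mem_cons] at hI
      obtain hI | rfl | hI := hI
      · rw [List.eq_of_mem_replicate hI]; simp [mem_intervalCells]
      · exact affIv_neg_mem (hw J (by simp))
      · exact ih (fun J hJ => hw J (by simp [hJ])) I hI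

theorem left_mem_freeMod {cs l : List Col} {c : Col} {v y : Box} {N : ℕ} {js : List ℕ}
    (hv : v ∈ cubeOp cs c) (hjs : IsTupShape cs N js y.length) (hl : IsProfile l c)
    (hN : l.length = N) (hy : IsFreeCell y) :
    evalBox (leftSlots c js) (v ++ y) ∈ freeMod l c := by
  rw [mem_cubeOp] at hv
  rw [mem_freeMod]
  obtain ⟨⟨hp, hd⟩, hvc⟩ := hv
  refine ⟨⟨hl, ?_⟩, ?_⟩
  · rw [evalBox, length_eval (by rw [inputs_leftSlots hjs hp, List.length_append, hd]),
      length_leftSlots hjs hp, hN]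
  have H := affLaws_affIv
  cases c with
  | a => rw [evalBox, eval_left_a]; trivial
  | m =>
    obtain ⟨js0, j, rfl, h2, h3, h4, h5, rfl⟩ := hjs.profile hp
    rw [evalBox, eval_left_hat H h2 hd h3, hat]
    split_ifs with h
    · cases js0 with
      | nil => simpa [leftBlock] using hy
      | cons => simp at h2; omega
    · rcases List.eq_nil_or_concat' js0 with rfl | ⟨js0, j0, rfl⟩
      · simp at h2; omega
      · rw [cubeDim] at hd
        rw [leftBlock_append (by simp at h2; omega)]
        simp only [leftBlock, H.act_cst, List.append_assoc, List.cons_append, List.nil_append]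
        rw [← List.append_assoc]
        norm_num
        have := (isFreeCell_append_zero hy (leftBlock (fun q => (NonemptyInterval.pure q : Iv))
          affIv js0 v ++ List.replicate (j0 - 1) (NonemptyInterval.pure 1)) ?_).2
        · simpa using this
        · intro I hI
          rw [List.mem_append] at hI
          obtain hI | hI := hI
          · exact mem_leftBlock hvc I hI
          · rw [List.eq_of_mem_replicate hI]; simp [mem_intervalCells]

/-- Concatenating profiles along a profile gives a profile. -/
theorem Tup.isProfile {X : List Col → Col → Type*} (hX : ∀ l c, X l c → IsProfile l c)
    {cs l : List Col} (T : Tup X cs l) {c : Col} (hc : IsProfile cs c) : IsProfile l c := by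
  obtain ⟨n, rfl⟩ := hc
  induction n generalizing l with
  | zero =>
    cases T with
    | cons hl x T => cases T; subst hl; rw [List.append_nil]; exact hX _ _ x
  | succ n ih =>
    rw [List.replicate_succ, List.cons_append] at T
    cases T with
    | cons hl x T =>
      subst hl
      rw [(hX _ _ x).eq_replicate_a]
      exact (ih T).of_replicate_append _

/-- The cubes and the freehedra satisfy the axioms of an operad and of a bimodule, and their
structure maps send products of cells onto cells. -/
theorem isCWPair : IsCWPair where
  one_cell c := by
    rw [mem_cubeOp]
    exact ⟨⟨⟨0, rfl⟩, by cases c <;> rfl⟩, by simp⟩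
  comp_cell := comp_mem_cubeOp
  right_cell := right_mem_freeMod
  left_cell {cs l c v} T hv := by
    have hf : ∀ l c (x : {w // w ∈ freeMod l c}), IsFreePt l c x.1 := fun l c x =>
      (mem_freeMod.1 x.2).1
    have hc := (mem_cubeOp.1 hv).1.1
    refine left_mem_freeMod hv (T.isTupShape _ hf) (T.isProfile (fun l c x => (hf l c x).1) hc) rfl ?_
    obtain ⟨l', x, hx⟩ := T.coords_profile _ hf hc
    rw [hx]
    exact (mem_freeMod.1 x.2).2
  one_comp hy := eval_one_comp affLaws_real ⟨hy.1, hy.2.1⟩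
  comp_one hx := eval_comp_one affLaws_real ⟨hx.1, hx.2.1⟩
  sequential hx hy hz :=
    eval_sequential affLaws_real ⟨hx.1, hx.2.1⟩ ⟨hy.1, hy.2.1⟩ ⟨hz.1, hz.2.1⟩
  parallel hx hy hz :=
    eval_parallel affLaws_real ⟨hx.1, hx.2.1⟩ ⟨hy.1, hy.2.1⟩ ⟨hz.1, hz.2.1⟩
  right_one hx := eval_right_one affLaws_real ⟨hx.1, hx.2.1⟩
  right_sequential hx hy hz :=
    eval_right_sequential affLaws_real ⟨hx.1, hx.2.1⟩ ⟨hy.1, hy.2.1⟩ ⟨hz.1, hz.2.1⟩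
  right_parallel hx hy hz :=
    eval_right_parallel affLaws_real ⟨hx.1, hx.2.1⟩ ⟨hy.1, hy.2.1⟩ ⟨hz.1, hz.2.1⟩
  one_left hy := eval_one_left affLaws_real ⟨hy.1, hy.2.1⟩
  left_comp T1 T T2 hx hy :=
    eval_left_comp affLaws_real ⟨hx.1, hx.2.1⟩ ⟨hy.1, hy.2.1⟩
      (T1.isTupShape _ fun _ _ x => ⟨x.2.1, x.2.2.1⟩)
      (T.isTupShape _ fun _ _ x => ⟨x.2.1, x.2.2.1⟩)
      (T2.isTupShape _ fun _ _ x => ⟨x.2.1, x.2.2.1⟩)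
  left_right T1 T2 hx ht hz :=
    eval_left_right affLaws_real ⟨hx.1, hx.2.1⟩ ⟨ht.1, ht.2.1⟩ ⟨hz.1, hz.2.1⟩
      (T1.isTupShape _ fun _ _ x => ⟨x.2.1, x.2.2.1⟩)
      (T2.isTupShape _ fun _ _ x => ⟨x.2.1, x.2.2.1⟩)

/-! ### Cell complexes of boxes -/

/-- The cells of a complex of boxes that is built one coordinate at a time: `A w` is the set of
cells of the new coordinate over the cell `w`. -/
def IsCell (A : Box → Finset Iv) : Box → Prop
  | [] => True
  | I :: w => IsCell A w ∧ I ∈ A w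

/-- Over every cell the new coordinate is `[0, 1]`, possibly halved, and if it is halved over a
cell, then also over the faces of that cell. -/
structure IsSubdivision (A : Box → Finset Iv) : Prop where
  cases : ∀ w, A w = intervalCells ∨ A w = halvedCells
  mono : ∀ v w, List.Forall₂ (fun J I : Iv => J ≤ I) v w → A w = halvedCells → A v = halvedCells

theorem intervalCells_ne_halvedCells : intervalCells ≠ halvedCells := by
  intro h
  have : (NonemptyInterval.pure (1 / 2) : Iv) ∈ intervalCells := by rw [h]; simp [mem_halvedCells]
  rw [mem_intervalCells] at this
  obtain h | h | h := this
  all_goals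
    have := congrArg (fun I : Iv => I.fst) h
    simp [unitIv, iv] at this
    try norm_num at this

theorem isSubdivision_interval : IsSubdivision fun _ => intervalCells where
  cases _ := Or.inl rfl
  mono _ _ _ h := (intervalCells_ne_halvedCells h).elim

theorem InDist.mono {v w : Box} (h : List.Forall₂ (fun J I : Iv => J ≤ I) v w) (hw : InDist w) :
    InDist v := by
  induction h with
  | nil => exact hw
  | @cons J I v w hJ h ih =>
    cases w with
    | nil => cases h; exact le_trans hJ hw
    | cons I' w =>
      cases h with
      | cons h1 h2 =>
        rw [inDist_cons (by simp)] at hw ⊢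
        exact ⟨le_trans hJ hw.1, ih hw.2⟩

theorem isSubdivision_cellsOver : IsSubdivision cellsOver where
  cases w := by rw [cellsOver]; split_ifs <;> simp
  mono v w h hw := by
    rw [cellsOver] at hw ⊢
    split_ifs at hw with h'
    · rw [if_pos (h'.mono h)]
    · exact (intervalCells_ne_halvedCells hw).elim

theorem isCell_interval (w : Box) :
    IsCell (fun _ => intervalCells) w ↔ ∀ I ∈ w, I ∈ intervalCells := by
  induction w with
  | nil => simp [IsCell]
  | cons I w ih => simp [IsCell, ih, and_comm]

theorem isCell_cellsOver (w : Box) : IsCell cellsOver w ↔ IsFreeCell w := by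
  induction w with
  | nil => simp [IsCell, IsFreeCell]
  | cons I w ih => simp [IsCell, IsFreeCell, ih]

/-- The relative interior of an interval. -/
def relInt (I : Iv) (t : ℝ) : Prop :=
  if I.fst < I.snd then (I.fst : ℝ) < t ∧ t < (I.snd : ℝ) else t = (I.fst : ℝ)

/-- Membership of the closed interval. -/
def memIv (I : Iv) (t : ℝ) : Prop := (I.fst : ℝ) ≤ t ∧ t ≤ (I.snd : ℝ)

theorem relInt_pure (q : ℚ) (t : ℝ) : relInt (NonemptyInterval.pure q) t ↔ t = q := by
  simp [relInt]

theorem relInt_iv {p q : ℚ} (h : p ≤ q) (h' : p < q) (t : ℝ) :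
    relInt (iv p q h) t ↔ (p : ℝ) < t ∧ t < q := by
  simp [relInt, iv, h']

theorem exists_intervalCells {t : ℝ} (h0 : 0 ≤ t) (h1 : t ≤ 1) :
    ∃ I ∈ intervalCells, relInt I t := by
  rcases eq_or_lt_of_le h0 with rfl | h0
  · exact ⟨NonemptyInterval.pure 0, by simp [mem_intervalCells], (relInt_pure _ _).2 (by simp)⟩
  rcases eq_or_lt_of_le h1 with rfl | h1
  · exact ⟨NonemptyInterval.pure 1, by simp [mem_intervalCells], (relInt_pure _ _).2 (by simp)⟩
  refine ⟨unitIv, by simp [mem_intervalCells], ?_⟩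
  rw [unitIv, relInt_iv _ (by norm_num)]
  simp [h0, h1]

theorem exists_halvedCells {t : ℝ} (h0 : 0 ≤ t) (h1 : t ≤ 1) :
    ∃ I ∈ halvedCells, relInt I t := by
  rcases eq_or_lt_of_le h0 with rfl | h0
  · exact ⟨NonemptyInterval.pure 0, by simp [mem_halvedCells], (relInt_pure _ _).2 (by simp)⟩
  rcases eq_or_lt_of_le h1 with rfl | h1
  · exact ⟨NonemptyInterval.pure 1, by simp [mem_halvedCells], (relInt_pure _ _).2 (by simp)⟩
  rcases lt_trichotomy t (1 / 2) with h | rfl | h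
  · refine ⟨iv 0 (1 / 2) (by norm_num), by simp [mem_halvedCells], ?_⟩
    rw [relInt_iv _ (by norm_num)]
    push_cast
    exact ⟨h0, h⟩
  · exact ⟨NonemptyInterval.pure (1 / 2), by simp [mem_halvedCells], (relInt_pure _ _).2 (by simp)⟩
  · refine ⟨iv (1 / 2) 1 (by norm_num), by simp [mem_halvedCells], ?_⟩
    rw [relInt_iv _ (by norm_num)]
    push_cast
    exact ⟨h, h1⟩

theorem IsSubdivision.exists_relInt {A : Box → Finset Iv} (hA : IsSubdivision A) (w : Box) {t : ℝ}
    (h0 : 0 ≤ t) (h1 : t ≤ 1) : ∃ I ∈ A w, relInt I t := by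
  obtain h | h := hA.cases w <;> rw [h]
  · exact exists_intervalCells h0 h1
  · exact exists_halvedCells h0 h1

theorem relInt_unique_halved {I J : Iv} {t : ℝ} (hI : I ∈ halvedCells) (hJ : J ∈ halvedCells)
    (h1 : relInt I t) (h2 : relInt J t) : I = J := by
  rw [mem_halvedCells] at hI hJ
  obtain rfl | rfl | rfl | rfl | rfl := hI <;> obtain rfl | rfl | rfl | rfl | rfl := hJ <;>
    simp only [relInt_pure, relInt_iv (p := 0) (q := 1 / 2) _ (by norm_num),
      relInt_iv (p := 1 / 2) (q := 1) _ (by norm_num)] at h1 h2 <;> push_cast at h1 h2 <;>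
    first | rfl | (exfalso; linarith)

theorem relInt_unique_interval {I J : Iv} {t : ℝ} (hI : I ∈ intervalCells)
    (hJ : J ∈ intervalCells) (h1 : relInt I t) (h2 : relInt J t) : I = J := by
  rw [mem_intervalCells] at hI hJ
  obtain rfl | rfl | rfl := hI <;> obtain rfl | rfl | rfl := hJ <;>
    simp only [relInt_pure, unitIv, relInt_iv (p := 0) (q := 1) _ (by norm_num)] at h1 h2 <;>
    push_cast at h1 h2 <;>
    first | rfl | (exfalso; linarith)

theorem IsSubdivision.relInt_unique {A : Box → Finset Iv} (hA : IsSubdivision A) {w : Box}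
    {I J : Iv} {t : ℝ} (hI : I ∈ A w) (hJ : J ∈ A w) (h1 : relInt I t) (h2 : relInt J t) :
    I = J := by
  obtain h | h := hA.cases w <;> rw [h] at hI hJ
  · exact relInt_unique_interval hI hJ h1 h2
  · exact relInt_unique_halved hI hJ h1 h2

/-- A proper interval is one of the open cells, so a point of a cell lies in its relative interior or
is a vertex. -/
theorem relInt_or_endpoint {I : Iv} {t : ℝ} (h : memIv I t) :
    relInt I t ∨ (I.fst < I.snd ∧ (t = I.fst ∨ t = I.snd)) := by
  rw [relInt]
  split_ifs with h'
  · obtain ⟨h1, h2⟩ := h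
    rcases eq_or_lt_of_le h1 with h1 | h1
    · exact Or.inr ⟨h', Or.inl h1.symm⟩
    rcases eq_or_lt_of_le h2 with h2 | h2
    · exact Or.inr ⟨h', Or.inr h2⟩
    exact Or.inl ⟨h1, h2⟩
  · left
    have : I.fst = I.snd := le_antisymm I.fst_le_snd (not_lt.1 h')
    exact le_antisymm (by rw [this]; exact h.2) h.1

theorem IsSubdivision.pure_mem {A : Box → Finset Iv} (hA : IsSubdivision A) {w : Box}
    {I : Iv} (hI : I ∈ A w) :
    NonemptyInterval.pure I.fst ∈ A w ∧ NonemptyInterval.pure I.snd ∈ A w := by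
  obtain h | h := hA.cases w <;> rw [h] at hI ⊢
  · rw [mem_intervalCells] at hI
    obtain rfl | rfl | rfl := hI <;> simp [mem_intervalCells, unitIv, iv]
  · rw [mem_halvedCells] at hI
    obtain rfl | rfl | rfl | rfl | rfl := hI <;> simp [mem_halvedCells, iv]

theorem IsSubdivision.zero_le {A : Box → Finset Iv} (hA : IsSubdivision A) {w : Box}
    {I : Iv} (hI : I ∈ A w) : 0 ≤ I.fst ∧ I.snd ≤ 1 := by
  obtain h | h := hA.cases w <;> rw [h] at hI
  · rw [mem_intervalCells] at hI
    obtain rfl | rfl | rfl := hI <;> simp [unitIv, iv]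
  · rw [mem_halvedCells] at hI
    obtain rfl | rfl | rfl | rfl | rfl := hI <;> simp [iv] <;> norm_num

/-- Halving refines. -/
theorem exists_halved_le {I : Iv} (hI : I ∈ intervalCells) {t : ℝ} (h : memIv I t) :
    ∃ J ∈ halvedCells, J ≤ I ∧ relInt J t ∧ (J.fst < J.snd → I.fst < I.snd) := by
  by_cases hu : I = unitIv
  · subst hu
    obtain ⟨J, hJ, hJ'⟩ := exists_halvedCells (t := t) (by simpa [unitIv, iv] using h.1)
      (by simpa [unitIv, iv] using h.2)
    refine ⟨J, hJ, ?_, hJ', fun _ => by simp [unitIv, iv]⟩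
    rw [mem_halvedCells] at hJ
    rw [NonemptyInterval.le_def]
    obtain rfl | rfl | rfl | rfl | rfl := hJ <;> simp [unitIv, iv] <;> norm_num
  · refine ⟨I, intervalCells_subset_of_point hI hu, le_rfl, ?_, id⟩
    rw [mem_intervalCells] at hI
    obtain rfl | rfl | rfl := hI
    · rw [relInt_pure]; exact le_antisymm (by simpa using h.2) (by simpa using h.1)
    · rw [relInt_pure]; exact le_antisymm (by simpa using h.2) (by simpa using h.1)
    · exact (hu rfl).elim

theorem IsSubdivision.exists_over {A : Box → Finset Iv} (hA : IsSubdivision A) {v w : Box}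
    (hvw : List.Forall₂ (fun J I : Iv => J ≤ I) v w) {I : Iv} (hI : I ∈ A w) {t : ℝ}
    (h : memIv I t) :
    ∃ J ∈ A v, J ≤ I ∧ relInt J t ∧ (J.fst < J.snd → I.fst < I.snd) ∧
      (v = w → J = I ∨ (¬ J.fst < J.snd ∧ I.fst < I.snd)) := by
  by_cases heq : A v = A w
  · rw [heq]
    obtain h' | ⟨h1, h2 | h2⟩ := relInt_or_endpoint h
    · exact ⟨I, hI, le_rfl, h', id, fun _ => Or.inl rfl⟩
    · refine ⟨_, (hA.pure_mem hI).1, ?_, (relInt_pure _ _).2 h2, fun _ => h1,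
        fun _ => Or.inr ⟨by simp, h1⟩⟩
      rw [NonemptyInterval.le_def]; simp [h1.le]
    · refine ⟨_, (hA.pure_mem hI).2, ?_, (relInt_pure _ _).2 h2, fun _ => h1,
        fun _ => Or.inr ⟨by simp, h1⟩⟩
      rw [NonemptyInterval.le_def]; simp [h1.le]
  · have hw : A w = intervalCells := by
      obtain h | h := hA.cases w
      · exact h
      · exact (heq (by rw [h, hA.mono v w hvw h])).elim
    have hv : A v = halvedCells := by
      obtain h | h := hA.cases v
      · exact (heq (by rw [h, hw])).elim
      · exact h
    rw [hw] at hI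
    obtain ⟨J, hJ, h1, h2, h3⟩ := exists_halved_le hI h
    exact ⟨J, hv ▸ hJ, h1, h2, h3, fun h => (heq (by rw [h])).elim⟩

/-- The relative interior of a box. -/
def openPts (w : Box) : Set (List ℝ) := {x | List.Forall₂ (fun t I => relInt I t) x w}

theorem boxDim_cons (I : Iv) (w : Box) :
    boxDim (I :: w) = boxDim w + if I.fst < I.snd then 1 else 0 := by
  simp [boxDim, List.countP_cons]

theorem IsSubdivision.exists_mem_openPts {A : Box → Finset Iv} (hA : IsSubdivision A) (x : List ℝ)
    (hx : ∀ t ∈ x, 0 ≤ t ∧ t ≤ 1) : ∃ w, IsCell A w ∧ x ∈ openPts w := by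
  induction x with
  | nil => exact ⟨[], trivial, .nil⟩
  | cons t x ih =>
    obtain ⟨w, h1, h2⟩ := ih fun s hs => hx s (by simp [hs])
    have := hx t (by simp)
    obtain ⟨I, h3, h4⟩ := hA.exists_relInt w this.1 this.2
    exact ⟨I :: w, ⟨h1, h3⟩, .cons h4 h2⟩

theorem IsSubdivision.openPts_unique {A : Box → Finset Iv} (hA : IsSubdivision A) {v w : Box}
    {x : List ℝ} (hv : IsCell A v) (hw : IsCell A w) (hxv : x ∈ openPts v) (hxw : x ∈ openPts w) :
    v = w := by
  induction hxv generalizing w with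
  | nil => cases hxw; rfl
  | cons h1 h2 ih =>
    cases hxw with
    | cons h3 h4 =>
      obtain rfl := ih hv.1 hw.1 h4
      rw [hA.relInt_unique hv.2 hw.2 h1 h3]

/-- The open cell through a point of a closed cell is the cell itself or a face of smaller
dimension. -/
theorem IsSubdivision.exists_face {A : Box → Finset Iv} (hA : IsSubdivision A) {w : Box}
    {x : List ℝ} (hw : IsCell A w) (hx : x ∈ boxPts w) :
    ∃ v, IsCell A v ∧ x ∈ openPts v ∧ List.Forall₂ (fun J I : Iv => J ≤ I) v w ∧
      (v = w ∨ boxDim v < boxDim w) := by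
  induction hx with
  | nil => exact ⟨[], trivial, .nil, .nil, Or.inl rfl⟩
  | @cons t I x w h1 h2 ih =>
    obtain ⟨v, h3, h4, h5, h6⟩ := ih hw.1
    obtain ⟨J, hJ, h7, h8, h9, h10⟩ := hA.exists_over h5 hw.2 h1
    refine ⟨J :: v, ⟨h3, hJ⟩, .cons h8 h4, .cons h7 h5, ?_⟩
    rw [boxDim_cons, boxDim_cons]
    obtain rfl | h6 := h6
    · obtain rfl | ⟨h11, h12⟩ := h10 rfl
      · exact Or.inl rfl
      · right; simp [h11, h12]
    · right
      split_ifs with h11 h12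
      · omega
      · exact (h12 (h9 h11)).elim
      · omega
      · omega

theorem openPts_subset_boxPts (w : Box) : openPts w ⊆ boxPts w := by
  intro x hx
  refine List.Forall₂.imp (fun t I h => ?_) hx
  rw [relInt] at h
  split_ifs at h with h'
  · exact ⟨h.1.le, h.2.le⟩
  · have : I.fst = I.snd := le_antisymm I.fst_le_snd (not_lt.1 h')
    rw [h, this]; exact ⟨le_rfl, le_rfl⟩

/-! ### Characteristic maps of boxes -/

section Chart

variable {n d : ℕ} (lo hi : Fin n → ℝ) (e : Fin d ≃ {i // lo i < hi i})

open Classical in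
/-- The affine map from the standard cube `[-1, 1]^d` onto the box with corners `lo` and `hi`, for an
enumeration `e` of the coordinates in which the box is not degenerate. -/
noncomputable def boxChart : PartialEquiv (Fin d → ℝ) (Fin n → ℝ) where
  toFun y i := if h : lo i < hi i then (lo i + hi i) / 2 + (hi i - lo i) / 2 * y (e.symm ⟨i, h⟩)
    else lo i
  invFun x j := (x (e j) - (lo (e j) + hi (e j)) / 2) / ((hi (e j) - lo (e j)) / 2)
  source := Metric.ball 0 1
  target := {x | ∀ i, if lo i < hi i then lo i < x i ∧ x i < hi i else x i = lo i}
  map_source' y hy i := by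
    rw [mem_ball_zero_iff, pi_norm_lt_iff one_pos] at hy
    split_ifs with h
    · have := hy (e.symm ⟨i, h⟩)
      rw [Real.norm_eq_abs, abs_lt] at this
      simp only [h, dite_true]
      constructor <;> nlinarith
    · simp only [h, dite_false]
  map_target' x hx := by
    rw [mem_ball_zero_iff, pi_norm_lt_iff one_pos]
    intro j
    have h := (e j).2
    have := hx (e j)
    rw [if_pos h] at this
    rw [Real.norm_eq_abs, abs_lt, lt_div_iff₀ (by linarith), div_lt_iff₀ (by linarith)]
    constructor <;> linarith
  left_inv' y hy := by
    ext j
    have h := (e j).2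
    have h' : hi (e j) - lo (e j) ≠ 0 := by linarith
    simp only [h, dite_true, Subtype.coe_eta, Equiv.symm_apply_apply]
    field_simp
    ring
  right_inv' x hx := by
    ext i
    have := hx i
    split_ifs at this with h
    · have h' : hi i - lo i ≠ 0 := by linarith
      simp only [h, dite_true, Equiv.apply_symm_apply]
      field_simp
      ring
    · simp only [h, dite_false, this]

theorem boxChart_image_closedBall (h : ∀ i, lo i ≤ hi i) :
    boxChart lo hi e '' Metric.closedBall 0 1 = {x | ∀ i, lo i ≤ x i ∧ x i ≤ hi i} := by
  ext x
  constructor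
  · rintro ⟨y, hy, rfl⟩ i
    rw [mem_closedBall_zero_iff, pi_norm_le_iff_of_nonneg zero_le_one] at hy
    change lo i ≤ (dite _ _ _ : ℝ) ∧ (dite _ _ _ : ℝ) ≤ hi i
    split_ifs with h'
    · have := hy (e.symm ⟨i, h'⟩)
      rw [Real.norm_eq_abs, abs_le] at this
      constructor <;> nlinarith
    · exact ⟨le_rfl, h i⟩
  · intro hx
    refine ⟨(boxChart lo hi e).symm x, ?_, ?_⟩
    · rw [mem_closedBall_zero_iff, pi_norm_le_iff_of_nonneg zero_le_one]
      intro j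
      have h := (e j).2
      have := hx (e j)
      change ‖(x (e j) - (lo (e j) + hi (e j)) / 2) / ((hi (e j) - lo (e j)) / 2)‖ ≤ 1
      rw [Real.norm_eq_abs, abs_le, le_div_iff₀ (by linarith), div_le_iff₀ (by linarith)]
      constructor <;> linarith
    · ext i
      change (dite _ _ _ : ℝ) = _
      have := hx i
      split_ifs with h'
      · have h'' : hi i - lo i ≠ 0 := by linarith
        change (lo i + hi i) / 2 + (hi i - lo i) / 2 *
          ((x (e (e.symm ⟨i, h'⟩)) - (lo (e (e.symm ⟨i, h'⟩)) + hi (e (e.symm ⟨i, h'⟩))) / 2) /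
            ((hi (e (e.symm ⟨i, h'⟩)) - lo (e (e.symm ⟨i, h'⟩))) / 2)) = x i
        simp only [Equiv.apply_symm_apply]
        field_simp
        ring
      · linarith [h i, not_lt.1 h']

theorem boxChart_continuous : Continuous (boxChart lo hi e) := by
  refine continuous_pi fun i => ?_
  change Continuous fun y => (dite _ _ _ : ℝ)
  split_ifs with h
  · fun_prop
  · fun_prop

theorem boxChart_continuous_symm : Continuous (boxChart lo hi e).symm := by
  refine continuous_pi fun j => ?_
  change Continuous fun x : Fin n → ℝ =>
    (x (e j) - (lo (e j) + hi (e j)) / 2) / ((hi (e j) - lo (e j)) / 2)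
  fun_prop

theorem boxChart_image_ball :
    boxChart lo hi e '' Metric.ball 0 1
      = {x | ∀ i, if lo i < hi i then lo i < x i ∧ x i < hi i else x i = lo i} :=
  (boxChart lo hi e).image_source_eq_target

theorem mem_ball_of_boxChart_mem {y : Fin d → ℝ}
    (hy : ∀ i, if lo i < hi i then lo i < boxChart lo hi e y i ∧ boxChart lo hi e y i < hi i
      else boxChart lo hi e y i = lo i) : y ∈ Metric.ball (0 : Fin d → ℝ) 1 := by
  rw [mem_ball_zero_iff, pi_norm_lt_iff one_pos]
  intro j
  have h := (e j).2
  have := hy (e j)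
  have hval : boxChart lo hi e y (e j)
      = (lo (e j) + hi (e j)) / 2 + (hi (e j) - lo (e j)) / 2 * y j := by
    change (dite _ _ _ : ℝ) = _
    simp only [h, dite_true, Subtype.coe_eta, Equiv.symm_apply_apply]
  rw [if_pos h, hval] at this
  rw [Real.norm_eq_abs, abs_lt]
  constructor <;> nlinarith

end Chart

/-- Lower corner of a box of length `n`. -/
def boxLo (n : ℕ) (w : Box) (i : Fin n) : ℝ := ((w.getD i default).fst : ℝ)

/-- Upper corner of a box of length `n`. -/
def boxHi (n : ℕ) (w : Box) (i : Fin n) : ℝ := ((w.getD i default).snd : ℝ)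

theorem ofFn_forall₂ {α β : Type*} [Inhabited β] {R : α → β → Prop} {n : ℕ} (x : Fin n → α)
    (w : List β) (hw : w.length = n) :
    List.Forall₂ R (List.ofFn x) w ↔ ∀ i : Fin n, R (x i) (w.getD i default) := by
  induction n generalizing w with
  | zero => simp [List.length_eq_zero_iff.1 hw]
  | succ n ih =>
    cases w with
    | nil => simp at hw
    | cons I w =>
      rw [List.ofFn_succ, List.forall₂_cons, ih _ w (by simpa using hw), Fin.forall_fin_succ]
      simp

theorem card_proper (n : ℕ) (w : Box) (hw : w.length = n) :
    Fintype.card {i : Fin n // boxLo n w i < boxHi n w i} = boxDim w := by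
  rw [Fintype.card_subtype]
  induction n generalizing w with
  | zero => simp [List.length_eq_zero_iff.1 hw, boxDim]
  | succ n ih =>
    cases w with
    | nil => simp at hw
    | cons I w =>
      have := ih w (by simpa using hw)
      rw [boxDim_cons, ← this, Fin.card_filter_univ_succ]
      simp only [boxLo, boxHi]
      simp only [Fin.val_zero, List.getD_cons_zero, Fin.val_succ, List.getD_cons_succ,
        Rat.cast_lt]
      split_ifs <;> simp

/-- A complex of boxes whose open cells partition the cube, and in which the boundary of every cell
is covered by cells of smaller dimension, is a CW structure. -/
theorem isCellStructure_of_subdivision {A : Box → Finset Iv} (hA : IsSubdivision A) (n : ℕ)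
    (X : Finset Box) (hX : ∀ w, w ∈ X ↔ w.length = n ∧ IsCell A w) : IsCellStructure n X := by
  classical
  have hunit : ∀ {w : Box}, IsCell A w → ∀ x ∈ boxPts w, ∀ t ∈ x, (0 : ℝ) ≤ t ∧ t ≤ 1 := by
    intro w hw x hx
    induction hx with
    | nil => simp
    | @cons t I x w h1 h2 ih =>
      have h3 := hA.zero_le hw.2
      have h4 : (0 : ℝ) ≤ (I.fst : ℝ) := by exact_mod_cast h3.1
      have h5 : (I.snd : ℝ) ≤ 1 := by exact_mod_cast h3.2
      simpa using ⟨⟨h4.trans h1.1, h1.2.trans h5⟩, by simpa using ih hw.1⟩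
  have hlo : ∀ w i, boxLo n w i ≤ boxHi n w i := fun w i => by
    simp only [boxLo, boxHi]; exact_mod_cast NonemptyInterval.fst_le_snd _
  have hlen : ∀ {d : ℕ} (w : {w // w ∈ X ∧ boxDim w = d}), w.1.length = n :=
    fun w => ((hX w.1).1 w.2.1).1
  have hcell : ∀ {d : ℕ} (w : {w // w ∈ X ∧ boxDim w = d}), IsCell A w.1 :=
    fun w => ((hX w.1).1 w.2.1).2
  let e : ∀ (d : ℕ) (w : {w // w ∈ X ∧ boxDim w = d}),
      Fin d ≃ {i : Fin n // boxLo n w.1 i < boxHi n w.1 i} := fun d w =>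
    (Fintype.equivFinOfCardEq ((card_proper n w.1 (hlen w)).trans w.2.2)).symm
  have hset : ∀ w : Box, w.length = n →
      boxSet n w = {x | ∀ i, boxLo n w i ≤ x i ∧ x i ≤ boxHi n w i} := fun w hw => by
    ext x; exact ofFn_forall₂ x w hw
  have hopen : ∀ w : Box, w.length = n → ∀ x : Fin n → ℝ,
      (∀ i, if boxLo n w i < boxHi n w i then boxLo n w i < x i ∧ x i < boxHi n w i
        else x i = boxLo n w i) ↔ List.ofFn x ∈ openPts w := fun w hw x => by
    rw [openPts, Set.mem_ofPred_eq, ofFn_forall₂ x w hw]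
    simp only [relInt, boxLo, boxHi, Rat.cast_lt]
  have hclosed : ∀ (d : ℕ) (w : {w // w ∈ X ∧ boxDim w = d}),
      boxChart (boxLo n w.1) (boxHi n w.1) (e d w) '' Metric.closedBall 0 1 = boxSet n w.1 :=
    fun d w => by rw [boxChart_image_closedBall _ _ _ (hlo _), hset _ (hlen w)]
  have hball : ∀ (d : ℕ) (w : {w // w ∈ X ∧ boxDim w = d}),
      boxChart (boxLo n w.1) (boxHi n w.1) (e d w) '' Metric.ball 0 1
        = {x | List.ofFn x ∈ openPts w.1} := fun d w => by
    rw [boxChart_image_ball]; ext x; exact hopen _ (hlen w) x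
  refine ⟨{
    cell := fun d => {w // w ∈ X ∧ boxDim w = d}
    map := fun d w => boxChart (boxLo n w.1) (boxHi n w.1) (e d w)
    source_eq := fun d w => rfl
    continuousOn := fun d w => (boxChart_continuous _ _ _).continuousOn
    continuousOn_symm := fun d w => (boxChart_continuous_symm _ _ _).continuousOn
    pairwiseDisjoint' := ?_
    mapsTo' := ?_
    closed' := ?_
    union' := ?_ }, ?_⟩
  · rintro ⟨d, v⟩ - ⟨d', w⟩ - hvw
    rw [Function.onFun, Set.disjoint_left]
    intro x hx hx'
    rw [hball] at hx hx'
    have := hA.openPts_unique (hcell v) (hcell w) hx hx'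
    obtain ⟨v, hv1, rfl⟩ := v
    obtain ⟨w, hw1, rfl⟩ := w
    subst this
    exact hvw rfl
  · intro d w
    have hfin : ∀ m, Finite {w // w ∈ X ∧ boxDim w = m} := fun m =>
      Finite.of_injective (fun w => (⟨w.1, w.2.1⟩ : {w // w ∈ X}))
        fun v w h => Subtype.ext (congrArg (fun x : {w // w ∈ X} => x.1) h)
    let _ : ∀ m, Fintype {w // w ∈ X ∧ boxDim w = m} := fun m => Fintype.ofFinite _
    refine ⟨fun m => Finset.univ, fun y hy => ?_⟩
    have hy1 : boxChart (boxLo n w.1) (boxHi n w.1) (e d w) y ∈ boxSet n w.1 := by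
      rw [← hclosed]; exact ⟨y, Metric.sphere_subset_closedBall hy, rfl⟩
    obtain ⟨v, h1, h2, h3, h4⟩ := hA.exists_face (hcell w) hy1
    have hvl : v.length = n := by rw [h3.length_eq]; exact hlen w
    have hdim : boxDim v < d := by
      obtain rfl | h4 := h4
      · have := mem_ball_of_boxChart_mem _ _ _ ((hopen _ hvl _).2 h2)
        rw [mem_ball_zero_iff] at this
        rw [mem_sphere_zero_iff_norm] at hy
        exact absurd this (by rw [hy]; exact lt_irrefl _)
      · exact h4.trans_eq w.2.2
    simp only [Set.mem_iUnion]
    refine ⟨boxDim v, hdim, ⟨v, (hX v).2 ⟨hvl, h1⟩, rfl⟩, Finset.mem_univ _, ?_⟩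
    rw [hclosed]
    exact openPts_subset_boxPts _ h2
  · intro B hB h
    have : B = ⋃ w ∈ X, B ∩ boxSet n w := by
      ext x
      simp only [Set.mem_iUnion, Set.mem_inter_iff]
      constructor
      · intro hx
        have hx' := hB hx
        obtain ⟨w, h1, h2⟩ := hA.exists_mem_openPts (List.ofFn x) (by
          intro t ht
          rw [List.mem_ofFn] at ht
          obtain ⟨i, rfl⟩ := ht
          exact ⟨hx'.1 i, hx'.2 i⟩)
        refine ⟨w, (hX w).2 ⟨?_, h1⟩, hx, openPts_subset_boxPts _ h2⟩
        rw [← List.Forall₂.length_eq h2, List.length_ofFn]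
      · rintro ⟨w, _, hx, -⟩; exact hx
    rw [this]
    refine isClosed_biUnion_finset fun w hw => ?_
    have := h (boxDim w) ⟨w, hw, rfl⟩
    rwa [hclosed] at this
  · ext x
    simp only [Set.mem_iUnion, hclosed]
    constructor
    · rintro ⟨d, w, hx⟩
      have := hunit (hcell w) _ hx
      exact ⟨fun i => (this (x i) (by simp [List.mem_ofFn])).1,
        fun i => (this (x i) (by simp [List.mem_ofFn])).2⟩
    · intro hx'
      obtain ⟨w, h1, h2⟩ := hA.exists_mem_openPts (List.ofFn x) (by
          intro t ht
          rw [List.mem_ofFn] at ht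
          obtain ⟨i, rfl⟩ := ht
          exact ⟨hx'.1 i, hx'.2 i⟩)
      refine ⟨_, ⟨w, (hX w).2 ⟨?_, h1⟩, rfl⟩, openPts_subset_boxPts _ h2⟩
      rw [← List.Forall₂.length_eq h2, List.length_ofFn]
  · intro d B
    constructor
    · rintro ⟨w, rfl⟩
      exact ⟨w.1, w.2.1, w.2.2, (hclosed d w).symm⟩
    · rintro ⟨w, h1, h2, rfl⟩
      exact ⟨⟨w, h1, h2⟩, hclosed d ⟨w, h1, h2⟩⟩

theorem isCellStructure_cube (n : ℕ) : IsCellStructure n (cube n) :=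
  isCellStructure_of_subdivision isSubdivision_interval n _ fun w => by
    rw [mem_cube, isCell_interval]

theorem isCellStructure_freehedron (n : ℕ) : IsCellStructure n (freehedron n) :=
  isCellStructure_of_subdivision isSubdivision_cellsOver n _ fun w => by
    rw [mem_freehedron, isCell_cellsOver]

/-! ### Labelled points -/

/-- A rational point of the line with a label: `(q, false)` stands for the vertex `q`, and
`(q, true)` for a formal primitive of it, so that the proper interval `[p, q]` becomes
`(q, true) - (p, true)`. -/
abbrev LPt : Type := ℚ × Bool

/-- Constants are vertices. -/
def lcst (q : ℚ) : LPt := (q, false)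

/-- Affine maps keep the label. -/
def lact (s t : ℚ) (x : LPt) : LPt := (s * x.1 + t, x.2)

theorem affLaws_lpt : AffLaws lcst lact where
  act_one x := by simp [lact]
  act_cst s t q := rfl
  act_act s t s' t' x := by simp [lact]; ring

section

variable {k : Type u} [Field k]

theorem bil_single {A B C : Type*} (g : A → B → C) (a : A) (b : B) (r s : k) :
    bil g (Finsupp.single a r) (Finsupp.single b s) = Finsupp.single (g a b) (r * s) := by
  simp [bil, Finsupp.linearCombination_single, Finsupp.mapDomain_single]

variable (k)

/-- Put a combination of labelled points in front, as a new first coordinate. -/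
noncomputable def pcons : (LPt →₀ k) →ₗ[k] (List LPt →₀ k) →ₗ[k] (List LPt →₀ k) :=
  bil List.cons

/-- The combination of labelled points that realizes an interval. -/
noncomputable def ivR (I : Iv) : LPt →₀ k :=
  if I.fst < I.snd then Finsupp.single (I.snd, true) 1 - Finsupp.single (I.fst, true) 1
  else Finsupp.single (I.fst, false) 1

/-- The combination of lists of labelled points that realizes a box. -/
noncomputable def boxR : Box → (List LPt →₀ k)
  | [] => Finsupp.single [] 1
  | I :: w => pcons k (ivR k I) (boxR w)

/-- The realization of combinations of boxes. -/
noncomputable def realBoxes : (Box →₀ k) →ₗ[k] (List LPt →₀ k) :=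
  Finsupp.linearCombination k (boxR k)

/-- The realization of cellular chains. -/
noncomputable def realChain (X : Finset Box) : Chain k X →ₗ[k] (List LPt →₀ k) :=
  realBoxes k ∘ₗ chainBoxes k X

/-- The boundary on lists of labelled points, the derivation with `(q, true) ↦ (q, false)`. -/
noncomputable def listD : List LPt → (List LPt →₀ k)
  | [] => 0
  | (q, true) :: L => Finsupp.single ((q, false) :: L) 1
      - Finsupp.mapDomain (List.cons (q, true)) (listD L)
  | (q, false) :: L => Finsupp.mapDomain (List.cons (q, false)) (listD L)

/-- The linear extension of `listD`. -/
noncomputable def realD : (List LPt →₀ k) →ₗ[k] (List LPt →₀ k) :=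
  Finsupp.linearCombination k (listD k)

variable {k}

theorem ivR_pure (q : ℚ) : ivR k (NonemptyInterval.pure q) = Finsupp.single (q, false) 1 := by
  rw [ivR, if_neg (show ¬ (NonemptyInterval.pure q : Iv).fst < (NonemptyInterval.pure q : Iv).snd
    from lt_irrefl q)]; rfl

theorem ivR_iv {p q : ℚ} (h : p ≤ q) (h' : p < q) :
    ivR k (iv p q h) = Finsupp.single (q, true) 1 - Finsupp.single (p, true) 1 := by
  rw [ivR, if_pos (show (iv p q h).fst < (iv p q h).snd from h')]; rfl

theorem pcons_single (p : LPt) (x : List LPt →₀ k) :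
    pcons k (Finsupp.single p 1) x = Finsupp.mapDomain (List.cons p) x := by
  simp [pcons, bil]

theorem realD_pcons_false (q : ℚ) (x : List LPt →₀ k) :
    realD k (pcons k (Finsupp.single (q, false) 1) x)
      = pcons k (Finsupp.single (q, false) 1) (realD k x) := by
  induction x using Finsupp.induction_linear with
  | zero => simp
  | add x y hx hy => simp only [map_add, hx, hy]
  | single L r =>
    rw [pcons_single, pcons_single, Finsupp.mapDomain_single, realD,
      Finsupp.linearCombination_single, Finsupp.linearCombination_single, listD,
      Finsupp.mapDomain_smul]

theorem realD_pcons_true (q : ℚ) (x : List LPt →₀ k) :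
    realD k (pcons k (Finsupp.single (q, true) 1) x)
      = pcons k (Finsupp.single (q, false) 1) x
        - pcons k (Finsupp.single (q, true) 1) (realD k x) := by
  induction x using Finsupp.induction_linear with
  | zero => simp
  | add x y hx hy => simp only [map_add, hx, hy]; abel
  | single L r =>
    rw [pcons_single, pcons_single, pcons_single, Finsupp.mapDomain_single,
      Finsupp.mapDomain_single, realD,
      Finsupp.linearCombination_single, Finsupp.linearCombination_single, listD,
      Finsupp.mapDomain_smul, smul_sub, Finsupp.smul_single, smul_eq_mul, mul_one]

/-- The boundary of a product with an interval. -/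
theorem realD_pcons_ivR (I : Iv) (x : List LPt →₀ k) :
    realD k (pcons k (ivR k I) x) =
      if I.fst < I.snd then
        pcons k (ivR k (NonemptyInterval.pure I.snd) - ivR k (NonemptyInterval.pure I.fst)) x
          - pcons k (ivR k I) (realD k x)
      else pcons k (ivR k I) (realD k x) := by
  split_ifs with h
  · rw [ivR_pure, ivR_pure, ivR, if_pos h]
    simp only [map_sub, LinearMap.sub_apply, realD_pcons_true]
    abel
  · rw [ivR, if_neg h, realD_pcons_false]

/-! ### The realization is injective -/

/-- The coefficients of the lists that begin with `p`. -/
noncomputable def headCoeff (p : LPt) : (List LPt →₀ k) →ₗ[k] (List LPt →₀ k) :=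
  Finsupp.lcomapDomain (List.cons p) (List.cons_injective)

theorem headCoeff_pcons (p : LPt) (v : LPt →₀ k) (x : List LPt →₀ k) :
    headCoeff p (pcons k v x) = v p • x := by
  induction v using Finsupp.induction_linear with
  | zero => simp
  | add x y hx hy => simp [hx, hy, add_smul]
  | single q r =>
    ext L
    rw [← mul_one r, ← smul_eq_mul, ← Finsupp.smul_single, map_smul, LinearMap.smul_apply, map_smul,
      pcons_single]
    simp only [headCoeff, Finsupp.lcomapDomain, LinearMap.coe_mk, AddHom.coe_mk, Finsupp.smul_apply,
      Finsupp.comapDomain_apply, smul_eq_mul]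
    by_cases h : q = p
    · subst h
      rw [Finsupp.mapDomain_apply List.cons_injective]; simp
    · rw [Finsupp.mapDomain_of_notMem_range _ _ (by rintro ⟨L', hL'⟩; exact h (List.cons.inj hL').1),
        Finsupp.single_eq_of_ne' h]
      simp

theorem sum_intervalCells {M : Type*} [AddCommMonoid M] (f : Iv → M) :
    ∑ I ∈ intervalCells, f I
      = f (NonemptyInterval.pure 0) + (f (NonemptyInterval.pure 1) + f unitIv) := by
  rw [intervalCells, Finset.sum_insert (by decide), Finset.sum_insert (by decide),
    Finset.sum_singleton]

theorem sum_halvedCells {M : Type*} [AddCommMonoid M] (f : Iv → M) :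
    ∑ I ∈ halvedCells, f I
      = f (NonemptyInterval.pure 0) + (f (NonemptyInterval.pure (1 / 2)) +
        (f (NonemptyInterval.pure 1) + (f (iv 0 (1 / 2) (by norm_num))
          + f (iv (1 / 2) 1 (by norm_num))))) := by
  rw [halvedCells, Finset.sum_insert, Finset.sum_insert, Finset.sum_insert, Finset.sum_insert,
    Finset.sum_singleton]
  all_goals
    simp only [Finset.mem_insert, Finset.mem_singleton, NonemptyInterval.ext_iff, Prod.ext_iff,
      NonemptyInterval.pure, iv]
    norm_num

theorem ivR_independent {A : Box → Finset Iv} (hA : IsSubdivision A) (w : Box) (c : Iv →₀ k)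
    (hc : ∀ I ∈ c.support, I ∈ A w) (h : Finsupp.linearCombination k (ivR k) c = 0) : c = 0 := by
  have hsum : ∑ I ∈ A w, c I • ivR k I = 0 := by
    rw [← h, Finsupp.linearCombination_apply, Finsupp.sum_of_support_subset c hc]
    simp
  have key : ∀ I ∈ A w, c I = 0 := by
    have hp := fun p : LPt => DFunLike.congr_fun hsum p
    obtain h | h := hA.cases w <;> rw [h] at hp ⊢
    · simp only [sum_intervalCells, ivR_pure, unitIv, ivR_iv (k := k) (p := 0) (q := 1) _
        (by norm_num)] at hp
      have h1 := hp (0, false)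
      have h2 := hp (1, false)
      have h3 := hp (1, true)
      simp at h1 h2 h3
      intro I hI
      rw [mem_intervalCells] at hI
      obtain rfl | rfl | rfl := hI <;> assumption
    · simp only [sum_halvedCells, ivR_pure, ivR_iv (k := k) (p := 0) (q := 1 / 2) _
        (by norm_num), ivR_iv (k := k) (p := 1 / 2) (q := 1) _ (by norm_num)] at hp
      have h1 := hp (0, false)
      have h2 := hp (1 / 2, false)
      have h3 := hp (1, false)
      have h4 := hp (0, true)
      have h5 := hp (1, true)
      simp at h1 h2 h3 h4 h5
      intro I hI
      rw [mem_halvedCells] at hI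
      obtain rfl | rfl | rfl | rfl | rfl := hI <;> simpa
  ext I
  by_cases hI : I ∈ c.support
  · exact key I (hc I hI)
  · simpa using hI

/-- The combination of the intervals over the box `w`. -/
noncomputable def overBox (w : Box) : (Box →₀ k) →ₗ[k] (Iv →₀ k) :=
  Finsupp.lcomapDomain (fun I => I :: w) (fun _ _ h => (List.cons.inj h).1)

open Classical in
/-- Restricting the first coordinate to the label `p` leaves a combination of boxes. -/
theorem exists_headCoeff_realBoxes (p : LPt) (c : Box →₀ k) (hc : c [] = 0) :
    ∃ c' : Box →₀ k, headCoeff p (realBoxes k c) = realBoxes k c' ∧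
      (∀ w ∈ c'.support, ∃ I : Iv, I :: w ∈ c.support) ∧
      ∀ w, c' w = (Finsupp.linearCombination k (ivR k) (overBox w c)) p := by
  let T : (Box →₀ k) →ₗ[k] (Box →₀ k) := Finsupp.linearCombination k fun w =>
    match w with
    | [] => 0
    | I :: w => Finsupp.single w (ivR k I p)
  have hT : ∀ w, T c w = (Finsupp.linearCombination k (ivR k) (overBox w c)) p := by
    intro w
    clear hc
    induction c using Finsupp.induction_linear with
    | zero => simp
    | add x y hx hy => simp only [map_add, Finsupp.add_apply, hx, hy]
    | single v r =>
      cases v with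
      | nil =>
        have : overBox w (Finsupp.single [] r) = 0 := by
          ext I
          simp [overBox, Finsupp.lcomapDomain]
        rw [this]; simp [T]
      | cons I v =>
        by_cases h : v = w
        · subst h
          have : overBox v (Finsupp.single (I :: v) r) = Finsupp.single I r := by
            ext J
            simp [overBox, Finsupp.lcomapDomain, Finsupp.single_apply]
          rw [this]; simp [T]
        · have : overBox w (Finsupp.single (I :: v) r) = 0 := by
            ext J
            simp [overBox, Finsupp.lcomapDomain, h]
          rw [this]; simp [T, h]
  refine ⟨T c, ?_, ?_, hT⟩
  · have : ∀ c : Box →₀ k, headCoeff p (realBoxes k c)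
        = realBoxes k (T c) + c [] • headCoeff p (Finsupp.single [] 1) := by
      intro c
      induction c using Finsupp.induction_linear with
      | zero => simp
      | add x y hx hy => simp only [map_add, hx, hy, Finsupp.add_apply, add_smul]; abel
      | single v r =>
        cases v with
        | nil =>
          simp only [T, realBoxes, boxR, Finsupp.linearCombination_single, smul_zero, map_zero,
            zero_add, Finsupp.single_eq_same, map_smul]
        | cons I v =>
          rw [Finsupp.single_eq_of_ne (by simp), zero_smul, add_zero]
          simp only [T, realBoxes, boxR, Finsupp.linearCombination_single, map_smul,
            headCoeff_pcons]
    rw [this c, hc, zero_smul, add_zero]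
  · intro w hw
    by_contra hcon
    push Not at hcon
    have : overBox w c = 0 := by
      ext I
      simpa [overBox, Finsupp.lcomapDomain] using hcon I
    rw [Finsupp.mem_support_iff, hT, this] at hw
    simp at hw

theorem realBoxes_eq_zero {A : Box → Finset Iv} (hA : IsSubdivision A) (n : ℕ) (c : Box →₀ k)
    (hc : ∀ w ∈ c.support, w.length = n ∧ IsCell A w) (h : realBoxes k c = 0) : c = 0 := by
  induction n generalizing c with
  | zero =>
    have hc' : c = Finsupp.single [] (c []) := by
      ext w
      by_cases hw : w = []
      · simp [hw]
      · rw [Finsupp.single_eq_of_ne hw]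
        by_contra h0
        exact hw (List.length_eq_zero_iff.1 (hc w (Finsupp.mem_support_iff.2 h0)).1)
    rw [hc'] at h ⊢
    simpa [realBoxes, boxR] using h
  | succ n ih =>
    have hnil : c [] = 0 := by
      by_contra h0
      simpa using (hc [] (Finsupp.mem_support_iff.2 h0)).1
    have key : ∀ w, overBox w c = 0 := by
      intro w
      by_cases hw : ∃ I, I :: w ∈ c.support
      · refine ivR_independent hA w _ (fun I hI => ?_) ?_
        · exact (hc (I :: w) (by simpa [overBox, Finsupp.lcomapDomain] using hI)).2.2
        · ext p
          obtain ⟨c', h1, h2, h3⟩ := exists_headCoeff_realBoxes p c hnil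
          rw [h, map_zero] at h1
          have := ih c' (fun w hw => by
            obtain ⟨I, hI⟩ := h2 w hw
            have := hc _ hI
            exact ⟨by simpa using this.1, this.2.1⟩) h1.symm
          rw [← h3, this]
          rfl
      · push Not at hw
        ext I
        simpa [overBox, Finsupp.lcomapDomain] using hw I
    ext w
    cases w with
    | nil => exact hnil
    | cons I w => simpa [overBox, Finsupp.lcomapDomain] using DFunLike.congr_fun (key w) I

/-- Cellular chains are determined by their realization. -/
theorem realChain_injective {A : Box → Finset Iv} (hA : IsSubdivision A) (n : ℕ) (X : Finset Box)
    (hX : ∀ w ∈ X, w.length = n ∧ IsCell A w) : Function.Injective (realChain k X) := by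
  rw [← LinearMap.ker_eq_bot, LinearMap.ker_eq_bot']
  intro c hc
  have : chainBoxes k X c = 0 := by
    refine realBoxes_eq_zero hA n _ (fun w hw => ?_) hc
    have := Finsupp.mapDomain_support hw
    rw [Finset.mem_image] at this
    obtain ⟨v, -, rfl⟩ := this
    exact hX _ v.2
  exact Finsupp.mapDomain_injective Subtype.val_injective (by simpa [chainBoxes] using this)

/-! ### The realization is a chain map -/

theorem boxDim_le_of_le {v w : Box} (h : List.Forall₂ (fun J I : Iv => J ≤ I) v w) :
    boxDim v ≤ boxDim w := by
  induction h with
  | nil => exact le_rfl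
  | cons h1 h2 ih =>
    rw [boxDim_cons, boxDim_cons]
    rw [NonemptyInterval.le_def] at h1
    split_ifs with h3 h4
    · omega
    · exact (h4 (lt_of_le_of_lt h1.1 (lt_of_lt_of_le h3 h1.2))).elim
    · omega
    · omega

theorem eq_of_le_point {I J : Iv} (h : J ≤ I) (hI : ¬ I.fst < I.snd) : J = I := by
  rw [NonemptyInterval.le_def] at h
  have h1 := J.fst_le_snd
  have h2 := not_lt.1 hI
  exact iv_ext (by linarith) (by linarith)

/-- Nested proper intervals over the same cell are equal. -/
theorem IsSubdivision.eq_of_le {A : Box → Finset Iv} (hA : IsSubdivision A) {w : Box} {I J : Iv}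
    (hI : I ∈ A w) (hJ : J ∈ A w) (h : J ≤ I) (hp : I.fst < I.snd → J.fst < J.snd) : J = I := by
  by_cases hI' : I.fst < I.snd
  · have hJ' := hp hI'
    rw [NonemptyInterval.le_def] at h
    obtain ⟨h1, h2⟩ := h
    refine hA.relInt_unique (t := (J.fst + J.snd) / 2) hJ hI ?_ ?_
    · rw [relInt, if_pos hJ']
      have : (J.fst : ℝ) < J.snd := by exact_mod_cast hJ'
      constructor <;> linarith
    · rw [relInt, if_pos hI']
      have h3 : (J.fst : ℝ) < J.snd := by exact_mod_cast hJ'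
      have h4 : (I.fst : ℝ) ≤ J.fst := by exact_mod_cast h1
      have h5 : (J.snd : ℝ) ≤ I.snd := by exact_mod_cast h2
      constructor <;> linarith
  · exact eq_of_le_point h hI'

theorem IsSubdivision.eq_of_face {A : Box → Finset Iv} (hA : IsSubdivision A) {v w : Box}
    (hv : IsCell A v) (hw : IsCell A w) (h : List.Forall₂ (fun J I : Iv => J ≤ I) v w)
    (hd : boxDim v = boxDim w) : v = w := by
  induction h with
  | nil => rfl
  | @cons J I v w h1 h2 ih =>
    have h3 := boxDim_le_of_le h2
    rw [boxDim_cons, boxDim_cons] at hd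
    rw [NonemptyInterval.le_def] at h1
    have h4 : J.fst < J.snd → I.fst < I.snd := fun h =>
      lt_of_le_of_lt h1.1 (lt_of_lt_of_le h h1.2)
    have h5 : I.fst < I.snd → J.fst < J.snd := by
      intro h; by_contra h'; rw [if_pos h, if_neg h'] at hd; omega
    obtain rfl := ih hv.1 hw.1 (by
      by_cases h : I.fst < I.snd
      · rw [if_pos h, if_pos (h5 h)] at hd; omega
      · rw [if_neg h, if_neg (mt h4 h)] at hd; omega)
    rw [hA.eq_of_le hw.2 hv.2 (NonemptyInterval.le_def.2 h1) h5]

open Classical in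
theorem incidence_cons_point {I J : Iv} {v w : Box} (hI : ¬ I.fst < I.snd) :
    incidence (I :: v) (J :: w) = if J = I then incidence v w else 0 := by
  simp only [incidence, faceSign, if_neg hI, List.forall₂_cons]
  by_cases h : J = I
  · subst h
    simp [boxDim_cons, hI]
  · rw [if_neg h, if_neg]
    rintro ⟨⟨h1, -⟩, -⟩
    exact h (eq_of_le_point h1 hI)

open Classical in
theorem incidence_cons_proper {I J : Iv} {v w : Box} (hI : I.fst < I.snd)
    (hvw : List.Forall₂ (fun J I : Iv => J ≤ I) w v → boxDim w = boxDim v → w = v) :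
    incidence (I :: v) (J :: w) =
      (if J.fst < J.snd ∧ J ≤ I then - incidence v w else 0)
      + (if w = v then (if J = NonemptyInterval.pure I.snd then 1 else 0)
          - (if J = NonemptyInterval.pure I.fst then 1 else 0) else 0) := by
  have hJ := J.fst_le_snd
  by_cases hJp : J.fst < J.snd
  · have h1 : J ≠ NonemptyInterval.pure I.snd := by rintro rfl; exact lt_irrefl _ hJp
    have h2 : J ≠ NonemptyInterval.pure I.fst := by rintro rfl; exact lt_irrefl _ hJp
    rw [if_neg h1, if_neg h2, sub_zero, ite_self, add_zero]
    simp only [hJp, true_and]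
    simp only [incidence, faceSign, if_pos hI, if_pos hJp, List.forall₂_cons, boxDim_cons,
      add_left_inj]
    by_cases h3 : J ≤ I
    · simp only [h3, true_and, if_true]
      split_ifs <;> simp
    · simp [h3]
  · have hJe : J = NonemptyInterval.pure J.fst :=
      iv_ext rfl (le_antisymm (not_lt.1 hJp) hJ)
    rw [if_neg (fun h => hJp h.1), zero_add]
    simp only [incidence, faceSign, if_pos hI, if_neg hJp, List.forall₂_cons, boxDim_cons,
      add_zero, add_left_inj]
    by_cases hw : w = v
    · subst hw
      rw [if_pos rfl]
      have hr : List.Forall₂ (fun J I : Iv => J ≤ I) w w := List.forall₂_same.2 fun _ _ => le_rfl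
      by_cases h1 : J.fst = I.snd
      · have h2 : J = NonemptyInterval.pure I.snd := by rw [← h1]; exact hJe
        have h3 : J ≠ NonemptyInterval.pure I.fst := by
          rw [h2]; intro h
          exact hI.ne' (congrArg (fun I : Iv => I.fst) h)
        have h4 : J ≤ I := by
          rw [h2, NonemptyInterval.le_def]; exact ⟨hI.le, le_rfl⟩
        simp [h1, h4, ← h2, h3]
      · have h2 : J ≠ NonemptyInterval.pure I.snd := by rintro rfl; exact h1 rfl
        by_cases h3 : J.fst = I.fst
        · have h4 : J = NonemptyInterval.pure I.fst := by rw [← h3]; exact hJe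
          have h5 : J ≤ I := by
            rw [h4, NonemptyInterval.le_def]; exact ⟨le_rfl, hI.le⟩
          simp [h2, h3, ← h4, h5, hI.ne]
        · have h4 : J ≠ NonemptyInterval.pure I.fst := by rintro rfl; exact h3 rfl
          simp [h1, h2, h3, h4]
    · rw [if_neg hw, if_neg]
      rintro ⟨⟨-, h1⟩, h2⟩
      exact hw (hvw h1 h2)

/-- The cells of dimension `n` of a subdivision, as a finite set. -/
noncomputable def cells (A : Box → Finset Iv) : ℕ → Finset Box
  | 0 => {[]}
  | n + 1 => (cells A n).biUnion fun w => (A w).image fun I => I :: w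

theorem mem_cells (A : Box → Finset Iv) (n : ℕ) (w : Box) :
    w ∈ cells A n ↔ w.length = n ∧ IsCell A w := by
  induction n generalizing w with
  | zero => cases w <;> simp [cells, IsCell]
  | succ n ih =>
    cases w with
    | nil => simp [cells]
    | cons I w =>
      simp only [cells, Finset.mem_biUnion, Finset.mem_image, List.cons.injEq, ih, IsCell,
        List.length_cons, Nat.add_right_cancel_iff]
      constructor
      · rintro ⟨v, ⟨h1, h2⟩, J, hJ, rfl, rfl⟩
        exact ⟨h1, h2, hJ⟩
      · rintro ⟨h1, h2, h3⟩
        exact ⟨w, ⟨h1, h2⟩, I, h3, rfl, rfl⟩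

theorem sum_cells_succ {M : Type*} [AddCommMonoid M] (A : Box → Finset Iv) (n : ℕ)
    (f : Box → M) :
    ∑ w ∈ cells A (n + 1), f w = ∑ w ∈ cells A n, ∑ I ∈ A w, f (I :: w) := by
  rw [cells, Finset.sum_biUnion]
  · refine Finset.sum_congr rfl fun w _ => ?_
    rw [Finset.sum_image]
    intro I _ J _ h
    exact (List.cons.inj h).1
  · intro v _ w _ hvw
    rw [Function.onFun, Finset.disjoint_left]
    intro x hx hx'
    rw [Finset.mem_image] at hx hx'
    obtain ⟨I, -, rfl⟩ := hx
    obtain ⟨J, -, h⟩ := hx'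
    exact hvw (List.cons.inj h).2.symm

theorem incidence_ne_zero {v w : Box} (h : incidence v w ≠ 0) :
    List.Forall₂ (fun J I : Iv => J ≤ I) w v := by
  rw [incidence] at h
  split_ifs at h with h'
  · exact h'.1
  · exact (h rfl).elim

/-- A point cell persists over faces. -/
theorem IsSubdivision.point_mem {A : Box → Finset Iv} (hA : IsSubdivision A) {v w : Box}
    (h : List.Forall₂ (fun J I : Iv => J ≤ I) w v) {I : Iv} (hI : I ∈ A v)
    (hp : ¬ I.fst < I.snd) : I ∈ A w := by
  obtain ⟨J, h1, h2, -⟩ := hA.exists_over h hI (t := I.fst)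
    ⟨le_rfl, by exact_mod_cast I.fst_le_snd⟩
  rwa [eq_of_le_point h2 hp] at h1

open Classical in
/-- Over a face, a proper interval is the sum of the proper intervals it consists of. -/
theorem IsSubdivision.sum_proper {A : Box → Finset Iv} (hA : IsSubdivision A) {v w : Box}
    (h : List.Forall₂ (fun J I : Iv => J ≤ I) w v) {I : Iv} (hI : I ∈ A v)
    (hp : I.fst < I.snd) :
    ∑ J ∈ A w, (if J.fst < J.snd ∧ J ≤ I then ivR k J else 0) = ivR k I := by
  by_cases heq : A w = A v
  · rw [heq, Finset.sum_eq_single_of_mem I hI, if_pos ⟨hp, le_rfl⟩]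
    intro J hJ hJI
    rw [if_neg]
    rintro ⟨h1, h2⟩
    exact hJI (hA.eq_of_le hI hJ h2 fun _ => h1)
  · have hv : A v = intervalCells := by
      obtain h' | h' := hA.cases v
      · exact h'
      · exact (heq (by rw [h', hA.mono _ _ h h'])).elim
    have hw : A w = halvedCells := by
      obtain h' | h' := hA.cases w
      · exact (heq (by rw [h', hv])).elim
      · exact h'
    rw [hv, mem_intervalCells] at hI
    obtain rfl | rfl | rfl := hI
    · exact (lt_irrefl _ hp).elim
    · exact (lt_irrefl _ hp).elim
    · rw [hw, sum_halvedCells, if_neg (fun h => lt_irrefl _ h.1), if_neg (fun h => lt_irrefl _ h.1),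
        if_neg (fun h => lt_irrefl _ h.1), if_pos, if_pos, ivR_iv _ (by norm_num),
        ivR_iv _ (by norm_num), unitIv, ivR_iv _ (by norm_num)]
      · simp
      · rw [NonemptyInterval.le_def]; simp [iv, unitIv]; norm_num
      · rw [NonemptyInterval.le_def]; simp [iv, unitIv]; norm_num

/-- The cellular boundary is realized by the formal boundary: subdivided faces add up. -/
theorem sum_incidence {A : Box → Finset Iv} (hA : IsSubdivision A) (n : ℕ) (v : Box)
    (hv : v ∈ cells A n) :
    ∑ w ∈ cells A n, ((incidence v w : ℤ) : k) • boxR k w = realD k (boxR k v) := by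
  classical
  induction n generalizing v with
  | zero =>
    rw [mem_cells] at hv
    obtain rfl := List.length_eq_zero_iff.1 hv.1
    simp [cells, incidence, boxDim, boxR, realD, listD]
  | succ n ih =>
    cases v with
    | nil => simp [mem_cells] at hv
    | cons I v =>
      rw [mem_cells] at hv
      have hvn : v ∈ cells A n := (mem_cells _ _ _).2 ⟨by simpa using hv.1, hv.2.1⟩
      rw [sum_cells_succ, boxR, realD_pcons_ivR, ← ih v hvn]
      split_ifs with hI
      · have : ∀ w ∈ cells A n, ∑ J ∈ A w, ((incidence (I :: v) (J :: w) : ℤ) : k) • boxR k (J :: w)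
            = - (((incidence v w : ℤ) : k) • pcons k (ivR k I) (boxR k w))
              + if w = v then pcons k (ivR k (NonemptyInterval.pure I.snd)
                - ivR k (NonemptyInterval.pure I.fst)) (boxR k v) else 0 := by
          intro w hw
          have hw' := (mem_cells _ _ _).1 hw
          have h1 : ∀ J ∈ A w, ((incidence (I :: v) (J :: w) : ℤ) : k) • boxR k (J :: w)
              = (- ((incidence v w : ℤ) : k)) • pcons k
                  (if J.fst < J.snd ∧ J ≤ I then ivR k J else 0) (boxR k w)
                + if w = v then ((if J = NonemptyInterval.pure I.snd then boxR k (J :: w) else 0)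
                    - (if J = NonemptyInterval.pure I.fst then boxR k (J :: w) else 0)) else 0 := by
            intro J _
            rw [incidence_cons_proper hI (hA.eq_of_face hw'.2 hv.2.1)]
            rw [Int.cast_add, add_smul]
            congr 1
            · split_ifs <;> simp [boxR]
            · split_ifs <;> simp
          rw [Finset.sum_congr rfl h1, Finset.sum_add_distrib, ← Finset.smul_sum]
          congr 1
          · by_cases h0 : incidence v w = 0
            · simp [h0]
            · rw [neg_smul, ← hA.sum_proper (incidence_ne_zero h0) hv.2.2 hI, map_sum,
                LinearMap.sum_apply]
          · split_ifs with hwv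
            · subst hwv
              rw [Finset.sum_sub_distrib, Finset.sum_ite_eq' (A w), Finset.sum_ite_eq' (A w),
                if_pos (hA.pure_mem hv.2.2).1, if_pos (hA.pure_mem hv.2.2).2, boxR, boxR, map_sub,
                LinearMap.sub_apply]
            · simp
        rw [Finset.sum_congr rfl this, Finset.sum_add_distrib, Finset.sum_ite_eq' _ v, if_pos hvn,
          map_sum, add_comm, Finset.sum_neg_distrib]
        simp only [map_smul]
        exact (sub_eq_add_neg _ _).symm
      · rw [map_sum]
        refine Finset.sum_congr rfl fun w _ => ?_
        by_cases h0 : incidence v w = 0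
        · rw [h0, Int.cast_zero, zero_smul, map_zero]
          refine Finset.sum_eq_zero fun J _ => ?_
          rw [incidence_cons_point hI, h0, ite_self, Int.cast_zero, zero_smul]
        · rw [Finset.sum_eq_single_of_mem I (hA.point_mem (incidence_ne_zero h0) hv.2.2 hI),
            incidence_cons_point hI, if_pos rfl, map_smul, boxR]
          intro J _ hJ
          rw [incidence_cons_point hI, if_neg hJ, Int.cast_zero, zero_smul]

theorem realChain_single (X : Finset Box) (w : {w // w ∈ X}) (r : k) :
    realChain k X (Finsupp.single w r) = r • boxR k w.1 := by
  simp [realChain, chainBoxes, realBoxes]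

theorem realChain_boundary {A : Box → Finset Iv} (hA : IsSubdivision A) (n : ℕ) (X : Finset Box)
    (hX : ∀ w, w ∈ X ↔ w.length = n ∧ IsCell A w) (x : Chain k X) :
    realChain k X (boundary k X x) = realD k (realChain k X x) := by
  have hX' : X = cells A n := by ext w; rw [hX, mem_cells]
  induction x using Finsupp.induction_linear with
  | zero => simp
  | add x y hx hy => simp only [map_add, hx, hy]
  | single v r =>
    rw [boundary, Finsupp.linearCombination_single, map_smul, map_sum, realChain_single, map_smul]
    congr 1
    simp only [realChain_single]
    subst hX'
    rw [← sum_incidence hA n v.1 v.2, ← Finset.sum_coe_sort (cells A n)]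

end

/-! ### Bilinear extensions and supports -/

section

variable {k : Type u} [Field k]

@[elab_as_elim]
theorem supported_induction {α : Type*} {s : Set α} {p : (α →₀ k) → Prop} (x : α →₀ k)
    (hx : x ∈ Finsupp.supported k k s) (h0 : p 0)
    (hadd : ∀ x y, p x → p y → p (x + y)) (hs : ∀ a ∈ s, ∀ r, p (Finsupp.single a r)) : p x := by
  rw [← Finsupp.sum_single x]
  exact Finset.sum_induction _ p hadd h0 fun a ha => hs a (hx ha) _

theorem bil_single_left {A B C : Type*} (g : A → B → C) (a : A) (r : k) (y : B →₀ k) :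
    bil g (Finsupp.single a r) y = r • Finsupp.mapDomain (g a) y := by
  simp [bil]

theorem bil_single_right {A B C : Type*} (g : A → B → C) (x : A →₀ k) (b : B) (s : k) :
    bil g x (Finsupp.single b s) = s • Finsupp.mapDomain (fun a => g a b) x := by
  induction x using Finsupp.induction_linear with
  | zero => simp
  | add x y hx hy => simp only [map_add, LinearMap.add_apply, hx, hy, Finsupp.mapDomain_add, smul_add]
  | single a r => rw [bil_single, Finsupp.mapDomain_single, Finsupp.smul_single, smul_eq_mul, mul_comm]

theorem bil_mapDomain {A A' B B' C : Type*} (g : A → B → C) (f : A' → A) (h : B' → B)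
    (x : A' →₀ k) (y : B' →₀ k) :
    bil g (Finsupp.mapDomain f x) (Finsupp.mapDomain h y) = bil (fun a b => g (f a) (h b)) x y := by
  induction x using Finsupp.induction_linear with
  | zero => simp
  | add x y hx hy => simp only [Finsupp.mapDomain_add, map_add, LinearMap.add_apply, hx, hy]
  | single a r =>
    rw [Finsupp.mapDomain_single, bil_single_left, bil_single_left, ← Finsupp.mapDomain_comp]
    rfl

theorem mapDomain_bil {A B C C' : Type*} (g : A → B → C) (f : C → C') (x : A →₀ k) (y : B →₀ k) :
    Finsupp.mapDomain f (bil g x y) = bil (fun a b => f (g a b)) x y := by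
  induction x using Finsupp.induction_linear with
  | zero => simp
  | add x y hx hy => simp only [Finsupp.mapDomain_add, map_add, LinearMap.add_apply, hx, hy]
  | single a r =>
    rw [bil_single_left, bil_single_left, Finsupp.mapDomain_smul, ← Finsupp.mapDomain_comp]
    rfl

theorem bil_mem_supported {A B C : Type*} {g : A → B → C} {sA : Set A} {sB : Set B} {sC : Set C}
    (h : ∀ a ∈ sA, ∀ b ∈ sB, g a b ∈ sC) {x : A →₀ k} {y : B →₀ k}
    (hx : x ∈ Finsupp.supported k k sA) (hy : y ∈ Finsupp.supported k k sB) :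
    bil g x y ∈ Finsupp.supported k k sC := by
  refine supported_induction x hx ?_ (fun x x' h h' => ?_) (fun a ha r => ?_)
  · simp
  · rw [map_add]; exact add_mem h h'
  · refine supported_induction y hy ?_ (fun x x' h h' => ?_) (fun b hb s => ?_)
    · simp
    · rw [map_add]; exact add_mem h h'
    · rw [bil_single]
      exact Finsupp.single_mem_supported k _ (h a ha b hb)

/-- A sequential identity between maps of bases extends to combinations. -/
theorem bil_seq {A B C D D' E : Type*} {g1 : A → B → D} {g2 : D → C → E} {h1 : B → C → D'}
    {h2 : A → D' → E} {sA : Set A} {sB : Set B} {sC : Set C}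
    (h : ∀ a ∈ sA, ∀ b ∈ sB, ∀ c ∈ sC, g2 (g1 a b) c = h2 a (h1 b c)) {x : A →₀ k} {y : B →₀ k}
    {z : C →₀ k} (hx : x ∈ Finsupp.supported k k sA) (hy : y ∈ Finsupp.supported k k sB)
    (hz : z ∈ Finsupp.supported k k sC) :
    bil g2 (bil g1 x y) z = bil h2 x (bil h1 y z) := by
  refine supported_induction x hx ?_ (fun x x' h h' => ?_) (fun a ha r => ?_)
  · simp
  · simp only [map_add, LinearMap.add_apply, h, h']
  refine supported_induction y hy ?_ (fun x x' h h' => ?_) (fun b hb s => ?_)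
  · simp
  · simp only [map_add, LinearMap.add_apply, h, h']
  refine supported_induction z hz ?_ (fun x x' h h' => ?_) (fun c hc t => ?_)
  · simp
  · simp only [map_add, h, h']
  · rw [bil_single, bil_single, bil_single, bil_single, h a ha b hb c hc, mul_assoc]

/-- A parallel identity between maps of bases extends to combinations. -/
theorem bil_par {A B C D D' E : Type*} {g1 : A → B → D} {g2 : D → C → E} {h1 : A → C → D'}
    {h2 : D' → B → E} {sA : Set A} {sB : Set B} {sC : Set C}
    (h : ∀ a ∈ sA, ∀ b ∈ sB, ∀ c ∈ sC, g2 (g1 a b) c = h2 (h1 a c) b) {x : A →₀ k} {y : B →₀ k}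
    {z : C →₀ k} (hx : x ∈ Finsupp.supported k k sA) (hy : y ∈ Finsupp.supported k k sB)
    (hz : z ∈ Finsupp.supported k k sC) :
    bil g2 (bil g1 x y) z = bil h2 (bil h1 x z) y := by
  refine supported_induction x hx ?_ (fun x x' h h' => ?_) (fun a ha r => ?_)
  · simp
  · simp only [map_add, LinearMap.add_apply, h, h']
  refine supported_induction y hy ?_ (fun x x' h h' => ?_) (fun b hb s => ?_)
  · simp
  · simp only [map_add, LinearMap.add_apply, h, h']
  refine supported_induction z hz ?_ (fun x x' h h' => ?_) (fun c hc t => ?_)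
  · simp
  · simp only [map_add, LinearMap.add_apply, h, h']
  · rw [bil_single, bil_single, bil_single, bil_single, h a ha b hb c hc, mul_right_comm]

theorem mapDomain_sub {A B : Type*} (f : A → B) (x y : A →₀ k) :
    Finsupp.mapDomain f (x - y) = Finsupp.mapDomain f x - Finsupp.mapDomain f y :=
  map_sub (Finsupp.lmapDomain k k f) x y

/-! ### Affine maps on labelled points -/

/-- The action of a list of slots on labelled points. -/
def evalL : List Slot → List LPt → List LPt := Slot.eval lcst lact

/-- The number of coordinates labelled `true`: the degree of a list of labelled points. -/
def countT (L : List LPt) : ℕ := L.countP fun p => p.2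

@[simp] theorem countT_nil : countT [] = 0 := rfl

theorem countT_cons (p : LPt) (L : List LPt) :
    countT (p :: L) = countT L + if p.2 then 1 else 0 := by
  simp [countT, List.countP_cons]

theorem countT_append (L L' : List LPt) : countT (L ++ L') = countT L + countT L' := by
  simp [countT]

theorem countT_evalL {S : List Slot} {L : List LPt} (h : L.length = Slot.inputs S) :
    countT (evalL S L) = countT L := by
  induction S generalizing L with
  | nil =>
    obtain rfl := List.length_eq_zero_iff.1 h
    rfl
  | cons a S ih =>
    cases a with
    | const q =>
      change countT (lcst q :: evalL S L) = _
      rw [countT_cons, ih h]; simp [lcst]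
    | aff s t =>
      cases L with
      | nil => simp [Slot.inputs] at h
      | cons p L =>
        change countT (lact s t p :: evalL S L) = _
        rw [countT_cons, countT_cons, ih (by simpa [Slot.inputs] using h)]; rfl

/-- Affine maps commute with the boundary. -/
theorem listD_evalL {S : List Slot} {L : List LPt} (h : L.length = Slot.inputs S) :
    listD k (evalL S L) = Finsupp.mapDomain (evalL S) (listD k L) := by
  induction S generalizing L with
  | nil =>
    obtain rfl := List.length_eq_zero_iff.1 h
    simp [evalL, Slot.eval, listD]
  | cons a S ih =>
    cases a with
    | const q =>
      change listD k ((q, false) :: evalL S L) = _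
      rw [listD, ih h, ← Finsupp.mapDomain_comp]
      rfl
    | aff s t =>
      cases L with
      | nil => simp [Slot.inputs] at h
      | cons p L =>
        obtain ⟨q, b⟩ := p
        have hL : L.length = Slot.inputs S := by simpa [Slot.inputs] using h
        change listD k ((s * q + t, b) :: evalL S L) = _
        cases b with
        | false =>
          rw [listD, listD, ih hL, ← Finsupp.mapDomain_comp, ← Finsupp.mapDomain_comp]
          rfl
        | true =>
          rw [listD, listD, ih hL, ← Finsupp.mapDomain_comp,
            mapDomain_sub, Finsupp.mapDomain_single,
            ← Finsupp.mapDomain_comp]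
          rfl

/-- The boundary is a derivation. -/
theorem listD_append (L L' : List LPt) :
    listD k (L ++ L') = Finsupp.mapDomain (fun K => K ++ L') (listD k L)
      + (-1 : k) ^ countT L • Finsupp.mapDomain (fun K => L ++ K) (listD k L') := by
  induction L with
  | nil => simp [listD]; exact (Finsupp.mapDomain_id (v := listD k L')).symm
  | cons p L ih =>
    obtain ⟨q, b⟩ := p
    rw [List.cons_append, countT_cons]
    cases b with
    | false =>
      rw [listD, listD, ih, Finsupp.mapDomain_add, Finsupp.mapDomain_smul, ← Finsupp.mapDomain_comp,
        ← Finsupp.mapDomain_comp, ← Finsupp.mapDomain_comp]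
      rfl
    | true =>
      rw [listD, listD, ih, Finsupp.mapDomain_add, Finsupp.mapDomain_smul,
        mapDomain_sub, Finsupp.mapDomain_single,
        ← Finsupp.mapDomain_comp, ← Finsupp.mapDomain_comp, ← Finsupp.mapDomain_comp,
        if_pos rfl, pow_succ, mul_neg_one, neg_smul, sub_add_eq_sub_sub, sub_eq_add_neg]
      rfl

/-- Every affine slot has a slope other than zero. -/
def SlopesNeZero (S : List Slot) : Prop := ∀ s t, Slot.aff s t ∈ S → s ≠ 0

theorem mapDomain_ivR {s : ℚ} (hs : s ≠ 0) (t : ℚ) (I : Iv) :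
    Finsupp.mapDomain (lact s t) (ivR k I)
      = (if I.fst < I.snd ∧ s < 0 then -1 else 1 : k) • ivR k (affIv s t I) := by
  by_cases hI : I.fst < I.snd
  · rw [ivR, if_pos hI, mapDomain_sub, Finsupp.mapDomain_single, Finsupp.mapDomain_single]
    rcases lt_or_gt_of_ne hs with h | h
    · have h' : s * I.snd + t < s * I.fst + t := by nlinarith
      rw [if_pos ⟨hI, h⟩, ivR, affIv_fst, affIv_snd, min_eq_right h'.le, max_eq_left h'.le,
        if_pos h']
      simp [lact]
    · have h' : s * I.fst + t < s * I.snd + t := by nlinarith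
      rw [if_neg (fun h2 => lt_asymm h h2.2), ivR, affIv_fst, affIv_snd, min_eq_left h'.le,
        max_eq_right h'.le, if_pos h']
      simp [lact]
  · have h1 : I.fst = I.snd := le_antisymm I.fst_le_snd (not_lt.1 hI)
    rw [ivR, if_neg hI, if_neg (fun h => hI h.1), ivR, affIv_fst, affIv_snd, h1, min_self,
      max_self, if_neg (lt_irrefl _), Finsupp.mapDomain_single, one_smul]
    rfl

theorem mapDomain_pcons (s t : ℚ) (S : List Slot) (v : LPt →₀ k) (x : List LPt →₀ k) :
    Finsupp.mapDomain (evalL (.aff s t :: S)) (pcons k v x)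
      = pcons k (Finsupp.mapDomain (lact s t) v) (Finsupp.mapDomain (evalL S) x) := by
  rw [pcons, mapDomain_bil, bil_mapDomain]
  rfl

/-- The realization of boxes turns the degree of an affine map into a sign. -/
theorem mapDomain_boxR {S : List Slot} (hS : SlopesNeZero S) {w : Box}
    (h : w.length = Slot.inputs S) :
    Finsupp.mapDomain (evalL S) (boxR k w)
      = ((evalSign S w : ℤ) : k) • boxR k (evalBox S w) := by
  induction S generalizing w with
  | nil =>
    obtain rfl := List.length_eq_zero_iff.1 h
    simp [boxR, evalL, evalBox, Slot.eval, evalSign]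
  | cons a S ih =>
    have hS' : SlopesNeZero S := fun s t h => hS s t (List.mem_cons_of_mem _ h)
    cases a with
    | const q =>
      rw [show evalBox (Slot.const q :: S) w = NonemptyInterval.pure q :: evalBox S w from rfl,
        show evalSign (Slot.const q :: S) w = evalSign S w by cases w <;> rfl, boxR, ivR_pure,
        ← map_smul, ← ih hS' h, pcons_single, ← Finsupp.mapDomain_comp]
      rfl
    | aff s t =>
      cases w with
      | nil => simp [Slot.inputs] at h
      | cons I w =>
        have h1 : evalBox (Slot.aff s t :: S) (I :: w) = affIv s t I :: evalBox S w := rfl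
        have h2 : ((evalSign (Slot.aff s t :: S) (I :: w) : ℤ) : k)
            = (if I.fst < I.snd ∧ s < 0 then -1 else 1 : k) * ((evalSign S w : ℤ) : k) := by
          rw [evalSign, Int.cast_mul]
          congr 1
          split_ifs <;> simp
        rw [h1, h2, boxR, boxR, mapDomain_pcons, ih hS' (by simpa [Slot.inputs] using h),
          mapDomain_ivR (hS s t (by simp)), map_smul, map_smul, LinearMap.smul_apply, smul_smul,
          mul_comm]

theorem bil_append_boxR (v w : Box) :
    bil (fun L L' : List LPt => L ++ L') (boxR k v) (boxR k w) = boxR k (v ++ w) := by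
  induction v with
  | nil =>
    rw [boxR, bil_single_left, one_smul]
    exact Finsupp.mapDomain_id
  | cons I v ih =>
    rw [List.cons_append, boxR, boxR, ← ih, pcons]
    exact bil_seq (g1 := fun (p : LPt) (L : List LPt) => p :: L) (g2 := fun L L' => L ++ L')
      (h1 := fun L L' => L ++ L') (h2 := fun p L => p :: L) (sA := Set.univ) (sB := Set.univ) (sC := Set.univ) (fun _ _ _ _ _ _ => rfl)
      (Set.subset_univ _) (Set.subset_univ _) (Set.subset_univ _)

theorem bil_evalL_boxR {S : List Slot} (hS : SlopesNeZero S) {v w : Box}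
    (h : (v ++ w).length = Slot.inputs S) :
    bil (fun L L' : List LPt => evalL S (L ++ L')) (boxR k v) (boxR k w)
      = ((evalSign S (v ++ w) : ℤ) : k) • boxR k (evalBox S (v ++ w)) := by
  rw [← mapDomain_boxR hS h, ← bil_append_boxR, mapDomain_bil]

theorem slopesNeZero_append {S T : List Slot} (hS : SlopesNeZero S) (hT : SlopesNeZero T) :
    SlopesNeZero (S ++ T) := fun s t h => (List.mem_append.1 h).elim (hS s t) (hT s t)

theorem slopesNeZero_replicate_const (n : ℕ) (q : ℚ) :
    SlopesNeZero (List.replicate n (.const q)) := by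
  intro s t h
  simpa using List.eq_of_mem_replicate h

theorem slopesNeZero_replicate_aff (n : ℕ) {s : ℚ} (hs : s ≠ 0) (t : ℚ) :
    SlopesNeZero (List.replicate n (.aff s t)) := by
  intro s' t' h
  obtain ⟨rfl, -⟩ := Slot.aff.inj (List.eq_of_mem_replicate h)
  exact hs

theorem slopesNeZero_copies (n : ℕ) : SlopesNeZero (copies n) :=
  slopesNeZero_replicate_aff n one_ne_zero 0

theorem slopesNeZero_compSlots (c c' : Col) (i n n' : ℕ) :
    SlopesNeZero (compSlots c c' i n n') := by
  cases c with
  | a => intro s t h; simp [compSlots] at h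
  | m =>
    cases c' with
    | a =>
      exact slopesNeZero_append (slopesNeZero_append (slopesNeZero_copies _)
        (slopesNeZero_replicate_const _ _)) (slopesNeZero_copies _)
    | m =>
      rw [compSlots]
      split_ifs
      · exact slopesNeZero_copies _
      · exact slopesNeZero_copies _
      · exact slopesNeZero_append (slopesNeZero_append (slopesNeZero_copies _)
          (slopesNeZero_replicate_const 1 1)) (slopesNeZero_copies _)

theorem slopesNeZero_rightSlots (c c' : Col) (i n n' : ℕ) :
    SlopesNeZero (rightSlots c c' i n n') := by
  cases c with
  | a => intro s t h; simp [rightSlots] at h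
  | m =>
    cases c' with
    | a =>
      exact slopesNeZero_append (slopesNeZero_append (slopesNeZero_copies _)
        (slopesNeZero_replicate_const _ _)) (slopesNeZero_copies _)
    | m =>
      rw [rightSlots]
      split_ifs
      · exact slopesNeZero_copies _
      · exact slopesNeZero_append (slopesNeZero_append (fun _ _ h => by simp at h)
          (slopesNeZero_replicate_aff _ (by norm_num) _)) (slopesNeZero_replicate_const 1 1)
      · exact slopesNeZero_append (slopesNeZero_append (slopesNeZero_append (slopesNeZero_copies _)
          (slopesNeZero_replicate_aff 1 (by norm_num) _))
          (slopesNeZero_replicate_aff _ (by norm_num) _)) (slopesNeZero_replicate_const 1 1)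

theorem slopesNeZero_leftSlots (c : Col) (js : List ℕ) : SlopesNeZero (leftSlots c js) := by
  cases c with
  | a => intro s t h; simp [leftSlots] at h
  | m =>
    rw [leftSlots]
    induction js using leftSlotsAux.induct with
    | case1 => intro s t h; simp [leftSlotsAux] at h
    | case2 => exact slopesNeZero_copies _
    | case3 =>
      exact slopesNeZero_append (slopesNeZero_replicate_const _ _)
        (slopesNeZero_append (slopesNeZero_replicate_const 1 0) (slopesNeZero_copies _))
    | case4 j j' j'' js ih =>
      exact slopesNeZero_append (slopesNeZero_replicate_const _ _)
        (slopesNeZero_append (slopesNeZero_replicate_aff 1 (by norm_num) _) ih)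

end

/-! ### Realization of operadic monomials -/

/-- A list of labelled points, together with a list of arities (the arities of the entries of a
tuple; empty for operadic monomials). -/
abbrev EPt : Type := List ℕ × List LPt

/-- Operadic composition on points. -/
def compG (c c' : Col) (i n n' : ℕ) (X Y : EPt) : EPt :=
  ([], evalL (compSlots c c' i n n') (X.2 ++ Y.2))

section

variable (k : Type u) [Field k]

/-- Attach arities. -/
noncomputable def emb (js : List ℕ) : (List LPt →₀ k) →ₗ[k] (EPt →₀ k) :=
  Finsupp.lmapDomain k k fun L => (js, L)

/-- The boundary of labelled points with arities. -/
noncomputable def ptD : (EPt →₀ k) →ₗ[k] (EPt →₀ k) :=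
  Finsupp.linearCombination k fun X => emb k X.1 (listD k X.2)

/-- The realization of the generator `μ^c_{n+2}`: the top cell of `I^n`, or the point. -/
noncomputable def muR : Col → ℕ → (List LPt →₀ k)
  | .m, n => boxR k (List.replicate n unitIv)
  | .a, n => if n = 0 then Finsupp.single [] 1 else 0

/-- The realization of operadic monomials. -/
noncomputable def OTerm.real : ∀ {l : List Col} {c : Col}, OTerm l c → (EPt →₀ k)
  | _, _, .one _ => Finsupp.single ([], []) 1
  | _, _, .mu c n => emb k [] (muR k c n)
  | _, _, .comp (l0 := l0) (l1 := l1) (l' := l') (c := c) (c' := c') _ _ x y =>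
      bil (compG c c' l1.length l0.length l'.length) x.real y.real

/-- The realization of combinations of operadic monomials. -/
noncomputable def realO (l : List Col) (c : Col) : (OTerm l c →₀ k) →ₗ[k] (EPt →₀ k) :=
  Finsupp.linearCombination k (OTerm.real k)

variable {k}

theorem emb_injective (js : List ℕ) : Function.Injective (emb k js) :=
  Finsupp.mapDomain_injective fun _ _ h => (Prod.ext_iff.1 h).2

theorem ptD_emb (js : List ℕ) (x : List LPt →₀ k) : ptD k (emb k js x) = emb k js (realD k x) := by
  induction x using Finsupp.induction_linear with
  | zero => simp
  | add x y hx hy => simp only [map_add, hx, hy]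
  | single L r =>
    simp only [ptD, emb, realD, Finsupp.lmapDomain_apply, Finsupp.mapDomain_single,
      Finsupp.linearCombination_single, Finsupp.mapDomain_smul]

theorem bil_emb {g : EPt → EPt → EPt} (js js' ks : List ℕ) (h : List LPt → List LPt → List LPt)
    (hg : ∀ L L', g (js, L) (js', L') = (ks, h L L')) (x y : List LPt →₀ k) :
    bil g (emb k js x) (emb k js' y) = emb k ks (bil h x y) := by
  rw [emb, emb, emb, Finsupp.lmapDomain_apply, Finsupp.lmapDomain_apply, Finsupp.lmapDomain_apply,
    bil_mapDomain, mapDomain_bil]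
  simp only [hg]

/-- Leibniz rule for a product followed by a map that commutes with the boundary. -/
theorem ptD_bil {g : EPt → EPt → EPt} (j : List ℕ → List ℕ → List ℕ)
    (φ : List ℕ → List ℕ → List LPt → List LPt)
    (hg : ∀ X Y, g X Y = (j X.1 Y.1, φ X.1 Y.1 (X.2 ++ Y.2))) {sX sY : Set EPt}
    (hφ : ∀ X ∈ sX, ∀ Y ∈ sY, listD k (φ X.1 Y.1 (X.2 ++ Y.2))
      = Finsupp.mapDomain (φ X.1 Y.1) (listD k (X.2 ++ Y.2)))
    {d : ℕ} (hd : ∀ X ∈ sX, countT X.2 = d) {x y : EPt →₀ k}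
    (hx : x ∈ Finsupp.supported k k sX) (hy : y ∈ Finsupp.supported k k sY) :
    ptD k (bil g x y) = bil g (ptD k x) y + (-1 : k) ^ d • bil g x (ptD k y) := by
  obtain rfl : g = fun X Y => (j X.1 Y.1, φ X.1 Y.1 (X.2 ++ Y.2)) := by
    funext X Y; exact hg X Y
  refine supported_induction x hx ?_ (fun x x' h h' => ?_) (fun X hX r => ?_)
  · simp
  · simp only [map_add, LinearMap.add_apply, h, h', smul_add]; abel
  refine supported_induction y hy ?_ (fun x x' h h' => ?_) (fun Y hY s => ?_)
  · simp
  · simp only [map_add, h, h', smul_add]; abel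
  rw [bil_single, bil_single_left, bil_single_right]
  simp only [ptD, Finsupp.linearCombination_single, emb, Finsupp.lmapDomain_apply]
  rw [hφ X hX Y hY, listD_append, hd X hX]
  simp only [Finsupp.mapDomain_add, Finsupp.mapDomain_smul, ← Finsupp.mapDomain_comp, smul_add,
    smul_smul]
  congr 1
  · rw [mul_comm]; rfl
  · rw [show r * s * (-1) ^ d = (-1) ^ d * r * s by ring, mul_assoc]
    rfl

theorem OTerm.isProfile {l : List Col} {c : Col} (x : OTerm l c) : IsProfile l c := by
  induction x with
  | one c => exact ⟨0, rfl⟩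
  | mu c n => exact ⟨n + 1, rfl⟩
  | comp hx hl x y hx' hy' =>
    subst hx hl
    exact hx'.plug hy'

theorem realO_single {l : List Col} {c : Col} (x : OTerm l c) (r : k) :
    realO k l c (Finsupp.single x r) = r • x.real k := by
  simp [realO]

theorem realO_bil {l0 l1 l2 l' l : List Col} {c c' : Col} (hx : l0 = l1 ++ c' :: l2)
    (hl : l = l1 ++ (l' ++ l2)) (x : OTerm l0 c →₀ k) (y : OTerm l' c' →₀ k) :
    realO k l c (bil (OTerm.comp hx hl) x y)
      = bil (compG c c' l1.length l0.length l'.length) (realO k _ _ x) (realO k _ _ y) := by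
  induction x using Finsupp.induction_linear with
  | zero => simp
  | add x y hx hy => simp only [map_add, LinearMap.add_apply, hx, hy]
  | single a r =>
    induction y using Finsupp.induction_linear with
    | zero => simp
    | add x y hx hy => simp only [map_add, hx, hy]
    | single b s =>
      rw [bil_single, realO_single, realO_single, realO_single, OTerm.real, map_smul, map_smul,
        LinearMap.smul_apply, smul_smul, mul_comm]

theorem boxR_supported (w : Box) :
    boxR k w ∈ Finsupp.supported k k {L : List LPt | L.length = w.length ∧ countT L = boxDim w} := by
  induction w with
  | nil => exact Finsupp.single_mem_supported k _ ⟨rfl, rfl⟩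
  | cons I w ih =>
    rw [boxR, pcons]
    refine bil_mem_supported (sA := {p | p.2 = decide (I.fst < I.snd)}) ?_ ?_ ih
    · rintro p hp L ⟨h1, h2⟩
      refine ⟨by simp [h1], ?_⟩
      have hp' : p.2 = decide (I.fst < I.snd) := hp
      rw [countT_cons, boxDim_cons, h2, hp']
      simp
    · rw [ivR]
      split_ifs with h
      · exact sub_mem (Finsupp.single_mem_supported k _ (by simp [h]))
          (Finsupp.single_mem_supported k _ (by simp [h]))
      · exact Finsupp.single_mem_supported k _ (by simpa using h)

theorem boxDim_replicate_unitIv (n : ℕ) : boxDim (List.replicate n unitIv) = n := by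
  have : unitIv.fst < unitIv.snd := by
    change (0 : ℚ) < 1
    norm_num
  simp [boxDim, List.countP_replicate, this]

theorem muR_supported (c : Col) (n : ℕ) :
    muR k c n ∈ Finsupp.supported k k {L : List LPt | L.length = cubeDim c (n + 2) ∧ countT L = n} := by
  cases c with
  | a =>
    rw [muR]
    split_ifs with h
    · subst h
      exact Finsupp.single_mem_supported k _ ⟨rfl, rfl⟩
    · exact zero_mem _
  | m => simpa [muR, cubeDim, boxDim_replicate_unitIv] using boxR_supported (k := k) (List.replicate n unitIv)

theorem emb_mem_supported {js : List ℕ} {x : List LPt →₀ k} {s : Set (List LPt)} {t : Set EPt}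
    (hx : x ∈ Finsupp.supported k k s) (h : ∀ L ∈ s, (js, L) ∈ t) :
    emb k js x ∈ Finsupp.supported k k t := by
  refine supported_induction x hx ?_ (fun x x' h h' => ?_) (fun L hL r => ?_)
  · simp
  · rw [map_add]; exact add_mem h h'
  · rw [emb, Finsupp.lmapDomain_apply, Finsupp.mapDomain_single]
    exact Finsupp.single_mem_supported k _ (h L hL)

theorem OTerm.real_supported {l : List Col} {c : Col} (x : OTerm l c) :
    x.real k ∈ Finsupp.supported k k
      {X : EPt | X.1 = [] ∧ IsCubePt l c X.2 ∧ countT X.2 = x.deg} := by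
  induction x with
  | one c =>
    exact Finsupp.single_mem_supported k _ ⟨rfl, ⟨⟨0, rfl⟩, by cases c <;> rfl⟩, rfl⟩
  | mu c n =>
    exact emb_mem_supported (muR_supported c n) fun L hL =>
      ⟨rfl, ⟨⟨n + 1, rfl⟩, by simpa using hL.1⟩, hL.2⟩
  | comp hx hl x y hx' hy' =>
    subst hx hl
    refine bil_mem_supported ?_ hx' hy'
    rintro X ⟨-, h1, h2⟩ Y ⟨-, h3, h4⟩
    refine ⟨rfl, h1.comp h3, ?_⟩
    rw [compG, countT_evalL, countT_append, h2, h4, OTerm.deg]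
    rw [inputs_compSlots h1.1, List.length_append, h1.2, h3.2]

theorem OTerm.real_cubePt {l : List Col} {c : Col} (x : OTerm l c) :
    x.real k ∈ Finsupp.supported k k {X : EPt | X.1 = [] ∧ IsCubePt l c X.2} := by
  refine Finsupp.supported_mono ?_ x.real_supported
  rintro X ⟨h1, h2, -⟩
  exact ⟨h1, h2⟩

/-- Operations with output `a` of positive degree are realized by zero. -/
theorem OTerm.real_eq_zero {l : List Col} (x : OTerm l .a) (h : x.deg ≠ 0) : x.real k = 0 := by
  have hs := x.real_supported (k := k)
  by_contra h0
  obtain ⟨X, hX⟩ := Finsupp.support_nonempty_iff.2 h0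
  obtain ⟨-, h1, h2⟩ := hs hX
  rw [h1.eq_nil] at h2
  exact h h2.symm

/-! ### The boundary of a cube -/

theorem realD_boxR_cube (n : ℕ) :
    realD k (boxR k (List.replicate n unitIv)) = ∑ p ∈ Finset.range n, (-1 : k) ^ p •
      (boxR k (List.replicate p unitIv ++ NonemptyInterval.pure 1 :: List.replicate (n - 1 - p) unitIv)
        - boxR k (List.replicate p unitIv
          ++ NonemptyInterval.pure 0 :: List.replicate (n - 1 - p) unitIv)) := by
  induction n with
  | zero => simp [boxR, realD, listD]
  | succ n ih =>
    have hu : unitIv.fst < unitIv.snd := by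
      change (0 : ℚ) < 1
      norm_num
    rw [List.replicate_succ, boxR, realD_pcons_ivR, if_pos hu, ih, Finset.sum_range_succ',
      sub_eq_add_neg, add_comm]
    congr 1
    · rw [map_sum, ← Finset.sum_neg_distrib]
      refine Finset.sum_congr rfl fun p hp => ?_
      rw [map_smul, map_sub, pow_succ, mul_neg_one, neg_smul, List.replicate_succ,
        show n + 1 - 1 - (p + 1) = n - 1 - p by omega]
      rfl
    · simp [boxR]
      rfl

theorem realO_dMu_term (c c' : Col) (p a b : ℕ) :
    bil (compG c c' p (a + 1 + 1) (b + 1 + 1)) (emb k [] (muR k c a)) (emb k [] (muR k c' b))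
      = emb k [] (bil (fun L L' => evalL (compSlots c c' p (a + 1 + 1) (b + 1 + 1)) (L ++ L'))
        (muR k c a) (muR k c' b)) :=
  bil_emb [] [] [] _ (fun _ _ => rfl) _ _

theorem evalSign_of_nonneg {S : List Slot} (hS : ∀ s t, Slot.aff s t ∈ S → 0 ≤ s) (w : Box) :
    evalSign S w = 1 := by
  induction S generalizing w with
  | nil => rfl
  | cons a S ih =>
    have ih' := ih fun s t h => hS s t (List.mem_cons_of_mem _ h)
    cases a with
    | const q => cases w <;> exact ih' _
    | aff s t =>
      cases w with
      | nil => rfl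
      | cons I w =>
        rw [evalSign, ih', if_neg, mul_one]
        exact fun h => (hS s t (by simp)).not_gt h.2

theorem slopes_compSlots (c c' : Col) (i n n' : ℕ) :
    ∀ s t, Slot.aff s t ∈ compSlots c c' i n n' → 0 ≤ s := by
  intro s t h
  have := isCellSlot_compSlots c c' i n n' _ h
  cases c <;> cases c' <;> simp only [compSlots, copies] at h
  · simp at h
  · simp at h
  · simp [List.mem_append, List.mem_replicate] at h
    obtain h | h := h <;> rw [h.2.1] <;> norm_num
  · split_ifs at h <;> simp [List.mem_append, List.mem_replicate] at h
    · rw [h.2.1]; norm_num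
    · rw [h.2.1]; norm_num
    · obtain h | h := h <;> rw [h.2.1] <;> norm_num

/-- Composition on products of boxes. -/
theorem bil_comp_boxR {c c' : Col} {i n n' : ℕ} {v w : Box}
    (h : (v ++ w).length = Slot.inputs (compSlots c c' i n n')) :
    bil (fun L L' : List LPt => evalL (compSlots c c' i n n') (L ++ L')) (boxR k v) (boxR k w)
      = boxR k (evalBox (compSlots c c' i n n') (v ++ w)) := by
  rw [bil_evalL_boxR (slopesNeZero_compSlots _ _ _ _ _) h,
    evalSign_of_nonneg (slopes_compSlots _ _ _ _ _), Int.cast_one, one_smul]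

/-- Plugging the product `μ^a_2` into a cube inserts a zero. -/
theorem bil_mu_a (n p : ℕ) (hp : p < n) :
    bil (fun L L' : List LPt => evalL (compSlots .m .a p (n - 1 + 1 + 1) (0 + 1 + 1)) (L ++ L'))
      (muR k .m (n - 1)) (muR k .a 0)
      = boxR k (List.replicate p unitIv
          ++ NonemptyInterval.pure 0 :: List.replicate (n - 1 - p) unitIv) := by
  have h1 : muR k .a 0 = boxR k [] := by simp [muR, boxR]
  rw [h1, muR, bil_comp_boxR, List.append_nil,
    show List.replicate (n - 1) unitIv
      = List.replicate p unitIv ++ List.replicate (n - 1 - p) unitIv by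
      rw [← List.replicate_add]; congr 1; omega, evalBox,
    eval_comp_a affLaws_affIv (by simp) (by simp; omega)]
  · rfl
  · simp [compSlots, inputs_append, inputs_copies, Slot.inputs]; omega

/-- Plugging `μ^m` into `μ^m` gives a face `x = 1`. -/
theorem bil_mu_m (a b : ℕ) (p : ℕ) :
    bil (fun L L' : List LPt => evalL (compSlots .m .m p (a + 1 + 1) (b + 1 + 1)) (L ++ L'))
      (muR k .m a) (muR k .m b)
      = boxR k (List.replicate a unitIv
          ++ NonemptyInterval.pure 1 :: List.replicate b unitIv) := by
  rw [muR, muR, bil_comp_boxR, evalBox, eval_comp_m affLaws_affIv (by simp) (by simp)]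
  simp [compSlots, inputs_append, inputs_copies, Slot.inputs]

/-- The differential of the generators is realized by the boundary of cubes. -/
theorem realO_dMu (c : Col) (n : ℕ) :
    realO k _ c (dMu k c n) = ptD k (emb k [] (muR k c n)) := by
  let X : ℕ → ℕ → (List LPt →₀ k) := fun s p =>
    (-1 : k) ^ (p + (s + 2) * (n - s - p)) •
      bil (fun L L' => evalL (compSlots c (headCol c (n - s - p)) p (n - s - 1 + 1 + 1) (s + 1 + 1))
        (L ++ L')) (muR k c (n - s - 1)) (muR k (headCol c (n - s - p)) s)
  have h1 : realO k _ c (dMu k c n)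
      = - emb k [] (∑ s ∈ Finset.range n, ∑ p ∈ Finset.range (n - s + 1), X s p) := by
    rw [dMu, map_neg, map_sum, map_sum, Finset.sum_range]
    congr 1
    refine Finset.sum_congr rfl fun s _ => ?_
    rw [map_sum, map_sum, Finset.sum_range]
    refine Finset.sum_congr rfl fun p _ => ?_
    rw [realO_single, OTerm.real, OTerm.real, OTerm.real, map_smul, ← realO_dMu_term]
    simp only [List.length_append, List.length_replicate, List.length_singleton]
  rw [h1, ptD_emb, ← map_neg]
  congr 1
  have hlast : ∀ s, X s (n - s) = (-1 : k) ^ (n - s) •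
      bil (fun L L' => evalL (compSlots c c (n - s) (n - s - 1 + 1 + 1) (s + 1 + 1))
        (L ++ L')) (muR k c (n - s - 1)) (muR k c s) := by
    intro s
    simp only [X, Nat.sub_self, mul_zero, add_zero, headCol, if_true]
  have hpos : ∀ s, ∀ p < n - s, s ≠ 0 → X s p = 0 := by
    intro s p hp hs
    have : headCol c (n - s - p) = .a := if_neg (by omega)
    simp only [X, this, muR, if_neg hs, map_zero, smul_zero]
  have hzero : ∀ p < n, X 0 p = (-1 : k) ^ p •
      bil (fun L L' => evalL (compSlots c .a p (n - 1 + 1 + 1) (0 + 1 + 1))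
        (L ++ L')) (muR k c (n - 1)) (muR k .a 0) := by
    intro p hp
    have : headCol c (n - p) = .a := if_neg (by omega)
    simp only [X, this, Nat.sub_zero, zero_add]
    rw [pow_add, pow_mul, neg_one_sq, one_pow, mul_one]
  have hsum : ∑ s ∈ Finset.range n, ∑ p ∈ Finset.range (n - s + 1), X s p
      = ∑ p ∈ Finset.range n, X 0 p + ∑ s ∈ Finset.range n, X s (n - s) := by
    simp only [Finset.sum_range_succ, Finset.sum_add_distrib]
    congr 1
    cases n with
    | zero => simp
    | succ n =>
      rw [Finset.sum_eq_single_of_mem 0 (by simp)]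
      · simp
      · intro s _ hs
        exact Finset.sum_eq_zero fun p hp => hpos s p (Finset.mem_range.1 hp) hs
  rw [hsum]
  cases c with
  | m =>
    rw [muR, realD_boxR_cube, ← Finset.sum_range_reflect (fun s => X s (n - s)),
      ← Finset.sum_add_distrib, ← Finset.sum_neg_distrib]
    refine Finset.sum_congr rfl fun p hp => ?_
    have hp := Finset.mem_range.1 hp
    rw [hzero p hp, hlast, bil_mu_a n p hp, show n - (n - 1 - p) = p + 1 by omega,
      Nat.add_sub_cancel, bil_mu_m, pow_succ, smul_sub]
    simp only [mul_neg, mul_one, neg_smul]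
    abel
  | a =>
    have h0 : realD k (muR k .a n) = 0 := by
      rw [muR]; split_ifs <;> simp [realD, listD]
    rw [h0, neg_eq_zero]
    rcases n with _ | _ | n
    · simp
    · rw [Finset.sum_range_one, Finset.sum_range_one, hlast, hzero 0 one_pos]
      simp only [zero_add, Nat.sub_zero, pow_zero, one_smul, pow_one, neg_smul]
      exact add_neg_cancel _
    · rw [Finset.sum_eq_zero, Finset.sum_eq_zero, add_zero]
      · intro s hs
        rw [hlast]
        by_cases hs0 : s = 0
        · subst hs0; simp [muR]
        · simp [muR, hs0]
      · intro p hp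
        rw [hzero p (Finset.mem_range.1 hp)]
        simp [muR]

/-- The realization is compatible with the differentials. -/
theorem OTerm.realO_d {l : List Col} {c : Col} (x : OTerm l c) :
    realO k l c (x.d k) = ptD k (x.real k) := by
  induction x with
  | one c =>
    rw [OTerm.d, OTerm.real, map_zero, ptD, Finsupp.linearCombination_single, listD, map_zero,
      smul_zero]
  | mu c n => exact realO_dMu c n
  | comp hx hl x y hx' hy' =>
    subst hx
    rw [OTerm.d, map_add, map_smul, realO_bil, realO_bil, realO_single, realO_single, one_smul,
      one_smul, hx', hy', OTerm.real]
    refine (ptD_bil (fun _ _ => []) (fun _ _ => evalL _) (fun _ _ => rfl) ?_ ?_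
      x.real_supported y.real_supported).symm
    · rintro X ⟨-, h1, -⟩ Y ⟨-, h2, -⟩
      exact listD_evalL (by rw [inputs_compSlots h1.1, List.length_append, h1.2, h2.2])
    · rintro X ⟨-, -, h⟩
      exact h

theorem realO_dO {l : List Col} {c : Col} (x : OTerm l c →₀ k) :
    realO k l c (dO k l c x) = ptD k (realO k l c x) := by
  induction x using Finsupp.induction_linear with
  | zero => simp
  | add x y hx hy => simp only [map_add, hx, hy]
  | single a r => rw [dO, Finsupp.linearCombination_single, map_smul, realO_single, map_smul, a.realO_d]

/-- The set of generators of `A_∞^Col` that vanish in `Ω`. -/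
abbrev muZ : Set (Col × ℕ) := {g | g.1 = Col.a ∧ g.2 + 2 > 2}

/-- Vanishing combinations of operadic monomials are realized by zero. -/
theorem realO_eq_zero {l : List Col} {c : Col} {x : OTerm l c →₀ k} (h : OZero k muZ x) :
    realO k l c x = 0 := by
  induction h with
  | zero => exact map_zero _
  | add _ _ h1 h2 => rw [map_add, h1, h2, add_zero]
  | smul s _ h => rw [map_smul, h, smul_zero]
  | comp_left hx hl y _ h => rw [realO_bil, h, map_zero, LinearMap.zero_apply]
  | comp_right hx hl x _ h => rw [realO_bil, h, map_zero]
  | diff _ h => rw [realO_dO, h, map_zero]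
  | @gen c n h =>
    obtain ⟨h1, h2⟩ := h
    have h3 : n ≠ 0 := by
      change n + 2 > 2 at h2
      omega
    simp only at h1
    subst h1
    rw [realO_single, OTerm.real, muR, if_neg h3, map_zero, smul_zero]
  | @one_comp l c hx hl y =>
    rw [map_sub, realO_single, realO_single, one_smul, one_smul, sub_eq_zero, OTerm.real,
      OTerm.real, bil_single_left, one_smul]
    refine supported_induction (y.real k) y.real_cubePt ?_ (fun x x' h h' => ?_) (fun Y hY r => ?_)
    · simp
    · rw [Finsupp.mapDomain_add, h, h']
    · rw [Finsupp.mapDomain_single]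
      congr 1
      exact Prod.ext hY.1.symm (eval_one_comp affLaws_lpt hY.2)
  | @comp_one l l1 l2 c c' hx hl x =>
    subst hx
    rw [map_sub, realO_single, realO_single, one_smul, one_smul, sub_eq_zero, OTerm.real,
      OTerm.real, bil_single_right, one_smul]
    refine supported_induction (x.real k) x.real_cubePt ?_ (fun x x' h h' => ?_) (fun Y hY r => ?_)
    · simp
    · rw [Finsupp.mapDomain_add, h, h']
    · rw [Finsupp.mapDomain_single]
      congr 1
      exact Prod.ext hY.1.symm (eval_comp_one affLaws_lpt hY.2)
  | @sequential l0 l1 l2 l' m1 m2 l'' lxy lyz l c c' c'' hx hy hxy hyz hxy' hl hl' x y z =>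
    subst hx hy hxy hyz hl'
    rw [map_sub, realO_single, realO_single, one_smul, one_smul, sub_eq_zero]
    simp only [OTerm.real]
    refine bil_seq ?_ x.real_cubePt y.real_cubePt z.real_cubePt
    intro X hX Y hY Z hZ
    exact Prod.ext rfl (eval_sequential affLaws_lpt hX.2 hY.2 hZ.2)
  | @parallel l0 l1 l2 l3 l' l'' lxy lxz l c c' c'' hx hx' hxy hxy' hxz hxz' hl hl' x y z =>
    subst hx hxy hxz' hl'
    rw [map_sub, map_smul, realO_single, realO_single, one_smul, one_smul, sub_eq_zero]
    have key : (OTerm.comp hxy' hl (OTerm.comp rfl rfl x y) z).real k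
        = (OTerm.comp rfl rfl (OTerm.comp hx' hxz x z) y).real k := by
      simp only [OTerm.real]
      refine bil_par ?_ x.real_cubePt y.real_cubePt z.real_cubePt
      intro X hX Y hY Z hZ
      exact Prod.ext rfl (eval_parallel affLaws_lpt hX.2 hY.2 hZ.2)
    rw [key]
    obtain ⟨-, ⟨-, h⟩ | ⟨rfl, -⟩⟩ := x.isProfile.append_cons
    · simp at h
    · by_cases h0 : y.deg = 0
      · rw [h0, zero_mul, pow_zero, one_smul]
      · simp only [OTerm.real, y.real_eq_zero h0, map_zero, smul_zero]

end

/-! ### Realization of bimodule monomials -/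

/-- Right action on points. -/
def rightG (N : ℕ) (c c' : Col) (i n n' : ℕ) (X Y : EPt) : EPt :=
  ([N], evalL (rightSlots c c' i n n') (X.2 ++ Y.2))

/-- Left action on points. -/
def leftG (N : ℕ) (c : Col) (X Y : EPt) : EPt := ([N], evalL (leftSlots c Y.1) (X.2 ++ Y.2))

/-- Concatenation of tuples of points. -/
def consG (X Y : EPt) : EPt := (X.1 ++ Y.1, X.2 ++ Y.2)

/-- The list of output colours. -/
def Out.cols : Out → List Col
  | .single c => [c]
  | .tuple cs => cs

section

variable (k : Type u) [Field k]

/-- The realization of bimodule monomials and of tuples. The generator `f^c_{n+1}` is the top cell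
of a freehedron whose underlying cube is that of `μ^c_{n+2}`. -/
noncomputable def BTerm.real : ∀ {o : Out} {l : List Col}, BTerm o l → (EPt →₀ k)
  | _, _, .f c n => emb k [n + 1] (muR k c n)
  | _, _, .right (l0 := l0) (l1 := l1) (l' := l') (l := l) (c := c) (c' := c') _ _ x y =>
      bil (rightG l.length c c' l1.length l0.length l'.length) x.real (y.real k)
  | _, _, .left (l := l) (c := c) x T => bil (leftG l.length c) (x.real k) T.real
  | _, _, .nil => Finsupp.single ([], []) 1
  | _, _, .cons _ t T => bil consG t.real T.real

/-- The realization of combinations of bimodule monomials. -/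
noncomputable def realB (o : Out) (l : List Col) : (BTerm o l →₀ k) →ₗ[k] (EPt →₀ k) :=
  Finsupp.linearCombination k (BTerm.real k)

variable {k}

theorem realB_single {o : Out} {l : List Col} (x : BTerm o l) (r : k) :
    realB k o l (Finsupp.single x r) = r • x.real k := by
  simp [realB]

theorem realB_right {l0 l1 l2 l' l : List Col} {c c' : Col} (hx : l0 = l1 ++ c' :: l2)
    (hl : l = l1 ++ (l' ++ l2)) (x : BTerm (.single c) l0 →₀ k) (y : OTerm l' c' →₀ k) :
    realB k _ l (bil (BTerm.right hx hl) x y)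
      = bil (rightG l.length c c' l1.length l0.length l'.length) (realB k _ _ x)
        (realO k _ _ y) := by
  induction x using Finsupp.induction_linear with
  | zero => simp
  | add x y hx hy => simp only [map_add, LinearMap.add_apply, hx, hy]
  | single a r =>
    induction y using Finsupp.induction_linear with
    | zero => simp
    | add x y hx hy => simp only [map_add, hx, hy]
    | single b s =>
      rw [bil_single, realB_single, realB_single, realO_single, BTerm.real, map_smul, map_smul,
        LinearMap.smul_apply, smul_smul, mul_comm]

theorem realB_left {cs l : List Col} {c : Col} (x : OTerm cs c →₀ k)
    (T : BTerm (.tuple cs) l →₀ k) :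
    realB k _ l (bil BTerm.left x T)
      = bil (leftG l.length c) (realO k _ _ x) (realB k _ _ T) := by
  induction x using Finsupp.induction_linear with
  | zero => simp
  | add x y hx hy => simp only [map_add, LinearMap.add_apply, hx, hy]
  | single a r =>
    induction T using Finsupp.induction_linear with
    | zero => simp
    | add x y hx hy => simp only [map_add, hx, hy]
    | single b s =>
      rw [bil_single, realB_single, realB_single, realO_single, BTerm.real, map_smul, map_smul,
        LinearMap.smul_apply, smul_smul, mul_comm]

theorem realB_cons {c : Col} {cs l1 l2 l : List Col} (hl : l = l1 ++ l2)
    (t : BTerm (.single c) l1 →₀ k) (T : BTerm (.tuple cs) l2 →₀ k) :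
    realB k _ l (bil (BTerm.cons hl) t T) = bil consG (realB k _ _ t) (realB k _ _ T) := by
  induction t using Finsupp.induction_linear with
  | zero => simp
  | add x y hx hy => simp only [map_add, LinearMap.add_apply, hx, hy]
  | single a r =>
    induction T using Finsupp.induction_linear with
    | zero => simp
    | add x y hx hy => simp only [map_add, hx, hy]
    | single b s =>
      rw [bil_single, realB_single, realB_single, realB_single, BTerm.real, map_smul, map_smul,
        LinearMap.smul_apply, smul_smul, mul_comm]

/-- The profiles of bimodule monomials and of tuples. -/
def Out.IsProf : Out → List Col → Prop
  | .single c, l => IsProfile l c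
  | .tuple cs, l => (cs = [] → l = []) ∧ ∀ c, IsProfile cs c → IsProfile l c

theorem BTerm.isProf {o : Out} {l : List Col} (x : BTerm o l) : o.IsProf l := by
  induction x with
  | f c n => exact ⟨n, rfl⟩
  | right hx hl x y h =>
    subst hx hl
    exact IsProfile.plug h y.isProfile
  | left x T h => exact h.2 _ x.isProfile
  | nil => exact ⟨fun _ => rfl, fun _ h => h⟩
  | @cons c cs l1 l2 l hl t T ht hT =>
    subst hl
    refine ⟨by simp, fun c' hc' => ?_⟩
    obtain ⟨-, ⟨rfl, rfl⟩ | ⟨rfl, h⟩⟩ := IsProfile.append_cons (l1 := []) hc'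
    · rw [hT.1 rfl, List.append_nil]; exact ht
    · rw [IsProfile.eq_replicate_a ht]
      exact (hT.2 _ h).of_replicate_append _

theorem BTerm.isProfile {c : Col} {l : List Col} (x : BTerm (.single c) l) : IsProfile l c :=
  x.isProf

theorem IsTupShape.single_inv {c : Col} {N d : ℕ} {js : List ℕ} (h : IsTupShape [c] N js d) :
    js = [N] ∧ d = freeDim c N ∧ 1 ≤ N := by
  cases h with
  | cons hj h =>
    obtain ⟨rfl, rfl, rfl⟩ := h.nil_inv
    exact ⟨rfl, rfl, hj⟩

theorem BTerm.real_supported {o : Out} {l : List Col} (x : BTerm o l) :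
    x.real k ∈ Finsupp.supported k k
      {X : EPt | IsTupShape o.cols l.length X.1 X.2.length ∧ countT X.2 = x.deg} := by
  induction x with
  | f c n =>
    refine emb_mem_supported (muR_supported c n) ?_
    rintro L ⟨h1, h2⟩
    refine ⟨?_, h2⟩
    have : L.length = freeDim c (n + 1) := by rw [h1]; cases c <;> rfl
    simp only [Out.cols, List.length_append, List.length_replicate, List.length_singleton, this]
    exact isTupShape_singleton (by omega)
  | right hx hl x y h =>
    have hp := x.isProfile
    subst hx hl
    refine bil_mem_supported ?_ h y.real_supported
    rintro X ⟨h1, h2⟩ Y ⟨-, h3, h4⟩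
    obtain ⟨-, h5, -⟩ := h1.single_inv
    have h6 : IsFreePt _ _ X.2 := ⟨hp, h5⟩
    have h7 := h6.right h3 (cst := lcst) (act := lact)
    refine ⟨?_, ?_⟩
    · simp only [rightG, evalL, h7.2]
      exact isTupShape_singleton h7.1.length_pos
    · rw [rightG, countT_evalL, countT_append, h2, h4, BTerm.deg]
      rw [inputs_rightSlots hp, List.length_append, h5, h3.2]
  | @left cs l c x T h =>
    have hp := BTerm.isProfile (.left x T)
    refine bil_mem_supported ?_ x.real_supported h
    rintro X ⟨-, h1, h2⟩ Y ⟨h3, h4⟩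
    have hin : (X.2 ++ Y.2).length = Slot.inputs (leftSlots c Y.1) := by
      rw [inputs_leftSlots h3 h1.1, List.length_append, h1.2]; rfl
    refine ⟨?_, ?_⟩
    · simp only [leftG, evalL, length_eval hin]
      rw [length_leftSlots h3 h1.1]
      exact isTupShape_singleton hp.length_pos
    · rw [leftG, countT_evalL hin, countT_append, h2, h4, BTerm.deg]
  | nil => exact Finsupp.single_mem_supported k _ ⟨IsTupShape.nil, rfl⟩
  | cons hl t T ht hT =>
    subst hl
    refine bil_mem_supported ?_ ht hT
    rintro X ⟨h1, h2⟩ Y ⟨h3, h4⟩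
    refine ⟨?_, ?_⟩
    · simp only [consG, List.length_append]
      exact h1.append h3
    · rw [consG, countT_append, h2, h4, BTerm.deg]

theorem BTerm.real_shape {o : Out} {l : List Col} (x : BTerm o l) :
    x.real k ∈ Finsupp.supported k k {X : EPt | IsTupShape o.cols l.length X.1 X.2.length} := by
  refine Finsupp.supported_mono ?_ x.real_supported
  rintro X ⟨h1, -⟩
  exact h1

theorem BTerm.real_freePt {l : List Col} {c : Col} (x : BTerm (.single c) l) :
    x.real k ∈ Finsupp.supported k k {X : EPt | X.1 = [l.length] ∧ IsFreePt l c X.2} := by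
  refine Finsupp.supported_mono ?_ x.real_supported
  rintro X ⟨h1, -⟩
  obtain ⟨h2, h3, -⟩ := h1.single_inv
  exact ⟨h2, x.isProfile, h3⟩

/-- Tuples with outputs `a` of positive degree are realized by zero. -/
theorem BTerm.real_eq_zero {o : Out} {l : List Col} (x : BTerm o l) {n : ℕ}
    (ho : o.cols = List.replicate n Col.a) (h : x.deg ≠ 0) : x.real k = 0 := by
  have hs := x.real_supported (k := k)
  by_contra h0
  obtain ⟨X, hX⟩ := Finsupp.support_nonempty_iff.2 h0
  obtain ⟨h1, h2⟩ := hs hX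
  rw [ho] at h1
  rw [List.length_eq_zero_iff.1 h1.eq_zero] at h2
  exact h h2.symm

theorem consG_assoc (X Y Z : EPt) : consG (consG X Y) Z = consG X (consG Y Z) := by
  simp [consG]

theorem BTerm.real_appendTo {cs' l' : List Col} (T' : BTerm (.tuple cs') l') {o : Out}
    {l : List Col} (T : BTerm o l) :
    (BTerm.appendTo T' T).real k = bil consG (T.real k) (T'.real k) := by
  induction T with
  | f c n => rfl
  | right hx hl x y h => rfl
  | left x T h => rfl
  | nil =>
    rw [BTerm.real, bil_single_left, one_smul]
    exact (Finsupp.mapDomain_id (v := T'.real k)).symm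
  | cons hl t T ht hT =>
    have h : (BTerm.appendTo T' (BTerm.cons hl t T)).real k
        = bil consG (t.real k) ((BTerm.appendTo T' T).real k) := rfl
    rw [h, hT, BTerm.real]
    exact (bil_seq (g1 := consG) (g2 := consG) (h1 := consG) (h2 := consG) (sA := Set.univ)
      (sB := Set.univ) (sC := Set.univ) (fun _ _ _ _ _ _ => consG_assoc _ _ _) (Set.subset_univ _) (Set.subset_univ _)
      (Set.subset_univ _)).symm

theorem BTerm.real_append {cs l cs' l' : List Col} (T : BTerm (.tuple cs) l)
    (T' : BTerm (.tuple cs') l') : (T.append T').real k = bil consG (T.real k) (T'.real k) :=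
  T'.real_appendTo T

end

/-! ### The boundary of a freehedron -/

section

variable {k : Type u} [Field k]

theorem evalSign_append_const (S : List Slot) (q : ℚ) (w : Box) :
    evalSign (.const q :: S) w = evalSign S w := by
  cases w <;> rfl

theorem evalSign_replicate (s t : ℚ) (j : ℕ) (S : List Slot) (w : Box) :
    evalSign (List.replicate j (.aff s t) ++ S) (List.replicate j unitIv ++ w)
      = (if s < 0 then -1 else 1) ^ j * evalSign S w := by
  induction j with
  | zero => simp
  | succ j ih =>
    have hu : unitIv.fst < unitIv.snd := by
      change (0 : ℚ) < 1
      norm_num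
    rw [List.replicate_succ, List.replicate_succ, List.cons_append, List.cons_append, evalSign, ih,
      pow_succ']
    simp only [hu, true_and, mul_assoc]

theorem evalSign_copies (j : ℕ) (S : List Slot) (w : Box) :
    evalSign (copies j ++ S) (List.replicate j unitIv ++ w) = evalSign S w := by
  rw [copies, evalSign_replicate, if_neg (by norm_num), one_pow, one_mul]

theorem leftSlotsAux_ones (j i : ℕ) :
    leftSlotsAux (List.replicate (j + 1) 1 ++ [i])
      = List.replicate j (.aff (-1) 1) ++ .const 0 :: copies (i - 1) := by
  induction j with
  | zero => rfl
  | succ j ih =>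
    rw [List.replicate_succ (n := j + 1), List.cons_append]
    cases j with
    | zero => rfl
    | succ j =>
      have h : leftSlotsAux (1 :: (List.replicate (j + 1 + 1) 1 ++ [i]))
          = .aff (-1) 1 :: leftSlotsAux (List.replicate (j + 1 + 1) 1 ++ [i]) := rfl
      rw [h, ih]
      rfl

theorem affIv_neg_unitIv : affIv (-1) 1 unitIv = unitIv :=
  iv_ext (by rw [affIv_fst]; change min (-1 * (0 : ℚ) + 1) (-1 * 1 + 1) = 0; norm_num)
    (by rw [affIv_snd]; change max (-1 * (0 : ℚ) + 1) (-1 * 1 + 1) = 1; norm_num)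

/-- The cell `[0,1/2]`. -/
def lowerIv : Iv := iv 0 (1 / 2) (by norm_num)

theorem affIv_half_unitIv : affIv (1 / 2) 0 unitIv = lowerIv :=
  iv_ext (by rw [affIv_fst]; change min (1 / 2 * (0 : ℚ) + 0) (1 / 2 * 1 + 0) = 0; norm_num)
    (by rw [affIv_snd]; change max (1 / 2 * (0 : ℚ) + 0) (1 / 2 * 1 + 0) = 1 / 2; norm_num)

theorem affIv_neg_half_unitIv : affIv (-1 / 2) 1 unitIv = upperIv :=
  iv_ext (by rw [affIv_fst]; change min (-1 / 2 * (0 : ℚ) + 1) (-1 / 2 * 1 + 1) = 1 / 2; norm_num)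
    (by rw [affIv_snd]; change max (-1 / 2 * (0 : ℚ) + 1) (-1 / 2 * 1 + 1) = 1; norm_num)

theorem ivR_unitIv : ivR k unitIv = ivR k lowerIv + ivR k upperIv := by
  rw [unitIv, lowerIv, upperIv, ivR_iv _ (by norm_num), ivR_iv _ (by norm_num),
    ivR_iv _ (by norm_num)]
  abel

/-- A cube is subdivided by the position of the last coordinate that is at most `1/2`, when all
later ones are at least `1/2`. -/
theorem boxR_subdivide (m : ℕ) (w : Box) :
    boxR k (List.replicate m unitIv ++ w)
      = ∑ p ∈ Finset.range m,
          boxR k (List.replicate p unitIv ++ lowerIv :: (List.replicate (m - 1 - p) upperIv ++ w))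
        + boxR k (List.replicate m upperIv ++ w) := by
  induction m with
  | zero => simp
  | succ m ih =>
    rw [List.replicate_succ, List.cons_append, boxR, ih, Finset.sum_range_succ', map_add, map_sum,
      add_assoc]
    congr 1
    · refine Finset.sum_congr rfl fun p hp => ?_
      rw [show m + 1 - 1 - (p + 1) = m - 1 - p by omega, List.replicate_succ]
      rfl
    · rw [ivR_unitIv, map_add, LinearMap.add_apply]
      rfl

/-- The left action of a cube on `(f₁, …, f₁, f)` is a face `x = 0`. -/
theorem bil_left_boxR (j r : ℕ) :
    bil (fun L L' : List LPt => evalL (leftSlots .m (List.replicate (j + 1) 1 ++ [r + 1])) (L ++ L'))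
      (muR k .m j) (muR k .m r)
      = (-1 : k) ^ j • boxR k (List.replicate j unitIv
          ++ NonemptyInterval.pure 0 :: List.replicate r unitIv) := by
  rw [muR, muR, bil_evalL_boxR (slopesNeZero_leftSlots _ _), leftSlots, leftSlotsAux_ones,
    evalSign_replicate, if_pos (by norm_num), evalSign_append_const, Nat.add_sub_cancel]
  · congr 1
    · have := evalSign_copies r [] []
      rw [List.append_nil, List.append_nil] at this
      rw [this]
      simp [evalSign]
    · rw [evalBox, eval_append _ _ _ _ (by rw [inputs_replicate_aff]; simp),
        eval_replicate_aff _ _ _ _ (by simp), Slot.eval, eval_copies affLaws_affIv _ _ (by simp),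
        List.map_replicate, affIv_neg_unitIv]
  · simp [leftSlots, leftSlotsAux_ones, inputs_append, inputs_replicate_aff, Slot.inputs,
      inputs_copies]

/-- The right action of `μ^a_2` on a freehedron is a face `x = 1`. -/
theorem bil_right_a (n p : ℕ) (hp : p < n) :
    bil (fun L L' : List LPt => evalL (rightSlots .m .a p (n - 1 + 1) (0 + 1 + 1)) (L ++ L'))
      (muR k .m (n - 1)) (muR k .a 0)
      = boxR k (List.replicate p unitIv
          ++ NonemptyInterval.pure 1 :: List.replicate (n - 1 - p) unitIv) := by
  have h1 : muR k .a 0 = boxR k [] := by simp [muR, boxR]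
  have h2 : rightSlots .m .a p (n - 1 + 1) (0 + 1 + 1)
      = copies p ++ .const 1 :: copies (n - 1 - p) := by
    simp [rightSlots]
  rw [h1, muR, h2, bil_evalL_boxR, List.append_nil,
    show List.replicate (n - 1) unitIv
      = List.replicate p unitIv ++ List.replicate (n - 1 - p) unitIv by
      rw [← List.replicate_add]; congr 1; omega, evalSign_copies, evalSign_append_const, evalBox,
    eval_copies_append affLaws_affIv _ _ _ _ (by simp), Slot.eval,
    eval_copies affLaws_affIv _ _ (by simp)]
  · have := evalSign_copies (n - 1 - p) [] []
    rw [List.append_nil, List.append_nil] at this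
    rw [this]
    simp [evalSign]
  · exact slopesNeZero_append (slopesNeZero_copies _) (slopesNeZero_append
      (slopesNeZero_replicate_const 1 1) (slopesNeZero_copies _))
  · simp [inputs_append, inputs_copies, Slot.inputs]; omega

/-- The right action of `μ^m` on a freehedron is a cell of the last face `x = 1`. -/
theorem bil_right_m (p i s : ℕ) :
    bil (fun L L' : List LPt => evalL (rightSlots .m .m i (p + 1) (s + 1 + 1)) (L ++ L'))
      (muR k .m p) (muR k .m s)
      = (-1 : k) ^ s • boxR k ((if p = 0 then [] else List.replicate (p - 1) unitIv ++ [lowerIv])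
          ++ (List.replicate s upperIv ++ [NonemptyInterval.pure 1])) := by
  have hend : evalSign (List.replicate s (.aff (-1 / 2) 1) ++ [.const 1])
      (List.replicate s unitIv ++ []) = (-1) ^ s := by
    rw [evalSign_replicate, if_pos (by norm_num), evalSign_append_const]
    simp [evalSign]
  have hev : evalBox (List.replicate s (.aff (-1 / 2) 1) ++ [.const 1]) (List.replicate s unitIv)
      = List.replicate s upperIv ++ [NonemptyInterval.pure 1] := by
    have := eval_append (cst := fun q => (NonemptyInterval.pure q : Iv)) (act := affIv)
      (List.replicate s (.aff (-1 / 2) 1)) [.const 1] (List.replicate s unitIv) []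
      (by rw [inputs_replicate_aff]; simp)
    rw [List.append_nil] at this
    rw [evalBox, this, eval_replicate_aff _ _ _ _ (by simp), List.map_replicate,
      affIv_neg_half_unitIv]
    rfl
  rw [List.append_nil] at hend
  rcases p with _ | p
  · have h2 : rightSlots .m .m i (0 + 1) (s + 1 + 1)
        = List.replicate s (.aff (-1 / 2) 1) ++ [.const 1] := by
      simp [rightSlots]
    rw [muR, muR, bil_evalL_boxR (slopesNeZero_rightSlots _ _ _ _ _), h2]
    · simp only [List.replicate_zero, List.nil_append, if_true]
      rw [hend, hev]
      simp
    · simp [h2, inputs_append, inputs_replicate_aff, Slot.inputs]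
  · have h2 : rightSlots .m .m i (p + 1 + 1) (s + 1 + 1)
        = copies p ++ .aff (1 / 2) 0 :: (List.replicate s (.aff (-1 / 2) 1) ++ [.const 1]) := by
      simp [rightSlots]
    rw [muR, muR, bil_evalL_boxR (slopesNeZero_rightSlots _ _ _ _ _), h2]
    · rw [if_neg (by omega), Nat.add_sub_cancel, List.replicate_succ', List.append_assoc,
        evalSign_copies, List.singleton_append, evalSign, hend, if_neg, one_mul, evalBox,
        eval_copies_append affLaws_affIv _ _ _ _ (by simp), Slot.eval, affIv_half_unitIv]
      · rw [evalBox] at hev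
        rw [hev, List.append_assoc]
        simp
      · rintro ⟨-, h⟩
        norm_num at h
    · simp [h2, inputs_append, inputs_replicate_aff, Slot.inputs, inputs_copies]
      omega

theorem realB_fSum (c : Col) (j n : ℕ) :
    realB k _ _ (fSum k c j n)
      = if j ≤ n then emb k (List.replicate j 1 ++ [n - j + 1]) (muR k c (n - j)) else 0 := by
  induction j generalizing n with
  | zero =>
    rw [fSum, realB_single, one_smul, BTerm.real, BTerm.real, BTerm.real, bil_single_right, one_smul,
      if_pos (Nat.zero_le _), emb, emb, Finsupp.lmapDomain_apply, Finsupp.lmapDomain_apply,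
      ← Finsupp.mapDomain_comp]
    congr 1
    funext L
    simp [consG]
  | succ j ih =>
    have hterm : ∀ i : Fin n, realB k _ _ (Finsupp.mapDomain
        (fun T => BTerm.cons (l1 := List.replicate i Col.a ++ [Col.a])
          (l2 := List.replicate (n - 1 - i) Col.a ++ [c])
          (l := List.replicate n Col.a ++ [c])
          (by
            rw [← List.replicate_succ', ← List.append_assoc, ← List.replicate_add]
            congr 2; omega)
          (BTerm.f Col.a i) T)
        (fSum k c j (n - 1 - i)))
        = bil consG (emb k [(i : ℕ) + 1] (muR k .a i)) (realB k _ _ (fSum k c j (n - 1 - i))) := by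
      intro i
      have := bil_single_left (BTerm.cons (l1 := List.replicate i Col.a ++ [Col.a])
          (l2 := List.replicate (n - 1 - i) Col.a ++ [c])
          (l := List.replicate n Col.a ++ [c]) (cs := List.replicate j Col.a ++ [c])
          (by
            rw [← List.replicate_succ', ← List.append_assoc, ← List.replicate_add]
            congr 2; omega)) (BTerm.f Col.a i) (1 : k) (fSum k c j (n - 1 - i))
      rw [one_smul] at this
      erw [← this]
      rw [realB_cons, realB_single, one_smul, BTerm.real]
    rw [fSum, map_sum]
    rcases n with _ | n
    · simp
    · rw [Finset.sum_eq_single_of_mem (0 : Fin (n + 1)) (Finset.mem_univ _)]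
      · rw [map_smul]
        erw [hterm 0]
        rw [ih]
        simp only [Fin.val_zero, mul_zero, pow_zero, one_smul, zero_add, Nat.add_sub_cancel,
          Nat.sub_zero, Nat.add_le_add_iff_right, Nat.add_sub_add_right]
        split_ifs with h
        · rw [muR, if_pos rfl, emb, Finsupp.lmapDomain_apply, Finsupp.mapDomain_single,
            bil_single_left, one_smul, emb, emb, Finsupp.lmapDomain_apply, Finsupp.lmapDomain_apply,
            ← Finsupp.mapDomain_comp]
          rfl
        · rw [map_zero]
      · intro i _ hi
        have hi : (i : ℕ) ≠ 0 := fun h => hi (Fin.ext h)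
        rw [map_smul]
        erw [hterm i]
        rw [muR, if_neg hi, map_zero, map_zero, LinearMap.zero_apply, smul_zero]

/-- The differential of the generators is realized by the boundary of freehedra. -/
theorem realB_dF (c : Col) (n : ℕ) :
    realB k _ _ (dF k c n) = ptD k (emb k [n + 1] (muR k c n)) := by
  let X : ℕ → ℕ → (List LPt →₀ k) := fun s p =>
    (-1 : k) ^ (p + (s + 2) * (n - 1 - s - p)) •
      bil (fun L L' => evalL (rightSlots c (headCol c (n - 1 - s - p)) p (n - 1 - s + 1) (s + 1 + 1))
        (L ++ L')) (muR k c (n - 1 - s)) (muR k (headCol c (n - 1 - s - p)) s)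
  let Y : ℕ → (List LPt →₀ k) := fun j =>
    bil (fun L L' => evalL (leftSlots c (List.replicate (j + 1) 1 ++ [n - (j + 1) + 1])) (L ++ L'))
      (muR k c j) (muR k c (n - (j + 1)))
  have h1 : realB k _ _ (dF k c n)
      = emb k [n + 1] (∑ s ∈ Finset.range n, ∑ p ∈ Finset.range (n - s), X s p
        - ∑ j ∈ Finset.range n, Y j) := by
    rw [dF, map_sub, map_sub, map_sum, map_sum, map_sum, map_sum, Finset.sum_range,
      Finset.sum_range]
    congr 1
    · refine Finset.sum_congr rfl fun s _ => ?_
      rw [map_sum, map_sum, Finset.sum_range]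
      refine Finset.sum_congr rfl fun p _ => ?_
      rw [realB_single, BTerm.real, BTerm.real, OTerm.real, map_smul]
      congr 1
      simp only [List.length_append, List.length_replicate, List.length_singleton]
      exact bil_emb _ _ _ _ (fun _ _ => rfl) _ _
    · refine Finset.sum_congr rfl fun j _ => ?_
      have := bil_single_left (BTerm.left (c := c) (l := List.replicate n Col.a ++ [c]))
        (OTerm.mu c j) (1 : k) (fSum k c (j + 1) n)
      rw [one_smul] at this
      rw [← this, realB_left, realO_single, one_smul, OTerm.real, realB_fSum,
        if_pos (by omega)]
      refine bil_emb _ _ _ _ (fun _ _ => ?_) _ _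
      simp [leftG]
  rw [h1, ptD_emb]
  congr 1
  have hlast : ∀ s, X s (n - 1 - s) = (-1 : k) ^ (n - 1 - s) •
      bil (fun L L' => evalL (rightSlots c c (n - 1 - s) (n - 1 - s + 1) (s + 1 + 1))
        (L ++ L')) (muR k c (n - 1 - s)) (muR k c s) := by
    intro s
    simp only [X, Nat.sub_self, mul_zero, add_zero, headCol, if_true]
  have hpos : ∀ s, ∀ p < n - 1 - s, s ≠ 0 → X s p = 0 := by
    intro s p hp hs
    have : headCol c (n - 1 - s - p) = .a := if_neg (by omega)
    simp only [X, this, muR, if_neg hs, map_zero, smul_zero]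
  have hzero : ∀ p < n - 1, X 0 p = (-1 : k) ^ p •
      bil (fun L L' => evalL (rightSlots c .a p (n - 1 + 1) (0 + 1 + 1))
        (L ++ L')) (muR k c (n - 1)) (muR k .a 0) := by
    intro p hp
    have : headCol c (n - 1 - p) = .a := if_neg (by omega)
    simp only [X, this, Nat.sub_zero, zero_add]
    rw [pow_add, pow_mul, neg_one_sq, one_pow, mul_one]
  have hsum : ∑ s ∈ Finset.range n, ∑ p ∈ Finset.range (n - s), X s p
      = ∑ p ∈ Finset.range (n - 1), X 0 p + ∑ s ∈ Finset.range n, X s (n - 1 - s) := by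
    have : ∀ s ∈ Finset.range n, ∑ p ∈ Finset.range (n - s), X s p
        = ∑ p ∈ Finset.range (n - 1 - s), X s p + X s (n - 1 - s) := by
      intro s hs
      have hs := Finset.mem_range.1 hs
      rw [← Finset.sum_range_succ]
      congr 2
      omega
    rw [Finset.sum_congr rfl this, Finset.sum_add_distrib]
    congr 1
    cases n with
    | zero => simp
    | succ n =>
      rw [Finset.sum_eq_single_of_mem 0 (by simp)]
      · simp
      · intro s _ hs
        exact Finset.sum_eq_zero fun p hp => hpos s p (Finset.mem_range.1 hp) hs
  rw [hsum]
  cases c with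
  | m =>
    rcases n with _ | n
    · simp [muR, boxR, realD, listD]
    have hY : ∑ j ∈ Finset.range (n + 1), Y j = ∑ j ∈ Finset.range (n + 1), (-1 : k) ^ j •
        boxR k (List.replicate j unitIv
          ++ NonemptyInterval.pure 0 :: List.replicate (n - j) unitIv) := by
      refine Finset.sum_congr rfl fun j hj => ?_
      have hj := Finset.mem_range.1 hj
      simp only [Y]
      rw [bil_left_boxR, show n + 1 - (j + 1) = n - j by omega]
    have hX : ∑ s ∈ Finset.range (n + 1), X s (n + 1 - 1 - s)
        = (-1 : k) ^ n • boxR k (List.replicate n unitIv ++ [NonemptyInterval.pure 1]) := by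
      rw [boxR_subdivide, smul_add, Finset.smul_sum, Finset.sum_range_succ]
      congr 1
      · rw [← Finset.sum_range_reflect]
        refine Finset.sum_congr rfl fun s hs => ?_
        have hs := Finset.mem_range.1 hs
        rw [hlast, show n + 1 - 1 - (n - 1 - s) = s + 1 by omega, bil_right_m, if_neg (by omega),
          smul_smul, ← pow_add, show s + 1 + (n - 1 - s) = n by omega, Nat.add_sub_cancel,
          List.append_assoc, List.singleton_append]
      · rw [hlast, show n + 1 - 1 - n = 0 by omega, bil_right_m, if_pos rfl, pow_zero, one_smul,
          List.nil_append]
    rw [hY, hX, muR, realD_boxR_cube, Nat.add_sub_cancel]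
    simp only [smul_sub, Finset.sum_sub_distrib]
    congr 1
    rw [Finset.sum_range_succ, Nat.sub_self, List.replicate_zero]
    congr 1
    refine Finset.sum_congr rfl fun p hp => ?_
    have hp := Finset.mem_range.1 hp
    have := bil_right_a (k := k) (n + 1) p (by omega)
    rw [hzero p (by omega), this, Nat.add_sub_cancel]
  | a =>
    have h0 : realD k (muR k .a n) = 0 := by
      rw [muR]; split_ifs <;> simp [realD, listD]
    rw [h0]
    rcases n with _ | _ | n
    · simp
    · rw [Finset.sum_range_one, Finset.sum_range_one, hlast]
      simp only [zero_add, Nat.sub_self, Finset.range_zero, Finset.sum_empty, pow_zero,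
        one_smul]
      exact sub_self _
    · rw [Finset.sum_eq_zero, Finset.sum_eq_zero, Finset.sum_eq_zero]
      · simp
      · intro j hj
        simp only [Y]
        by_cases hj0 : j = 0
        · subst hj0; simp [muR]
        · simp [muR, hj0]
      · intro s hs
        rw [hlast]
        by_cases hs0 : s = 0
        · subst hs0; simp [muR]
        · simp [muR, hs0]
      · intro p hp
        rw [hzero p (Finset.mem_range.1 hp)]
        simp [muR]

end

/-! ### Vanishing combinations of bimodule monomials are realized by zero -/

section

variable {k : Type u} [Field k]

/-- The realization is compatible with the differentials. -/
theorem BTerm.realB_d {o : Out} {l : List Col} (x : BTerm o l) :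
    realB k o l (x.d k) = ptD k (x.real k) := by
  induction x with
  | f c n => exact realB_dF c n
  | right hx hl x y h =>
    have hp := x.isProfile
    subst hx
    rw [BTerm.d, map_add, map_smul, realB_right, realB_right, realB_single, realO_single, one_smul,
      one_smul, h, y.realO_d, BTerm.real]
    refine (ptD_bil (fun _ _ => _) (fun _ _ => evalL _) (fun _ _ => rfl) ?_ ?_
      x.real_supported y.real_supported).symm
    · rintro X ⟨h1, -⟩ Y ⟨-, h2, -⟩
      obtain ⟨-, h3, -⟩ := h1.single_inv
      exact listD_evalL (by rw [inputs_rightSlots hp, List.length_append, h3, h2.2])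
    · rintro X ⟨-, h⟩
      exact h
  | @left cs l c x T h =>
    rw [BTerm.d, map_add, map_smul, realB_left, realB_left, realB_single, realO_single, one_smul,
      one_smul, h, x.realO_d, BTerm.real]
    refine (ptD_bil (fun _ _ => _) (fun _ js => evalL (leftSlots c js)) (fun _ _ => rfl) ?_ ?_
      x.real_supported T.real_supported).symm
    · rintro X ⟨-, h1, -⟩ Y ⟨h2, -⟩
      refine listD_evalL ?_
      rw [inputs_leftSlots h2 h1.1, List.length_append, h1.2]; rfl
    · rintro X ⟨-, -, h⟩
      exact h
  | nil =>
    rw [BTerm.d, BTerm.real, map_zero, ptD, Finsupp.linearCombination_single, listD, map_zero,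
      smul_zero]
  | cons hl t T ht hT =>
    rw [BTerm.d, map_add, map_smul, realB_cons, realB_cons, realB_single, realB_single, one_smul,
      one_smul, ht, hT, BTerm.real]
    refine (ptD_bil (fun js js' => js ++ js') (fun _ _ => id) (fun _ _ => rfl) ?_ ?_
      t.real_supported T.real_supported).symm
    · intro X _ Y _
      exact Finsupp.mapDomain_id.symm
    · rintro X ⟨-, h⟩
      exact h

theorem realB_dB {o : Out} {l : List Col} (x : BTerm o l →₀ k) :
    realB k o l (dB k o l x) = ptD k (realB k o l x) := by
  induction x using Finsupp.induction_linear with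
  | zero => simp
  | add x y hx hy => simp only [map_add, hx, hy]
  | single a r =>
    rw [dB, Finsupp.linearCombination_single, map_smul, realB_single, map_smul, a.realB_d]

/-- An identity of the shape `(x y)(T₁, T, T₂) = x (T₁, y T, T₂)` extends to combinations. -/
theorem bil_nested {A : Type*} {g2 : A → A → A} {g1 h1 h4 : A → A → A} {q : A → A → A}
    {sX sY s1 s s2 : Set A}
    (h : ∀ x ∈ sX, ∀ y ∈ sY, ∀ a ∈ s1, ∀ b ∈ s, ∀ c ∈ s2,
      g1 (g2 x y) (q a (q b c)) = h1 x (q a (q (h4 y b) c)))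
    {x y a b c : A →₀ k} (hx : x ∈ Finsupp.supported k k sX) (hy : y ∈ Finsupp.supported k k sY)
    (ha : a ∈ Finsupp.supported k k s1) (hb : b ∈ Finsupp.supported k k s)
    (hc : c ∈ Finsupp.supported k k s2) :
    bil g1 (bil g2 x y) (bil q a (bil q b c)) = bil h1 x (bil q a (bil q (bil h4 y b) c)) := by
  refine supported_induction x hx ?_ (fun x x' h h' => ?_) (fun x hx r1 => ?_)
  · simp
  · simp only [map_add, LinearMap.add_apply, h, h']
  refine supported_induction y hy ?_ (fun x x' h h' => ?_) (fun y hy r2 => ?_)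
  · simp
  · simp only [map_add, LinearMap.add_apply, h, h']
  refine supported_induction a ha ?_ (fun x x' h h' => ?_) (fun a ha r3 => ?_)
  · simp
  · simp only [map_add, LinearMap.add_apply, h, h']
  refine supported_induction b hb ?_ (fun x x' h h' => ?_) (fun b hb r4 => ?_)
  · simp
  · simp only [map_add, LinearMap.add_apply, h, h']
  refine supported_induction c hc ?_ (fun x x' h h' => ?_) (fun c hc r5 => ?_)
  · simp
  · simp only [map_add, h, h']
  simp only [bil_single]
  rw [h x hx y hy a ha b hb c hc]
  congr 1
  ring

/-- An identity of the shape `x (T₁, t, T₂) z = x (T₁, t z, T₂)` extends to combinations. -/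
theorem bil_nested_right {A : Type*} {g1 g2 h1 h4 : A → A → A} {q : A → A → A}
    {sX sZ s1 s s2 : Set A}
    (h : ∀ x ∈ sX, ∀ a ∈ s1, ∀ b ∈ s, ∀ c ∈ s2, ∀ z ∈ sZ,
      g1 (g2 x (q a (q b c))) z = h1 x (q a (q (h4 b z) c)))
    {x z a b c : A →₀ k} (hx : x ∈ Finsupp.supported k k sX)
    (ha : a ∈ Finsupp.supported k k s1) (hb : b ∈ Finsupp.supported k k s)
    (hc : c ∈ Finsupp.supported k k s2) (hz : z ∈ Finsupp.supported k k sZ) :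
    bil g1 (bil g2 x (bil q a (bil q b c))) z = bil h1 x (bil q a (bil q (bil h4 b z) c)) := by
  refine supported_induction x hx ?_ (fun x x' h h' => ?_) (fun x hx r1 => ?_)
  · simp
  · simp only [map_add, LinearMap.add_apply, h, h']
  refine supported_induction a ha ?_ (fun x x' h h' => ?_) (fun a ha r3 => ?_)
  · simp
  · simp only [map_add, LinearMap.add_apply, h, h']
  refine supported_induction b hb ?_ (fun x x' h h' => ?_) (fun b hb r4 => ?_)
  · simp
  · simp only [map_add, LinearMap.add_apply, h, h']
  refine supported_induction c hc ?_ (fun x x' h h' => ?_) (fun c hc r5 => ?_)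
  · simp
  · simp only [map_add, LinearMap.add_apply, h, h']
  refine supported_induction z hz ?_ (fun x x' h h' => ?_) (fun z hz r2 => ?_)
  · simp
  · simp only [map_add, LinearMap.add_apply, h, h']
  simp only [bil_single]
  rw [h x hx a ha b hb c hc z hz]
  congr 1
  ring

/-- The set of generators of `M_∞^Col` that vanish in `T`. -/
abbrev fW : Set (Col × ℕ) := {g | g.1 = Col.a ∧ g.2 + 1 > 1}

/-- Vanishing combinations of bimodule monomials are realized by zero. -/
theorem realB_eq_zero {o : Out} {l : List Col} {x : BTerm o l →₀ k} (h : BZero k muZ fW x) :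
    realB k o l x = 0 := by
  induction h with
  | zero => exact map_zero _
  | add _ _ h1 h2 => rw [map_add, h1, h2, add_zero]
  | smul s _ h => rw [map_smul, h, smul_zero]
  | right_left hx hl y _ h => rw [realB_right, h, map_zero, LinearMap.zero_apply]
  | right_right hx hl x h => rw [realB_right, realO_eq_zero h, map_zero]
  | left_left T h => rw [realB_left, realO_eq_zero h, map_zero, LinearMap.zero_apply]
  | left_right x _ h => rw [realB_left, h, map_zero]
  | cons_left hl T _ h => rw [realB_cons, h, map_zero, LinearMap.zero_apply]
  | cons_right hl t _ h => rw [realB_cons, h, map_zero]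
  | diff _ h => rw [realB_dB, h, map_zero]
  | @gen c n h =>
    obtain ⟨h1, h2⟩ := h
    have h3 : n ≠ 0 := by
      change n + 1 > 1 at h2
      omega
    simp only at h1
    subst h1
    rw [realB_single, BTerm.real, muR, if_neg h3, map_zero, smul_zero]
  | @one_left l c hl t =>
    rw [map_sub, realB_single, realB_single, one_smul, one_smul, sub_eq_zero, BTerm.real,
      BTerm.real, OTerm.real, BTerm.real, bil_single_left, one_smul, bil_single_right, one_smul,
      ← Finsupp.mapDomain_comp]
    refine supported_induction (t.real k) t.real_freePt ?_ (fun x x' h h' => ?_) (fun Y hY r => ?_)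
    · simp
    · rw [Finsupp.mapDomain_add, h, h']
    · rw [Finsupp.mapDomain_single]
      congr 1
      refine Prod.ext hY.1.symm ?_
      have := eval_one_left affLaws_lpt hY.2
      simp only [leftG, consG, Function.comp, hY.1, List.append_nil]
      exact this
  | @right_one l l1 l2 c c' hx hl x =>
    subst hx
    rw [map_sub, realB_single, realB_single, one_smul, one_smul, sub_eq_zero, BTerm.real,
      OTerm.real, bil_single_right, one_smul]
    refine supported_induction (x.real k) x.real_freePt ?_ (fun x x' h h' => ?_) (fun Y hY r => ?_)
    · simp
    · rw [Finsupp.mapDomain_add, h, h']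
    · rw [Finsupp.mapDomain_single]
      congr 1
      exact Prod.ext hY.1.symm (eval_right_one affLaws_lpt hY.2)
  | @right_sequential l0 l1 l2 l' m1 m2 l'' lxy lyz l c c' c'' hx hy hxy hyz hxy' hl hl' x y z =>
    subst hx hy hxy hyz hl'
    rw [map_sub, realB_single, realB_single, one_smul, one_smul, sub_eq_zero]
    simp only [BTerm.real, OTerm.real]
    refine bil_seq ?_ x.real_freePt y.real_cubePt z.real_cubePt
    intro X hX Y hY Z hZ
    exact Prod.ext rfl (eval_right_sequential affLaws_lpt hX.2 hY.2 hZ.2)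
  | @right_parallel l0 l1 l2 l3 l' l'' lxy lxz l c c' c'' hx hx' hxy hxy' hxz hxz' hl hl' x y z =>
    subst hx hxy hxz' hl'
    rw [map_sub, map_smul, realB_single, realB_single, one_smul, one_smul, sub_eq_zero]
    have key : (BTerm.right hxy' hl (BTerm.right rfl rfl x y) z).real k
        = (BTerm.right rfl rfl (BTerm.right hx' hxz x z) y).real k := by
      simp only [BTerm.real]
      refine bil_par ?_ x.real_freePt y.real_cubePt z.real_cubePt
      intro X hX Y hY Z hZ
      exact Prod.ext rfl (eval_right_parallel affLaws_lpt hX.2 hY.2 hZ.2)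
    rw [key]
    obtain ⟨-, ⟨-, h⟩ | ⟨rfl, -⟩⟩ := x.isProfile.append_cons
    · simp at h
    · by_cases h0 : y.deg = 0
      · rw [h0, zero_mul, pow_zero, one_smul]
      · simp only [BTerm.real, y.real_eq_zero h0, map_zero, smul_zero]
  | @left_comp cs1 cs2 cs l1 l2 l c c' x y T1 T T2 =>
    rw [map_sub, map_smul, realB_single, realB_single, one_smul, one_smul, sub_eq_zero]
    have key : (BTerm.left (OTerm.comp rfl rfl x y) (T1.append (T.append T2))).real k
        = (BTerm.left x (T1.append (BTerm.cons rfl (BTerm.left y T) T2))).real k := by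
      simp only [BTerm.real, BTerm.real_append, OTerm.real]
      refine bil_nested ?_ x.real_cubePt y.real_cubePt T1.real_shape T.real_shape T2.real_shape
      intro X hX Y hY X1 h1 X2 h2 X3 h3
      exact Prod.ext rfl (eval_left_comp affLaws_lpt hX.2 hY.2 h1 h2 h3)
    rw [key]
    by_cases h0 : T1.deg = 0
    · rw [h0, mul_zero, pow_zero, one_smul]
    · have h1 := T1.real_eq_zero (k := k) x.isProfile.append_cons.1 h0
      simp only [BTerm.real, BTerm.real_append, h1, map_zero, LinearMap.zero_apply, smul_zero]
  | @left_right_comm cs1 cs2 l1 l2 lt m1 m2 lz ltz c c' c'' ht htz hx hl x T1 t T2 z =>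
    subst ht htz
    rw [map_sub, map_smul, realB_single, realB_single, one_smul, one_smul, sub_eq_zero]
    have key : (BTerm.right hx hl (BTerm.left x (T1.append (BTerm.cons rfl t T2))) z).real k
        = (BTerm.left x (T1.append (BTerm.cons rfl (BTerm.right rfl rfl t z) T2))).real k := by
      simp only [BTerm.real, BTerm.real_append]
      refine bil_nested_right ?_ x.real_cubePt T1.real_shape t.real_freePt T2.real_shape
        z.real_cubePt
      rintro X hX X1 h1 X2 h2 X3 h3 Z hZ
      refine Prod.ext rfl ?_
      have := eval_left_right affLaws_lpt hX.2 h2.2 hZ.2 h1 h3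
      simp only [rightG, leftG, consG, h2.1]
      exact this
    rw [key]
    obtain ⟨-, ⟨-, rfl⟩ | ⟨rfl, -⟩⟩ := x.isProfile.append_cons
    · by_cases h0 : T2.deg = 0
      · rw [h0, mul_zero, pow_zero, one_smul]
      · have h1 := T2.real_eq_zero (k := k) (n := 0) rfl h0
        simp only [BTerm.real, BTerm.real_append, h1, map_zero, smul_zero]
    · by_cases h0 : z.deg = 0
      · rw [h0, zero_mul, pow_zero, one_smul]
      · have hc : c'' = .a := by
          obtain ⟨-, ⟨h, -⟩ | ⟨h, -⟩⟩ := t.isProfile.append_cons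
          · exact h
          · exact h
        subst hc
        simp only [BTerm.real, BTerm.real_append, z.real_eq_zero h0, map_zero, LinearMap.zero_apply,
          smul_zero]

end

/-! ### Realization of the quotients and of cellular chains -/

section

variable {k : Type u} [Field k]

/-- The class of an operadic monomial in `Ω`. -/
noncomputable def clO (k : Type u) [Field k] {l : List Col} {c : Col} (x : OTerm l c) : OQuot k muZ l c :=
  Submodule.Quotient.mk (Finsupp.single x 1)

/-- The class in `T` of a bimodule monomial or of a tuple. -/
noncomputable def clB (k : Type u) [Field k] {o : Out} {l : List Col} (x : BTerm o l) : BQuot k muZ fW o l :=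
  Submodule.Quotient.mk (Finsupp.single x 1)

/-- The realization of `Ω`. -/
noncomputable def quotO (k : Type u) [Field k] (l : List Col) (c : Col) :
    OQuot k muZ l c →ₗ[k] (EPt →₀ k) :=
  (idealO k muZ l c).liftQ (realO k l c) fun _ h => LinearMap.mem_ker.2 (realO_eq_zero h)

/-- The realization of `T`. -/
noncomputable def quotB (k : Type u) [Field k] (o : Out) (l : List Col) :
    BQuot k muZ fW o l →ₗ[k] (EPt →₀ k) :=
  (idealB k muZ fW o l).liftQ (realB k o l) fun _ h => LinearMap.mem_ker.2 (realB_eq_zero h)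

theorem quotO_clO {l : List Col} {c : Col} (x : OTerm l c) : quotO k l c (clO k x) = x.real k := by
  rw [clO, quotO, Submodule.liftQ_apply, realO_single, one_smul]

theorem quotB_clB {o : Out} {l : List Col} (x : BTerm o l) : quotB k o l (clB k x) = x.real k := by
  rw [clB, quotB, Submodule.liftQ_apply, realB_single, one_smul]

theorem span_clO (l : List Col) (c : Col) :
    Submodule.span k (Set.range (clO k : OTerm l c → OQuot k muZ l c)) = ⊤ := by
  rw [eq_top_iff]
  rintro x -
  obtain ⟨x, rfl⟩ := Submodule.Quotient.mk_surjective _ x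
  induction x using Finsupp.induction_linear with
  | zero => exact zero_mem _
  | add x y hx hy => rw [Submodule.Quotient.mk_add]; exact add_mem hx hy
  | single a r =>
    rw [show Finsupp.single a r = r • Finsupp.single a (1 : k) by simp,
      Submodule.Quotient.mk_smul]
    exact Submodule.smul_mem _ _ (Submodule.subset_span ⟨a, rfl⟩)

theorem span_clB (o : Out) (l : List Col) :
    Submodule.span k (Set.range (clB k : BTerm o l → BQuot k muZ fW o l)) = ⊤ := by
  rw [eq_top_iff]
  rintro x -
  obtain ⟨x, rfl⟩ := Submodule.Quotient.mk_surjective _ x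
  induction x using Finsupp.induction_linear with
  | zero => exact zero_mem _
  | add x y hx hy => rw [Submodule.Quotient.mk_add]; exact add_mem hx hy
  | single a r =>
    rw [show Finsupp.single a r = r • Finsupp.single a (1 : k) by simp,
      Submodule.Quotient.mk_smul]
    exact Submodule.smul_mem _ _ (Submodule.subset_span ⟨a, rfl⟩)

theorem quotO_d {l : List Col} {c : Col} (x : (omegaT k).P l c) :
    quotO k l c ((omegaT k).dP l c x) = ptD k (quotO k l c x) := by
  obtain ⟨x, rfl⟩ := Submodule.Quotient.mk_surjective _ x
  exact realO_dO x

theorem quotB_d {l : List Col} {c : Col} (x : (omegaT k).M l c) :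
    quotB k _ l ((omegaT k).dM l c x) = ptD k (quotB k _ l x) := by
  obtain ⟨x, rfl⟩ := Submodule.Quotient.mk_surjective _ x
  exact realB_dB x

theorem quotO_comp {l0 l1 l2 l' l : List Col} {c c' : Col} (hx : l0 = l1 ++ c' :: l2)
    (hl : l = l1 ++ (l' ++ l2)) (x : (omegaT k).P l0 c) (y : (omegaT k).P l' c') :
    quotO k l c ((omegaT k).comp hx hl x y)
      = bil (compG c c' l1.length l0.length l'.length) (quotO k _ _ x) (quotO k _ _ y) := by
  obtain ⟨x, rfl⟩ := Submodule.Quotient.mk_surjective _ x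
  obtain ⟨y, rfl⟩ := Submodule.Quotient.mk_surjective _ y
  exact realO_bil hx hl x y

theorem quotB_right {l0 l1 l2 l' l : List Col} {c c' : Col} (hx : l0 = l1 ++ c' :: l2)
    (hl : l = l1 ++ (l' ++ l2)) (x : (omegaT k).M l0 c) (y : (omegaT k).P l' c') :
    quotB k _ l ((omegaT k).right hx hl x y)
      = bil (rightG l.length c c' l1.length l0.length l'.length) (quotB k _ _ x)
        (quotO k _ _ y) := by
  obtain ⟨x, rfl⟩ := Submodule.Quotient.mk_surjective _ x
  obtain ⟨y, rfl⟩ := Submodule.Quotient.mk_surjective _ y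
  exact realB_right hx hl x y

theorem quotB_left {cs l : List Col} {c : Col} (x : (omegaT k).P cs c)
    (T : Tup (omegaT k).M cs l) :
    quotB k _ l ((omegaT k).left x T)
      = bil (leftG l.length c) (quotO k _ _ x) (quotB k _ _ (tupClass k muZ fW T)) := by
  change quotB k _ l (bilQ (idealO k _ _ _) (idealB k _ _ _ _) (idealB k _ _ _ _) (bil BTerm.left)
      _ _ x (tupClass k muZ fW T)) = _
  generalize tupClass k muZ fW T = T
  obtain ⟨x, rfl⟩ := Submodule.Quotient.mk_surjective _ x
  obtain ⟨T, rfl⟩ := Submodule.Quotient.mk_surjective _ T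
  exact realB_left x T

theorem quotB_cons {c : Col} {cs l1 l2 l : List Col} (hl : l = l1 ++ l2) (t : (omegaT k).M l1 c)
    (T : Tup (omegaT k).M cs l2) :
    quotB k _ l (tupClass k muZ fW (Tup.cons hl t T))
      = bil consG (quotB k _ _ t) (quotB k _ _ (tupClass k muZ fW T)) := by
  change quotB k _ l (bilQ (idealB k _ _ _ _) (idealB k _ _ _ _) (idealB k _ _ _ _)
      (bil (BTerm.cons hl)) _ _ t (tupClass k muZ fW T)) = _
  generalize tupClass k muZ fW T = T
  obtain ⟨t, rfl⟩ := Submodule.Quotient.mk_surjective _ t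
  obtain ⟨T, rfl⟩ := Submodule.Quotient.mk_surjective _ T
  exact realB_cons hl t T

/-- The realization of chains on cubes. -/
noncomputable def cellO (k : Type u) [Field k] (l : List Col) (c : Col) :
    Chain k (cubeOp l c) →ₗ[k] (EPt →₀ k) :=
  emb k [] ∘ₗ realChain k (cubeOp l c)

/-- The realization of chains on freehedra. -/
noncomputable def cellB (k : Type u) [Field k] (l : List Col) (c : Col) :
    Chain k (freeMod l c) →ₗ[k] (EPt →₀ k) :=
  emb k [l.length] ∘ₗ realChain k (freeMod l c)

theorem cubeOp_length {l : List Col} {c : Col} {w : Box} (h : w ∈ cubeOp l c) :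
    w.length = cubeDim c l.length ∧ IsCell (fun _ => intervalCells) w := by
  rw [mem_cubeOp] at h
  exact ⟨h.1.2, (isCell_interval w).2 h.2⟩

theorem freeMod_length {l : List Col} {c : Col} {w : Box} (h : w ∈ freeMod l c) :
    w.length = freeDim c l.length ∧ IsCell cellsOver w := by
  rw [mem_freeMod] at h
  exact ⟨h.1.2, (isCell_cellsOver w).2 h.2⟩

theorem cellO_injective (l : List Col) (c : Col) : Function.Injective (cellO k l c) :=
  (emb_injective _).comp
    (realChain_injective isSubdivision_interval _ _ fun _ h => cubeOp_length h)

theorem cellB_injective (l : List Col) (c : Col) : Function.Injective (cellB k l c) :=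
  (emb_injective _).comp
    (realChain_injective isSubdivision_cellsOver _ _ fun _ h => freeMod_length h)

theorem cellO_d {l : List Col} {c : Col} (x : Chain k (cubeOp l c)) :
    cellO k l c (boundary k (cubeOp l c) x) = ptD k (cellO k l c x) := by
  by_cases h : IsProfile l c
  · rw [cellO, LinearMap.comp_apply, LinearMap.comp_apply, ptD_emb,
      realChain_boundary isSubdivision_interval (cubeDim c l.length)]
    intro w
    rw [mem_cubeOp, isCell_interval]
    exact ⟨fun h => ⟨h.1.2, h.2⟩, fun h' => ⟨⟨h, h'.1⟩, h'.2⟩⟩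
  · have : IsEmpty {w // w ∈ cubeOp l c} := ⟨fun w => h (mem_cubeOp.1 w.2).1.1⟩
    rw [Subsingleton.elim x 0]
    simp

theorem cellB_d {l : List Col} {c : Col} (x : Chain k (freeMod l c)) :
    cellB k l c (boundary k (freeMod l c) x) = ptD k (cellB k l c x) := by
  by_cases h : IsProfile l c
  · rw [cellB, LinearMap.comp_apply, LinearMap.comp_apply, ptD_emb,
      realChain_boundary isSubdivision_cellsOver (freeDim c l.length)]
    intro w
    rw [mem_freeMod, isCell_cellsOver]
    exact ⟨fun h => ⟨h.1.2, h.2⟩, fun h' => ⟨⟨h, h'.1⟩, h'.2⟩⟩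
  · have : IsEmpty {w // w ∈ freeMod l c} := ⟨fun w => h (mem_freeMod.1 w.2).1.1⟩
    rw [Subsingleton.elim x 0]
    simp

theorem toChain_single {X : Finset Box} {w : Box} (h : w ∈ X) (r : k) :
    toChain k X (Finsupp.single w r) = Finsupp.single ⟨w, h⟩ r := by
  ext v
  simp only [toChain, Finsupp.lcomapDomain, LinearMap.coe_mk, AddHom.coe_mk,
    Finsupp.comapDomain_apply]
  by_cases hv : v = ⟨w, h⟩
  · subst hv; simp
  · rw [Finsupp.single_eq_of_ne hv, Finsupp.single_eq_of_ne fun h' => hv (Subtype.ext h')]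

theorem realChain_cellChain {X : Finset Box} {w : Box} (h : w ∈ X) :
    realChain k X (cellChain k X w) = boxR k w := by
  rw [cellChain, toChain_single h, realChain_single, one_smul]

/-- Maps of cells induce the corresponding maps of realizations. -/
theorem realChain_pushChain {S : List Slot} {X : Finset Box} (hS : SlopesNeZero S) {b : Box →₀ k}
    (hb : b ∈ Finsupp.supported k k {w : Box | w.length = Slot.inputs S ∧ evalBox S w ∈ X}) :
    realChain k X (pushChain k S X b) = Finsupp.mapDomain (evalL S) (realBoxes k b) := by
  refine supported_induction b hb ?_ (fun x x' h h' => ?_) (fun w hw r => ?_)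
  · simp
  · simp only [map_add, Finsupp.mapDomain_add, h, h']
  · rw [pushChain, LinearMap.comp_apply, Finsupp.linearCombination_single, map_smul,
      toChain_single hw.2, map_smul, realChain_single, realBoxes, Finsupp.linearCombination_single,
      Finsupp.mapDomain_smul, mapDomain_boxR hS hw.1]

theorem realBoxes_cross (x y : Box →₀ k) :
    realBoxes k (cross k x y) = bil (fun L L' : List LPt => L ++ L') (realBoxes k x)
      (realBoxes k y) := by
  induction x using Finsupp.induction_linear with
  | zero => simp
  | add x y hx hy => simp only [map_add, LinearMap.add_apply, hx, hy]
  | single a r =>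
    induction y using Finsupp.induction_linear with
    | zero => simp
    | add x y hx hy => simp only [map_add, hx, hy]
    | single b s =>
      rw [cross, bil_single, realBoxes, Finsupp.linearCombination_single,
        Finsupp.linearCombination_single, Finsupp.linearCombination_single, map_smul, map_smul,
        LinearMap.smul_apply, smul_smul, mul_comm, bil_append_boxR]

theorem chainBoxes_supported (X : Finset Box) (x : Chain k X) :
    chainBoxes k X x ∈ Finsupp.supported k k {w : Box | w ∈ X} := by
  induction x using Finsupp.induction_linear with
  | zero => simp
  | add x y hx hy => rw [map_add]; exact add_mem hx hy
  | single a r =>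
    rw [chainBoxes, Finsupp.lmapDomain_apply, Finsupp.mapDomain_single]
    exact Finsupp.single_mem_supported k _ a.2

theorem cellO_comp {l0 l1 l2 l' l : List Col} {c c' : Col} (hx : l0 = l1 ++ c' :: l2)
    (hl : l = l1 ++ (l' ++ l2)) (x : Chain k (cubeOp l0 c)) (y : Chain k (cubeOp l' c')) :
    cellO k l c ((cellularPair k).comp hx hl x y)
      = bil (compG c c' l1.length l0.length l'.length) (cellO k _ _ x) (cellO k _ _ y) := by
  subst hx hl
  change emb k [] (realChain k _ (pushChain k _ _ (cross k (chainBoxes k _ x) (chainBoxes k _ y))))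
    = _
  rw [realChain_pushChain (slopesNeZero_compSlots _ _ _ _ _), realBoxes_cross, mapDomain_bil]
  · exact (bil_emb [] [] [] _ (fun _ _ => rfl) _ _).symm
  · refine bil_mem_supported ?_ (chainBoxes_supported _ x) (chainBoxes_supported _ y)
    intro v hv w hw
    have h1 := (mem_cubeOp.1 hv).1
    have h2 := (mem_cubeOp.1 hw).1
    exact ⟨by rw [List.length_append, inputs_compSlots h1.1, h1.2, h2.2], comp_mem_cubeOp hv hw⟩

theorem cellB_right {l0 l1 l2 l' l : List Col} {c c' : Col} (hx : l0 = l1 ++ c' :: l2)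
    (hl : l = l1 ++ (l' ++ l2)) (x : Chain k (freeMod l0 c)) (y : Chain k (cubeOp l' c')) :
    cellB k l c ((cellularPair k).right hx hl x y)
      = bil (rightG l.length c c' l1.length l0.length l'.length) (cellB k _ _ x)
        (cellO k _ _ y) := by
  subst hx hl
  change emb k _ (realChain k _ (pushChain k _ _ (cross k (chainBoxes k _ x) (chainBoxes k _ y))))
    = _
  rw [realChain_pushChain (slopesNeZero_rightSlots _ _ _ _ _), realBoxes_cross, mapDomain_bil]
  · exact (bil_emb _ _ _ _ (fun _ _ => rfl) _ _).symm
  · refine bil_mem_supported ?_ (chainBoxes_supported _ x) (chainBoxes_supported _ y)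
    intro v hv w hw
    have h1 := (mem_freeMod.1 hv).1
    have h2 := (mem_cubeOp.1 hw).1
    exact ⟨by rw [List.length_append, inputs_rightSlots h1.1, h1.2, h2.2], right_mem_freeMod hv hw⟩

/-- Chains of tuples are supported on tuples of cells. -/
theorem tupBoxes_supported {cs l : List Col} (T : Tup (fun l c => Chain k (freeMod l c)) cs l) :
    tupBoxes k T ∈ Finsupp.supported k k
      {w : Box | ∃ T' : Tup (fun l c => {w // w ∈ freeMod l c}) cs l,
        T'.arities = T.arities ∧ T'.coords (fun _ _ w => w.1) = w} := by
  induction T with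
  | nil => exact Finsupp.single_mem_supported k _ ⟨Tup.nil, rfl, rfl⟩
  | @cons c cs l1 l2 l hl x T ih =>
    refine bil_mem_supported ?_ (chainBoxes_supported _ x) ih
    rintro v hv w ⟨T', h1, h2⟩
    exact ⟨Tup.cons hl ⟨v, hv⟩ T', by rw [Tup.arities, Tup.arities, h1], by rw [Tup.coords, h2]⟩

/-- The realization of tuples of chains. -/
noncomputable def cellTup (k : Type u) [Field k] {cs l : List Col}
    (T : Tup (fun l c => Chain k (freeMod l c)) cs l) : EPt →₀ k :=
  emb k T.arities (realBoxes k (tupBoxes k T))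

theorem cellTup_nil : cellTup k Tup.nil = Finsupp.single ([], []) 1 := by
  simp [cellTup, tupBoxes, Tup.arities, realBoxes, boxR, emb]

theorem cellTup_cons {c : Col} {cs l1 l2 l : List Col} (hl : l = l1 ++ l2)
    (t : Chain k (freeMod l1 c)) (T : Tup (fun l c => Chain k (freeMod l c)) cs l2) :
    cellTup k (Tup.cons hl t T) = bil consG (cellB k _ _ t) (cellTup k T) := by
  rw [cellTup, tupBoxes, realBoxes_cross]
  exact (bil_emb _ _ _ _ (fun _ _ => rfl) _ _).symm

theorem cellB_left {cs l : List Col} {c : Col} (x : Chain k (cubeOp cs c))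
    (T : Tup (fun l c => Chain k (freeMod l c)) cs l) :
    cellB k l c ((cellularPair k).left x T)
      = bil (leftG l.length c) (cellO k _ _ x) (cellTup k T) := by
  change emb k _ (realChain k _ (pushChain k _ _ (cross k (chainBoxes k _ x) (tupBoxes k T)))) = _
  rw [realChain_pushChain (slopesNeZero_leftSlots _ _), realBoxes_cross, mapDomain_bil]
  · exact (bil_emb _ _ _ _ (fun _ _ => rfl) _ _).symm
  · refine bil_mem_supported ?_ (chainBoxes_supported _ x) (tupBoxes_supported T)
    rintro v hv w ⟨T', h1, rfl⟩
    rw [← h1]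
    refine ⟨?_, isCWPair.left_cell T' hv⟩
    have h2 := (mem_cubeOp.1 hv).1
    rw [List.length_append, inputs_leftSlots
      (T'.isTupShape _ fun _ _ w => (mem_freeMod.1 w.2).1) h2.1, h2.2]

/-! ### Degrees -/

/-- A chain whose realization has degree `n` has degree `n`. -/
theorem mem_chainGrade {X : Finset Box} (hX : Function.Injective (realChain k X)) {n : ℕ}
    {x : Chain k X}
    (h : realChain k X x ∈ Finsupp.supported k k {L : List LPt | countT L = n}) :
    x ∈ chainGrade k X n := by
  classical
  have hreal : ∀ y : Chain k X, ∀ s : Set ℕ, (∀ w ∈ y.support, boxDim w.1 ∈ s) →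
      realChain k X y ∈ Finsupp.supported k k {L : List LPt | countT L ∈ s} := by
    intro y s hy
    refine supported_induction (s := {w : {w // w ∈ X} | boxDim w.1 ∈ s}) y hy ?_ (fun x x' h h' => ?_)
      (fun w hw r => ?_)
    · simp
    · rw [map_add]; exact add_mem h h'
    · rw [realChain_single]
      refine Submodule.smul_mem _ _ (Finsupp.supported_mono ?_ (boxR_supported w.1))
      rintro L ⟨-, hL⟩
      rw [Set.mem_ofPred_eq, hL]
      exact hw
  have hsum := Finsupp.filter_add_filter_not x fun w => boxDim w.1 = n
  set x1 := x.filter fun w => boxDim w.1 = n with hx1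
  set x2 := x.filter fun w => ¬ boxDim w.1 = n with hx2
  have h1 := hreal x1 {n} fun w hw => by
    rw [hx1, Finsupp.support_filter, Finset.mem_filter] at hw
    exact hw.2
  have h2 := hreal x2 {n}ᶜ fun w hw => by
    rw [hx2, Finsupp.support_filter, Finset.mem_filter] at hw
    exact hw.2
  have h3 : realChain k X x2 ∈ Finsupp.supported k k {L : List LPt | countT L = n} := by
    rw [← hsum, map_add] at h
    exact (Submodule.add_mem_iff_right _ h1).1 h
  have h4 : realChain k X x2 = 0 := by
    rw [← Finsupp.support_eq_empty, Finset.eq_empty_iff_forall_notMem]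
    intro L hL
    exact h2 hL (h3 hL)
  have h5 : x2 = 0 := hX (by rw [h4, map_zero])
  rw [← hsum, h5, add_zero]
  refine supported_induction (s := {w : {w // w ∈ X} | boxDim w.1 = n}) x1 ?_ (zero_mem _)
    (fun x x' h h' => add_mem h h') (fun w hw r => ?_)
  · intro w hw
    rw [Finset.mem_coe, hx1, Finsupp.support_filter, Finset.mem_filter] at hw
    exact hw.2
  · rw [show Finsupp.single w r = r • Finsupp.single w (1 : k) by simp]
    exact Submodule.smul_mem _ _ (Submodule.subset_span ⟨w, hw, rfl⟩)

theorem boxR_ne_zero (w : Box) : boxR k w ≠ 0 := by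
  induction w with
  | nil => simp [boxR]
  | cons I w ih =>
    intro h
    have h1 := headCoeff_pcons (k := k) (I.snd, decide (I.fst < I.snd)) (ivR k I) (boxR k w)
    rw [← boxR, h, map_zero] at h1
    have h2 : ivR k I (I.snd, decide (I.fst < I.snd)) = 1 := by
      rw [ivR]
      split_ifs with h3
      · simp [h3, h3.ne]
      · have h4 : I.fst = I.snd := le_antisymm I.fst_le_snd (not_lt.1 h3)
        simp [h4]
    rw [h2, one_smul] at h1
    exact ih h1.symm

/-! ### A criterion for isomorphisms -/

/-- A map that sends a spanning family, up to units, to the images of a basis under an injective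
map, induces an isomorphism with the free module on that basis. -/
theorem exists_equiv {Q V ι : Type*} [AddCommGroup Q] [Module k Q] [AddCommGroup V] [Module k V]
    (r : Q →ₗ[k] V) (ρ : (ι →₀ k) →ₗ[k] V) (hρ : Function.Injective ρ) (N : Q → ι → Prop)
    (hspan : Submodule.span k {q | ∃ w, N q w} = ⊤)
    (hr : ∀ q w, N q w → ∃ s : k, s ≠ 0 ∧ r q = s • ρ (Finsupp.single w 1))
    (huniq : ∀ q q' w, N q w → N q' w → q = q') (hex : ∀ w, ∃ q, N q w) :
    ∃ e : Q ≃ₗ[k] (ι →₀ k), ∀ x, ρ (e x) = r x := by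
  choose q hq using hex
  choose s hs0 hs using fun w => hr (q w) w (hq w)
  let g : (ι →₀ k) →ₗ[k] Q := Finsupp.linearCombination k fun w => (s w)⁻¹ • q w
  have hg : ∀ x, r (g x) = ρ x := by
    intro x
    induction x using Finsupp.induction_linear with
    | zero => simp
    | add x y hx hy => simp only [map_add, hx, hy]
    | single w c =>
      rw [Finsupp.linearCombination_single, map_smul, map_smul, hs, inv_smul_smul₀ (hs0 w),
        ← map_smul, Finsupp.smul_single, smul_eq_mul, mul_one]
  have hinj : Function.Injective g := fun x y h => hρ (by rw [← hg, ← hg, h])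
  have hsurj : Function.Surjective g := by
    rw [← LinearMap.range_eq_top, eq_top_iff, ← hspan, Submodule.span_le]
    rintro x ⟨w, hw⟩
    rw [huniq x (q w) w hw (hq w)]
    refine ⟨Finsupp.single w (s w), ?_⟩
    rw [Finsupp.linearCombination_single, smul_inv_smul₀ (hs0 w)]
  refine ⟨(LinearEquiv.ofBijective g ⟨hinj, hsurj⟩).symm, fun x => ?_⟩
  rw [← hg]
  congr 1
  exact (LinearEquiv.ofBijective g ⟨hinj, hsurj⟩).apply_symm_apply x

end

/-! ### Normal forms in the operad -/

section

variable {k : Type u} [Field k]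

theorem clO_eq {l : List Col} {c : Col} {x y : OTerm l c}
    (h : OZero k muZ (Finsupp.single x 1 - Finsupp.single y 1)) : clO k x = clO k y :=
  (Submodule.Quotient.eq _).2 h

theorem clO_comp {l0 l1 l2 l' l : List Col} {c c' : Col} (hx : l0 = l1 ++ c' :: l2)
    (hl : l = l1 ++ (l' ++ l2)) (x : OTerm l0 c) (y : OTerm l' c') :
    clO k (OTerm.comp hx hl x y) = (omegaT k).comp hx hl (clO k x) (clO k y) := by
  change _ = Submodule.Quotient.mk (bil (OTerm.comp hx hl) (Finsupp.single x 1)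
    (Finsupp.single y 1))
  rw [bil_single, mul_one]
  rfl

theorem clO_comp_congr_left {l0 l1 l2 l' l : List Col} {c c' : Col} (hx : l0 = l1 ++ c' :: l2)
    (hl : l = l1 ++ (l' ++ l2)) {x x' : OTerm l0 c} (y : OTerm l' c')
    (h : clO k x = clO k x') : clO k (OTerm.comp hx hl x y) = clO k (OTerm.comp hx hl x' y) := by
  rw [clO_comp, clO_comp, h]

theorem clO_comp_congr_right {l0 l1 l2 l' l : List Col} {c c' : Col} (hx : l0 = l1 ++ c' :: l2)
    (hl : l = l1 ++ (l' ++ l2)) (x : OTerm l0 c) {y y' : OTerm l' c'}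
    (h : clO k y = clO k y') : clO k (OTerm.comp hx hl x y) = clO k (OTerm.comp hx hl x y') := by
  rw [clO_comp, clO_comp, h]

theorem clO_parallel {l0 l1 l2 l3 l' l'' lxy lxz l : List Col} {c c' c'' : Col}
    (hx : l0 = l1 ++ c' :: (l2 ++ c'' :: l3)) (hx' : l0 = (l1 ++ c' :: l2) ++ c'' :: l3)
    (hxy : lxy = l1 ++ (l' ++ (l2 ++ c'' :: l3)))
    (hxy' : lxy = (l1 ++ (l' ++ l2)) ++ c'' :: l3)
    (hxz : lxz = (l1 ++ c' :: l2) ++ (l'' ++ l3))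
    (hxz' : lxz = l1 ++ c' :: (l2 ++ (l'' ++ l3)))
    (hl : l = (l1 ++ (l' ++ l2)) ++ (l'' ++ l3)) (hl' : l = l1 ++ (l' ++ (l2 ++ (l'' ++ l3))))
    (x : OTerm l0 c) (y : OTerm l' c') (z : OTerm l'' c'') (hd : y.deg * z.deg = 0) :
    clO k (OTerm.comp hxy' hl (OTerm.comp hx hxy x y) z)
      = clO k (OTerm.comp hxz' hl' (OTerm.comp hx' hxz x z) y) := by
  refine clO_eq ?_
  have := OZero.parallel (k := k) (Z := muZ) hx hx' hxy hxy' hxz hxz' hl hl' x y z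
  rwa [hd, pow_zero, one_smul] at this

/-- The sequential axiom, with the profiles given up to equality. -/
theorem clO_seq {l0 l1 l2 l' m1 m2 l'' lxy lyz L1 L2 l : List Col} {c c' c'' : Col}
    (h1 : L1 = l1 ++ m1) (h2 : L2 = m2 ++ l2)
    (hx : l0 = l1 ++ c' :: l2) (hy : l' = m1 ++ c'' :: m2)
    (hxy : lxy = l1 ++ (l' ++ l2)) (hyz : lyz = m1 ++ (l'' ++ m2))
    (hxy' : lxy = L1 ++ c'' :: L2)
    (hl : l = L1 ++ (l'' ++ L2)) (hl' : l = l1 ++ (lyz ++ l2))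
    (x : OTerm l0 c) (y : OTerm l' c') (z : OTerm l'' c'') :
    clO k (OTerm.comp hxy' hl (OTerm.comp hx hxy x y) z)
      = clO k (OTerm.comp hx hl' x (OTerm.comp hy hyz y z)) := by
  subst h1 h2
  exact clO_eq (OZero.sequential hx hy hxy hyz hxy' hl hl' x y z)

theorem clO_mu_a {n : ℕ} (h : n ≠ 0) : clO k (OTerm.mu .a n) = 0 :=
  (Submodule.Quotient.mk_eq_zero _).2 (OZero.gen ⟨rfl, by change n + 2 > 2; omega⟩)

/-- The profile of `μ^a_2`. -/
abbrev aa : List Col := List.replicate (0 + 1) Col.a ++ [Col.a]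

/-- The product `μ^a_2` is associative, since `μ^a_3` vanishes. -/
theorem clO_assoc (hx : aa = [Col.a] ++ Col.a :: []) (hx' : aa = [] ++ Col.a :: [Col.a])
    {l : List Col} (hl : l = [Col.a] ++ (aa ++ [])) (hl' : l = [] ++ (aa ++ [Col.a])) :
    clO k (OTerm.comp hx hl (OTerm.mu .a 0) (OTerm.mu .a 0))
      = clO k (OTerm.comp hx' hl' (OTerm.mu .a 0) (OTerm.mu .a 0)) := by
  subst hl
  have h : OZero k muZ (dMu k .a 1) := by
    have := OZero.diff (OZero.gen (k := k) (Z := muZ) (c := .a) (n := 1)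
      ⟨rfl, by change 1 + 2 > 2; omega⟩)
    rw [dO, Finsupp.linearCombination_single, one_smul] at this
    exact this
  have h2 : dMu k .a 1 = Finsupp.single (OTerm.comp hx rfl (OTerm.mu .a 0) (OTerm.mu .a 0)) 1
      - Finsupp.single (OTerm.comp hx' hl' (OTerm.mu .a 0) (OTerm.mu .a 0)) 1 := by
    rw [dMu, Fin.sum_univ_one]
    erw [Fin.sum_univ_two]
    refine (congrArg Neg.neg (congrArg₂ (· + ·)
      (congrArg₂ Finsupp.single (rfl : _ = OTerm.comp hx' hl' (OTerm.mu .a 0) (OTerm.mu .a 0))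
        (by norm_num : _ = (1 : k)))
      (congrArg₂ Finsupp.single (rfl : _ = OTerm.comp hx rfl (OTerm.mu .a 0) (OTerm.mu .a 0))
        (by norm_num : _ = (-1 : k))))).trans ?_
    rw [Finsupp.single_neg]
    abel
  exact clO_eq (h2 ▸ h)

/-- Two insertions of `μ^a_2` can be exchanged, so that the leftmost one comes last. -/
theorem clO_mu_mu {c : Col} {l0 l1' l2' lm l1 l2 l : List Col} (hx0 : l0 = l1' ++ Col.a :: l2')
    (hl0 : lm = l1' ++ (aa ++ l2')) (hx : lm = l1 ++ Col.a :: l2) (hl : l = l1 ++ (aa ++ l2))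
    (h : l1'.length < l1.length) (x : OTerm l0 c) :
    ∃ (lA lB lz l2'' : List Col) (hxz : l0 = lA ++ Col.a :: lB) (hlz : lz = lA ++ (aa ++ lB))
      (hx3 : lz = l1' ++ Col.a :: l2'') (hl3 : l = l1' ++ (aa ++ l2'')),
      lA.length + 1 = l1.length ∧
      clO k (OTerm.comp hx hl (OTerm.comp hx0 hl0 x (OTerm.mu .a 0)) (OTerm.mu .a 0))
        = clO k (OTerm.comp hx3 hl3 (OTerm.comp hxz hlz x (OTerm.mu .a 0)) (OTerm.mu .a 0)) := by
  have h1 : l1' ++ (aa ++ l2') = l1 ++ Col.a :: l2 := hl0.symm.trans hx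
  rw [List.append_eq_append_iff] at h1
  obtain ⟨r, rfl, h2⟩ | ⟨r, rfl, -⟩ := h1
  swap
  · simp at h
  match r, h2, h with
  | [], _, h => simp at h
  | [e], h2, h =>
    obtain ⟨rfl, rfl⟩ : Col.a = e ∧ l2' = l2 := by simpa [aa] using h2
    refine ⟨l1', l2', _, Col.a :: l2', hx0, rfl, rfl, by rw [hl]; simp, by simp, ?_⟩
    subst hl0 hl
    have e1 := clO_seq (k := k) (m1 := [Col.a]) (m2 := []) rfl rfl hx0 rfl rfl rfl hx rfl
      (by simp) x (.mu .a 0) (.mu .a 0)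
    have e2 := clO_seq (k := k) (l1 := l1') (m1 := []) (m2 := [Col.a])
      (l := (l1' ++ [Col.a]) ++ (aa ++ l2')) (L1 := l1') (L2 := Col.a :: l2') (by simp) rfl hx0
      (lyz := [] ++ (aa ++ [Col.a])) rfl rfl rfl (by simp) (by simp) (by simp) x
      (.mu .a 0) (.mu .a 0)
    refine e1.trans ((clO_comp_congr_right _ _ x ?_).trans e2.symm)
    exact clO_assoc _ _ _ _
  | e1 :: e2 :: l3, h2, h =>
    obtain ⟨rfl, rfl, rfl⟩ : Col.a = e1 ∧ Col.a = e2 ∧ l2' = l3 ++ Col.a :: l2 := by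
      simpa [aa] using h2
    refine ⟨l1' ++ Col.a :: l3, l2, _, l3 ++ (aa ++ l2), by rw [hx0]; simp, rfl, by simp,
      by rw [hl]; simp [aa], by simp; omega, ?_⟩
    exact clO_parallel hx0 _ hl0 hx _ _ hl _ x (.mu .a 0) (.mu .a 0) rfl

/-- The cells of `[0,1]`: the two vertices and the interval. -/
inductive Letter : Type
  | z : Letter
  | o : Letter
  | s : Letter
  deriving DecidableEq

/-- The interval that a letter stands for. -/
def Letter.iv : Letter → Iv
  | .z => NonemptyInterval.pure 0
  | .o => NonemptyInterval.pure 1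
  | .s => unitIv

/-- `CubeWord s w t`: the operadic monomial `t` is the normal form of the cell `[0,1]^s × w`. A
vertex `0` is an insertion of `μ^a_2`, and a vertex `1` separates a generator `μ^m` from the
operation that is plugged into its module input. -/
inductive CubeWord : ℕ → List Letter → ∀ {l : List Col}, OTerm l .m → Prop
  | nil (s : ℕ) : CubeWord s [] (OTerm.mu .m s)
  | star {s : ℕ} {w : List Letter} {l : List Col} {t : OTerm l .m} :
      CubeWord (s + 1) w t → CubeWord s (.s :: w) t
  | zero {s : ℕ} {w : List Letter} {l0 l1 l2 l : List Col} {t : OTerm l0 .m}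
      (hx : l0 = l1 ++ Col.a :: l2) (hl : l = l1 ++ (aa ++ l2)) (h1 : l1.length = s) :
      CubeWord s w t → CubeWord s (.z :: w) (OTerm.comp hx hl t (OTerm.mu .a 0))
  | one {s : ℕ} {w : List Letter} {l1 l' l : List Col} {t : OTerm l' .m}
      (hx : List.replicate (s + 1) Col.a ++ [Col.m] = l1 ++ Col.m :: [])
      (hl : l = l1 ++ (l' ++ [])) :
      CubeWord 0 w t → CubeWord s (.o :: w) (OTerm.comp hx hl (OTerm.mu .m s) t)

theorem CubeWord.length {s : ℕ} {w : List Letter} {l : List Col} {t : OTerm l .m}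
    (h : CubeWord s w t) : l.length = s + w.length + 2 := by
  induction h with
  | nil s => simp
  | star _ ih => rw [ih, List.length_cons]; omega
  | zero hx hl h1 _ ih =>
    subst hx hl
    simp at ih ⊢
    omega
  | one hx hl _ ih =>
    have := congrArg List.length hx
    subst hl
    simp at ih this ⊢
    omega

theorem CubeWord.unique {s : ℕ} {w : List Letter} {l l' : List Col} {t : OTerm l .m}
    {t' : OTerm l' .m} (h : CubeWord s w t) (h' : CubeWord s w t') :
    (⟨l, t⟩ : Σ l, OTerm l .m) = ⟨l', t'⟩ := by
  induction h generalizing l' with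
  | nil s => cases h'; rfl
  | star _ ih =>
    cases h' with
    | star h' => exact ih h'
  | zero hx hl h1 _ ih =>
    cases h' with
    | zero hx' hl' h1' h' =>
      cases ih h'
      obtain ⟨rfl, h2⟩ := List.append_inj (hx.symm.trans hx') (h1.trans h1'.symm)
      cases h2
      subst hl hl'
      rfl
  | one hx hl _ ih =>
    cases h' with
    | one hx' hl' h' =>
      cases ih h'
      obtain rfl := List.append_cancel_right (hx.symm.trans hx')
      subst hl hl'
      rfl

theorem CubeWord.exists (s : ℕ) (w : List Letter) :
    ∃ (l : List Col) (t : OTerm l .m), CubeWord s w t := by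
  induction w generalizing s with
  | nil => exact ⟨_, _, .nil s⟩
  | cons a w ih =>
    cases a with
    | s =>
      obtain ⟨l, t, h⟩ := ih (s + 1)
      exact ⟨l, t, .star h⟩
    | z =>
      obtain ⟨l, t, h⟩ := ih s
      have hx : l = List.replicate s Col.a ++ Col.a :: (List.replicate w.length Col.a ++ [Col.m]) := by
        rw [t.isProfile.eq_replicate, h.length,
          show s + w.length + 2 - 1 = s + (w.length + 1) by omega, List.replicate_add,
          List.append_assoc, List.replicate_succ]
        rfl
      exact ⟨_, _, .zero hx rfl (by simp) h⟩
    | o =>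
      obtain ⟨l, t, h⟩ := ih 0
      exact ⟨_, _, .one rfl rfl h⟩

theorem CubeWord.stars (q s n : ℕ) (h : n = s + q) :
    CubeWord s (List.replicate q .s) (OTerm.mu .m n) := by
  induction q generalizing s with
  | zero => subst h; exact .nil _
  | succ q ih => exact .star (ih (s + 1) (by omega))

/-- Plugging `μ^a_2` into an algebra input of a normal form. -/
theorem CubeWord.comp_a {s : ℕ} {w : List Letter} {l0 : List Col} {t : OTerm l0 .m}
    (h : CubeWord s w t) (i : ℕ) {l1 l2 l : List Col} (hx : l0 = l1 ++ Col.a :: l2)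
    (hl : l = l1 ++ (aa ++ l2)) (hi : l1.length = s + i) :
    ∃ (w' : List Letter) (t' : OTerm l .m), CubeWord s w' t' ∧
      clO k t' = clO k (OTerm.comp hx hl t (OTerm.mu .a 0)) := by
  induction h generalizing i l1 l2 l with
  | nil s =>
    rcases i with _ | i
    · exact ⟨_, _, .zero hx hl hi (.nil s), rfl⟩
    · exfalso
      have h1 : l2.length = 0 := by
        have := congrArg List.length hx
        simp at this
        omega
      obtain rfl := List.length_eq_zero_iff.1 h1
      simpa using (List.append_inj' hx rfl).2
  | @star s w l0 t h0 ih =>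
    rcases i with _ | i
    · exact ⟨_, _, .zero hx hl hi (.star h0), rfl⟩
    · obtain ⟨w', t', h1, h2⟩ := ih i hx hl (by omega)
      exact ⟨_, t', .star h1, h2⟩
  | @zero s w l0 l1' l2' lm t hx0 hl0 h1 h0 ih =>
    rcases i with _ | i
    · exact ⟨_, _, .zero hx hl hi (.zero hx0 hl0 h1 h0), rfl⟩
    · obtain ⟨lA, lB, lz, l2'', hxz, hlz, hx3, hl3, h2, h3⟩ :=
        clO_mu_mu (k := k) hx0 hl0 hx hl (by omega) t
      obtain ⟨w', t', h4, h5⟩ := ih i hxz hlz (by omega)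
      exact ⟨_, _, .zero hx3 hl3 h1 h4, by rw [h3]; exact clO_comp_congr_left _ _ _ h5⟩
  | @one s w l1' l' lm t hx0 hl0 h0 ih =>
    rcases i with _ | i
    · exact ⟨_, _, .zero hx hl hi (.one hx0 hl0 h0), rfl⟩
    · have hlen : l1'.length = s + 1 := by
        have := congrArg List.length hx0
        simp at this
        omega
      obtain ⟨r, rfl, h2⟩ : ∃ r, l1 = l1' ++ r ∧ l' = r ++ Col.a :: l2 := by
        have h1 : l1' ++ l' = l1 ++ Col.a :: l2 := by rw [← hx, hl0, List.append_nil]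
        obtain h2 | ⟨r, rfl, h2⟩ := List.append_eq_append_iff.1 h1
        · exact h2
        · rw [List.length_append] at hlen
          obtain rfl := List.length_eq_zero_iff.1 (show r.length = 0 by omega)
          exact ⟨[], by simp, by simpa using h2.symm⟩
      obtain ⟨w', t', h3, h4⟩ := ih i h2 rfl (by simp at hi; omega)
      refine ⟨_, _, .one hx0 (by rw [hl]; simp) h3, ?_⟩
      refine (clO_comp_congr_right _ _ _ h4).trans ?_
      exact (clO_seq rfl (by simp) hx0 h2 hl0 rfl hx hl _ (.mu .m s) t (.mu .a 0)).symm

theorem OTerm.eq_append_m {l : List Col} (t : OTerm l .m) : ∃ l', l = l' ++ [Col.m] :=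
  ⟨_, t.isProfile.eq_replicate⟩

/-- Plugging `μ^m` into the module input of a normal form. -/
theorem CubeWord.comp_m {s : ℕ} {w : List Letter} {l0 : List Col} {t : OTerm l0 .m}
    (h : CubeWord s w t) (q : ℕ) {l1 l : List Col} (hx : l0 = l1 ++ Col.m :: [])
    (hl : l = l1 ++ ((List.replicate (q + 1) Col.a ++ [Col.m]) ++ [])) :
    ∃ (w' : List Letter) (t' : OTerm l .m), CubeWord s w' t' ∧
      clO k t' = clO k (OTerm.comp hx hl t (OTerm.mu .m q)) := by
  induction h generalizing l1 l with
  | nil s => exact ⟨_, _, .one hx hl (CubeWord.stars q 0 q (by omega)), rfl⟩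
  | @star s w l0 t h0 ih =>
    obtain ⟨w', t', h1, h2⟩ := ih hx hl
    exact ⟨_, t', .star h1, h2⟩
  | @zero s w l0 l1' l2' lm t hx0 hl0 h1 h0 ih =>
    obtain ⟨r, rfl⟩ : ∃ r, l2' = r ++ [Col.m] := by
      have h2 := t.isProfile
      rw [hx0] at h2
      obtain ⟨-, ⟨h3, -⟩ | ⟨-, h3⟩⟩ := h2.append_cons
      · cases h3
      · exact ⟨_, h3.eq_replicate⟩
    obtain rfl : l1 = l1' ++ (aa ++ r) := by
      refine List.append_cancel_right (bs := [Col.m]) ?_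
      rw [← hx, hl0]; simp
    obtain ⟨w', t', h3, h4⟩ := ih (l1 := l1' ++ Col.a :: r) (by rw [hx0]; simp) rfl
    refine ⟨_, _, .zero (l1 := l1')
      (l2 := r ++ ((List.replicate (q + 1) Col.a ++ [Col.m]) ++ [])) (by simp) (by rw [hl]; simp)
      h1 h3, ?_⟩
    refine (clO_comp_congr_left _ _ _ h4).trans ?_
    exact (clO_parallel hx0 _ hl0 hx _ _ hl _ t (.mu .a 0) (.mu .m q) (zero_mul _)).symm
  | @one s w l1' l' lm t hx0 hl0 h0 ih =>
    obtain ⟨m1, rfl⟩ := t.eq_append_m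
    obtain rfl : l1 = l1' ++ m1 := by
      refine List.append_cancel_right (bs := [Col.m]) ?_
      rw [← hx, hl0]; simp
    obtain ⟨w', t', h3, h4⟩ := ih (l1 := m1) rfl rfl
    refine ⟨_, _, .one hx0 (by rw [hl]; simp) h3, ?_⟩
    refine (clO_comp_congr_right _ _ _ h4).trans ?_
    exact (clO_seq rfl (by simp) hx0 rfl hl0 rfl hx hl _ (.mu .m s) t (.mu .m q)).symm

theorem muR_a_zero : muR k .a 0 = boxR k [] := by simp [muR, boxR]

/-- Composition of monomials that are realized by boxes. -/
theorem real_comp_box {l0 l1 l2 l' l : List Col} {c c' : Col} (hx : l0 = l1 ++ c' :: l2)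
    (hl : l = l1 ++ (l' ++ l2)) {x : OTerm l0 c} {y : OTerm l' c'} {v w : Box}
    (hv : x.real k = emb k [] (boxR k v)) (hw : y.real k = emb k [] (boxR k w))
    (h : (v ++ w).length = Slot.inputs (compSlots c c' l1.length l0.length l'.length)) :
    (OTerm.comp hx hl x y).real k
      = emb k [] (boxR k (evalBox (compSlots c c' l1.length l0.length l'.length) (v ++ w))) := by
  rw [OTerm.real, hv, hw, ← bil_comp_boxR h]
  exact bil_emb [] [] [] _ (fun _ _ => rfl) _ _

/-- The normal form of a cell is realized by that cell. -/
theorem CubeWord.real {s : ℕ} {w : List Letter} {l : List Col} {t : OTerm l .m}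
    (h : CubeWord s w t) :
    t.real k = emb k [] (boxR k (List.replicate s unitIv ++ w.map Letter.iv)) := by
  induction h with
  | nil s => rw [OTerm.real, muR, List.map_nil, List.append_nil]
  | star _ ih => rw [ih, List.replicate_succ', List.append_assoc]; rfl
  | @zero s w l0 l1' l2' lm t hx0 hl0 h1 h0 ih =>
    have hlen := h0.length
    rw [real_comp_box hx0 hl0 ih (w := []) (by rw [OTerm.real, muR_a_zero]), List.append_nil,
      evalBox, eval_comp_a affLaws_affIv (by simp [h1]) (by simp; omega)]
    · rfl
    · simp [compSlots, inputs_append, inputs_copies, Slot.inputs]; omega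
  | @one s w l1' l' lm t hx0 hl0 h0 ih =>
    have hlen := h0.length
    rw [real_comp_box hx0 hl0 (v := List.replicate s unitIv) (by rw [OTerm.real, muR]) ih,
      evalBox, eval_comp_m affLaws_affIv (by simp) (by simp; omega)]
    · rfl
    · have h2 : ¬ l'.length ≤ 1 := by omega
      simp [compSlots, inputs_append, inputs_copies, Slot.inputs, h2]; omega

/-- The normal forms of the operations with output `m`: the unit, and those of cells of cubes. -/
inductive CubeForm : Option (List Letter) → ∀ {l : List Col}, OTerm l .m → Prop
  | one : CubeForm none (OTerm.one .m)
  | word {w : List Letter} {l : List Col} {t : OTerm l .m} : CubeWord 0 w t → CubeForm (some w) t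

/-- The normal forms of the operations with output `a`: the iterated products
`((x₁ x₂) x₃) ⋯ xₙ`. -/
inductive AssocForm : ∀ {l : List Col}, OTerm l .a → Prop
  | one : AssocForm (OTerm.one .a)
  | step {l0 l2 l : List Col} {t : OTerm l0 .a} (hx : l0 = [] ++ Col.a :: l2)
      (hl : l = [] ++ (aa ++ l2)) : AssocForm t → AssocForm (OTerm.comp hx hl t (OTerm.mu .a 0))

/-- The normal forms of operadic monomials. -/
def IsFormO : ∀ {l : List Col} {c : Col}, OTerm l c → Prop
  | _, .m, t => ∃ u, CubeForm u t
  | _, .a, t => AssocForm t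

theorem CubeForm.unique {u : Option (List Letter)} {l l' : List Col} {t : OTerm l .m}
    {t' : OTerm l' .m} (h : CubeForm u t) (h' : CubeForm u t') :
    (⟨l, t⟩ : Σ l, OTerm l .m) = ⟨l', t'⟩ := by
  cases h with
  | one => cases h'; rfl
  | word h =>
    cases h' with
    | word h' => exact h.unique h'

theorem AssocForm.unique {l l' : List Col} {t : OTerm l .a} {t' : OTerm l' .a} (h : AssocForm t)
    (h' : AssocForm t') (hl : l.length = l'.length) :
    (⟨l, t⟩ : Σ l, OTerm l .a) = ⟨l', t'⟩ := by
  induction h generalizing l' with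
  | one =>
    cases h' with
    | one => rfl
    | step hx hl' h' =>
      subst hl'
      simp at hl
  | step hx hl0 h ih =>
    cases h' with
    | one =>
      subst hl0
      simp at hl
    | step hx' hl' h' =>
      cases ih h' (by subst hx hx' hl0 hl'; simpa using hl)
      obtain rfl := (List.cons.inj (hx.symm.trans hx')).2
      subst hl0 hl'
      rfl

theorem AssocForm.exists (n : ℕ) :
    ∃ (t : OTerm (List.replicate (n + 1) Col.a) .a), AssocForm t := by
  induction n with
  | zero => exact ⟨_, .one⟩
  | succ n ih =>
    obtain ⟨t, h⟩ := ih
    exact ⟨_, .step (l2 := List.replicate n Col.a) rfl rfl h⟩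

theorem AssocForm.real {l : List Col} {t : OTerm l .a} (h : AssocForm t) :
    t.real k = emb k [] (boxR k []) := by
  induction h with
  | one => simp [OTerm.real, emb, boxR]
  | @step l0 l2 l t hx hl h ih =>
    rw [real_comp_box hx hl ih (w := []) (by rw [OTerm.real, muR_a_zero])]
    · rfl
    · rfl

theorem CubeForm.real {u : Option (List Letter)} {l : List Col} {t : OTerm l .m}
    (h : CubeForm u t) : t.real k = emb k [] (boxR k ((u.getD []).map Letter.iv)) := by
  cases h with
  | one => simp [OTerm.real, emb, boxR]
  | word h => exact h.real

/-- Plugging `μ^a_2` into an iterated product. -/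
theorem AssocForm.comp_a {l0 : List Col} {t : OTerm l0 .a} (h : AssocForm t) {l1 l2 l : List Col}
    (hx : l0 = l1 ++ Col.a :: l2) (hl : l = l1 ++ (aa ++ l2)) :
    ∃ t' : OTerm l .a, AssocForm t' ∧ clO k t' = clO k (OTerm.comp hx hl t (OTerm.mu .a 0)) := by
  by_cases h1 : l1 = []
  · subst h1
    exact ⟨_, .step hx hl h, rfl⟩
  induction h generalizing l1 l2 l with
  | one =>
    cases l1 with
    | nil => exact absurd rfl h1
    | cons e l1 => simp at hx
  | @step l0 l2' lm t hx0 hl0 h0 ih =>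
    obtain ⟨lA, lB, lz, l2'', hxz, hlz, hx3, hl3, h2, h3⟩ :=
      clO_mu_mu (k := k) hx0 hl0 hx hl (List.length_pos_iff.2 h1) t
    obtain ⟨t', h4, h5⟩ : ∃ t' : OTerm lz .a, AssocForm t' ∧
        clO k t' = clO k (OTerm.comp hxz hlz t (OTerm.mu .a 0)) := by
      by_cases hA : lA = []
      · subst hA
        exact ⟨_, .step hxz hlz h0, rfl⟩
      · exact ih hxz hlz hA
    exact ⟨_, .step hx3 hl3 h4, by rw [h3]; exact clO_comp_congr_left _ _ _ h5⟩

theorem clO_comp_eq_zero {l0 l1 l2 l' l : List Col} {c c' : Col} (hx : l0 = l1 ++ c' :: l2)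
    (hl : l = l1 ++ (l' ++ l2)) (x : OTerm l0 c) {y : OTerm l' c'} (h : clO k y = 0) :
    clO k (OTerm.comp hx hl x y) = 0 := by
  rw [clO_comp, h]
  exact map_zero _

/-- Plugging a generator into a normal form. -/
theorem IsFormO.comp_mu {l0 l1 l2 l : List Col} {c c' : Col} (hx : l0 = l1 ++ c' :: l2) (n : ℕ)
    (hl : l = l1 ++ ((List.replicate (n + 1) Col.a ++ [c']) ++ l2)) {x : OTerm l0 c}
    (h : IsFormO x) :
    clO k (OTerm.comp hx hl x (OTerm.mu c' n)) = 0 ∨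
      ∃ t : OTerm l c, IsFormO t ∧ clO k t = clO k (OTerm.comp hx hl x (OTerm.mu c' n)) := by
  by_cases hz : c' = .a ∧ n ≠ 0
  · obtain ⟨rfl, hn⟩ := hz
    exact .inl (clO_comp_eq_zero hx hl x (clO_mu_a hn))
  refine .inr ?_
  have hp := x.isProfile
  rw [hx] at hp
  cases c with
  | a =>
    obtain rfl : c' = .a := by
      obtain ⟨-, ⟨h1, -⟩ | ⟨h1, -⟩⟩ := hp.append_cons <;> exact h1
    obtain rfl : n = 0 := by simpa using hz
    obtain ⟨t', h1, h2⟩ := AssocForm.comp_a (k := k) h hx hl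
    exact ⟨t', h1, h2⟩
  | m =>
    obtain ⟨u, hu⟩ := h
    cases hu with
    | one =>
      obtain ⟨rfl, rfl, rfl⟩ : l1 = [] ∧ c' = .m ∧ l2 = [] := by
        cases l1 with
        | nil => simpa [eq_comm] using hx
        | cons e l1 => simp at hx
      simp only [List.nil_append, List.append_nil] at hl
      subst hl
      exact ⟨_, ⟨_, .word (CubeWord.stars n 0 n (by omega))⟩,
        (clO_eq (OZero.one_comp hx _ (OTerm.mu .m n))).symm⟩
    | word hw =>
      cases c' with
      | a =>
        obtain rfl : n = 0 := by simpa using hz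
        obtain ⟨w', t', h1, h2⟩ := hw.comp_a (k := k) l1.length hx hl (by omega)
        exact ⟨t', ⟨_, .word h1⟩, h2⟩
      | m =>
        obtain ⟨-, ⟨-, rfl⟩ | ⟨h1, -⟩⟩ := hp.append_cons
        · obtain ⟨w', t', h1, h2⟩ := hw.comp_m (k := k) n hx hl
          exact ⟨t', ⟨_, .word h1⟩, h2⟩
        · cases h1

/-- Every operation that is plugged into a normal form can be reduced. -/
theorem IsFormO.comp {l' : List Col} {c' : Col} (y : OTerm l' c') {l0 l1 l2 l : List Col} {c : Col}
    (hx : l0 = l1 ++ c' :: l2) (hl : l = l1 ++ (l' ++ l2)) {x : OTerm l0 c} (h : IsFormO x) :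
    clO k (OTerm.comp hx hl x y) = 0 ∨
      ∃ t : OTerm l c, IsFormO t ∧ clO k t = clO k (OTerm.comp hx hl x y) := by
  induction y generalizing l0 l1 l2 l c with
  | one c' =>
    obtain rfl : l0 = l := by rw [hx, hl]; simp
    exact .inr ⟨x, h, (clO_eq (OZero.comp_one hx hl x)).symm⟩
  | mu c' n => exact h.comp_mu hx n hl
  | @comp m0 m1 m2 l'' ly c'' c3 hy hyz y z ihy ihz =>
    have e := clO_seq (k := k) (L1 := l1 ++ m1) (L2 := m2 ++ l2) rfl rfl hx hy rfl hyz
      (by rw [hy]; simp) (l := l) (by rw [hl, hyz]; simp) hl x y z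
    obtain h0 | ⟨t, ht, h1⟩ := ihy hx rfl h
    · left
      rw [← e, clO_comp, h0]
      exact (congrFun (congrArg DFunLike.coe (map_zero _)) _)
    · obtain h2 | ⟨t', ht', h3⟩ := ihz (l1 := l1 ++ m1) (l2 := m2 ++ l2) (l := l)
        (by rw [hy]; simp) (by rw [hl, hyz]; simp) ht
      · left
        rw [← e, ← h2]
        exact clO_comp_congr_left _ _ _ h1.symm
      · refine .inr ⟨t', ht', h3.trans ?_⟩
        rw [← e]
        exact clO_comp_congr_left _ _ _ h1

/-- Every operadic monomial vanishes in `Ω` or is equal to a normal form. -/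
theorem exists_isFormO {l : List Col} {c : Col} (x : OTerm l c) :
    clO k x = 0 ∨ ∃ t : OTerm l c, IsFormO t ∧ clO k t = clO k x := by
  induction x with
  | one c =>
    refine .inr ⟨_, ?_, rfl⟩
    cases c with
    | a => exact AssocForm.one
    | m => exact ⟨_, .one⟩
  | mu c n =>
    cases c with
    | a =>
      by_cases hn : n = 0
      · subst hn
        refine .inr ⟨_, AssocForm.step (l2 := []) rfl rfl .one, ?_⟩
        exact clO_eq (OZero.one_comp rfl rfl (OTerm.mu .a 0))
      · exact .inl (clO_mu_a hn)
    | m => exact .inr ⟨_, ⟨_, .word (CubeWord.stars n 0 n (by omega))⟩, rfl⟩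
  | @comp l0 l1 l2 l' l c c' hx hl x y ihx _ =>
    obtain h0 | ⟨t, ht, h1⟩ := ihx
    · left
      rw [clO_comp, h0]
      exact (congrFun (congrArg DFunLike.coe (map_zero _)) _)
    · obtain h2 | ⟨t', ht', h3⟩ := IsFormO.comp (k := k) y hx hl ht
      · left
        rw [← h2]
        exact clO_comp_congr_left _ _ _ h1.symm
      · exact .inr ⟨t', ht', h3.trans (clO_comp_congr_left _ _ _ h1)⟩

end

/-! ### Relations in the bimodule -/

section

variable {k : Type u} [Field k]

theorem clB_eq {o : Out} {l : List Col} {x y : BTerm o l}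
    (h : BZero k muZ fW (Finsupp.single x 1 - Finsupp.single y 1)) : clB k x = clB k y :=
  (Submodule.Quotient.eq _).2 h

theorem clB_eq_smul {o : Out} {l : List Col} {x y : BTerm o l} {s : k}
    (h : BZero k muZ fW (Finsupp.single x 1 - s • Finsupp.single y 1)) :
    clB k x = s • clB k y :=
  (Submodule.Quotient.eq _).2 h

theorem clB_right {l0 l1 l2 l' l : List Col} {c c' : Col} (hx : l0 = l1 ++ c' :: l2)
    (hl : l = l1 ++ (l' ++ l2)) (x : BTerm (.single c) l0) (y : OTerm l' c') :
    clB k (BTerm.right hx hl x y) = (omegaT k).right hx hl (clB k x) (clO k y) := by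
  change _ = Submodule.Quotient.mk (bil (BTerm.right hx hl) (Finsupp.single x 1)
    (Finsupp.single y 1))
  rw [bil_single, mul_one]
  rfl

/-- The left action on classes of tuples. -/
noncomputable def leftQ (k : Type u) [Field k] (cs l : List Col) (c : Col) :
    OQuot k muZ cs c →ₗ[k] BQuot k muZ fW (.tuple cs) l →ₗ[k] BQuot k muZ fW (.single c) l :=
  bilQ (idealO k _ _ _) (idealB k _ _ _ _) (idealB k _ _ _ _) (bil BTerm.left)
    (fun _ h y => BZero.left_left y h) (fun x _ h => BZero.left_right x h)

theorem clB_left {cs l : List Col} {c : Col} (x : OTerm cs c) (T : BTerm (.tuple cs) l) :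
    clB k (BTerm.left x T) = leftQ k cs l c (clO k x) (clB k T) := by
  change _ = Submodule.Quotient.mk (bil BTerm.left (Finsupp.single x 1) (Finsupp.single T 1))
  rw [bil_single, mul_one]
  rfl

/-- Prolongation of classes of tuples. -/
noncomputable def consQ (k : Type u) [Field k] {l1 l2 l : List Col} (c : Col) (cs : List Col)
    (hl : l = l1 ++ l2) :
    BQuot k muZ fW (.single c) l1 →ₗ[k] BQuot k muZ fW (.tuple cs) l2 →ₗ[k]
      BQuot k muZ fW (.tuple (c :: cs)) l :=
  bilQ (idealB k _ _ _ _) (idealB k _ _ _ _) (idealB k _ _ _ _) (bil (BTerm.cons hl))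
    (fun _ h y => BZero.cons_left hl y h) (fun x _ h => BZero.cons_right hl x h)

theorem clB_cons {c : Col} {cs l1 l2 l : List Col} (hl : l = l1 ++ l2) (t : BTerm (.single c) l1)
    (T : BTerm (.tuple cs) l2) :
    clB k (BTerm.cons hl t T) = consQ k c cs hl (clB k t) (clB k T) := by
  change _ = Submodule.Quotient.mk (bil (BTerm.cons hl) (Finsupp.single t 1) (Finsupp.single T 1))
  rw [bil_single, mul_one]
  rfl

theorem clB_right_congr {l0 l1 l2 l' l : List Col} {c c' : Col} (hx : l0 = l1 ++ c' :: l2)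
    (hl : l = l1 ++ (l' ++ l2)) {x x' : BTerm (.single c) l0} (y : OTerm l' c') {s : k}
    (h : clB k x = s • clB k x') :
    clB k (BTerm.right hx hl x y) = s • clB k (BTerm.right hx hl x' y) := by
  rw [clB_right, clB_right, h]
  exact congrFun (congrArg DFunLike.coe (map_smul ((omegaT k).right hx hl) s (clB k x'))) _

theorem clB_right_congr_right {l0 l1 l2 l' l : List Col} {c c' : Col} (hx : l0 = l1 ++ c' :: l2)
    (hl : l = l1 ++ (l' ++ l2)) (x : BTerm (.single c) l0) {y y' : OTerm l' c'}
    (h : clO k y = clO k y') :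
    clB k (BTerm.right hx hl x y) = clB k (BTerm.right hx hl x y') := by
  rw [clB_right, clB_right, h]

theorem clB_right_zero_left {l0 l1 l2 l' l : List Col} {c c' : Col} (hx : l0 = l1 ++ c' :: l2)
    (hl : l = l1 ++ (l' ++ l2)) {x : BTerm (.single c) l0} (y : OTerm l' c')
    (h : clB k x = 0) : clB k (BTerm.right hx hl x y) = 0 := by
  have := clB_right_congr (k := k) hx hl (x' := x) (s := 0) y (by rw [h, smul_zero])
  rwa [zero_smul] at this

theorem clB_right_zero_right {l0 l1 l2 l' l : List Col} {c c' : Col} (hx : l0 = l1 ++ c' :: l2)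
    (hl : l = l1 ++ (l' ++ l2)) (x : BTerm (.single c) l0) {y : OTerm l' c'}
    (h : clO k y = 0) : clB k (BTerm.right hx hl x y) = 0 := by
  rw [clB_right, h]
  exact map_zero _

theorem clB_left_congr {cs l : List Col} {c : Col} (x : OTerm cs c) {T T' : BTerm (.tuple cs) l}
    {s : k} (h : clB k T = s • clB k T') :
    clB k (BTerm.left x T) = s • clB k (BTerm.left x T') := by
  rw [clB_left, clB_left, h, map_smul]

theorem clB_cons_congr {c : Col} {cs l1 l2 l : List Col} (hl : l = l1 ++ l2)
    {t t' : BTerm (.single c) l1} (T : BTerm (.tuple cs) l2) {s : k}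
    (h : clB k t = s • clB k t') :
    clB k (BTerm.cons hl t T) = s • clB k (BTerm.cons hl t' T) := by
  rw [clB_cons, clB_cons, h, map_smul, LinearMap.smul_apply]

theorem clB_cons_congr_right {c : Col} {cs l1 l2 l : List Col} (hl : l = l1 ++ l2)
    (t : BTerm (.single c) l1) {T T' : BTerm (.tuple cs) l2} {s : k}
    (h : clB k T = s • clB k T') :
    clB k (BTerm.cons hl t T) = s • clB k (BTerm.cons hl t T') := by
  rw [clB_cons, clB_cons, h, map_smul]

theorem clB_appendTo_congr {cs' l' : List Col} {T T' : BTerm (.tuple cs') l'} {o : Out}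
    {l : List Col} (T1 : BTerm o l) {s : k} (h : clB k T = s • clB k T') :
    clB k (BTerm.appendTo T T1) = s • clB k (BTerm.appendTo T' T1) := by
  induction T1 with
  | f c n => exact clB_cons_congr_right _ _ h
  | right hx hl x y _ => exact clB_cons_congr_right _ _ h
  | left x T1 _ => exact clB_cons_congr_right _ _ h
  | nil => exact h
  | cons hl t T1 _ ih => exact clB_cons_congr_right _ _ ih

theorem clB_seq {l0 l1 l2 l' m1 m2 l'' lxy lyz L1 L2 l : List Col} {c c' c'' : Col}
    (h1 : L1 = l1 ++ m1) (h2 : L2 = m2 ++ l2)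
    (hx : l0 = l1 ++ c' :: l2) (hy : l' = m1 ++ c'' :: m2)
    (hxy : lxy = l1 ++ (l' ++ l2)) (hyz : lyz = m1 ++ (l'' ++ m2))
    (hxy' : lxy = L1 ++ c'' :: L2)
    (hl : l = L1 ++ (l'' ++ L2)) (hl' : l = l1 ++ (lyz ++ l2))
    (x : BTerm (.single c) l0) (y : OTerm l' c') (z : OTerm l'' c'') :
    clB k (BTerm.right hxy' hl (BTerm.right hx hxy x y) z)
      = clB k (BTerm.right hx hl' x (OTerm.comp hy hyz y z)) := by
  subst h1 h2
  exact clB_eq (BZero.right_sequential hx hy hxy hyz hxy' hl hl' x y z)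

theorem clB_parallel {l0 l1 l2 l3 l' l'' lxy lxz l : List Col} {c c' c'' : Col}
    (hx : l0 = l1 ++ c' :: (l2 ++ c'' :: l3)) (hx' : l0 = (l1 ++ c' :: l2) ++ c'' :: l3)
    (hxy : lxy = l1 ++ (l' ++ (l2 ++ c'' :: l3)))
    (hxy' : lxy = (l1 ++ (l' ++ l2)) ++ c'' :: l3)
    (hxz : lxz = (l1 ++ c' :: l2) ++ (l'' ++ l3))
    (hxz' : lxz = l1 ++ c' :: (l2 ++ (l'' ++ l3)))
    (hl : l = (l1 ++ (l' ++ l2)) ++ (l'' ++ l3)) (hl' : l = l1 ++ (l' ++ (l2 ++ (l'' ++ l3))))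
    (x : BTerm (.single c) l0) (y : OTerm l' c') (z : OTerm l'' c'') (hd : y.deg * z.deg = 0) :
    clB k (BTerm.right hxy' hl (BTerm.right hx hxy x y) z)
      = clB k (BTerm.right hxz' hl' (BTerm.right hx' hxz x z) y) := by
  refine clB_eq ?_
  have := BZero.right_parallel (k := k) (Z := muZ) (W := fW) hx hx' hxy hxy' hxz hxz' hl hl' x y z
  rwa [hd, pow_zero, one_smul] at this

theorem clB_f_a {n : ℕ} (h : n ≠ 0) : clB k (BTerm.f .a n) = 0 :=
  (Submodule.Quotient.mk_eq_zero _).2 (BZero.gen ⟨rfl, by change n + 1 > 1; omega⟩)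

/-- Two right actions of `μ^a_2` can be exchanged, so that the leftmost one comes last. -/
theorem clB_mu_mu {c : Col} {l0 l1' l2' lm l1 l2 l : List Col} (hx0 : l0 = l1' ++ Col.a :: l2')
    (hl0 : lm = l1' ++ (aa ++ l2')) (hx : lm = l1 ++ Col.a :: l2) (hl : l = l1 ++ (aa ++ l2))
    (h : l1'.length < l1.length) (x : BTerm (.single c) l0) :
    ∃ (lA lB lz l2'' : List Col) (hxz : l0 = lA ++ Col.a :: lB) (hlz : lz = lA ++ (aa ++ lB))
      (hx3 : lz = l1' ++ Col.a :: l2'') (hl3 : l = l1' ++ (aa ++ l2'')),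
      lA.length + 1 = l1.length ∧
      clB k (BTerm.right hx hl (BTerm.right hx0 hl0 x (OTerm.mu .a 0)) (OTerm.mu .a 0))
        = clB k (BTerm.right hx3 hl3 (BTerm.right hxz hlz x (OTerm.mu .a 0)) (OTerm.mu .a 0)) := by
  have h1 : l1' ++ (aa ++ l2') = l1 ++ Col.a :: l2 := hl0.symm.trans hx
  rw [List.append_eq_append_iff] at h1
  obtain ⟨r, rfl, h2⟩ | ⟨r, rfl, -⟩ := h1
  swap
  · simp at h
  match r, h2, h with
  | [], _, h => simp at h
  | [e], h2, h =>
    obtain ⟨rfl, rfl⟩ : Col.a = e ∧ l2' = l2 := by simpa [aa] using h2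
    refine ⟨l1', l2', _, Col.a :: l2', hx0, rfl, rfl, by rw [hl]; simp, by simp, ?_⟩
    subst hl0 hl
    have e1 := clB_seq (k := k) (m1 := [Col.a]) (m2 := []) rfl rfl hx0 rfl rfl rfl hx rfl
      (by simp) x (.mu .a 0) (.mu .a 0)
    have e2 := clB_seq (k := k) (l1 := l1') (m1 := []) (m2 := [Col.a])
      (l := (l1' ++ [Col.a]) ++ (aa ++ l2')) (L1 := l1') (L2 := Col.a :: l2') (by simp) rfl hx0
      (lyz := [] ++ (aa ++ [Col.a])) rfl rfl rfl (by simp) (by simp) (by simp) x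
      (.mu .a 0) (.mu .a 0)
    refine e1.trans ((clB_right_congr_right _ _ x ?_).trans e2.symm)
    exact clO_assoc _ _ _ _
  | e1 :: e2 :: l3, h2, h =>
    obtain ⟨rfl, rfl, rfl⟩ : Col.a = e1 ∧ Col.a = e2 ∧ l2' = l3 ++ Col.a :: l2 := by
      simpa [aa] using h2
    refine ⟨l1' ++ Col.a :: l3, l2, _, l3 ++ (aa ++ l2), by rw [hx0]; simp, rfl, by simp,
      by rw [hl]; simp [aa], by simp; omega, ?_⟩
    exact clB_parallel hx0 _ hl0 hx _ _ hl _ x (.mu .a 0) (.mu .a 0) rfl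

/-- A right action on the last entry of a tuple commutes with left actions. -/
theorem clB_left_right {cs1 R lt m1 m2 lz ltz L1 L2 : List Col} {c c' c'' : Col}
    (h1 : L1 = R ++ m1) (h2 : L2 = m2 ++ [])
    (ht : lt = m1 ++ c'' :: m2) (htz : ltz = m1 ++ (lz ++ m2))
    (hx : R ++ (lt ++ []) = L1 ++ c'' :: L2)
    (hl : R ++ (ltz ++ []) = L1 ++ (lz ++ L2))
    (x : OTerm (cs1 ++ [c']) c) (T1 : BTerm (.tuple cs1) R)
    (t : BTerm (.single c') lt) (z : OTerm lz c'') :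
    clB k (BTerm.right hx hl (BTerm.left x (T1.append (BTerm.cons rfl t BTerm.nil))) z)
      = clB k (BTerm.left x (T1.append (BTerm.cons rfl (BTerm.right ht htz t z) BTerm.nil))) := by
  subst h1 h2
  refine clB_eq ?_
  have := BZero.left_right_comm (k := k) (Z := muZ) (W := fW) ht htz hx hl x T1 t BTerm.nil z
  rwa [show (BTerm.nil).deg = 0 from rfl, mul_zero, pow_zero, one_smul] at this

/-! ### Normal forms in the bimodule -/

/-- The tuple `(f^a_1, …, f^a_1)`. -/
def onesT : ∀ n : ℕ, BTerm (.tuple (List.replicate n Col.a)) (List.replicate n Col.a)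
  | 0 => .nil
  | n + 1 => .cons (l1 := [Col.a]) rfl (.f .a 0) (onesT n)

/-- `FreeWord s v q`: the bimodule monomial `q` is the normal form of the face `[0,1]^s × v` of the
cube. A vertex `1` is a right action of `μ^a_2`, and a vertex `0` separates a left action of `μ^m`
from the operation that it acts on. -/
inductive FreeWord : ℕ → List Letter → ∀ {l : List Col}, BTerm (.single .m) l → Prop
  | nil (s : ℕ) : FreeWord s [] (BTerm.f .m s)
  | star {s : ℕ} {v : List Letter} {l : List Col} {q : BTerm (.single .m) l} :
      FreeWord (s + 1) v q → FreeWord s (.s :: v) q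
  | one {s : ℕ} {v : List Letter} {l0 l1 l2 l : List Col} {q : BTerm (.single .m) l0}
      (hx : l0 = l1 ++ Col.a :: l2) (hl : l = l1 ++ (aa ++ l2)) (h1 : l1.length = s) :
      FreeWord s v q → FreeWord s (.o :: v) (BTerm.right hx hl q (OTerm.mu .a 0))
  | zero {s : ℕ} {v : List Letter} {l : List Col} {q : BTerm (.single .m) l} :
      FreeWord 0 v q → FreeWord s (.z :: v)
        (BTerm.left (OTerm.mu .m s) ((onesT (s + 1)).append (BTerm.cons rfl q BTerm.nil)))

theorem FreeWord.length {s : ℕ} {v : List Letter} {l : List Col} {q : BTerm (.single .m) l}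
    (h : FreeWord s v q) : l.length = s + v.length + 1 := by
  induction h with
  | nil s => simp
  | star _ ih => rw [ih, List.length_cons]; omega
  | one hx hl h1 _ ih =>
    subst hx hl
    simp at ih ⊢
    omega
  | zero _ ih =>
    simp at ih ⊢
    omega

theorem FreeWord.unique {s : ℕ} {v : List Letter} {l l' : List Col} {q : BTerm (.single .m) l}
    {q' : BTerm (.single .m) l'} (h : FreeWord s v q) (h' : FreeWord s v q') :
    (⟨l, q⟩ : Σ l, BTerm (.single .m) l) = ⟨l', q'⟩ := by
  induction h generalizing l' with
  | nil s => cases h'; rfl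
  | star _ ih =>
    cases h' with
    | star h' => exact ih h'
  | one hx hl h1 _ ih =>
    cases h' with
    | one hx' hl' h1' h' =>
      cases ih h'
      obtain ⟨rfl, h2⟩ := List.append_inj (hx.symm.trans hx') (h1.trans h1'.symm)
      cases h2
      subst hl hl'
      rfl
  | zero _ ih =>
    cases h' with
    | zero h' => cases ih h'; rfl

/-- A normal form does not end in a vertex `1`: such cells come from the right action at the
module input. -/
theorem FreeWord.last {s : ℕ} {v : List Letter} {l : List Col} {q : BTerm (.single .m) l}
    (h : FreeWord s v q) : v.getLast? ≠ some .o := by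
  induction h with
  | nil s => simp
  | @star s v l q h ih =>
    cases v with
    | nil => simp
    | cons a v => simpa using ih
  | @one s v l0 l1 l2 l q hx hl h1 h ih =>
    cases v with
    | nil =>
      exfalso
      have h2 := h.length
      have h3 := q.isProfile
      rw [hx] at h2 h3
      have h4 : l2 = [] := List.length_eq_zero_iff.1 (by simp at h2; omega)
      subst h4
      obtain ⟨-, ⟨h5, -⟩ | ⟨-, h5⟩⟩ := h3.append_cons
      · cases h5
      · exact absurd h5.length_pos (by simp)
    | cons a v => simpa using ih
  | @zero s v l q h ih =>
    cases v with
    | nil => simp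
    | cons a v => simpa using ih

theorem FreeWord.exists (s : ℕ) (v : List Letter) (hv : v.getLast? ≠ some .o) :
    ∃ (l : List Col) (q : BTerm (.single .m) l), FreeWord s v q := by
  induction v generalizing s with
  | nil => exact ⟨_, _, .nil s⟩
  | cons a v ih =>
    have hv' : v.getLast? ≠ some .o := by
      cases v with
      | nil => simp
      | cons b v => simpa using hv
    cases a with
    | s =>
      obtain ⟨l, q, h⟩ := ih (s + 1) hv'
      exact ⟨l, q, .star h⟩
    | o =>
      obtain ⟨n, hn⟩ : ∃ n, v.length = n + 1 := by
        cases v with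
        | nil => simp at hv
        | cons b v => exact ⟨_, rfl⟩
      obtain ⟨l, q, h⟩ := ih s hv'
      have hx : l = List.replicate s Col.a ++ Col.a :: (List.replicate n Col.a ++ [Col.m]) := by
        rw [q.isProfile.eq_replicate, h.length, hn,
          show s + (n + 1) + 1 - 1 = s + (n + 1) by omega, List.replicate_add,
          List.append_assoc, List.replicate_succ]
        rfl
      exact ⟨_, _, .one hx rfl (by simp) h⟩
    | z =>
      obtain ⟨l, q, h⟩ := ih 0 hv'
      exact ⟨_, _, .zero h⟩

theorem FreeWord.add_stars {s r : ℕ} {v : List Letter} {l : List Col} {q : BTerm (.single .m) l}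
    (n : ℕ) (hr : r = s + n) (h : FreeWord r v q) : FreeWord s (List.replicate n .s ++ v) q := by
  induction n generalizing s with
  | zero => subst hr; exact h
  | succ n ih => exact .star (ih (by omega))

/-- The right action of `μ^a_2` on a normal form. -/
theorem FreeWord.right_a {s : ℕ} {v : List Letter} {l0 : List Col} {q : BTerm (.single .m) l0}
    (h : FreeWord s v q) (i : ℕ) {l1 l2 l : List Col} (hx : l0 = l1 ++ Col.a :: l2)
    (hl : l = l1 ++ (aa ++ l2)) (hi : l1.length = s + i) :
    ∃ (v' : List Letter) (q' : BTerm (.single .m) l), FreeWord s v' q' ∧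
      clB k q' = clB k (BTerm.right hx hl q (OTerm.mu .a 0)) := by
  induction h generalizing i l1 l2 l with
  | nil s =>
    exfalso
    have h1 : l2.length = 0 := by
      have := congrArg List.length hx
      simp at this
      omega
    obtain rfl := List.length_eq_zero_iff.1 h1
    simpa using (List.append_inj' hx rfl).2
  | @star s v l0 q h0 ih =>
    rcases i with _ | i
    · exact ⟨_, _, .one hx hl hi (.star h0), rfl⟩
    · obtain ⟨v', q', h1, h2⟩ := ih i hx hl (by omega)
      exact ⟨_, q', .star h1, h2⟩
  | @one s v l0 l1' l2' lm q hx0 hl0 h1 h0 ih =>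
    rcases i with _ | i
    · exact ⟨_, _, .one hx hl hi (.one hx0 hl0 h1 h0), rfl⟩
    · obtain ⟨lA, lB, lz, l2'', hxz, hlz, hx3, hl3, h2, h3⟩ :=
        clB_mu_mu (k := k) hx0 hl0 hx hl (by omega) q
      obtain ⟨v', q', h4, h5⟩ := ih i hxz hlz (by omega)
      refine ⟨_, _, .one hx3 hl3 h1 h4, ?_⟩
      rw [h3, clB_right, clB_right, h5]
  | @zero s v lq q h0 ih =>
    rcases i with _ | i
    · exact ⟨_, _, .one hx hl hi (.zero h0), rfl⟩
    · obtain ⟨m1, rfl, h2⟩ : ∃ m1, l1 = List.replicate (s + 1) Col.a ++ m1 ∧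
          lq = m1 ++ Col.a :: l2 := by
        have h1 : List.replicate (s + 1) Col.a ++ lq = l1 ++ Col.a :: l2 := by
          rw [← hx, List.append_nil]
        obtain h2 | ⟨r, h3, h2⟩ := List.append_eq_append_iff.1 h1
        · exact h2
        · have h4 := congrArg List.length h3
          rw [List.length_append, List.length_replicate] at h4
          obtain rfl := List.length_eq_zero_iff.1 (show r.length = 0 by omega)
          exact ⟨[], by simpa using h3.symm, by simpa using h2.symm⟩
      obtain ⟨v', q', h3, h4⟩ := ih i h2 rfl (by simp at hi; omega)
      have hl' : l = List.replicate (s + 1) Col.a ++ ((m1 ++ (aa ++ l2)) ++ []) := by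
        rw [hl]; simp
      subst hl'
      refine ⟨_, _, .zero h3, ?_⟩
      rw [clB_left_right rfl (by simp) h2 rfl hx hl]
      have h5 := clB_left_congr (k := k) (OTerm.mu .m s) (clB_appendTo_congr (onesT (s + 1))
        (clB_cons_congr rfl BTerm.nil (s := 1) (h4.trans (one_smul k _).symm)))
      rw [one_smul] at h5
      exact h5

end

/-! ### Reduction of bimodule monomials -/

section

variable {k : Type u} [Field k]

/-- The normal forms of the bimodule monomials that are not right actions at the last input. -/
inductive IsCore : ∀ {l : List Col} {c : Col}, BTerm (.single c) l → Prop
  | a : IsCore (BTerm.f .a 0)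
  | m {v : List Letter} {l : List Col} {q : BTerm (.single .m) l} : FreeWord 0 v q → IsCore q

/-- Right actions, at the last input, on the normal forms of `IsCore`. -/
inductive IsSemi : ∀ {l : List Col} {c : Col}, BTerm (.single c) l → Prop
  | mk {l0 l1 l' l : List Col} {c : Col} (hx : l0 = l1 ++ c :: []) (hl : l = l1 ++ (l' ++ []))
      {q : BTerm (.single c) l0} (y : OTerm l' c) : IsCore q → IsSemi (BTerm.right hx hl q y)

/-- The class of a monomial is a multiple of the class of a monomial with `IsSemi`. -/
def Red (k : Type u) [Field k] {l : List Col} {c : Col} (x : BTerm (.single c) l) : Prop :=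
  clB k x = 0 ∨ ∃ t : BTerm (.single c) l, IsSemi t ∧ ∃ s : k, clB k x = s • clB k t

theorem Red.congr {l : List Col} {c : Col} {x y : BTerm (.single c) l} {s : k}
    (h : clB k x = s • clB k y) (hy : Red k y) : Red k x := by
  obtain h0 | ⟨t, ht, s', h1⟩ := hy
  · exact .inl (by rw [h, h0, smul_zero])
  · exact .inr ⟨t, ht, s * s', by rw [h, h1, smul_smul]⟩

theorem Red.of_eq {l : List Col} {c : Col} {x y : BTerm (.single c) l}
    (h : clB k x = clB k y) (hy : Red k y) : Red k x :=
  Red.congr (s := 1) (by rw [h, one_smul]) hy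

theorem IsSemi.red {l : List Col} {c : Col} {x : BTerm (.single c) l} (h : IsSemi x) : Red k x :=
  .inr ⟨x, h, 1, (one_smul _ _).symm⟩

theorem IsCore.red {l : List Col} {c : Col} {x : BTerm (.single c) l} (h : IsCore x) :
    Red k x := by
  have hx := x.isProfile.eq_replicate
  refine Red.of_eq ?_ (IsSemi.mk hx (by rw [List.append_nil]; exact hx) (OTerm.one c) h).red
  exact (clB_eq (BZero.right_one hx _ x)).symm

/-- The right action of a generator. -/
theorem IsSemi.right_mu {l0 l1 l2 l : List Col} {c c' : Col} (hx : l0 = l1 ++ c' :: l2) (n : ℕ)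
    (hl : l = l1 ++ ((List.replicate (n + 1) Col.a ++ [c']) ++ l2)) {x : BTerm (.single c) l0}
    (h : IsSemi x) : Red k (BTerm.right hx hl x (OTerm.mu c' n)) := by
  by_cases hz : c' = .a ∧ n ≠ 0
  · obtain ⟨rfl, hn⟩ := hz
    exact .inl (clB_right_zero_right hx hl x (clO_mu_a hn))
  cases h with
  | @mk m0 m1 l' _ _ hx0 hl0 q y hq =>
    have h1 : m1 ++ l' = l1 ++ c' :: l2 := by rw [← hx, hl0, List.append_nil]
    have hseq : ∀ r, l1 = m1 ++ r → l' = r ++ c' :: l2 →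
        Red k (BTerm.right hx hl (BTerm.right hx0 hl0 q y) (OTerm.mu c' n)) := by
      intro r h2 h3
      refine Red.of_eq (clB_seq h2 (by simp) hx0 h3 hl0 rfl hx hl (by rw [hl, h2]; simp) q y _) ?_
      exact (IsSemi.mk _ _ _ hq).red
    obtain ⟨r, h2, h3⟩ | ⟨r, h2, h3⟩ := List.append_eq_append_iff.1 h1
    · exact hseq r h2 h3
    cases r with
    | nil => exact hseq [] (by simpa using h2.symm) (by simpa using h3.symm)
    | cons e r =>
      obtain ⟨rfl, rfl⟩ : c' = e ∧ l2 = r ++ l' := by simpa using h3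
      subst h2
      have hp := q.isProfile
      rw [hx0, List.append_assoc, List.cons_append] at hp
      obtain rfl : c' = .a := by
        obtain ⟨-, ⟨-, h4⟩ | ⟨h4, -⟩⟩ := hp.append_cons
        · simp at h4
        · exact h4
      obtain rfl : n = 0 := by simpa using hz
      cases hq with
      | a =>
        have := congrArg List.length hx0
        simp at this
        omega
      | @m v _ q hq =>
        obtain ⟨v', q', h4, h5⟩ := hq.right_a (k := k) l1.length (l1 := l1) (l2 := r ++ [Col.m])
          (by rw [hx0]; simp) rfl (by omega)
        refine Red.of_eq (y := BTerm.right (l1 := l1 ++ (aa ++ r)) (by simp) (by rw [hl]; simp)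
          q' y) ?_ (IsSemi.mk _ _ _ (.m h4)).red
        have h6 := clB_parallel (k := k) (l1 := l1) (l2 := r) (l3 := []) (l' := aa)
          (by rw [hx0]; simp) hx0 rfl (by simp) hl0
          (by rw [hl0]; simp) (l := l) (by rw [hl]; simp) (by rw [hl]; simp) q (.mu .a 0) y
          (zero_mul _)
        have h7 := clB_right_congr (k := k) (s := 1) (l1 := l1 ++ (aa ++ r)) (c' := .m) (l2 := [])
          (by simp) (l := l) (by rw [hl]; simp) y (h5.trans (one_smul _ _).symm)
        rw [one_smul] at h7
        rw [h7, h6]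
        simp only [List.append_nil]

theorem Red.right_mu {l0 l1 l2 l : List Col} {c c' : Col} (hx : l0 = l1 ++ c' :: l2) (n : ℕ)
    (hl : l = l1 ++ ((List.replicate (n + 1) Col.a ++ [c']) ++ l2)) {x : BTerm (.single c) l0}
    (h : Red k x) : Red k (BTerm.right hx hl x (OTerm.mu c' n)) := by
  obtain h0 | ⟨t, ht, s, h1⟩ := h
  · exact .inl (clB_right_zero_left hx hl _ h0)
  · exact Red.congr (clB_right_congr hx hl _ h1) (ht.right_mu hx n hl)

theorem Red.right {l' : List Col} {c' : Col} (y : OTerm l' c') {l0 l1 l2 l : List Col} {c : Col}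
    (hx : l0 = l1 ++ c' :: l2) (hl : l = l1 ++ (l' ++ l2)) {x : BTerm (.single c) l0}
    (h : Red k x) : Red k (BTerm.right hx hl x y) := by
  induction y generalizing l0 l1 l2 l c with
  | one c' =>
    obtain rfl : l0 = l := by rw [hx, hl]; simp
    exact Red.of_eq (clB_eq (BZero.right_one hx hl x)) h
  | mu c' n => exact h.right_mu hx n hl
  | @comp m0 m1 m2 l'' ly c'' c3 hy hyz y z ihy ihz =>
    have e := clB_seq (k := k) (L1 := l1 ++ m1) (L2 := m2 ++ l2) rfl rfl hx hy rfl hyz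
      (by rw [hy]; simp) (l := l) (by rw [hl, hyz]; simp) hl x y z
    exact Red.of_eq e.symm (ihz _ _ (ihy hx rfl h))

/-- All entries of a tuple have the property `P`. -/
inductive AllT (P : ∀ {l : List Col} {c : Col}, BTerm (.single c) l → Prop) :
    ∀ {cs l : List Col}, BTerm (.tuple cs) l → Prop
  | nil : AllT P BTerm.nil
  | cons {c : Col} {cs l1 l2 l : List Col} (hl : l = l1 ++ l2) {t : BTerm (.single c) l1}
      {T : BTerm (.tuple cs) l2} : P t → AllT P T → AllT P (BTerm.cons hl t T)

/-- The tuple `T'` arises from `T` by omitting the right action on one entry. -/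
inductive Pull : ∀ {cs l l' : List Col}, BTerm (.tuple cs) l → BTerm (.tuple cs) l' → Prop
  | mk {cs1 cs2 l1 l2 lt m1 m2 lz ltz : List Col} {c' c'' : Col}
      (ht : lt = m1 ++ c'' :: m2) (htz : ltz = m1 ++ (lz ++ m2))
      (T1 : BTerm (.tuple cs1) l1) (t : BTerm (.single c') lt) (T2 : BTerm (.tuple cs2) l2)
      (z : OTerm lz c'') :
      Pull (T1.append (BTerm.cons rfl (BTerm.right ht htz t z) T2))
        (T1.append (BTerm.cons rfl t T2))

/-- The reflexive and transitive closure of `Pull`. -/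
inductive Pulls {cs l : List Col} (T : BTerm (.tuple cs) l) :
    ∀ {l' : List Col}, BTerm (.tuple cs) l' → Prop
  | refl : Pulls T T
  | tail {l' l'' : List Col} {T' : BTerm (.tuple cs) l'} {T'' : BTerm (.tuple cs) l''} :
      Pulls T T' → Pull T' T'' → Pulls T T''

theorem Pull.cons {c : Col} {cs l0 l l' L L' : List Col} {T : BTerm (.tuple cs) l}
    {T' : BTerm (.tuple cs) l'} (h : Pull T T') (t : BTerm (.single c) l0) (hL : L = l0 ++ l)
    (hL' : L' = l0 ++ l') : Pull (BTerm.cons hL t T) (BTerm.cons hL' t T') := by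
  have key : ∀ {K K' : List Col} (hK : K = l0 ++ l) (hK' : K' = l0 ++ l'),
      Pull (BTerm.cons hK t T) (BTerm.cons hK' t T') →
        Pull (BTerm.cons hL t T) (BTerm.cons hL' t T') := by
    intro K K' hK hK' h
    subst hK hK' hL hL'
    exact h
  cases h with
  | mk ht htz T1 t' T2 z =>
    exact key _ _ (Pull.mk ht htz (BTerm.cons rfl t T1) t' T2 z)

theorem Pulls.cons {c : Col} {cs l0 l l' L L' : List Col} {T : BTerm (.tuple cs) l}
    {T' : BTerm (.tuple cs) l'} (h : Pulls T T') (t : BTerm (.single c) l0) (hL : L = l0 ++ l)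
    (hL' : L' = l0 ++ l') : Pulls (BTerm.cons hL t T) (BTerm.cons hL' t T') := by
  induction h generalizing L' with
  | refl => subst hL hL'; exact .refl
  | tail _ h ih => exact (ih rfl).tail (h.cons t rfl hL')

/-- Right actions on the entries can be moved out of a left action. -/
theorem Pull.red {cs l l' : List Col} {c : Col} {T : BTerm (.tuple cs) l}
    {T' : BTerm (.tuple cs) l'} (h : Pull T T') (x : OTerm cs c) (h' : Red k (BTerm.left x T')) :
    Red k (BTerm.left x T) := by
  cases h with
  | @mk cs1 cs2 l1 l2 lt m1 m2 lz ltz c' c'' ht htz T1 t T2 z =>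
    have hx : l1 ++ (lt ++ l2) = (l1 ++ m1) ++ c'' :: (m2 ++ l2) := by rw [ht]; simp
    have hl : l1 ++ (ltz ++ l2) = (l1 ++ m1) ++ (lz ++ (m2 ++ l2)) := by rw [htz]; simp
    have h1 := clB_eq_smul (BZero.left_right_comm (k := k) (Z := muZ) (W := fW) ht htz hx hl x T1 t
      T2 z)
    refine Red.congr (s := (-1) ^ (z.deg * T2.deg)) ?_ (Red.right z hx hl h')
    rw [h1, smul_smul, ← pow_add, Even.neg_one_pow ⟨_, rfl⟩, one_smul]

theorem Pulls.red {cs l l' : List Col} {c : Col} {T : BTerm (.tuple cs) l}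
    {T' : BTerm (.tuple cs) l'} (h : Pulls T T') (x : OTerm cs c)
    (h' : Red k (BTerm.left x T')) : Red k (BTerm.left x T) := by
  induction h with
  | refl => exact h'
  | tail _ h ih => exact ih (h.red x h')

theorem AllT.exists_semi {cs l : List Col} {T : BTerm (.tuple cs) l} (h : AllT (Red k) T) :
    clB k T = 0 ∨ ∃ T' : BTerm (.tuple cs) l, AllT IsSemi T' ∧ ∃ s : k,
      clB k T = s • clB k T' := by
  induction h with
  | nil => exact .inr ⟨_, .nil, 1, (one_smul _ _).symm⟩
  | @cons c cs l1 l2 l hl t T ht _ ih =>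
    obtain h0 | ⟨t', ht', s, h1⟩ := ht
    · left
      rw [clB_cons, h0, map_zero, LinearMap.zero_apply]
    obtain h0 | ⟨T', hT', s', h2⟩ := ih
    · left
      rw [clB_cons, h0, map_zero]
    refine .inr ⟨_, .cons hl ht' hT', s * s', ?_⟩
    rw [clB_cons_congr hl T h1, clB_cons_congr_right hl t' h2, smul_smul]

theorem AllT.exists_core {cs l : List Col} {T : BTerm (.tuple cs) l} (h : AllT IsSemi T) :
    ∃ (l' : List Col) (T' : BTerm (.tuple cs) l'), AllT IsCore T' ∧ Pulls T T' := by
  induction h with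
  | nil => exact ⟨_, _, .nil, .refl⟩
  | @cons c cs l1 l2 l hl t T ht _ ih =>
    obtain ⟨l', T', hT', h1⟩ := ih
    cases ht with
    | mk hx hl0 y hq =>
      exact ⟨_, _, .cons rfl hq hT', (h1.cons _ hl rfl).tail (Pull.mk hx hl0 BTerm.nil _ T' y)⟩

theorem AllT.core_eq {n : ℕ} {c : Col} {l : List Col}
    {T : BTerm (.tuple (List.replicate n Col.a ++ [c])) l} (h : AllT IsCore T) :
    ∃ (l' : List Col) (q : BTerm (.single c) l'), IsCore q ∧
      (⟨l, T⟩ : Σ l, BTerm (.tuple (List.replicate n Col.a ++ [c])) l)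
        = ⟨_, (onesT n).append (BTerm.cons rfl q BTerm.nil)⟩ := by
  induction n generalizing l with
  | zero =>
    change AllT IsCore (cs := [c]) T at h
    cases h with
    | cons hl ht hT =>
      cases hT with
      | nil =>
        subst hl
        exact ⟨_, _, ht, rfl⟩
  | succ n ih =>
    change AllT IsCore (cs := Col.a :: (List.replicate n Col.a ++ [c])) T at h
    cases h with
    | cons hl ht hT =>
      cases ht with
      | a =>
        obtain ⟨l', q, hq, h1⟩ := ih hT
        cases h1
        subst hl
        exact ⟨l', q, hq, rfl⟩

/-- The relation `μ^a_2 (f^a_1, f^a_1) = f^a_1 μ^a_2`, which holds since `f^a_2` vanishes. -/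
theorem clB_left_ones (hx : [Col.a] = [] ++ Col.a :: []) (hl : aa = [] ++ (aa ++ []))
    (h1 : aa = [Col.a] ++ [Col.a]) (h2 : [Col.a] = [Col.a] ++ []) :
    clB k (BTerm.left (OTerm.mu .a 0) (BTerm.cons h1 (BTerm.f .a 0)
        (BTerm.cons h2 (BTerm.f .a 0) BTerm.nil)))
      = clB k (BTerm.right hx hl (BTerm.f .a 0) (OTerm.mu .a 0)) := by
  have h : BZero k muZ fW (dF k .a 1) := by
    have := BZero.diff (BZero.gen (k := k) (Z := muZ) (W := fW) (c := .a) (n := 1)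
      ⟨rfl, by change 1 + 1 > 1; omega⟩)
    rw [dB, Finsupp.linearCombination_single, one_smul] at this
    exact this
  have h3 : fSum k .a 1 1 = Finsupp.single (BTerm.cons h1 (BTerm.f .a 0)
        (BTerm.cons h2 (BTerm.f .a 0) BTerm.nil)) 1 := by
    rw [fSum, Fin.sum_univ_one]
    erw [fSum, Finsupp.mapDomain_single]
    exact (congrArg₂ (· • ·) (by simp : _ = (1 : k)) rfl).trans (one_smul _ _)
  have h4 : dF k .a 1 = Finsupp.single (BTerm.right hx hl (BTerm.f .a 0) (OTerm.mu .a 0)) (1 : k)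
      - Finsupp.single (BTerm.left (OTerm.mu .a 0) (BTerm.cons h1 (BTerm.f .a 0)
        (BTerm.cons h2 (BTerm.f .a 0) BTerm.nil))) (1 : k) := by
    rw [dF, Fin.sum_univ_one, Fin.sum_univ_one]
    erw [Fin.sum_univ_one]
    refine congrArg₂ (· - ·) (congrArg₂ Finsupp.single rfl (by norm_num)) ?_
    erw [h3, Finsupp.mapDomain_single]
    rfl
  exact (clB_eq (h4 ▸ h)).symm

/-- The left action of a generator. -/
theorem AllT.left_mu {n : ℕ} {c : Col} {l : List Col}
    {T : BTerm (.tuple (List.replicate (n + 1) Col.a ++ [c])) l} (h : AllT (Red k) T) :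
    Red k (BTerm.left (OTerm.mu c n) T) := by
  obtain h0 | ⟨T', hT', s, h1⟩ := h.exists_semi
  · left
    rw [clB_left, h0, map_zero]
  refine Red.congr (clB_left_congr _ h1) ?_
  obtain ⟨l', T'', hT'', h2⟩ := hT'.exists_core
  refine h2.red _ ?_
  obtain ⟨l'', q, hq, h3⟩ := hT''.core_eq
  cases h3
  cases hq with
  | m hq => 
    exact (IsCore.m (FreeWord.add_stars n (Nat.zero_add n).symm (.zero hq))).red
  | a =>
    by_cases hn : n = 0
    · subst hn
      exact Red.of_eq (clB_left_ones rfl rfl rfl rfl) (IsSemi.mk (l1 := []) rfl rfl _ .a).red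
    · left
      rw [clB_left, clO_mu_a hn, map_zero, LinearMap.zero_apply]

theorem AllT.split {P : ∀ {l : List Col} {c : Col}, BTerm (.single c) l → Prop}
    {cs1 cs2 l : List Col} {T : BTerm (.tuple (cs1 ++ cs2)) l} (h : AllT P T) :
    ∃ (l1 l2 : List Col) (T1 : BTerm (.tuple cs1) l1) (T2 : BTerm (.tuple cs2) l2),
      AllT P T1 ∧ AllT P T2 ∧
      (⟨l, T⟩ : Σ l, BTerm (.tuple (cs1 ++ cs2)) l) = ⟨_, T1.append T2⟩ := by
  induction cs1 generalizing l with
  | nil => exact ⟨[], l, .nil, T, .nil, h, rfl⟩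
  | cons c cs1 ih =>
    change AllT P (cs := c :: (cs1 ++ cs2)) T at h
    cases h with
    | @cons _ _ l0 l3 _ hl t T ht hT =>
      obtain ⟨l1, l2, T1, T2, h1, h2, h3⟩ := ih hT
      cases h3
      refine ⟨_, _, .cons rfl t T1, T2, .cons rfl ht h1, h2, ?_⟩
      have key : ∀ {L L' : List Col} (h : L = l0 ++ (l1 ++ l2)) (h' : L' = l0 ++ (l1 ++ l2)),
          (⟨L, BTerm.cons h t (T1.append T2)⟩ : Σ l, BTerm (.tuple (c :: (cs1 ++ cs2))) l)
            = ⟨L', BTerm.cons h' t (T1.append T2)⟩ := by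
        intro L L' h h'
        subst h h'
        rfl
      exact key _ _

theorem AllT.appendTo {P : ∀ {l : List Col} {c : Col}, BTerm (.single c) l → Prop}
    {cs1 cs2 l1 l2 : List Col} {T1 : BTerm (.tuple cs1) l1} {T2 : BTerm (.tuple cs2) l2}
    (h1 : AllT P T1) (h2 : AllT P T2) : AllT P (T1.append T2) := by
  induction h1 with
  | nil => exact h2
  | cons hl ht _ ih => exact .cons _ ht ih

/-- Left actions preserve reducibility. -/
theorem AllT.left {cs : List Col} {c : Col} (x : OTerm cs c) {l : List Col}
    {T : BTerm (.tuple cs) l} (h : AllT (Red k) T) : Red k (BTerm.left x T) := by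
  induction x generalizing l with
  | one c =>
    cases h with
    | cons hl ht hT =>
      cases hT with
      | nil =>
        rename_i l1 t
        obtain rfl : l = l1 := by rw [hl, List.append_nil]
        exact Red.of_eq (clB_eq (BZero.one_left hl t)) ht
  | mu c n => exact h.left_mu
  | comp hx hl x y ihx ihy =>
    subst hx hl
    obtain ⟨L1, L', T1, T', h1, h', e⟩ := h.split
    cases e
    obtain ⟨L, L2, T, T2, h0, h2, e⟩ := h'.split
    cases e
    refine Red.congr (clB_eq_smul (BZero.left_comp x y T1 T T2)) (ihx ?_)
    exact h1.appendTo (.cons rfl (ihy h0) h2)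

/-- Reducibility of monomials and tuples. -/
def RedOut (k : Type u) [Field k] : ∀ {o : Out} {l : List Col}, BTerm o l → Prop
  | .single _, _, x => Red k x
  | .tuple _, _, T => AllT (Red k) T

theorem redOut {o : Out} {l : List Col} (x : BTerm o l) : RedOut k x := by
  induction x with
  | f c n =>
    cases c with
    | a =>
      by_cases hn : n = 0
      · subst hn
        exact IsCore.a.red
      · exact .inl (clB_f_a hn)
    | m => exact (IsCore.m (FreeWord.add_stars n (Nat.zero_add n).symm (.nil n))).red
  | right hx hl x y ih => exact Red.right y hx hl ih
  | left x T ih => exact AllT.left x ih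
  | nil => exact .nil
  | cons hl t T iht ihT => exact .cons hl iht ihT

/-- The normal forms of bimodule monomials. -/
inductive IsFormB : ∀ {l : List Col} {c : Col}, BTerm (.single c) l → Prop
  | mk {l0 l1 l' l : List Col} {c : Col} (hx : l0 = l1 ++ c :: []) (hl : l = l1 ++ (l' ++ []))
      {q : BTerm (.single c) l0} {y : OTerm l' c} :
      IsCore q → IsFormO y → IsFormB (BTerm.right hx hl q y)

/-- Every bimodule monomial is a multiple of a normal form in `T`. -/
theorem exists_isFormB {l : List Col} {c : Col} (x : BTerm (.single c) l) :
    clB k x = 0 ∨ ∃ t : BTerm (.single c) l, IsFormB t ∧ ∃ s : k, clB k x = s • clB k t := by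
  obtain h0 | ⟨t, ht, s, h1⟩ : Red k x := redOut x
  · exact .inl h0
  cases ht with
  | mk hx hl y hq =>
    obtain h2 | ⟨y', hy', h2⟩ := exists_isFormO (k := k) y
    · left
      rw [h1, clB_right_zero_right hx hl _ h2, smul_zero]
    · exact .inr ⟨_, .mk hx hl hq hy', s, by rw [h1, clB_right_congr_right hx hl _ h2]⟩

end

/-! ### Words for the cells of freehedra -/

theorem Letter.iv_mem (a : Letter) : a.iv ∈ intervalCells := by
  rw [mem_intervalCells]
  cases a <;> simp [Letter.iv]

theorem Letter.exists_iv {I : Iv} (h : I ∈ intervalCells) : ∃ a : Letter, a.iv = I := by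
  rw [mem_intervalCells] at h
  rcases h with rfl | rfl | rfl
  exacts [⟨.z, rfl⟩, ⟨.o, rfl⟩, ⟨.s, rfl⟩]

theorem Letter.exists_map_iv {w : Box} (h : ∀ I ∈ w, I ∈ intervalCells) :
    ∃ u : List Letter, u.map Letter.iv = w := by
  induction w with
  | nil => exact ⟨[], rfl⟩
  | cons I w ih =>
    obtain ⟨a, rfl⟩ := Letter.exists_iv (h I (by simp))
    obtain ⟨u, rfl⟩ := ih fun J hJ => h J (by simp [hJ])
    exact ⟨a :: u, rfl⟩

theorem Letter.fst_iv (a : Letter) : a.iv.fst = if a = .o then 1 else 0 := by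
  cases a <;> rfl

theorem Letter.snd_iv (a : Letter) : a.iv.snd = if a = .z then 0 else 1 := by
  cases a <;> rfl

theorem Letter.iv_injective : Function.Injective Letter.iv := by
  intro a b h
  have h1 := congrArg (fun I : Iv => I.fst) h
  have h2 := congrArg (fun I : Iv => I.snd) h
  simp only [Letter.fst_iv, Letter.snd_iv] at h1 h2
  cases a <;> cases b <;> simp at h1 h2 ⊢

theorem affIv_injective {s t : ℚ} (hs : s ≠ 0) : Function.Injective (affIv s t) := by
  intro I J h
  have h1 := congrArg (affIv s⁻¹ (-(s⁻¹ * t))) h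
  rw [affLaws_affIv.act_act, affLaws_affIv.act_act, inv_mul_cancel₀ hs, add_neg_cancel,
    affLaws_affIv.act_one, affLaws_affIv.act_one] at h1
  exact h1

/-- The first interval of a cell whose word starts with `a`: it is halved if `a` is the last letter
of the first word and a second word follows. -/
def headIv (a : Letter) (v : List Letter) (u : Option (List Letter)) : Iv :=
  if v = [] ∧ u.isSome then affIv (1 / 2) 0 a.iv else a.iv

/-- The cell of the freehedron that is encoded by two words: for `u = none` it is the cell `v` of
the cube, and otherwise the image of `v × u` under the right action at the module input. -/
def cellOf : List Letter → Option (List Letter) → Box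
  | [], none => []
  | [], some u => (u.map Letter.iv).map (affIv (-1 / 2) 1) ++ [NonemptyInterval.pure 1]
  | a :: v, u => headIv a v u :: cellOf v u

theorem cellOf_none (v : List Letter) : cellOf v none = v.map Letter.iv := by
  induction v with
  | nil => rfl
  | cons a v ih => rw [cellOf, ih, headIv, if_neg (by simp)]; rfl

theorem cellOf_concat (x : List Letter) (a : Letter) (u : List Letter) :
    cellOf (x ++ [a]) (some u)
      = x.map Letter.iv ++ (affIv (1 / 2) 0 a.iv ::
        ((u.map Letter.iv).map (affIv (-1 / 2) 1) ++ [NonemptyInterval.pure 1])) := by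
  induction x with
  | nil => rfl
  | cons b x ih =>
    rw [List.cons_append, cellOf, ih, headIv, if_neg (by simp)]
    rfl

theorem length_cellOf (v : List Letter) (u : Option (List Letter)) :
    (cellOf v u).length = v.length + u.elim 0 fun u => u.length + 1 := by
  induction v with
  | nil => cases u <;> simp [cellOf]
  | cons a v ih => rw [cellOf, List.length_cons, ih, List.length_cons]; omega

theorem affIv_half_fst (a : Letter) (h : a ≠ .o) : (affIv (1 / 2) 0 a.iv).fst = 0 := by
  rw [affIv_fst, Letter.fst_iv, Letter.snd_iv, if_neg h]
  split_ifs <;> norm_num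

theorem headIv_fst {a : Letter} {u : Option (List Letter)} {v : List Letter} (h : a ≠ .o) :
    (headIv a v u).fst = 0 := by
  rw [headIv]
  split_ifs
  · exact affIv_half_fst a h
  · rw [Letter.fst_iv, if_neg h]

/-- The last interval of the first part of a cell starts at `0`. -/
theorem exists_fst_lt {v : List Letter} (u : Option (List Letter)) (hv : v ≠ [])
    (h : v.getLast? ≠ some .o) : ∃ I ∈ cellOf v u, I.fst < 1 / 2 := by
  induction v with
  | nil => exact absurd rfl hv
  | cons a v ih =>
    by_cases hv' : v = []
    · subst hv'
      have ha : a ≠ .o := by simpa using h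
      exact ⟨_, List.mem_cons_self, by rw [headIv_fst ha]; norm_num⟩
    · obtain ⟨I, hI, h1⟩ := ih hv' (by
        cases v with
        | nil => exact absurd rfl hv'
        | cons b v => simpa using h)
      exact ⟨I, List.mem_cons_of_mem _ hI, h1⟩

theorem InDist.fst_ge {w : Box} (h : InDist w) : ∀ I ∈ w, 1 / 2 ≤ I.fst := by
  induction w with
  | nil => exact absurd h id
  | cons J w ih =>
    cases w with
    | nil =>
      intro I hI
      rw [List.mem_singleton.1 hI]
      have : J ≤ NonemptyInterval.pure 1 := h
      have h1 : (1 : ℚ) ≤ J.fst := this.1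
      linarith
    | cons K w =>
      intro I hI
      rcases List.mem_cons.1 hI with rfl | hI
      · exact h.1.1
      · exact ih h.2 I hI

theorem inDist_cellOf_some (u : List Letter) :
    InDist (cellOf [] (some u)) ∧ IsFreeCell (cellOf [] (some u)) :=
  upper_cells fun I hI => by
    obtain ⟨a, -, rfl⟩ := List.mem_map.1 hI
    exact a.iv_mem

theorem last_of_cons {a : Letter} {v : List Letter} (h : (a :: v).getLast? ≠ some .o) :
    v.getLast? ≠ some .o := by
  cases v with
  | nil => simp
  | cons b v => simpa using h

theorem not_inDist_cellOf {v : List Letter} {u : Option (List Letter)}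
    (h : v.getLast? ≠ some .o) (hvu : v ≠ [] ∨ u = none) : ¬ InDist (cellOf v u) := by
  intro hd
  by_cases hv : v = []
  · subst hv
    obtain rfl : u = none := by simpa using hvu
    exact hd
  · obtain ⟨I, hI, h1⟩ := exists_fst_lt u hv h
    exact absurd (hd.fst_ge I hI) (not_le.2 h1)

theorem headIv_mem (a : Letter) {v : List Letter} {u : Option (List Letter)}
    (h : v.getLast? ≠ some .o) : headIv a v u ∈ cellsOver (cellOf v u) := by
  rw [headIv]
  split_ifs with h1
  · obtain ⟨rfl, h1⟩ := h1
    obtain ⟨u, rfl⟩ := Option.isSome_iff_exists.1 h1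
    rw [cellsOver, if_pos (inDist_cellOf_some u).1]
    exact (affIv_half_lower a.iv_mem).1
  · rw [cellsOver, if_neg (not_inDist_cellOf h ?_)]
    · exact a.iv_mem
    · by_cases hv : v = []
      · exact .inr (by simpa [hv] using h1)
      · exact .inl hv

theorem isFreeCell_cellOf {v : List Letter} {u : Option (List Letter)}
    (h : v.getLast? ≠ some .o) : IsFreeCell (cellOf v u) := by
  induction v with
  | nil =>
    cases u with
    | none => trivial
    | some u => exact (inDist_cellOf_some u).2
  | cons a v ih =>
    have h' := last_of_cons h
    exact ⟨ih h', headIv_mem a h'⟩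

theorem affIv_half_zero : affIv (1 / 2) 0 Letter.z.iv = NonemptyInterval.pure 0 := by
  apply iv_ext <;> simp [affIv_fst, affIv_snd, Letter.fst_iv, Letter.snd_iv]

theorem affIv_neg_half_zero : affIv (-1 / 2) 1 Letter.z.iv = NonemptyInterval.pure 1 := by
  apply iv_ext <;> simp [affIv_fst, affIv_snd, Letter.fst_iv, Letter.snd_iv]

theorem affIv_neg_half_one : affIv (-1 / 2) 1 Letter.o.iv = NonemptyInterval.pure (1 / 2) := by
  apply iv_ext <;> simp [affIv_fst, affIv_snd, Letter.fst_iv, Letter.snd_iv] <;> norm_num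

/-- Every cell of a freehedron is encoded by a pair of words. -/
theorem exists_cellOf {w : Box} (hw : IsFreeCell w) :
    ∃ (v : List Letter) (u : Option (List Letter)), v.getLast? ≠ some .o ∧ cellOf v u = w := by
  induction w with
  | nil => exact ⟨[], none, by simp, rfl⟩
  | cons I w ih =>
    obtain ⟨v, u, hv, rfl⟩ := ih hw.1
    have hI := hw.2
    by_cases hvu : v ≠ [] ∨ u = none
    · rw [cellsOver, if_neg (not_inDist_cellOf hv hvu)] at hI
      obtain ⟨a, rfl⟩ := Letter.exists_iv hI
      by_cases h1 : (a :: v).getLast? = some .o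
      · obtain rfl : v = [] := by
          cases v with
          | nil => rfl
          | cons b v => exact absurd (by simpa using h1) hv
        obtain rfl : u = none := by simpa using hvu
        obtain rfl : a = .o := by simpa using h1
        exact ⟨[], some [], by simp, rfl⟩
      · refine ⟨a :: v, u, h1, ?_⟩
        rw [cellOf, headIv, if_neg]
        rintro ⟨h2, h3⟩
        rcases hvu with h4 | rfl
        · exact h4 h2
        · simp at h3
    · rw [not_or, not_not] at hvu
      obtain ⟨rfl, h1⟩ := hvu
      obtain ⟨u, rfl⟩ := Option.ne_none_iff_exists'.1 h1
      rw [cellsOver, if_pos (inDist_cellOf_some u).1, mem_halvedCells] at hI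
      have hlow : ∀ a : Letter, a ≠ .o → affIv (1 / 2) 0 a.iv = I →
          ∃ (v : List Letter) (u' : Option (List Letter)), v.getLast? ≠ some .o ∧
            cellOf v u' = I :: cellOf [] (some u) := by
        intro a ha h2
        refine ⟨[a], some u, by simpa using ha, ?_⟩
        change headIv a [] (some u) :: cellOf [] (some u) = _
        rw [headIv, if_pos ⟨rfl, rfl⟩, h2]
      have hup : ∀ a : Letter, affIv (-1 / 2) 1 a.iv = I →
          ∃ (v : List Letter) (u' : Option (List Letter)), v.getLast? ≠ some .o ∧
            cellOf v u' = I :: cellOf [] (some u) := by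
        intro a h2
        exact ⟨[], some (a :: u), by simp, by simp [cellOf, h2]⟩
      rcases hI with rfl | rfl | rfl | rfl | rfl
      · exact hlow .z (by simp) affIv_half_zero
      · exact hup .o affIv_neg_half_one
      · exact hup .z affIv_neg_half_zero
      · exact hlow .s (by simp) affIv_half_unitIv
      · exact hup .s affIv_neg_half_unitIv

theorem cellOf_nil_injective {u u' : Option (List Letter)} (h : cellOf [] u = cellOf [] u') :
    u = u' := by
  cases u with
  | none =>
    cases u' with
    | none => rfl
    | some u' => simp [cellOf] at h
  | some u =>
    cases u' with
    | none => simp [cellOf] at h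
    | some u' =>
      have h1 := List.append_cancel_right h
      rw [List.map_injective_iff.2 Letter.iv_injective (List.map_injective_iff.2
        (affIv_injective (by norm_num)) h1)]

theorem cellOf_ne {v : List Letter} (hv : v ≠ []) (h : v.getLast? ≠ some .o)
    (u u' : Option (List Letter)) : cellOf [] u' ≠ cellOf v u := by
  intro h1
  cases u' with
  | none =>
    obtain ⟨I, hI, -⟩ := exists_fst_lt u hv h
    rw [← h1] at hI
    simp [cellOf] at hI
  | some u' =>
    obtain ⟨I, hI, h2⟩ := exists_fst_lt u hv h
    rw [← h1] at hI
    exact absurd ((inDist_cellOf_some u').1.fst_ge I hI) (not_le.2 h2)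

/-- A cell determines its words. -/
theorem cellOf_injective {v v' : List Letter} {u u' : Option (List Letter)}
    (hv : v.getLast? ≠ some .o) (hv' : v'.getLast? ≠ some .o) (h : cellOf v u = cellOf v' u') :
    v = v' ∧ u = u' := by
  induction v generalizing v' with
  | nil =>
    cases v' with
    | nil => exact ⟨rfl, cellOf_nil_injective h⟩
    | cons b v' => exact absurd h (cellOf_ne (by simp) hv' _ _)
  | cons a v ih =>
    cases v' with
    | nil => exact absurd h.symm (cellOf_ne (by simp) hv _ _)
    | cons b v' =>
      rw [cellOf, cellOf, List.cons.injEq] at h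
      obtain ⟨rfl, rfl⟩ := ih (last_of_cons hv) (last_of_cons hv') h.2
      refine ⟨?_, rfl⟩
      have h1 := h.1
      rw [headIv, headIv] at h1
      split_ifs at h1 with h2
      · rw [Letter.iv_injective (affIv_injective (by norm_num) h1)]
      · rw [Letter.iv_injective h1]

/-! ### Realization of normal forms -/

section

variable {k : Type u} [Field k]

theorem evalSign_ne_zero (S : List Slot) (w : Box) : ((evalSign S w : ℤ) : k) ≠ 0 := by
  have h : evalSign S w = 1 ∨ evalSign S w = -1 := by
    induction S generalizing w with
    | nil => exact .inl rfl
    | cons a S ih =>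
      cases a with
      | const q => exact ih w
      | aff s t =>
        cases w with
        | nil => exact .inl rfl
        | cons I w =>
          rw [evalSign]
          split_ifs <;> rcases ih w with h | h <;> rw [h] <;> simp
  rcases h with h | h <;> simp [h]

/-- Right actions on monomials that are realized by boxes, up to units. -/
theorem real_right_box {l0 l1 l2 l' l : List Col} {c c' : Col} (hx : l0 = l1 ++ c' :: l2)
    (hl : l = l1 ++ (l' ++ l2)) {x : BTerm (.single c) l0} {y : OTerm l' c'} {v w : Box}
    {n : List ℕ} (hv : ∃ ε : k, ε ≠ 0 ∧ x.real k = ε • emb k n (boxR k v))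
    (hw : y.real k = emb k [] (boxR k w))
    (h : (v ++ w).length = Slot.inputs (rightSlots c c' l1.length l0.length l'.length)) :
    ∃ ε : k, ε ≠ 0 ∧ (BTerm.right hx hl x y).real k = ε • emb k [l.length]
      (boxR k (evalBox (rightSlots c c' l1.length l0.length l'.length) (v ++ w))) := by
  obtain ⟨ε, hε, hv⟩ := hv
  refine ⟨ε * _, mul_ne_zero hε (evalSign_ne_zero
    (rightSlots c c' l1.length l0.length l'.length) (v ++ w)), ?_⟩
  rw [BTerm.real, hv, hw, map_smul, LinearMap.smul_apply, mul_smul, ← map_smul (emb k [l.length]),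
    ← bil_evalL_boxR (slopesNeZero_rightSlots _ _ _ _ _) h]
  exact congrArg (ε • ·) (bil_emb n [] [l.length] _ (fun _ _ => rfl) _ _)

theorem real_onesT (n : ℕ) :
    (onesT n).real k = Finsupp.single (List.replicate n 1, []) 1 := by
  induction n with
  | zero => rfl
  | succ n ih =>
    rw [onesT, BTerm.real, BTerm.real, ih, muR_a_zero, boxR, emb, Finsupp.lmapDomain_apply,
      Finsupp.mapDomain_single, bil_single, mul_one]
    rfl

/-- The normal form of a face is realized by that face, up to a unit. -/
theorem FreeWord.real {s : ℕ} {v : List Letter} {l : List Col} {q : BTerm (.single .m) l}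
    (h : FreeWord s v q) : ∃ ε : k, ε ≠ 0 ∧
      q.real k = ε • emb k [l.length] (boxR k (List.replicate s unitIv ++ v.map Letter.iv)) := by
  induction h with
  | nil s =>
    refine ⟨1, one_ne_zero, ?_⟩
    rw [BTerm.real, muR, List.map_nil, List.append_nil, one_smul]
    simp
  | star _ ih =>
    rw [List.replicate_succ', List.append_assoc] at ih
    exact ih
  | @one s v l0 l1 l2 l q hx hl h1 h0 ih =>
    have hlen := h0.length
    obtain ⟨ε, hε, h2⟩ := real_right_box hx hl ih (w := []) (by rw [OTerm.real, muR_a_zero])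
      (by
        have : l0.length = l1.length + (l2.length + 1) := by rw [hx]; simp
        have h5 : v.length ≠ 0 := by
          intro h5
          obtain rfl := List.length_eq_zero_iff.1 h5
          have := (FreeWord.one hx hl h1 h0).last
          simp at this
        simp [rightSlots, inputs_append, inputs_copies, Slot.inputs]
        omega)
    refine ⟨ε, hε, ?_⟩
    rw [h2, List.append_nil, evalBox, eval_right_a affLaws_affIv (by simp [h1]) (by simp; omega)]
    rfl
  | @zero s v l q h0 ih =>
    obtain ⟨ε, hε, h1⟩ := ih
    have hlen := h0.length
    have h2 : ((onesT (s + 1)).append (BTerm.cons rfl q BTerm.nil)).real k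
        = ε • emb k (List.replicate (s + 1) 1 ++ [l.length]) (boxR k (v.map Letter.iv)) := by
      rw [BTerm.real_append, real_onesT, BTerm.real, BTerm.real, h1, map_smul,
        LinearMap.smul_apply, map_smul]
      congr 1
      rw [bil_single_right, one_smul, bil_single_left, one_smul, emb, emb,
        Finsupp.lmapDomain_apply, Finsupp.lmapDomain_apply, ← Finsupp.mapDomain_comp,
        ← Finsupp.mapDomain_comp, List.replicate_zero, List.nil_append]
      congr 1
      funext L
      simp [consG]
    have hS : leftSlots .m (List.replicate (s + 1) 1 ++ [l.length])
        = List.replicate s (.aff (-1) 1) ++ .const 0 :: copies (l.length - 1) := by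
      rw [leftSlots, leftSlotsAux_ones]
    refine ⟨ε * _, mul_ne_zero hε (evalSign_ne_zero
      (leftSlots .m (List.replicate (s + 1) 1 ++ [l.length]))
      (List.replicate s unitIv ++ v.map Letter.iv)), ?_⟩
    have h3 : boxR k (List.replicate s unitIv ++ (Letter.z :: v).map Letter.iv)
        = boxR k (evalBox (leftSlots .m (List.replicate (s + 1) 1 ++ [l.length]))
            (List.replicate s unitIv ++ v.map Letter.iv)) := by
      rw [hS, evalBox, eval_append _ _ _ _ (by rw [inputs_replicate_aff]; simp),
        eval_replicate_aff _ _ _ _ (by simp), Slot.eval,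
        eval_copies affLaws_affIv _ _ (by simp; omega), List.map_replicate, affIv_neg_unitIv]
      rfl
    rw [BTerm.real, OTerm.real, muR, h2, map_smul, mul_smul, h3, ← map_smul (emb k _),
      ← bil_evalL_boxR (slopesNeZero_leftSlots _ _)]
    · exact congrArg (ε • ·) (bil_emb [] _ _ _ (fun _ _ => rfl) _ _)
    · rw [hS]
      simp [inputs_append, inputs_replicate_aff, Slot.inputs, inputs_copies]
      omega

/-- The normal forms with output `m`, with the words of their cells. -/
inductive FormM (v : List Letter) (u : Option (List Letter)) :
    ∀ {l : List Col}, BTerm (.single .m) l → Prop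
  | mk {l0 l1 l' l : List Col} (hx : l0 = l1 ++ Col.m :: []) (hl : l = l1 ++ (l' ++ []))
      {q : BTerm (.single .m) l0} {y : OTerm l' .m} :
      FreeWord 0 v q → CubeForm u y → FormM v u (BTerm.right hx hl q y)

/-- The normal forms with output `a`. -/
inductive FormA : ∀ {l : List Col}, BTerm (.single .a) l → Prop
  | mk {l1 l' l : List Col} (hx : [Col.a] = l1 ++ Col.a :: []) (hl : l = l1 ++ (l' ++ []))
      {y : OTerm l' .a} : AssocForm y → FormA (BTerm.right hx hl (BTerm.f .a 0) y)

theorem IsFormB.formM {l : List Col} {t : BTerm (.single .m) l} (h : IsFormB t) :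
    ∃ v u, FormM v u t := by
  cases h with
  | mk hx hl hq hy =>
    obtain ⟨u, hu⟩ := hy
    cases hq with
    | m hq => exact ⟨_, _, .mk hx hl hq hu⟩

theorem IsFormB.formA {l : List Col} {t : BTerm (.single .a) l} (h : IsFormB t) : FormA t := by
  cases h with
  | mk hx hl hq hy =>
    cases hq with
    | a => exact .mk hx hl hy

theorem FormM.last {v : List Letter} {u : Option (List Letter)} {l : List Col}
    {t : BTerm (.single .m) l} (h : FormM v u t) : v.getLast? ≠ some .o := by
  cases h with
  | mk hx hl hq hy => exact hq.last

theorem CubeForm.length {u : Option (List Letter)} {l : List Col} {t : OTerm l .m}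
    (h : CubeForm u t) : l.length = 1 + u.elim 0 fun u => u.length + 1 := by
  cases h with
  | one => rfl
  | word h => rw [h.length, Option.elim]; omega

theorem FormM.length {v : List Letter} {u : Option (List Letter)} {l : List Col}
    {t : BTerm (.single .m) l} (h : FormM v u t) : l.length = (cellOf v u).length + 1 := by
  cases h with
  | mk hx hl hq hy =>
    have h1 := hq.length
    have h2 := hy.length
    rw [length_cellOf]
    subst hx hl
    simp only [List.length_append, List.length_cons, List.length_nil] at h1 h2 ⊢
    omega

theorem FormM.unique {v : List Letter} {u : Option (List Letter)} {l : List Col}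
    {t t' : BTerm (.single .m) l} (h : FormM v u t) (h' : FormM v u t') : t = t' := by
  cases h with
  | mk hx hl hq hy =>
    cases h' with
    | mk hx' hl' hq' hy' =>
      cases hq.unique hq'
      cases hy.unique hy'
      obtain rfl := List.append_cancel_right (hx.symm.trans hx')
      rfl

theorem FormA.unique {l : List Col} {t t' : BTerm (.single .a) l} (h : FormA t) (h' : FormA t') :
    t = t' := by
  cases h with
  | mk hx hl hy =>
    cases h' with
    | mk hx' hl' hy' =>
      obtain rfl := List.append_cancel_right (hx.symm.trans hx')
      cases hy.unique hy' (by
        have h1 := congrArg List.length (hl.symm.trans hl')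
        simpa using h1)
      rfl

theorem FormM.exists {l : List Col} (hl : IsProfile l .m) {v : List Letter}
    {u : Option (List Letter)} (hv : v.getLast? ≠ some .o)
    (h : l.length = (cellOf v u).length + 1) : ∃ t : BTerm (.single .m) l, FormM v u t := by
  obtain ⟨l0, q, hq⟩ := FreeWord.exists 0 v hv
  obtain ⟨l', y, hy⟩ : ∃ (l' : List Col) (y : OTerm l' .m), CubeForm u y := by
    cases u with
    | none => exact ⟨_, _, .one⟩
    | some u =>
      obtain ⟨l', y, hy⟩ := CubeWord.exists 0 u
      exact ⟨l', y, .word hy⟩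
  have h1 := hq.length
  have h2 := hy.length
  rw [length_cellOf] at h
  have hl1 : l = List.replicate (l0.length - 1) Col.a ++ (l' ++ []) := by
    rw [hl.eq_replicate, List.append_nil, y.isProfile.eq_replicate, ← List.append_assoc,
      ← List.replicate_add]
    congr 2
    have : 1 ≤ l'.length := y.isProfile.length_pos
    omega
  exact ⟨_, .mk q.isProfile.eq_replicate hl1 hq hy⟩

theorem FormA.exists {l : List Col} (hl : IsProfile l .a) :
    ∃ t : BTerm (.single .a) l, FormA t := by
  obtain ⟨n, rfl⟩ := hl
  obtain ⟨y, hy⟩ := AssocForm.exists n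
  exact ⟨_, .mk (l1 := []) rfl (by simp [List.replicate_succ']) hy⟩

/-- A normal form with output `m` is realized by its cell, up to a unit. -/
theorem FormM.real {v : List Letter} {u : Option (List Letter)} {l : List Col}
    {t : BTerm (.single .m) l} (h : FormM v u t) :
    ∃ ε : k, ε ≠ 0 ∧ t.real k = ε • emb k [l.length] (boxR k (cellOf v u)) := by
  cases h with
  | @mk l0 l1 l' _ hx hl q y hq hy =>
    have h1 := hq.length
    have h2 := hy.length
    have h3 : Slot.inputs (rightSlots .m .m l1.length l0.length l'.length)
        = l0.length - 1 + (l'.length - 2) := by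
      subst hx
      exact inputs_rightSlots q.isProfile
    obtain ⟨ε, hε, h4⟩ := real_right_box (k := k) hx hl hq.real hy.real (by
      rw [h3]
      cases u <;> simp at h2 ⊢ <;> omega)
    refine ⟨ε, hε, ?_⟩
    rw [h4, List.replicate_zero, List.nil_append]
    congr 3
    cases u with
    | none =>
      rw [evalBox, cellOf_none, Option.getD_none, List.map_nil, List.append_nil,
        eval_right_m_one affLaws_affIv (by simp [h2]) (by simp; omega)]
    | some u =>
      rw [Option.elim] at h2
      rw [evalBox, Option.getD_some]
      rcases List.eq_nil_or_concat' v with rfl | ⟨x, a, rfl⟩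
      · rw [List.map_nil, List.nil_append, eval_right_m_nil (by simp [h1]) (by simp; omega)]
        rfl
      · rw [cellOf_concat, List.map_append, List.map_singleton,
          eval_right_m affLaws_affIv (by simp at h1 ⊢; omega) (by simp; omega)]

theorem FormA.real {l : List Col} {t : BTerm (.single .a) l} (h : FormA t) :
    ∃ ε : k, ε ≠ 0 ∧ t.real k = ε • emb k [l.length] (boxR k []) := by
  cases h with
  | mk hx hl hy =>
    exact real_right_box hx hl (n := [0 + 1]) (v := [])
      ⟨1, one_ne_zero, by rw [BTerm.real, muR_a_zero, one_smul]⟩ hy.real rfl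

end

/-! ### The isomorphism -/

section

variable {k : Type u} [Field k]

/-- The normal form `t` belongs to the cell `w` of the cubes. -/
def FormO (w : Box) : ∀ {l : List Col} {c : Col}, OTerm l c → Prop
  | _, .m, t => ∃ u, CubeForm u t ∧ (u.getD []).map Letter.iv = w
  | _, .a, t => AssocForm t ∧ w = []

/-- The normal form `t` belongs to the cell `w` of the freehedra. -/
def FormB (w : Box) : ∀ {l : List Col} {c : Col}, BTerm (.single c) l → Prop
  | _, .m, t => ∃ v u, FormM v u t ∧ cellOf v u = w
  | _, .a, t => FormA t ∧ w = []

theorem IsFormO.formO {l : List Col} {c : Col} {t : OTerm l c} (h : IsFormO t) :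
    ∃ w ∈ cubeOp l c, FormO w t := by
  cases c with
  | a => exact ⟨[], mem_cubeOp.2 ⟨⟨t.isProfile, rfl⟩, by simp⟩, h, rfl⟩
  | m =>
    obtain ⟨u, hu⟩ := h
    refine ⟨_, mem_cubeOp.2 ⟨⟨t.isProfile, ?_⟩, fun I hI => ?_⟩, u, hu, rfl⟩
    · rw [hu.length, List.length_map]
      cases u <;> simp [cubeDim]
      omega
    · obtain ⟨a, -, rfl⟩ := List.mem_map.1 hI
      exact a.iv_mem

theorem FormO.unique {w : Box} {l : List Col} {c : Col} {t t' : OTerm l c} (h : FormO w t)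
    (h' : FormO w t') : t = t' := by
  cases c with
  | a => simpa using h.1.unique h'.1 rfl
  | m =>
    obtain ⟨u, hu, h1⟩ := h
    obtain ⟨u', hu', h2⟩ := h'
    obtain rfl : u = u' := by
      have h3 := hu.length.symm.trans hu'.length
      have h4 := List.map_injective_iff.2 Letter.iv_injective (h1.trans h2.symm)
      cases u with
      | none =>
        cases u' with
        | none => rfl
        | some u' => simp at h3
      | some u =>
        cases u' with
        | none => simp at h3
        | some u' => exact congrArg some h4
    simpa using hu.unique hu'

theorem FormO.exists {w : Box} {l : List Col} {c : Col} (hw : w ∈ cubeOp l c) :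
    ∃ t : OTerm l c, FormO w t := by
  obtain ⟨⟨hp, hlen⟩, hc⟩ := mem_cubeOp.1 hw
  cases c with
  | a =>
    obtain ⟨n, rfl⟩ := hp
    obtain ⟨t, ht⟩ := AssocForm.exists n
    have key : ∀ {l : List Col}, l = List.replicate (n + 1) Col.a →
        ∃ t : OTerm l .a, FormO w t := by
      rintro _ rfl
      exact ⟨t, ht, List.length_eq_zero_iff.1 hlen⟩
    exact key List.replicate_succ'.symm
  | m =>
    obtain ⟨u, rfl⟩ := Letter.exists_map_iv hc
    by_cases h1 : l.length = 1
    · obtain rfl : l = [Col.m] := by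
        rw [hp.eq_replicate, h1]
        rfl
      obtain rfl : u = [] := by
        refine List.length_eq_zero_iff.1 ?_
        rw [List.length_map] at hlen
        exact hlen
      exact ⟨_, none, .one, rfl⟩
    · obtain ⟨l', t, ht⟩ := CubeWord.exists 0 u
      have h2 := ht.length
      rw [List.length_map, cubeDim] at hlen
      have h3 := hp.length_pos
      obtain rfl : l' = l := by
        rw [hp.eq_replicate, t.isProfile.eq_replicate, show l'.length = l.length by omega]
      exact ⟨t, some u, .word ht, rfl⟩

theorem FormO.real {w : Box} {l : List Col} {c : Col} {t : OTerm l c} (h : FormO w t) :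
    t.real k = emb k [] (boxR k w) := by
  cases c with
  | a => rw [h.1.real, h.2]
  | m =>
    obtain ⟨u, hu, rfl⟩ := h
    exact hu.real

theorem IsFormB.formB {l : List Col} {c : Col} {t : BTerm (.single c) l} (h : IsFormB t) :
    ∃ w ∈ freeMod l c, FormB w t := by
  cases c with
  | a => exact ⟨[], mem_freeMod.2 ⟨⟨t.isProfile, rfl⟩, trivial⟩, h.formA, rfl⟩
  | m =>
    obtain ⟨v, u, hu⟩ := h.formM
    refine ⟨_, mem_freeMod.2 ⟨⟨t.isProfile, ?_⟩, isFreeCell_cellOf hu.last⟩, v, u, hu, rfl⟩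
    rw [hu.length]
    rfl

theorem FormB.unique {w : Box} {l : List Col} {c : Col} {t t' : BTerm (.single c) l}
    (h : FormB w t) (h' : FormB w t') : t = t' := by
  cases c with
  | a => exact h.1.unique h'.1
  | m =>
    obtain ⟨v, u, hu, h1⟩ := h
    obtain ⟨v', u', hu', h2⟩ := h'
    obtain ⟨rfl, rfl⟩ := cellOf_injective hu.last hu'.last (h1.trans h2.symm)
    exact hu.unique hu'

theorem FormB.exists {w : Box} {l : List Col} {c : Col} (hw : w ∈ freeMod l c) :
    ∃ t : BTerm (.single c) l, FormB w t := by
  obtain ⟨⟨hp, hlen⟩, hc⟩ := mem_freeMod.1 hw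
  cases c with
  | a =>
    obtain ⟨t, ht⟩ := FormA.exists hp
    exact ⟨t, ht, List.length_eq_zero_iff.1 hlen⟩
  | m =>
    obtain ⟨v, u, hv, rfl⟩ := exists_cellOf hc
    obtain ⟨t, ht⟩ := FormM.exists hp (u := u) hv (by
      have := hp.length_pos
      rw [freeDim] at hlen
      omega)
    exact ⟨t, v, u, ht, rfl⟩

theorem FormB.real {w : Box} {l : List Col} {c : Col} {t : BTerm (.single c) l}
    (h : FormB w t) : ∃ ε : k, ε ≠ 0 ∧ t.real k = ε • emb k [l.length] (boxR k w) := by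
  cases c with
  | a =>
    obtain ⟨h, rfl⟩ := h
    exact h.real
  | m =>
    obtain ⟨v, u, h, rfl⟩ := h
    exact h.real

theorem cellO_single {l : List Col} {c : Col} (w : {w // w ∈ cubeOp l c}) :
    cellO k l c (Finsupp.single w 1) = emb k [] (boxR k w.1) := by
  rw [cellO, LinearMap.comp_apply, realChain_single, one_smul]

theorem cellB_single {l : List Col} {c : Col} (w : {w // w ∈ freeMod l c}) :
    cellB k l c (Finsupp.single w 1) = emb k [l.length] (boxR k w.1) := by
  rw [cellB, LinearMap.comp_apply, realChain_single, one_smul]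

/-- The isomorphism `Ω(l; c) ≅ C_*(I(l; c))` that is compatible with the realizations. -/
theorem exists_onP (k : Type u) [Field k] (l : List Col) (c : Col) :
    ∃ e : OQuot k muZ l c ≃ₗ[k] Chain k (cubeOp l c), ∀ x, cellO k l c (e x) = quotO k l c x := by
  refine exists_equiv (quotO k l c) (cellO k l c) (cellO_injective l c)
    (fun q w => ∃ t, FormO w.1 t ∧ q = clO k t) ?_ ?_ ?_ ?_
  · rw [eq_top_iff, ← span_clO, Submodule.span_le]
    rintro _ ⟨x, rfl⟩
    obtain h | ⟨t, ht, h⟩ := exists_isFormO (k := k) x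
    · rw [h]; exact zero_mem _
    · obtain ⟨w, hw, hwt⟩ := ht.formO
      exact Submodule.subset_span ⟨⟨w, hw⟩, t, hwt, h.symm⟩
  · rintro _ w ⟨t, ht, rfl⟩
    exact ⟨1, one_ne_zero, by rw [quotO_clO, cellO_single, ht.real, one_smul]⟩
  · rintro _ _ w ⟨t, ht, rfl⟩ ⟨t', ht', rfl⟩
    rw [ht.unique ht']
  · intro w
    obtain ⟨t, ht⟩ := FormO.exists w.2
    exact ⟨_, t, ht, rfl⟩

/-- The isomorphism `T(l; c) ≅ C_*(F(l; c))` that is compatible with the realizations. -/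
theorem exists_onM (k : Type u) [Field k] (l : List Col) (c : Col) :
    ∃ e : BQuot k muZ fW (.single c) l ≃ₗ[k] Chain k (freeMod l c),
      ∀ x, cellB k l c (e x) = quotB k _ l x := by
  refine exists_equiv (quotB k _ l) (cellB k l c) (cellB_injective l c)
    (fun q w => ∃ t, FormB w.1 t ∧ q = clB k t) ?_ ?_ ?_ ?_
  · rw [eq_top_iff, ← span_clB, Submodule.span_le]
    rintro _ ⟨x, rfl⟩
    obtain h | ⟨t, ht, s, h⟩ := exists_isFormB (k := k) x
    · rw [h]; exact zero_mem _
    · obtain ⟨w, hw, hwt⟩ := ht.formB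
      rw [h]
      exact Submodule.smul_mem _ _ (Submodule.subset_span ⟨⟨w, hw⟩, t, hwt, rfl⟩)
  · rintro _ w ⟨t, ht, rfl⟩
    obtain ⟨ε, hε, h⟩ := ht.real (k := k)
    exact ⟨ε, hε, by rw [quotB_clB, cellB_single, h]⟩
  · rintro _ _ w ⟨t, ht, rfl⟩ ⟨t', ht', rfl⟩
    rw [ht.unique ht']
  · intro w
    obtain ⟨t, ht⟩ := FormB.exists w.2
    exact ⟨_, t, ht, rfl⟩

theorem supported_of_emb {js : List ℕ} {x : List LPt →₀ k} {n : ℕ}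
    (h : emb k js x ∈ Finsupp.supported k k {X : EPt | countT X.2 = n}) :
    x ∈ Finsupp.supported k k {L : List LPt | countT L = n} := by
  classical
  intro L hL
  refine h (a := (js, L)) ?_
  rw [Finset.mem_coe, emb, Finsupp.lmapDomain_apply, Finsupp.mapDomain_support_of_injective
    (fun _ _ h => (Prod.ext_iff.1 h).2)]
  exact Finset.mem_image_of_mem _ hL

/-- A linear isomorphism with chains that is compatible with realizations preserves degrees. -/
theorem map_grade {Q τ : Type*} [AddCommGroup Q] [Module k Q] {X : Finset Box} {js : List ℕ}
    (hX : Function.Injective (emb k js ∘ₗ realChain k X)) (e : Q ≃ₗ[k] Chain k X) (cl : τ → Q)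
    (deg : τ → ℕ) (re : τ → (EPt →₀ k)) (he : ∀ t, emb k js (realChain k X (e (cl t))) = re t)
    (hre : ∀ t, re t ∈ Finsupp.supported k k {Y : EPt | countT Y.2 = deg t})
    (hex : ∀ w ∈ X, ∃ t, ∃ ε : k, ε ≠ 0 ∧ re t = ε • emb k js (boxR k w)) (n : ℕ) :
    (Submodule.span k {x | ∃ t, deg t = n ∧ x = cl t}).map e.toLinearMap = chainGrade k X n := by
  refine le_antisymm ?_ ?_
  · rw [Submodule.map_span_le]
    rintro _ ⟨t, rfl, rfl⟩
    refine mem_chainGrade (Function.Injective.of_comp (f := emb k js) hX) (supported_of_emb (js := js) ?_)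
    have := hre t
    rwa [← he t] at this
  · rw [chainGrade, Submodule.span_le]
    rintro _ ⟨w, hw, rfl⟩
    obtain ⟨t, ε, hε, ht⟩ := hex w.1 w.2
    have h1 : e (cl t) = ε • Finsupp.single w 1 := by
      refine hX ?_
      rw [map_smul, LinearMap.comp_apply, LinearMap.comp_apply, he, ht, realChain_single, one_smul]
    have h2 : deg t = n := by
      obtain ⟨L, hL⟩ := Finsupp.support_nonempty_iff.2 (boxR_ne_zero (k := k) w.1)
      have h3 := hre t
      rw [ht] at h3
      have h4 := (Submodule.smul_mem_iff _ hε).1 h3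
      rw [← hw, ← (boxR_supported w.1 hL).2]
      exact (supported_of_emb h4 hL).symm
    refine ⟨ε⁻¹ • cl t, Submodule.smul_mem _ _ (Submodule.subset_span ⟨t, h2, rfl⟩), ?_⟩
    rw [LinearEquiv.coe_coe, map_smul, h1, inv_smul_smul₀ hε]

theorem nil_mem_cubeOp {l : List Col} {c : Col} (h : IsProfile l c) (h' : cubeDim c l.length = 0) :
    [] ∈ cubeOp l c :=
  mem_cubeOp.2 ⟨⟨h, h'.symm⟩, by simp⟩

theorem cellO_cellChain {l : List Col} {c : Col} {w : Box} (h : w ∈ cubeOp l c) :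
    cellO k l c (cellChain k _ w) = emb k [] (boxR k w) := by
  rw [cellO, LinearMap.comp_apply, realChain_cellChain h]

theorem cellB_cellChain {l : List Col} {c : Col} {w : Box} (h : w ∈ freeMod l c) :
    cellB k l c (cellChain k _ w) = emb k [l.length] (boxR k w) := by
  rw [cellB, LinearMap.comp_apply, realChain_cellChain h]

/-- Isomorphisms that are compatible with the realizations are compatible with tuples. -/
theorem cellTup_map (e : ∀ l c, (omegaT k).M l c ≃ₗ[k] Chain k (freeMod l c))
    (he : ∀ l c x, cellB k l c (e l c x) = quotB k _ l x) {cs l : List Col}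
    (T : Tup (omegaT k).M cs l) :
    cellTup k (T.map fun l c => e l c) = quotB k _ l (tupClass k muZ fW T) := by
  induction T with
  | nil =>
    rw [Tup.map, cellTup_nil]
    exact (quotB_clB BTerm.nil).symm
  | cons hl t T ih =>
    rw [Tup.map, cellTup_cons, ih, he]
    exact (quotB_cons hl t T).symm

/-- The isomorphism of pairs `(Ω, T) ≅ C_*(I, F)`. -/
noncomputable def omegaIso (k : Type u) [Field k] : (omegaT k).Iso (cellularPair k) where
  onP l c := (exists_onP k l c).choose
  onM l c := (exists_onM k l c).choose
  map_gradeP l c n := by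
    have h := map_grade (cellO_injective (k := k) l c) (exists_onP k l c).choose (clO k) OTerm.deg
      (OTerm.real k)
      (fun t => ((exists_onP k l c).choose_spec _).trans (quotO_clO t))
      (fun t => Finsupp.supported_mono (fun _ h => h.2.2) t.real_supported)
      (fun w hw => by
        obtain ⟨t, ht⟩ := FormO.exists hw
        exact ⟨t, 1, one_ne_zero, by rw [ht.real, one_smul]⟩) n
    refine Eq.trans ?_ h
    congr 1
    change Submodule.map _ _ = _
    rw [Submodule.map_span]
    congr 1
    ext x
    constructor
    · rintro ⟨_, ⟨t, ht, rfl⟩, rfl⟩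
      exact ⟨t, ht, rfl⟩
    · rintro ⟨t, ht, rfl⟩
      exact ⟨_, ⟨t, ht, rfl⟩, rfl⟩
  map_gradeM l c n := by
    have h := map_grade (cellB_injective (k := k) l c) (exists_onM k l c).choose (clB k) BTerm.deg
      (BTerm.real k)
      (fun t => ((exists_onM k l c).choose_spec _).trans (quotB_clB t))
      (fun t => Finsupp.supported_mono (fun _ h => h.2) t.real_supported)
      (fun w hw => by
        obtain ⟨t, ht⟩ := FormB.exists hw
        exact ⟨t, ht.real⟩) n
    refine Eq.trans ?_ h
    congr 1
    change Submodule.map _ _ = _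
    rw [Submodule.map_span]
    congr 1
    ext x
    constructor
    · rintro ⟨_, ⟨t, ht, rfl⟩, rfl⟩
      exact ⟨t, ht, rfl⟩
    · rintro ⟨t, ht, rfl⟩
      exact ⟨_, ⟨t, ht, rfl⟩, rfl⟩
  map_dP l c x := by
    refine cellO_injective (k := k) l c ?_
    refine ((exists_onP k l c).choose_spec _).trans ((quotO_d x).trans ?_)
    exact (congrArg (ptD k) ((exists_onP k l c).choose_spec x).symm).trans (cellO_d _).symm
  map_dM l c x := by
    refine cellB_injective (k := k) l c ?_
    refine ((exists_onM k l c).choose_spec _).trans ((quotB_d x).trans ?_)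
    exact (congrArg (ptD k) ((exists_onM k l c).choose_spec x).symm).trans (cellB_d _).symm
  map_one c := by
    refine cellO_injective (k := k) [c] c ?_
    refine ((exists_onP k [c] c).choose_spec _).trans ?_
    refine (quotO_clO (OTerm.one c)).trans ?_
    refine Eq.trans ?_ (cellO_cellChain (nil_mem_cubeOp ⟨0, rfl⟩ (by cases c <;> rfl))).symm
    rw [OTerm.real, boxR, emb, Finsupp.lmapDomain_apply, Finsupp.mapDomain_single]
  map_comp hx hl x y := by
    refine cellO_injective (k := k) _ _ ?_
    refine ((exists_onP k _ _).choose_spec _).trans ((quotO_comp hx hl x y).trans ?_)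
    exact (congrArg₂ (fun a b => bil _ a b) ((exists_onP k _ _).choose_spec x).symm
      ((exists_onP k _ _).choose_spec y).symm).trans (cellO_comp hx hl _ _).symm
  map_right hx hl x y := by
    refine cellB_injective (k := k) _ _ ?_
    refine ((exists_onM k _ _).choose_spec _).trans ((quotB_right hx hl x y).trans ?_)
    exact (congrArg₂ (fun a b => bil _ a b) ((exists_onM k _ _).choose_spec x).symm
      ((exists_onP k _ _).choose_spec y).symm).trans (cellB_right hx hl _ _).symm
  map_left x T := by
    refine cellB_injective (k := k) _ _ ?_
    refine ((exists_onM k _ _).choose_spec _).trans ((quotB_left x T).trans ?_)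
    exact (congrArg₂ (fun a b => bil _ a b) ((exists_onP k _ _).choose_spec x).symm
      (cellTup_map (fun l c => (exists_onM k l c).choose)
        (fun l c => (exists_onM k l c).choose_spec) T).symm).trans (cellB_left _ _).symm

/-- The generators `μ` of `Ω` correspond to cells that have the same realization. -/
theorem omegaIso_onP {l : List Col} {c : Col} (t : OTerm l c) {w : Box} (hw : w ∈ cubeOp l c)
    (h : t.real k = emb k [] (boxR k w)) :
    (omegaIso k).onP l c (clO k t) = cellChain k _ w := by
  refine cellO_injective (k := k) l c ?_
  refine ((exists_onP k l c).choose_spec _).trans ?_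
  rw [quotO_clO, h, cellO_cellChain hw]

theorem omegaIso_onM {l : List Col} {c : Col} (t : BTerm (.single c) l) {w : Box}
    (hw : w ∈ freeMod l c) (h : t.real k = emb k [l.length] (boxR k w)) :
    (omegaIso k).onM l c (clB k t) = cellChain k _ w := by
  refine cellB_injective (k := k) l c ?_
  refine ((exists_onM k l c).choose_spec _).trans ?_
  rw [quotB_clB, h, cellB_cellChain hw]

theorem omegaIso_mu_m (n : ℕ) : (omegaIso k).onP _ _ (omegaMu k Col.m n)
    = cellChain k _ (List.replicate n unitIv) := by
  refine omegaIso_onP (OTerm.mu .m n) ?_ rfl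
  refine mem_cubeOp.2 ⟨⟨⟨_, rfl⟩, by simp [cubeDim]⟩, fun I hI => ?_⟩
  rw [List.eq_of_mem_replicate hI]
  exact Letter.iv_mem .s

theorem omegaIso_mu_a : (omegaIso k).onP _ _ (omegaMu k Col.a 0) = cellChain k _ [] :=
  omegaIso_onP (OTerm.mu .a 0) (nil_mem_cubeOp ⟨_, rfl⟩ rfl) (by rw [OTerm.real, muR_a_zero])

theorem omegaIso_f_m (n : ℕ) : (omegaIso k).onM _ _ (omegaF k Col.m n)
    = cellChain k _ (List.replicate n unitIv) := by
  refine omegaIso_onM (BTerm.f .m n) ?_ ?_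
  · refine mem_freeMod.2 ⟨⟨⟨_, rfl⟩, by simp [freeDim]⟩, ?_⟩
    have h := isFreeCell_cellOf (v := List.replicate n .s) (u := none) (by
      cases n <;> simp [List.getLast?_replicate])
    rwa [cellOf_none, List.map_replicate] at h
  · rw [BTerm.real, muR]
    simp

theorem omegaIso_f_a : (omegaIso k).onM _ _ (omegaF k Col.a 0) = cellChain k _ [] :=
  omegaIso_onM (BTerm.f .a 0) (mem_freeMod.2 ⟨⟨⟨0, rfl⟩, rfl⟩, trivial⟩)
    (by rw [BTerm.real, muR_a_zero]; rfl)

end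

end OperadicFreehedra

theorem mainTheorem2 (k : Type u) [Field k] :
    (∀ n : ℕ, IsCellStructure n (cube n)) ∧
    (∀ n : ℕ, IsCellStructure n (freehedron n)) ∧
    IsCWPair ∧
    ∃ e : (omegaT k).Iso (cellularPair k),
      e.onP _ _ (omegaMu k Col.a 0) = cellChain k _ [] ∧
      e.onM _ _ (omegaF k Col.a 0) = cellChain k _ [] ∧
      (∀ n : ℕ, e.onP _ _ (omegaMu k Col.m n) = cellChain k _ (List.replicate n unitIv)) ∧
      (∀ n : ℕ, e.onM _ _ (omegaF k Col.m n) = cellChain k _ (List.replicate n unitIv)) := by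
  exact ⟨isCellStructure_cube, isCellStructure_freehedron, isCWPair, omegaIso k, omegaIso_mu_a,
    omegaIso_f_a, omegaIso_mu_m, omegaIso_f_m⟩
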